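/- **Setting.** Let $\kappa,\lambda\ge 0$, $d\mid 256$, $q$ a prime, $\mathcal R=\mathbb Z[X]/(X^d+1)$, $\mathcal R_q=\mathbb Z_q[X]/(X^d+1)$. Let $l\mid d$ and let $\zeta\in\mathbb Z_q$ be a primitive $2l$-th root of unity such that the polynomials $X^{d/l}-\zeta^{2j+1}$, $0\le j<l$, are irreducible (so $X^d+1$ has exactly these $l$ prime factors mod $q$). Let $\omega\ge 1$ be an integer, $0<p<1$, and $\chi$ a distribution on $\{-1,0,1\}$. Put $n=\kappa+\lambda+3$, $N=2(2\kappa+\lambda+3)$ and $$\mathfrak s_1=11\,\omega\sqrt{Nd},\quad \mathfrak s_2=11\,\omega\sqrt{nd},\quad \mathfrak s_3=11\sqrt{337}\cdot 2nd,$$ $$B_1=\mathfrak s_1\sqrt{4(2\kappa+\lambda+3)d},\quad B_2=\mathfrak s_2\sqrt{2nd},\quad B_3=\sqrt{2\cdot128}\;\mathfrak s_3 .$$ Norms on $\mathcal R_q^r$ are those of the coefficient vectors with representatives in $(-q/2,q/2]$; $\sigma_{-1}$ is the ring automorphism $X\mapsto X^{-1}$. $D_s$ is the discrete Gaussian on $\mathbb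 Z$ with weights $e^{-z^2/(2s^2)}$; $\mathrm{Bin}_1$ takes the values $0,1,-1$ with probabilities $\frac12,\frac14,\frac14$. The challenge distribution $\mathcal C$ is that of a polynomial with independent coefficients, equal to $0$ with probability $p$ and to $\pm1$ with probability $\frac{1-p}2$ each, conditioned on $\ell_1$-norm at most $\omega$. $\mathrm{Rej}(z,v,s)$ (applied to integer vectors) draws $u\in[0,1)$ uniformly and aborts if $u>\frac13\exp\big((-2\langle z,v\rangle+\|v\|^2)/(2s^2)\big)$. A commitment key is $(A_3,A_4,B',B'')$ with $A_3\in\mathcal R_q^{\kappa\times N}$, $A_4\in\mathcal R_q^{\kappa\times n}$, $B'\in\mathcal R_q^{(256/d)\times n}$, $B''\in\mathcal R_q^{1\times n}$. A statement $x$ consists of $A\in\mathcal R_q^{\kappa\times n}$, a public key $(pk_1,pk_2)\in(\mathcal R_q^{n})^2$ and two commitments $com=(com_0,\dots,com_3)$, $com'=(com'_0,\dots,com'_3)$ in $\mathcal R_q^{\kappa}\times\mathcal R_q^3$. With $\delta=com-com'$ let $$\tilde A=\begin{pmatrix}A^T&I&0&0\\0&0&A^T&I\end{pmatrix},\ u=\begin{pmatrix}pk_1\\pk_2\end{pmatrix},\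 \tilde C=\begin{pmatrix}\delta_0^T&0&0&0\\0&0&\delta_0^T&0\end{pmatrix},\ \tilde u=\begin{pmatrix}\delta_1\\\delta_2\end{pmatrix}.$$ An honest prover holds $m=s_1\|e_1\|s_2\|e_2\in\mathcal R_q^{N}$ with coefficients in $\{-1,0,1\}$, $\tilde A m=u$ and $\|\tilde C m-\tilde u\|_2\le 2nd$. **Protocol $\pi^{Eq}$.** Index the set $[256]$ by the coefficients of vectors in $\mathcal R_q^{256/d}$ and let $e_j$ be the vector whose coefficient vector is the $j$-th unit vector. 1. The prover draws $s\in\mathcal R_q^n$ with i.i.d. coefficients from $\chi$, $g\in\mathcal R_q$ uniform with constant coefficient $0$, $y_1\leftarrow D_{\mathfrak s_1}^{Nd}$, $y_2\leftarrow D_{\mathfrak s_2}^{nd}$, $y_3\leftarrow D_{\mathfrak s_3}^{256}$, and sends $f=A_3m+A_4s$, $u_1=B's+y_3$, $u_2=B''s+g$. 2. The verifier sends $R\leftarrow\mathrm{Bin}_1^{256\times2d}$; $r_j\in\mathcal R_q^2$ denotes the vector with the $j$-th row of $R$ as coefficients. 3. With $\ell=\tilde Cm-\tilde u$ (centered coefficients),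 the prover sends $z_3=y_3+R\ell$ after $\mathrm{Rej}(z_3,R\ell,\mathfrak s_3)$. 4. The verifier sends uniform $d_j\in\mathbb Z_q$, $j\in[256]$. 5. The prover sends $h=g+\sum_jd_j\big(\sigma_{-1}(r_j)^T\tilde Cm+\sigma_{-1}(e_j)^Ty_3-\sigma_{-1}(e_j)^Tz_3-\sigma_{-1}(r_j)^T\tilde u\big)$, $w=A_3y_1+A_4y_2$ and $v=T\,(y_1,\,-B'y_2,\,-B''y_2)^T$, where $T=\begin{pmatrix}\tilde A&0&0\\\sum_jd_j\sigma_{-1}(r_j)^T\tilde C&\sum_jd_j\sigma_{-1}(e_j)^T&1\end{pmatrix}$. 6. The verifier sends $c\leftarrow\mathcal C$. 7. The prover sends $z_1=y_1+cm$, $z_2=y_2+cs$ after $\mathrm{Rej}(z_1,cm,\mathfrak s_1)$ and $\mathrm{Rej}(z_2,cs,\mathfrak s_2)$. The products $cm$, $cs$ in step 7 and $R\ell$ in step 3 are computed over $\mathbb Z$; all messages are reduced mod $q$. The verifier accepts iff (a) $\|z_1\|_2\le B_1$; (b) $\|z_2\|_2\le B_2$; (c) $\|z_3\|_\infty\le B_3$;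 (d) $h$ has constant coefficient $0$; (e) $A_3z_1+A_4z_2=w+cf$; (f) $$v=T\begin{pmatrix}z_1\\cu_1-B'z_2\\cu_2-B''z_2\end{pmatrix}-c\begin{pmatrix}u\\h+\sum_jd_j\sigma_{-1}(e_j)^Tz_3+\sum_jd_j\sigma_{-1}(r_j)^T\tilde u\end{pmatrix}.$$ **Proved relation.** $(\bar c,m,s)$ is a witness for $(x,f)$ if $\|\bar c\|_1\le2\omega$, $\bar c$ is invertible in $\mathcal R_q$, $A_3m+A_4s=f$, $\|\bar cm\|_2\le2B_1$, $\|\bar cs\|_2\le2B_2$, $\tilde Am=u$ and $\|\tilde Cm-\tilde u\|_\infty\le2B_3$: that is, $f$ commits (weak opening) to a secret key of $pk$ that decrypts the difference of the two commitments to a short value. **Computation.** The adversaries and simulator for HVZK, and the extractor, are straight-line probabilistic programs on registers with values in $\mathcal R_q$ (constants, addition, multiplication, inversion of units, $\sigma_{-1}$, extraction of a coefficient, comparison of constant coefficients, sampling from the distributions above); running time is the number of instructions. An extractor may moreover run the prover, with the same coins, on challenges of its choice (one step each). $\mathrm{poly}$ below is evaluated at $\kappa+\lambda+d$. **Theorem.**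 There are a polynomial $\mathrm{poly}$ and an integer $e\ge1$ such that for all parameters as above the following hold. 1. *Completeness.* For every commitment key, every statement and every honest $m$, the prover does not abort with probability at least $3^{-3}-2^{-100}$, and conditioned on this the verifier accepts with probability at least $1-\big(2^{-(2\kappa+\lambda+3)d/4}+2^{-(\kappa+\lambda+3)d/8}+512\,e^{-128}+2^{-100}\big)$. 2. *Honest-verifier zero-knowledge.* There is a simulator of running time at most $\mathrm{poly}$, whose input is the commitment key and the statement, such that for all $T$ and $\varepsilon$: if no algorithm of running time at most $T+\mathrm{poly}$ distinguishes $(M,Ms)$ from $(M,t)$ with advantage more than $\varepsilon$, where $M\in\mathcal R_q^{(\kappa+256/d+1)\times(\kappa+\lambda+3)}$ and $t$ are uniform and $s$ has i.i.d. coefficients from $\chi$ (dual Module-LWE), then for every statement and every honest $m$, and a uniformly random commitment key, no algorithm of running time at most $T$ distinguishes (given the key) the transcript of the honest execution conditioned on non-abort from the simulator's output with advantage more than $\varepsilon+2^{-100}$. 3. *Knowledge soundness with error $O(l/q^{d/l})+1/q+2^{-256}$.* Let $$\mathsf M=\frac1q+\frac1q\sum_{j\in\mathbb Z_q^\times}\prod_{k=0}^{l-1}\Big|p+(1-p)\cos\big(2\pi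 j\zeta^k/q\big)\Big|,$$ and let $K$ be a real number with $\mathsf M^{d/l}\le K\,q^{-d/l}\,\Pr[\|c\|_1\le\omega]$, the probability being over polynomials $c$ with independent coefficients ($0$ with probability $p$, $\pm1$ with probability $\frac{1-p}2$ each). Put $\mathrm{err}=K\,\frac{l}{q^{d/l}}+\frac1q+\frac1{2^{256}}$. There is an extractor of running time at most $\mathrm{poly}$ such that for every commitment key, every statement and every (computationally unbounded, probabilistic) prover that makes the verifier accept with probability $\epsilon>\mathrm{err}$, the extractor outputs with probability at least $(\epsilon-\mathrm{err})^e/\mathrm{poly}$ either a witness of the proved relation for the first message $f$ of the prover, or a solution of the Module-SIS instance $[A_3\mid A_4]\in\mathcal R_q^{\kappa\times(5\kappa+3\lambda+9)}$ with bound $\beta=8\omega\sqrt{B_1^2+B_2^2}$, that is, a vector $y$ with $[A_3\mid A_4]\,y=0$ and $0<\|y\|_2\le\beta$. -/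

import Mathlib

open Polynomial
open scoped ENNReal Matrix

noncomputable section

namespace PoE

/-! ### The rings `S[X]/(X^d+1)`, coefficients, the automorphism `X ↦ X⁻¹`, norms -/

/-- The ring `S[X]/(X^d+1)`; with `S = ℤ` this is `𝓡`, with `S = ZMod q` it is `𝓡_q`. -/
abbrev CycRing (S : Type) [CommRing S] (d : ℕ) : Type := AdjoinRoot (X ^ d + 1 : S[X])

theorem monic_cyc (S : Type) [CommRing S] {d : ℕ} (hd : d ≠ 0) : (X ^ d + 1 : S[X]).Monic := by
  have h := monic_X_pow_add_C (1 : S) hd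
  simpa using h

/-- The `k`-th coefficient of the representative of degree `< d`. -/
def coeff {S : Type} [CommRing S] {d : ℕ} (x : CycRing S d) (k : Fin d) : S :=
  (AdjoinRoot.modByMonicHom (monic_cyc S (Nat.ne_of_gt k.pos)) x).coeff k

/-- The ring element `∑ a_i X^i`. -/
def ofCoeffs {S : Type} [CommRing S] {d : ℕ} (a : Fin d → S) : CycRing S d :=
  ∑ i, AdjoinRoot.of (X ^ d + 1 : S[X]) (a i) * AdjoinRoot.root (X ^ d + 1 : S[X]) ^ (i : ℕ)

theorem conj_aux (S : Type) [CommRing S] (d : ℕ) :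
    (X ^ d + 1 : S[X]).eval₂ (AdjoinRoot.of (X ^ d + 1 : S[X]))
      (-(AdjoinRoot.root (X ^ d + 1 : S[X])) ^ (d - 1)) = 0 := by
  have h0 : (AdjoinRoot.root (X ^ d + 1 : S[X])) ^ d + 1 = 0 := by
    have h := AdjoinRoot.eval₂_root (X ^ d + 1 : S[X])
    simpa using h
  have h1 : (AdjoinRoot.root (X ^ d + 1 : S[X])) ^ d = -1 := eq_neg_of_add_eq_zero_left h0
  rcases d with _ | m
  · simpa using h0
  · simp only [eval₂_add, eval₂_pow, eval₂_X, eval₂_one, Nat.add_sub_cancel]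
    rw [neg_pow, ← pow_mul, mul_comm m, pow_mul, h1, ← pow_add]
    have : m + 1 + m = 2 * m + 1 := by ring
    rw [this, Odd.neg_one_pow ⟨m, rfl⟩]
    simp

/-- The ring automorphism `σ₋₁ : X ↦ X⁻¹ = -X^(d-1)`. -/
def conj {S : Type} [CommRing S] {d : ℕ} : CycRing S d →+* CycRing S d :=
  AdjoinRoot.lift (AdjoinRoot.of (X ^ d + 1 : S[X]))
    (-(AdjoinRoot.root (X ^ d + 1 : S[X])) ^ (d - 1)) (conj_aux S d)

/-- The ring element with the given ternary coefficients. -/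
def tern (S : Type) [CommRing S] {d : ℕ} (a : Fin d → SignType) : CycRing S d :=
  ofCoeffs fun i => ((a i : ℤ) : S)

/-- Reduction modulo `q` of a polynomial with integer coefficients. -/
def red (q : ℕ) {d : ℕ} (a : Fin d → ℤ) : CycRing (ZMod q) d :=
  ofCoeffs fun i => ((a i : ℤ) : ZMod q)

/-- The coefficient of `x`, lifted to the representative in `(-q/2, q/2]`. -/
def cent {q d : ℕ} (x : CycRing (ZMod q) d) (k : Fin d) : ℤ := (coeff x k).valMinAbs

/-- The Euclidean norm of a vector over `𝓡_q` (centered representatives). -/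
def l2 {q d : ℕ} {ι : Type} [Fintype ι] (v : ι → CycRing (ZMod q) d) : ℝ :=
  Real.sqrt (∑ i, ∑ k, ((cent (v i) k : ℤ) : ℝ) ^ 2)

/-- The maximum norm of a vector over `𝓡_q`. -/
def linf {q d : ℕ} {ι : Type} [Fintype ι] (v : ι → CycRing (ZMod q) d) : ℕ :=
  Finset.univ.sup fun p : ι × Fin d => (cent (v p.1) p.2).natAbs

/-- The `ℓ₁` norm of an element of `𝓡_q`. -/
def l1 {q d : ℕ} (x : CycRing (ZMod q) d) : ℕ := ∑ k, (cent x k).natAbs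

/-! ### Probability -/

/-- Probability of an event, as a real number. -/
def Pr {α : Type} (μ : PMF α) (E : Set α) : ℝ := (μ.toOuterMeasure E).toReal

theorem iid_aux_fin {α : Type} (μ : PMF α) (n : ℕ) :
    ∑' f : Fin n → α, ∏ i, μ (f i) = 1 := by
  induction n with
  | zero => simp
  | succ n ih =>
    rw [← (Fin.consEquiv fun _ : Fin (n + 1) => α).tsum_eq]
    simp only [Fin.consEquiv_apply, Fin.prod_univ_succ, Fin.cons_zero, Fin.cons_succ]
    rw [ENNReal.tsum_prod']
    simp only [ENNReal.tsum_mul_left, ih, mul_one, μ.tsum_coe]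

theorem iid_aux {α : Type} (μ : PMF α) (ι : Type) [Fintype ι] :
    ∑' f : ι → α, ∏ i, μ (f i) = 1 := by
  rw [← iid_aux_fin μ (Fintype.card ι),
    ← (Equiv.arrowCongr (Fintype.equivFin ι).symm (Equiv.refl α)).tsum_eq]
  refine tsum_congr fun f => ?_
  exact Fintype.prod_equiv (Fintype.equivFin ι) _ _ fun i => by
    simp [Equiv.arrowCongr]

/-- A family of independent samples of `μ`, indexed by `ι`. -/
def iid {α : Type} (ι : Type) [Fintype ι] (μ : PMF α) : PMF (ι → α) :=
  ⟨fun f => ∏ i, μ (f i), ENNReal.summable.hasSum_iff.2 (iid_aux μ ι)⟩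

theorem ternary_aux (p : ℝ) (h0 : 0 ≤ p) (h1 : p ≤ 1) :
    ∑ s : SignType, (if s = 0 then ENNReal.ofReal p else ENNReal.ofReal ((1 - p) / 2)) = 1 := by
  have hu : (Finset.univ : Finset SignType) = {0, -1, 1} := by decide
  rw [hu]
  rw [Finset.sum_insert (by decide), Finset.sum_insert (by decide), Finset.sum_singleton]
  simp only [if_true, if_neg (show ¬((-1 : SignType) = 0) by decide),
    if_neg (show ¬((1 : SignType) = 0) by decide)]
  rw [← ENNReal.ofReal_add (by linarith) (by linarith), ← ENNReal.ofReal_add h0 (by linarith),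
    ← ENNReal.ofReal_one]
  congr 1
  ring

/-- The distribution on `{-1,0,1}` with `Pr[0] = p` and `Pr[1] = Pr[-1] = (1-p)/2`. -/
def ternary (p : ℝ) (h0 : 0 ≤ p) (h1 : p ≤ 1) : PMF SignType :=
  PMF.ofFintype _ (ternary_aux p h0 h1)

/-- The centered binomial distribution `Bin₁`. -/
def bin1 : PMF SignType := ternary (1 / 2) (by norm_num) (by norm_num)

theorem coin_aux (t : ℝ) (h0 : 0 ≤ t) (h1 : t ≤ 1) :
    ∑ b : Bool, (if b then ENNReal.ofReal t else ENNReal.ofReal (1 - t)) = 1 := by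
  simp only [Fintype.sum_bool, if_true, Bool.false_eq_true, if_false]
  rw [← ENNReal.ofReal_add h0 (by linarith), ← ENNReal.ofReal_one]
  congr 1
  ring

/-- A coin that shows `true` with probability `t`. -/
def coin (t : ℝ) (h0 : 0 ≤ t) (h1 : t ≤ 1) : PMF Bool := PMF.ofFintype _ (coin_aux t h0 h1)

/-- The Gaussian weight `exp(-z²/(2s²))`. -/
def gaussWeight (s : ℝ) (z : ℤ) : ℝ≥0∞ := ENNReal.ofReal (Real.exp (-(z : ℝ) ^ 2 / (2 * s ^ 2)))

theorem gauss_ne_zero (s : ℝ) : ∑' z, gaussWeight s z ≠ 0 := by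
  intro h
  have := ENNReal.tsum_eq_zero.1 h 0
  simp [gaussWeight] at this

theorem gauss_ne_top (s : ℝ) (hs : 0 < s) : ∑' z, gaussWeight s z ≠ ⊤ := by
  have hc : -(1 / (2 * s ^ 2)) < 0 := by
    have : 0 < 1 / (2 * s ^ 2) := by positivity
    linarith
  have hnat : Summable fun n : ℕ => Real.exp (-((n : ℤ) : ℝ) ^ 2 / (2 * s ^ 2)) := by
    have h := Real.summable_exp_nat_mul_of_ge hc (f := fun n : ℕ => (n : ℝ) ^ 2) (fun i => by
      rcases Nat.eq_zero_or_pos i with h | h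
      · simp [h]
      · have : (1 : ℝ) ≤ i := by exact_mod_cast h
        nlinarith)
    refine h.congr fun n => ?_
    congr 1
    push_cast
    ring
  have hint : Summable fun z : ℤ => Real.exp (-(z : ℝ) ^ 2 / (2 * s ^ 2)) := by
    refine Summable.of_nat_of_neg hnat ?_
    refine hnat.congr fun n => ?_
    push_cast
    rw [neg_sq]
  exact hint.tsum_ofReal_ne_top

/-- The discrete Gaussian distribution `D_s` on `ℤ`, centered at `0`; `D_s^ι` is `iid ι (dgauss s _)`. -/
def dgauss (s : ℝ) (hs : 0 < s) : PMF ℤ :=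
  PMF.normalize (gaussWeight s) (gauss_ne_zero s) (gauss_ne_top s hs)

theorem rej_bounds (t : ℝ) (h : 0 ≤ t) : 0 ≤ min 1 t ∧ min 1 t ≤ 1 :=
  ⟨le_min zero_le_one h, min_le_left _ _⟩

/-- Rejection sampling with repetition rate `M = 3`: with `u` uniform in `[0,1)`, the outcome is
`true` (do not abort) iff `u ≤ (1/M) exp((-2⟨z,v⟩+‖v‖²)/(2s²))`, an event of probability
`min 1 (…)`. The vectors are the integer coefficient vectors. -/
def rej {ι : Type} [Fintype ι] (z v : ι → ℤ) (s : ℝ) : PMF Bool :=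
  let t : ℝ := 1 / 3 * Real.exp
    ((-2 * ∑ i, (z i : ℝ) * (v i : ℝ) + ∑ i, (v i : ℝ) ^ 2) / (2 * s ^ 2))
  have h := rej_bounds t (by positivity)
  coin (min 1 t) h.1 h.2

/-! ### Parameters -/

/-- System parameters: module ranks `κ, lam`, ring degree `d`, modulus `q`, number `l` of prime
factors of `X^d+1` modulo `q` with a primitive `2l`-th root of unity `ζ`, a bound `ω` for the
`ℓ₁` norm of challenges, the probability `p` of a zero challenge coefficient, and the distribution
`χ` on `{-1,0,1}` of secrets. -/
structure Params where
  κ : ℕ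
  lam : ℕ
  d : ℕ
  q : ℕ
  l : ℕ
  ω : ℕ
  p : ℝ
  χ : PMF SignType
  ζ : ZMod q
  d_dvd : d ∣ 256
  q_prime : q.Prime
  l_dvd : l ∣ d
  ζ_prim : IsPrimitiveRoot ζ (2 * l)
  splits : ∀ j < l, Irreducible (X ^ (d / l) - C (ζ ^ (2 * j + 1)) : (ZMod q)[X])
  ω_pos : 0 < ω
  p_pos : 0 < p
  p_lt : p < 1

variable (P : Params)

instance : Fact P.q.Prime := ⟨P.q_prime⟩

instance : NeZero P.q := ⟨P.q_prime.ne_zero⟩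

instance : NeZero P.d := ⟨fun h => by have := P.d_dvd; rw [h] at this; norm_num at this⟩

theorem Params.d_pos : 0 < P.d := Nat.pos_of_ne_zero (NeZero.ne P.d)

namespace Params

/-- The ring `𝓡_q`. -/
abbrev Rq : Type := CycRing (ZMod P.q) P.d

/-- The rank `κ + lam + 3`. -/
abbrev n : ℕ := P.κ + P.lam + 3

/-- Index set of `m = s₁‖e₁‖s₂‖e₂`: `(b, inl i)` is the `i`-th entry of `s_b`, and `(b, inr j)` the
`j`-th entry of `e_b`; it has `2(2κ+lam+3)` elements. -/
abbrev MIdx : Type := Fin 2 × (Fin P.κ ⊕ Fin P.n)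

/-- Index set of vectors in `𝓡_q^(256/d)`. -/
abbrev E : Type := Fin (256 / P.d)

/-- The index set `[256]`; `(a, k)` is the coefficient of `X^k` of the `a`-th entry of a vector in
`𝓡_q^(256/d)`. -/
abbrev J : Type := P.E × Fin P.d

def s1 : ℝ := 11 * P.ω * Real.sqrt ((4 * P.κ + 2 * P.lam + 6) * P.d)

def s2 : ℝ := 11 * P.ω * Real.sqrt ((P.κ + P.lam + 3) * P.d)

def s3 : ℝ := 11 * Real.sqrt 337 * (2 * (P.κ + P.lam + 3) * P.d)

/-- Norm bound for `z₁` in the verification. -/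
def bound1 : ℝ := P.s1 * Real.sqrt (4 * (2 * P.κ + P.lam + 3) * P.d)

/-- Norm bound for `z₂` in the verification. -/
def bound2 : ℝ := P.s2 * Real.sqrt (2 * (P.κ + P.lam + 3) * P.d)

/-- Bound `√(2k)·s₃` with `k = 128` for the maximum norm of `z₃` in the verification. -/
def bound3 : ℝ := Real.sqrt (2 * 128) * P.s3

theorem s1_pos : 0 < P.s1 := by
  have h1 : (0 : ℝ) < P.ω := by exact_mod_cast P.ω_pos
  have h2 : (0 : ℝ) < P.d := by exact_mod_cast P.d_pos
  unfold s1
  positivity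

theorem s2_pos : 0 < P.s2 := by
  have h1 : (0 : ℝ) < P.ω := by exact_mod_cast P.ω_pos
  have h2 : (0 : ℝ) < P.d := by exact_mod_cast P.d_pos
  unfold s2
  positivity

theorem s3_pos : 0 < P.s3 := by
  have h2 : (0 : ℝ) < P.d := by exact_mod_cast P.d_pos
  unfold s3
  positivity

/-- The distribution of independent challenge coefficients. -/
def chalCoeffs : PMF (Fin P.d → SignType) :=
  iid (Fin P.d) (ternary P.p P.p_pos.le P.p_lt.le)

/-- The ternary polynomials of `ℓ₁` norm at most `ω`. -/
def chalSet : Set (Fin P.d → SignType) := {c | ∑ i, ((c i : ℤ)).natAbs ≤ P.ω}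

theorem chal_nonempty : ∃ c ∈ P.chalSet, c ∈ P.chalCoeffs.support := by
  refine ⟨fun _ => 0, ?_, ?_⟩
  · change ∑ i : Fin P.d, (((0 : SignType) : ℤ)).natAbs ≤ P.ω
    simp
  · rw [PMF.mem_support_iff]
    change ∏ i : Fin P.d, (ternary P.p P.p_pos.le P.p_lt.le) 0 ≠ 0
    rw [Finset.prod_ne_zero_iff]
    intro i _
    simpa [ternary] using P.p_pos

/-- The challenge distribution `𝒞`: independent coefficients in `{-1,0,1}`, conditioned on
`‖c‖₁ ≤ ω` (no condition at all if `ω ≥ d`). -/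
def chal : PMF (Fin P.d → SignType) := P.chalCoeffs.filter P.chalSet P.chal_nonempty

/-- The bound `M` for the maximal probability of a coefficient of an NTT component of a random
ternary polynomial. -/
def nttBound : ℝ :=
  1 / P.q + 1 / P.q * ∑ j : (ZMod P.q)ˣ, ∏ k ∈ Finset.range P.l,
    |P.p + (1 - P.p) * Real.cos (2 * Real.pi * (((j : ZMod P.q) * P.ζ ^ k).val : ℝ) / P.q)|

/-- The parameters are chosen such that challenges are nearly uniform in each NTT component: the
bound `M^(d/l)` for the probability of a value of an NTT component is at most `K/q^(d/l)`, for
coefficients conditioned on `‖c‖₁ ≤ ω`. -/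
def NearUniform (K : ℝ) : Prop :=
  P.nttBound ^ (P.d / P.l) ≤ K / (P.q : ℝ) ^ (P.d / P.l) * Pr P.chalCoeffs P.chalSet

/-- The uniform distribution on `𝓡_q`. -/
def unif : PMF P.Rq := (PMF.uniformOfFintype (Fin P.d → ZMod P.q)).map ofCoeffs

/-- The size measure in which running times are polynomial. -/
def size : ℕ := P.κ + P.lam + P.d

end Params

/-! ### Public parameters, statements, relations -/

/-- Commitment key `(A₃, A₄, B'_eq, B''_eq)` of the proof of equivalence. -/
structure PP where
  A3 : Matrix (Fin P.κ) P.MIdx P.Rq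
  A4 : Matrix (Fin P.κ) (Fin P.n) P.Rq
  B1 : Matrix P.E (Fin P.n) P.Rq
  B2 : Fin P.n → P.Rq

/-- A commitment `(com₀, com₁, com₂, com₃)`. -/
structure Com where
  c0 : Fin P.κ → P.Rq
  c1 : P.Rq
  c2 : P.Rq
  c3 : P.Rq

/-- A statement: the matrix `A`, the public key `(pk₁, pk₂)`, and the commitments `com`, `com'`. -/
structure Stmt where
  A : Matrix (Fin P.κ) (Fin P.n) P.Rq
  pk : Fin 2 → Fin P.n → P.Rq
  com : Com P
  com' : Com P

variable {P}

/-- The matrix `Ã = [[Aᵀ, Id, 0, 0], [0, 0, Aᵀ, Id]]`. -/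
def Stmt.ATilde (x : Stmt P) : Matrix (Fin 2 × Fin P.n) P.MIdx P.Rq := fun r c =>
  if r.1 = c.1 then
    match c.2 with
    | Sum.inl i => x.A i r.2
    | Sum.inr j => if r.2 = j then 1 else 0
  else 0

/-- The vector `u = (pk₁, pk₂)`. -/
def Stmt.u (x : Stmt P) : Fin 2 × Fin P.n → P.Rq := fun r => x.pk r.1 r.2

/-- The matrix `C̃ = [[com_diff,0ᵀ, 0, 0, 0], [0, 0, com_diff,0ᵀ, 0]]`, where
`com_diff = com - com'`. -/
def Stmt.CTilde (x : Stmt P) : Matrix (Fin 2) P.MIdx P.Rq := fun r c =>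
  if r = c.1 then
    match c.2 with
    | Sum.inl i => x.com.c0 i - x.com'.c0 i
    | Sum.inr _ => 0
  else 0

/-- The vector `ũ = (com_diff,1, com_diff,2)`. -/
def Stmt.uTilde (x : Stmt P) : Fin 2 → P.Rq :=
  ![x.com.c1 - x.com'.c1, x.com.c2 - x.com'.c2]

/-- The decryption `C̃m - ũ` of the difference of the two commitments. -/
def Stmt.ell (x : Stmt P) (m : P.MIdx → P.Rq) : Fin 2 → P.Rq := x.CTilde *ᵥ m - x.uTilde

/-- The relation between statements and the witnesses of honest provers: the secret key is ternary
and belongs to the public key, and the decrypted difference has norm at most `2(κ+lam+3)d`, the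
bound from which the standard deviation `s₃` is computed. -/
def HonestRel (x : Stmt P) (m : P.MIdx → Fin P.d → SignType) : Prop :=
  x.ATilde *ᵥ (fun i => tern (ZMod P.q) (m i)) = x.u ∧
  l2 (x.ell fun i => tern (ZMod P.q) (m i)) ≤ 2 * (P.κ + P.lam + 3) * P.d

/-- The relation proved by the protocol: `(cbar, m, s)` is a weak opening of `f` as a commitment to
a secret key `m` of `pk` which decrypts the difference of `com` and `com'` to a short value. -/
def RelPoE (pp : PP P) (x : Stmt P) (f : Fin P.κ → P.Rq)
    (cbar : P.Rq) (m : P.MIdx → P.Rq) (s : Fin P.n → P.Rq) : Prop :=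
  l1 cbar ≤ 2 * P.ω ∧ IsUnit cbar ∧
  pp.A3 *ᵥ m + pp.A4 *ᵥ s = f ∧
  l2 (fun i => cbar * m i) ≤ 2 * P.bound1 ∧
  l2 (fun i => cbar * s i) ≤ 2 * P.bound2 ∧
  x.ATilde *ᵥ m = x.u ∧
  (linf (x.ell m) : ℝ) ≤ 2 * P.bound3

/-- `y` solves the Module-SIS instance `M` with norm bound `β`. -/
def MSISSolution {r c : Type} [Fintype c] (M : Matrix r c P.Rq) (β : ℝ) (y : c → P.Rq) : Prop :=
  M *ᵥ y = 0 ∧ 0 < l2 y ∧ l2 y ≤ β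

variable (P) in
/-- The norm bound of the Module-SIS problem. -/
def msisBound : ℝ := 8 * P.ω * Real.sqrt (P.bound1 ^ 2 + P.bound2 ^ 2)

/-! ### The protocol -/

variable (P) in
/-- First message of the prover. -/
structure Msg1 where
  f : Fin P.κ → P.Rq
  u1 : P.E → P.Rq
  u2 : P.Rq

variable (P) in
/-- First challenge: the matrix `R` with rows indexed by `[256]` and `2d` columns. -/
abbrev ChR : Type := P.J → Fin 2 → Fin P.d → SignType

variable (P) in
/-- Second message: `z₃`. -/
abbrev Msg2 : Type := P.E → P.Rq

variable (P) in
/-- Second challenge: the scalars `d_{1,j}`. -/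
abbrev ChD : Type := P.J → ZMod P.q

variable (P) in
/-- Third message of the prover. -/
structure Msg3 where
  h : P.Rq
  w : Fin P.κ → P.Rq
  v : (Fin 2 × Fin P.n) ⊕ Unit → P.Rq

variable (P) in
/-- Third challenge: the coefficients of `c`. -/
abbrev ChC : Type := Fin P.d → SignType

variable (P) in
/-- Last message of the prover. -/
structure Msg4 where
  z1 : P.MIdx → P.Rq
  z2 : Fin P.n → P.Rq

variable (P) in
/-- A transcript of an interaction. -/
structure Transcript where
  m1 : Msg1 P
  R : ChR P
  z3 : Msg2 P
  dd : ChD P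
  m3 : Msg3 P
  c : ChC P
  m4 : Msg4 P

/-- The vector `r_j ∈ 𝓡_q²` whose coefficients are the `j`-th row of `R`. -/
def rvec (R : ChR P) (j : P.J) : Fin 2 → P.Rq := fun b => tern (ZMod P.q) (R j b)

/-- The vector `e_j` whose coefficient vector is the `j`-th unit vector. -/
def evec (j : P.J) : P.E → P.Rq := fun a =>
  if a = j.1 then AdjoinRoot.root (X ^ P.d + 1 : (ZMod P.q)[X]) ^ (j.2 : ℕ) else 0

/-- `∑_j d_j σ₋₁(r_j)ᵀ C̃`. -/
def rowC (x : Stmt P) (R : ChR P) (dd : ChD P) : P.MIdx → P.Rq :=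
  ∑ j, dd j • ((fun b => conj (rvec R j b)) ᵥ* x.CTilde)

/-- `∑_j d_j σ₋₁(e_j)ᵀ`. -/
def rowE (dd : ChD P) : P.E → P.Rq := ∑ j, dd j • (fun a => conj (evec j a))

/-- The constant `∑_j d_j (σ₋₁(e_j)ᵀ z₃ + σ₋₁(r_j)ᵀ ũ)`. -/
def affine (x : Stmt P) (R : ChR P) (z3 : Msg2 P) (dd : ChD P) : P.Rq :=
  ∑ j, dd j • ((fun a => conj (evec j a)) ⬝ᵥ z3 + (fun b => conj (rvec R j b)) ⬝ᵥ x.uTilde)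

/-- The matrix `T = [[Ã, 0, 0], [∑ d_j σ₋₁(r_j)ᵀC̃, ∑ d_j σ₋₁(e_j)ᵀ, 1]]`. -/
def matT (x : Stmt P) (R : ChR P) (dd : ChD P) :
    Matrix ((Fin 2 × Fin P.n) ⊕ Unit) (P.MIdx ⊕ (P.E ⊕ Unit)) P.Rq :=
  Matrix.fromBlocks x.ATilde 0
    (Matrix.replicateRow Unit (rowC x R dd))
    (Matrix.replicateRow Unit (Sum.elim (rowE dd) fun _ => 1))

/-- The verification routine. -/
def Accepts (pp : PP P) (x : Stmt P) (t : Transcript P) : Prop :=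
  let c : P.Rq := tern (ZMod P.q) t.c
  l2 t.m4.z1 ≤ P.bound1 ∧
  l2 t.m4.z2 ≤ P.bound2 ∧
  (linf t.z3 : ℝ) ≤ P.bound3 ∧
  coeff t.m3.h 0 = 0 ∧
  pp.A3 *ᵥ t.m4.z1 + pp.A4 *ᵥ t.m4.z2 = t.m3.w + c • t.m1.f ∧
  t.m3.v =
    matT x t.R t.dd *ᵥ Sum.elim t.m4.z1
      (Sum.elim (c • t.m1.u1 - pp.B1 *ᵥ t.m4.z2) fun _ => c * t.m1.u2 - pp.B2 ⬝ᵥ t.m4.z2)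
    - c • Sum.elim x.u fun _ => t.m3.h + affine x t.R t.z3 t.dd

/-- The honest execution on the secret key `m`; `none` means that the prover aborts in one of the
three rejection steps. Masking vectors and the vectors in the rejection steps are integer vectors,
messages are reduced modulo `q`. -/
def honestRun (pp : PP P) (x : Stmt P) (m : P.MIdx → Fin P.d → SignType) :
    PMF (Option (Transcript P)) := do
  let sT ← iid (Fin P.n) (iid (Fin P.d) P.χ)
  let g0 ← P.unif
  let y1 ← iid (P.MIdx × Fin P.d) (dgauss P.s1 P.s1_pos)
  let y2 ← iid (Fin P.n × Fin P.d) (dgauss P.s2 P.s2_pos)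
  let y3 ← iid P.J (dgauss P.s3 P.s3_pos)
  let mq : P.MIdx → P.Rq := fun i => tern (ZMod P.q) (m i)
  let sq : Fin P.n → P.Rq := fun i => tern (ZMod P.q) (sT i)
  let g : P.Rq := g0 - AdjoinRoot.of _ (coeff g0 0)
  let y1q : P.MIdx → P.Rq := fun i => red P.q fun k => y1 (i, k)
  let y2q : Fin P.n → P.Rq := fun i => red P.q fun k => y2 (i, k)
  let y3q : P.E → P.Rq := fun a => red P.q fun k => y3 (a, k)
  let m1 : Msg1 P := ⟨pp.A3 *ᵥ mq + pp.A4 *ᵥ sq, pp.B1 *ᵥ sq + y3q, pp.B2 ⬝ᵥ sq + g⟩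
  let R ← iid P.J (iid (Fin 2) (iid (Fin P.d) bin1))
  let v3 : P.J → ℤ := fun j => ∑ b, ∑ k, (R j b k : ℤ) * cent (x.ell mq b) k
  let ok3 ← rej (y3 + v3) v3 P.s3
  if ok3 then do
    let z3 : Msg2 P := fun a => red P.q fun k => (y3 + v3) (a, k)
    let dd ← iid P.J (PMF.uniformOfFintype (ZMod P.q))
    let h : P.Rq := g + (rowC x R dd ⬝ᵥ mq + rowE dd ⬝ᵥ y3q - affine x R z3 dd)
    let m3 : Msg3 P := ⟨h, pp.A3 *ᵥ y1q + pp.A4 *ᵥ y2q,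
      matT x R dd *ᵥ Sum.elim y1q (Sum.elim (-(pp.B1 *ᵥ y2q)) fun _ => -(pp.B2 ⬝ᵥ y2q))⟩
    let c ← P.chal
    let v1 : P.MIdx × Fin P.d → ℤ := fun i => coeff (tern ℤ c * tern ℤ (m i.1)) i.2
    let v2 : Fin P.n × Fin P.d → ℤ := fun i => coeff (tern ℤ c * tern ℤ (sT i.1)) i.2
    let ok1 ← rej (y1 + v1) v1 P.s1
    let ok2 ← rej (y2 + v2) v2 P.s2
    if ok1 && ok2 then
      pure (some ⟨m1, R, z3, dd, m3, c,
        ⟨fun i => red P.q fun k => (y1 + v1) (i, k), fun i => red P.q fun k => (y2 + v2) (i, k)⟩⟩)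
    else pure none
  else pure none

/-- The error in the completeness of the verifier. -/
def completenessError (P : Params) : ℝ :=
  2 ^ (-((2 * P.κ + P.lam + 3 : ℝ) * P.d / 4)) + 2 ^ (-((P.κ + P.lam + 3 : ℝ) * P.d / 8))
    + 256 * 2 * Real.exp (-128) + 2 ^ (-100 : ℝ)

/-- Completeness: the honest prover does not abort with probability at least `(1/3)³ - 2^(-100)`,
and conditioned on this, the verifier accepts except with probability `completenessError`. -/
def Complete (P : Params) : Prop :=
  ∀ (pp : PP P) (x : Stmt P) (m : P.MIdx → Fin P.d → SignType), HonestRel x m →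
    (1 / 3 : ℝ) ^ 3 - 2 ^ (-100 : ℝ) ≤ Pr (honestRun pp x m) {t | t ≠ none} ∧
    (1 - completenessError P) * Pr (honestRun pp x m) {t | t ≠ none} ≤
      Pr (honestRun pp x m) {t | ∃ t', t = some t' ∧ Accepts pp x t'}

/-! ### Computations

Probabilistic algorithms are straight-line programs whose registers hold elements of `𝓡_q`; the
running time is the number of instructions. Every instruction is an operation of cost polynomial in
`d` and `log q`, or draws a sample from one of the distributions of the protocol. -/

/-- The distributions that can be sampled. -/
inductive Dist where
  | unif
  | chi
  | bin
  | chal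
  | gauss1
  | gauss2
  | gauss3

/-- Sampling an element of `𝓡_q`. -/
def Dist.sample (P : Params) : Dist → PMF P.Rq
  | .unif => P.unif
  | .chi => (iid (Fin P.d) P.χ).map (tern (ZMod P.q))
  | .bin => (iid (Fin P.d) bin1).map (tern (ZMod P.q))
  | .chal => P.chal.map (tern (ZMod P.q))
  | .gauss1 => (iid (Fin P.d) (dgauss P.s1 P.s1_pos)).map (red P.q)
  | .gauss2 => (iid (Fin P.d) (dgauss P.s2 P.s2_pos)).map (red P.q)
  | .gauss3 => (iid (Fin P.d) (dgauss P.s3 P.s3_pos)).map (red P.q)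

/-- Instructions on registers with names in `ι`. The first argument is the register that is written.
`inv` inverts units (and maps non-units to `0`), `coeff` extracts a coefficient, `lt` compares the
constant coefficients as integers in `[0, q)`. -/
inductive Instr (P : Params) (ι : Type) where
  | const (r : ι) (a : P.Rq)
  | add (r a b : ι)
  | mul (r a b : ι)
  | inv (r a : ι)
  | conj (r a : ι)
  | coeff (r a : ι) (k : Fin P.d)
  | lt (r a b : ι)
  | sample (r : ι) (D : Dist)

open Classical in
/-- Execution of one instruction. -/
def Instr.run {ι : Type} : Instr P ι → (ι → P.Rq) → PMF (ι → P.Rq)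
  | .const r a, st => PMF.pure (Function.update st r a)
  | .add r a b, st => PMF.pure (Function.update st r (st a + st b))
  | .mul r a b, st => PMF.pure (Function.update st r (st a * st b))
  | .inv r a, st => PMF.pure (Function.update st r (Ring.inverse (st a)))
  | .conj r a, st => PMF.pure (Function.update st r (PoE.conj (st a)))
  | .coeff r a k, st =>
    PMF.pure (Function.update st r (AdjoinRoot.of _ (PoE.coeff (st a) k)))
  | .lt r a b, st => PMF.pure (Function.update st r
      (if (PoE.coeff (st a) 0).val < (PoE.coeff (st b) 0).val then 1 else 0))
  | .sample r D, st => (D.sample P).map (Function.update st r)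

/-- Execution of a list of instructions. -/
def runList {I S : Type} (step : I → S → PMF S) : List I → S → PMF S
  | [], st => PMF.pure st
  | i :: is, st => (step i st).bind (runList step is)

/-- Registers: inputs, outputs, and an unlimited number of work registers. -/
abbrev Regs (In Out : Type) : Type := In ⊕ (Out ⊕ ℕ)

/-- Programs with input registers `In` and output registers `Out`. -/
abbrev Prog (P : Params) (In Out : Type) : Type := List (Instr P (Regs In Out))

/-- The initial state: all registers except the inputs are `0`. -/
def initState {In Out : Type} (inp : In → P.Rq) : Regs In Out → P.Rq := Sum.elim inp fun _ => 0

/-- The distribution of the output of a program. -/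
def Prog.out {In Out : Type} (A : Prog P In Out) (inp : In → P.Rq) : PMF (Out → P.Rq) :=
  (runList Instr.run A (initState inp)).map fun st o => st (Sum.inr (Sum.inl o))

open Classical in
/-- The output bit of a program with one output register. -/
def Prog.bit {In : Type} (A : Prog P In Unit) (inp : In → P.Rq) : PMF Bool :=
  (A.out inp).map fun o => decide (o () = 1)

/-! ### The dual Module-LWE problem -/

/-- Input registers for a matrix and a vector. -/
inductive LWEVar (r c : Type) where
  | mat (i : r) (j : c)
  | vec (i : r)

/-- An instance as the content of registers. -/
def encLWE {r c : Type} (A : Matrix r c P.Rq) (t : r → P.Rq) : LWEVar r c → P.Rq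
  | .mat i j => A i j
  | .vec i => t i

variable (P) in
/-- The uniform distribution on matrices over `𝓡_q`. -/
def unifMatrix (r c : Type) [Fintype r] [Fintype c] : PMF (Matrix r c P.Rq) :=
  iid r (iid c P.unif)

/-- The algorithm on input `(A, As)` with `A` uniform and `s` drawn from `χ`. -/
def lweReal {r c : Type} [Fintype r] [Fintype c] (B : Prog P (LWEVar r c) Unit) : PMF Bool := do
  let A ← unifMatrix P r c
  let s ← iid c ((iid (Fin P.d) P.χ).map (tern (ZMod P.q)))
  B.bit (encLWE A (A *ᵥ s))

/-- The algorithm on input `(A, u)` with `A` and `u` uniform. -/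
def lweRandom {r c : Type} [Fintype r] [Fintype c] (B : Prog P (LWEVar r c) Unit) :
    PMF Bool := do
  let A ← unifMatrix P r c
  let t ← iid r P.unif
  B.bit (encLWE A t)

variable (P) in
/-- No algorithm of running time at most `T` has advantage more than `ε` in the dual Module-LWE
problem for `r × c` matrices and secrets drawn from `χ`. -/
def DualMLWEHard (r c : Type) [Fintype r] [Fintype c] (T : ℕ) (ε : ℝ) : Prop :=
  ∀ B : Prog P (LWEVar r c) Unit, B.length ≤ T →
    |Pr (lweReal B) {true} - Pr (lweRandom B) {true}| ≤ ε

/-! ### Honest-verifier zero-knowledge -/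

/-- Registers for a commitment key. -/
inductive PPVar (P : Params) where
  | A3 (i : Fin P.κ) (j : P.MIdx)
  | A4 (i : Fin P.κ) (j : Fin P.n)
  | B1 (a : P.E) (j : Fin P.n)
  | B2 (j : Fin P.n)

def PP.enc (pp : PP P) : PPVar P → P.Rq
  | .A3 i j => pp.A3 i j
  | .A4 i j => pp.A4 i j
  | .B1 a j => pp.B1 a j
  | .B2 j => pp.B2 j

/-- Registers for a statement. -/
inductive StmtVar (P : Params) where
  | A (i : Fin P.κ) (j : Fin P.n)
  | pk (b : Fin 2) (j : Fin P.n)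
  | c0 (i : Fin P.κ)
  | c1
  | c2
  | c3
  | c0' (i : Fin P.κ)
  | c1'
  | c2'
  | c3'

def Stmt.enc (x : Stmt P) : StmtVar P → P.Rq
  | .A i j => x.A i j
  | .pk b j => x.pk b j
  | .c0 i => x.com.c0 i
  | .c1 => x.com.c1
  | .c2 => x.com.c2
  | .c3 => x.com.c3
  | .c0' i => x.com'.c0 i
  | .c1' => x.com'.c1
  | .c2' => x.com'.c2
  | .c3' => x.com'.c3

/-- Registers for a transcript. -/
inductive TVar (P : Params) where
  | f (i : Fin P.κ)
  | u1 (a : P.E)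
  | u2
  | r (j : P.J) (b : Fin 2)
  | z3 (a : P.E)
  | dd (j : P.J)
  | h
  | w (i : Fin P.κ)
  | v (i : (Fin 2 × Fin P.n) ⊕ Unit)
  | c
  | z1 (i : P.MIdx)
  | z2 (i : Fin P.n)

def Transcript.enc (t : Transcript P) : TVar P → P.Rq
  | .f i => t.m1.f i
  | .u1 a => t.m1.u1 a
  | .u2 => t.m1.u2
  | .r j b => rvec t.R j b
  | .z3 a => t.z3 a
  | .dd j => AdjoinRoot.of _ (t.dd j)
  | .h => t.m3.h
  | .w i => t.m3.w i
  | .v i => t.m3.v i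
  | .c => tern (ZMod P.q) t.c
  | .z1 i => t.m4.z1 i
  | .z2 i => t.m4.z2 i

variable (P) in
/-- Uniformly random commitment keys. -/
def samplePP : PMF (PP P) := do
  let A3 ← unifMatrix P (Fin P.κ) P.MIdx
  let A4 ← unifMatrix P (Fin P.κ) (Fin P.n)
  let B1 ← unifMatrix P P.E (Fin P.n)
  let B2 ← iid (Fin P.n) P.unif
  pure ⟨A3, A4, B1, B2⟩

/-- The bit of a distinguisher on a random commitment key and a transcript of the honest execution;
`none` if the prover aborts. -/
def realBit (x : Stmt P) (m : P.MIdx → Fin P.d → SignType)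
    (D : Prog P (PPVar P ⊕ TVar P) Unit) : PMF (Option Bool) := do
  let pp ← samplePP P
  let t ← honestRun pp x m
  match t with
  | none => pure none
  | some t => (D.bit (Sum.elim pp.enc t.enc)).map some

/-- The bit of a distinguisher on a random commitment key and the output of a simulator. -/
def simBit (x : Stmt P) (S : Prog P (PPVar P ⊕ StmtVar P) (TVar P))
    (D : Prog P (PPVar P ⊕ TVar P) Unit) : PMF Bool := do
  let pp ← samplePP P
  let t ← S.out (Sum.elim pp.enc x.enc)
  D.bit (Sum.elim pp.enc t)

/-- The advantage in distinguishing non-aborting honest transcripts from simulated ones. -/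
def zkAdvantage (x : Stmt P) (m : P.MIdx → Fin P.d → SignType)
    (S : Prog P (PPVar P ⊕ StmtVar P) (TVar P)) (D : Prog P (PPVar P ⊕ TVar P) Unit) : ℝ :=
  |Pr (realBit x m D) {some true} / Pr (realBit x m D) {b | b ≠ none} - Pr (simBit x S D) {true}|

/-- Honest-verifier zero-knowledge, with a simulator of running time at most `τ`, under the dual
Module-LWE assumption for matrices with `κ + 256/d + 1` rows (those of `A₄`, `B'_eq`, `B''_eq`)
and `κ + lam + 3` columns, where a reduction adds at most `τ` to the running time. -/
def HVZK (P : Params) (τ : ℕ) : Prop :=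
  ∃ S : Prog P (PPVar P ⊕ StmtVar P) (TVar P), S.length ≤ τ ∧
    ∀ (T : ℕ) (ε : ℝ), DualMLWEHard P (Fin (P.κ + 256 / P.d + 1)) (Fin P.n) (T + τ) ε →
      ∀ (x : Stmt P) (m : P.MIdx → Fin P.d → SignType), HonestRel x m →
        ∀ D : Prog P (PPVar P ⊕ TVar P) Unit, D.length ≤ T →
          zkAdvantage x m S D ≤ ε + 2 ^ (-100 : ℝ)

/-! ### Knowledge soundness -/

variable (P) in
/-- A deterministic prover. An arbitrary prover is a probability distribution on these: its coins
are drawn first, and its messages are functions of the coins and of the challenges so far. -/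
structure Strategy where
  m1 : Msg1 P
  m2 : ChR P → Msg2 P
  m3 : ChR P → ChD P → Msg3 P
  m4 : ChR P → ChD P → ChC P → Msg4 P

/-- The transcript of the interaction of a prover with a verifier that sends given challenges. -/
def Strategy.transcript (A : Strategy P) (R : ChR P) (dd : ChD P) (c : ChC P) : Transcript P :=
  ⟨A.m1, R, A.m2 R, dd, A.m3 R dd, c, A.m4 R dd c⟩

/-- The interaction of a prover with the honest verifier. -/
def interact (A : PMF (Strategy P)) : PMF (Transcript P) := do
  let A ← A
  let R ← iid P.J (iid (Fin 2) (iid (Fin P.d) bin1))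
  let dd ← iid P.J (PMF.uniformOfFintype (ZMod P.q))
  let c ← P.chal
  pure (A.transcript R dd c)

/-- The probability that the prover convinces the verifier. -/
def acceptProb (pp : PP P) (x : Stmt P) (A : PMF (Strategy P)) : ℝ :=
  Pr (interact A) {t | Accepts pp x t}

/-- The ternary polynomial read from an element of `𝓡_q` (signs of centered coefficients). -/
def decTern (a : P.Rq) : Fin P.d → SignType := fun k => SignType.sign (cent a k)

/-- Output registers of an extractor: a witness and a candidate for a Module-SIS solution. -/
inductive KOut (P : Params) where
  | cbar
  | m (i : P.MIdx)
  | s (i : Fin P.n)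
  | y (i : P.MIdx ⊕ Fin P.n)

/-- Registers of an extractor: commitment key, statement, transcript, outputs, work registers. -/
abbrev KRegs (P : Params) : Type := Regs ((PPVar P ⊕ StmtVar P) ⊕ TVar P) (KOut P)

/-- Instructions of an extractor: those of programs, and the oracle call `query`. -/
inductive KInstr (P : Params) where
  | op (i : Instr P (KRegs P))
  | query

/-- A call of the oracle resets the prover with the same coins, runs it on the challenges found in
the transcript registers, and writes the resulting transcript to these registers. -/
def KInstr.run (A : Strategy P) : KInstr P → (KRegs P → P.Rq) → PMF (KRegs P → P.Rq)
  | .op i, st => i.run st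
  | .query, st =>
    let tv : TVar P → P.Rq := fun t => st (Sum.inl (Sum.inr t))
    let t := A.transcript (fun j b => decTern (tv (.r j b)))
      (fun j => coeff (tv (.dd j)) 0) (decTern (tv .c))
    PMF.pure (Sum.elim (Sum.elim (fun i => st (Sum.inl (Sum.inl i))) t.enc)
      fun o => st (Sum.inr o))

/-- The output of an extractor with access to the prover `A`. -/
def extract (K : List (KInstr P)) (pp : PP P) (x : Stmt P) (A : Strategy P) :
    PMF (KOut P → P.Rq) :=
  (runList (KInstr.run A) K
    (initState (Sum.elim (Sum.elim pp.enc x.enc) fun _ => 0))).map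
      fun st o => st (Sum.inr (Sum.inl o))

/-- The output contains a witness for the first message `f` of the prover, or a solution of the
Module-SIS problem for the matrix `[A₃ | A₄]`, which has `κ` rows and `5κ+3lam+9` columns. -/
def Extracted (pp : PP P) (x : Stmt P) (f : Fin P.κ → P.Rq) (o : KOut P → P.Rq) : Prop :=
  RelPoE pp x f (o .cbar) (fun i => o (.m i)) (fun i => o (.s i)) ∨
  MSISSolution (Matrix.fromCols pp.A3 pp.A4) (msisBound P) (fun i => o (.y i))

/-- The probability that the extractor succeeds. -/
def extractProb (K : List (KInstr P)) (pp : PP P) (x : Stmt P) (A : PMF (Strategy P)) : ℝ :=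
  Pr (do let A ← A
         let o ← extract K pp x A
         pure (A.m1.f, o)) {r | Extracted pp x r.1 r.2}

/-- Knowledge soundness with knowledge error `err`, with an extractor of running time at most `τ`:
a prover which convinces the verifier with probability `ε > err` is turned into an extractor of
success probability at least `(ε - err)^e / τ`. -/
def KnowledgeSound (P : Params) (τ e : ℕ) (err : ℝ) : Prop :=
  ∃ K : List (KInstr P), K.length ≤ τ ∧
    ∀ (pp : PP P) (x : Stmt P) (A : PMF (Strategy P)),
      err < acceptProb pp x A →
        (acceptProb pp x A - err) ^ e ≤ τ * extractProb K pp x A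

end PoE

end

open Polynomial
open scoped ENNReal Matrix

noncomputable section

namespace PoE

section

/-! ### Expectations -/

/-! Completeness and zero-knowledge rest on one computation. Substituting `z = y + v`, the accepted
response of a rejection step has density `D(z) · min(exp(-rejExp), 1/3)`, where `D` is the centred
Gaussian (`ex_rejection`). This never exceeds `D(z)/3` (`accSum_le`), and its total mass is almost
`1/3` as soon as `‖v‖ ≤ s/11` (`accSum_one_ge`). The standard deviations are chosen so that this
holds for `cm` and `cs` always, and for `Rℓ` except with probability `2^(-110)` over `R`
(`projection_tail`). Hence the honest run is dominated by `1/27` times an ideal run whose responses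
are Gaussians independent of the secrets (`ex_honestRun_le`), while it survives with probability at
least `(1 - 2^(-101))/27` (`honestRun_nonabort`). Conditioning on survival therefore changes the
probability of any event by at most `2^(-100)`.

In the ideal run the verification equations always hold, so rejection can only come from Gaussian
tails; this gives completeness. For zero-knowledge, the ideal transcript is rewritten so that `w`
and `v` are solved from the verification equations and `h` is uniform without constant term
(`honestTrZ_eq`). The randomness `s` then occurs only in `A₄s`, `B's`, `B''s`, which is a dual
Module-LWE sample. If that sample is uniform, it absorbs every remaining shift by a secret, and what
is left is the simulator (`exSim_eq`).

For soundness, two accepting transcripts that agree up to the last challenge, and whose last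
challenges differ by a unit, yield a weak opening `(m, s)` of `f` (`Opens`). Challenge differences
are units except with small probability: each NTT component of a challenge is nearly uniform by
Fourier analysis on `ℤ_q` (`not_isUnit_prob_le`). An opening also satisfies an affine relation in
the scalars `d_j` whose coefficients measure how far `z₃` is from `Rℓ + y₃`. A fixed opening with a
long decryption satisfies it, with `z₃` short, only with probability `1/q + 2^(-256)` over `R` and
`d` (`consistent_prob_le`). The extracted opening is not fixed, however; it depends on `R` and `d`.
So a second, independent pair of transcripts is taken: either the first opening is good, or, as a
fixed bad opening explains few challenges, the second opening often differs from the first, and two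
different openings give a Module-SIS solution (`forking`, `msis_of_opens`). Each pair costs a square
by Jensen, whence the exponent `4`.

The rest compiles simulator, reduction and extractor into straight-line programs. Lengths are
bounded by powers of one base `P.bnd`, so that counting instructions amounts to tracking exponents.
-/

/-- The expectation of a nonnegative function. -/
def ex {α : Type} (μ : PMF α) (f : α → ℝ≥0∞) : ℝ≥0∞ := ∑' a, μ a * f a

section Expectation

variable {α β : Type}

theorem ex_pure (a : α) (f : α → ℝ≥0∞) : ex (PMF.pure a) f = f a := by
  classical
  unfold ex
  rw [tsum_eq_single a]
  · simp
  · intro b hb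
    simp [hb]

theorem ex_bind (μ : PMF α) (k : α → PMF β) (f : β → ℝ≥0∞) :
    ex (μ.bind k) f = ex μ fun a => ex (k a) f := by
  unfold ex
  simp only [PMF.bind_apply, ← ENNReal.tsum_mul_left, ← ENNReal.tsum_mul_right]
  rw [ENNReal.tsum_comm]
  simp only [mul_assoc]

theorem ex_bind' (μ : PMF α) (k : α → PMF β) (f : β → ℝ≥0∞) :
    ex (μ >>= k) f = ex μ fun a => ex (k a) f := ex_bind μ k f

theorem ex_pure' (a : α) (f : α → ℝ≥0∞) : ex (pure a : PMF α) f = f a := ex_pure a f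

theorem ex_map (μ : PMF α) (g : α → β) (f : β → ℝ≥0∞) :
    ex (μ.map g) f = ex μ fun a => f (g a) := by
  unfold PMF.map
  rw [ex_bind]
  simp only [Function.comp, ex_pure]

theorem ex_mono (μ : PMF α) {f g : α → ℝ≥0∞} (h : ∀ a, f a ≤ g a) : ex μ f ≤ ex μ g :=
  ENNReal.tsum_le_tsum fun a => by gcongr; exact h a

theorem ex_mono_support (μ : PMF α) {f g : α → ℝ≥0∞} (h : ∀ a ∈ μ.support, f a ≤ g a) :
    ex μ f ≤ ex μ g :=
  ENNReal.tsum_le_tsum fun a => by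
    by_cases ha : μ a = 0
    · simp [ha]
    · gcongr
      exact h a ha

theorem ex_const (μ : PMF α) (c : ℝ≥0∞) : ex μ (fun _ => c) = c := by
  simp [ex, ENNReal.tsum_mul_right, μ.tsum_coe]

theorem ex_le_const (μ : PMF α) {f : α → ℝ≥0∞} {c : ℝ≥0∞} (h : ∀ a, f a ≤ c) : ex μ f ≤ c :=
  (ex_mono μ h).trans (ex_const μ c).le

theorem le_ex_const (μ : PMF α) {f : α → ℝ≥0∞} {c : ℝ≥0∞} (h : ∀ a, c ≤ f a) : c ≤ ex μ f :=
  (ex_const μ c).symm.le.trans (ex_mono μ h)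

theorem ex_mul_left (μ : PMF α) (c : ℝ≥0∞) (f : α → ℝ≥0∞) :
    ex μ (fun a => c * f a) = c * ex μ f := by
  unfold ex
  rw [← ENNReal.tsum_mul_left]
  exact tsum_congr fun a => by ring

theorem ex_mul_right (μ : PMF α) (c : ℝ≥0∞) (f : α → ℝ≥0∞) :
    ex μ (fun a => f a * c) = ex μ f * c := by
  rw [mul_comm, ← ex_mul_left]
  simp only [mul_comm]

theorem ex_add (μ : PMF α) (f g : α → ℝ≥0∞) :
    ex μ (fun a => f a + g a) = ex μ f + ex μ g := by
  unfold ex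
  rw [← ENNReal.tsum_add]
  exact tsum_congr fun a => by ring

theorem ex_finsetSum {ι : Type} (μ : PMF α) (s : Finset ι) (f : ι → α → ℝ≥0∞) :
    ex μ (fun a => ∑ i ∈ s, f i a) = ∑ i ∈ s, ex μ (f i) := by
  classical
  induction s using Finset.induction_on with
  | empty => simp [ex_const]
  | insert i s hi ih => simp only [Finset.sum_insert hi, ex_add, ih]

theorem ex_comm (μ : PMF α) (ν : PMF β) (f : α → β → ℝ≥0∞) :
    ex μ (fun a => ex ν (f a)) = ex ν fun b => ex μ fun a => f a b := by
  unfold ex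
  simp only [← ENNReal.tsum_mul_left]
  rw [ENNReal.tsum_comm]
  exact tsum_congr fun b => tsum_congr fun a => by ring

theorem ex_fintype [Fintype α] (μ : PMF α) (f : α → ℝ≥0∞) : ex μ f = ∑ a, μ a * f a :=
  tsum_fintype _

/-- Testing against indicators of points recovers the point masses. Composed sampling procedures can
thus be compared by pushing `ex` through `bind` and `map`. -/
theorem pmf_ext_ex {μ ν : PMF α} (h : ∀ f, ex μ f = ex ν f) : μ = ν := by
  classical
  ext a
  have := h (fun b => if b = a then 1 else 0)
  simpa [ex] using this

theorem Pr_eq_ex (μ : PMF α) (E : Set α) : Pr μ E = (ex μ (E.indicator 1)).toReal := by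
  unfold Pr ex
  rw [PMF.toOuterMeasure_apply]
  congr 1
  refine tsum_congr fun a => ?_
  by_cases h : a ∈ E <;> simp [h]

theorem ex_indicator_le_one (μ : PMF α) (E : Set α) : ex μ (E.indicator 1) ≤ 1 :=
  ex_le_const μ fun a => Set.indicator_le_self' (by simp) a

theorem ex_indicator_ne_top (μ : PMF α) (E : Set α) : ex μ (E.indicator 1) ≠ ⊤ :=
  ((ex_indicator_le_one μ E).trans_lt ENNReal.one_lt_top).ne

/-- Jensen's inequality, from `2tf ≤ f² + t²` averaged at `t = ex μ f`. Cancelling `t²` needs `t`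
finite; if `t = ⊤`, then `f ≤ 1 + f²` makes the right-hand side infinite too. -/
theorem ex_pow_two (μ : PMF α) (f : α → ℝ≥0∞) : ex μ f ^ 2 ≤ ex μ fun a => f a ^ 2 := by
  by_cases ht : ex μ f = ⊤
  · have h1 : ex μ f ≤ 1 + ex μ fun a => f a ^ 2 := by
      rw [← ex_const μ 1, ← ex_add]
      refine ex_mono μ fun a => ?_
      rcases le_total (f a) 1 with h | h
      · exact h.trans le_self_add
      · refine le_trans ?_ le_add_self
        calc f a = f a * 1 := (mul_one _).symm
          _ ≤ f a * f a := by gcongr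
          _ = f a ^ 2 := (sq _).symm
    rw [ht, top_le_iff, ENNReal.add_eq_top] at h1
    rcases h1 with h1 | h1
    · simp at h1
    · rw [h1]; exact le_top
  · set t := ex μ f with htdef
    have h2 : 2 * t * t ≤ (ex μ fun a => f a ^ 2) + t ^ 2 := by
      nth_rewrite 2 [htdef]
      rw [← ex_mul_left, ← ex_const μ (t ^ 2), ← ex_add]
      refine ex_mono μ fun a => ?_
      by_cases hf : f a = ⊤
      · simp [hf]
      · lift f a to NNReal using hf with y
        lift t to NNReal using ht with x
        norm_cast
        have := two_mul_le_add_sq x y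
        rw [add_comm]
        exact this
    have h3 : t ^ 2 + t ^ 2 ≤ (ex μ fun a => f a ^ 2) + t ^ 2 := by
      refine le_trans (le_of_eq ?_) h2
      ring
    exact (ENNReal.add_le_add_iff_right (by finiteness)).1 h3

theorem ex_pow_four (μ : PMF α) (f : α → ℝ≥0∞) : ex μ f ^ 4 ≤ ex μ fun a => f a ^ 4 := by
  calc ex μ f ^ 4 = (ex μ f ^ 2) ^ 2 := by ring
    _ ≤ (ex μ fun a => f a ^ 2) ^ 2 := by gcongr; exact ex_pow_two μ f
    _ ≤ ex μ fun a => (f a ^ 2) ^ 2 := ex_pow_two μ _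
    _ = _ := by simp only [← pow_mul]

/-- Truncated subtraction of a constant is convex, so this is again Jensen. It allows an error term
to be subtracted separately for each value of the coins. -/
theorem ex_tsub (μ : PMF α) (f : α → ℝ≥0∞) (c : ℝ≥0∞) :
    ex μ f - c ≤ ex μ fun a => f a - c := by
  rw [tsub_le_iff_right]
  nth_rewrite 2 [← ex_const μ c]
  rw [← ex_add]
  exact ex_mono μ fun a => le_tsub_add

/-! ### Independent samples -/

theorem iid_apply {ι : Type} [Fintype ι] (μ : PMF α) (a : ι → α) : iid ι μ a = ∏ i, μ (a i) := rfl

theorem prod_tsum_fin (n : ℕ) (g : Fin n → α → ℝ≥0∞) :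
    ∑' f : Fin n → α, ∏ i, g i (f i) = ∏ i, ∑' a, g i a := by
  induction n with
  | zero => simp
  | succ n ih =>
    rw [← (Fin.consEquiv fun _ : Fin (n + 1) => α).tsum_eq]
    simp only [Fin.consEquiv_apply, Fin.prod_univ_succ, Fin.cons_zero, Fin.cons_succ]
    rw [ENNReal.tsum_prod']
    simp only [ENNReal.tsum_mul_left]
    rw [ih fun i => g i.succ, ENNReal.tsum_mul_right]

theorem prod_tsum {ι : Type} [Fintype ι] (g : ι → α → ℝ≥0∞) :
    ∑' f : ι → α, ∏ i, g i (f i) = ∏ i, ∑' a, g i a := by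
  have h := prod_tsum_fin (Fintype.card ι) fun i => g ((Fintype.equivFin ι).symm i)
  rw [← (Equiv.arrowCongr (Fintype.equivFin ι).symm (Equiv.refl α)).tsum_eq]
  rw [Fintype.prod_equiv (Fintype.equivFin ι).symm _ (fun i => ∑' a, g i a) fun i => rfl] at h
  rw [← h]
  refine tsum_congr fun f => ?_
  exact Fintype.prod_equiv (Fintype.equivFin ι) _ _ fun i => by simp [Equiv.arrowCongr]

theorem ex_iid_prod {ι : Type} [Fintype ι] (μ : PMF α) (g : ι → α → ℝ≥0∞) :
    ex (iid ι μ) (fun a => ∏ i, g i (a i)) = ∏ i, ex μ (g i) := by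
  unfold ex
  rw [← prod_tsum]
  exact tsum_congr fun a => by rw [iid_apply, Finset.prod_mul_distrib]

theorem ex_iid_equiv {ι κ : Type} [Fintype ι] [Fintype κ] (e : ι ≃ κ) (μ : PMF α)
    (f : (κ → α) → ℝ≥0∞) : ex (iid κ μ) f = ex (iid ι μ) fun a => f (a ∘ e.symm) := by
  unfold ex
  rw [← (Equiv.arrowCongr e (Equiv.refl α)).tsum_eq]
  refine tsum_congr fun a => ?_
  congr 1
  rw [iid_apply, iid_apply]
  exact Fintype.prod_equiv e.symm _ _ fun i => by simp [Equiv.arrowCongr]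

theorem ex_iid_sum {ι κ : Type} [Fintype ι] [Fintype κ] (μ : PMF α) (f : (ι ⊕ κ → α) → ℝ≥0∞) :
    ex (iid (ι ⊕ κ) μ) f = ex (iid ι μ) fun a => ex (iid κ μ) fun b => f (Sum.elim a b) := by
  unfold ex
  rw [← (Equiv.sumArrowEquivProdArrow ι κ α).symm.tsum_eq, ENNReal.tsum_prod']
  refine tsum_congr fun a => ?_
  rw [← ENNReal.tsum_mul_left]
  refine tsum_congr fun b => ?_
  rw [← mul_assoc]
  congr 1
  simp [iid_apply, Equiv.sumArrowEquivProdArrow]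

theorem ex_iid_curry {ι κ : Type} [Fintype ι] [Fintype κ] (μ : PMF α)
    (f : (ι × κ → α) → ℝ≥0∞) :
    ex (iid (ι × κ) μ) f = ex (iid ι (iid κ μ)) fun a => f fun p => a p.1 p.2 := by
  unfold ex
  rw [← (Equiv.curry ι κ α).symm.tsum_eq]
  refine tsum_congr fun a => ?_
  simp only [iid_apply, Fintype.prod_prod_type]
  rfl

theorem iid_map {ι : Type} [Fintype ι] (μ : PMF α) (g : α → β) :
    iid ι (μ.map g) = (iid ι μ).map fun a i => g (a i) := by
  classical
  ext b
  rw [iid_apply, PMF.map_apply]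
  simp only [PMF.map_apply]
  rw [← prod_tsum]
  refine tsum_congr fun a => ?_
  rw [Finset.prod_ite_zero]
  simp [funext_iff, iid_apply]

theorem ex_iid_map {ι : Type} [Fintype ι] (μ : PMF α) (g : α → β) (f : (ι → β) → ℝ≥0∞) :
    ex (iid ι (μ.map g)) f = ex (iid ι μ) fun a => f fun i => g (a i) := by
  rw [iid_map, ex_map]

/-- Coordinate `i` is independent of the others, so overwriting it by a fresh sample preserves the
law. Followed by `ex_le_const`, this is conditioning on all other coordinates. -/
theorem ex_iid_resample {ι : Type} [Fintype ι] [DecidableEq ι] (μ : PMF α) (i : ι)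
    (f : (ι → α) → ℝ≥0∞) :
    ex (iid ι μ) f = ex (iid ι μ) fun a => ex μ fun b => f (Function.update a i b) := by
  -- Splitting a family into its value at `i` and the rest factors the weight; the overwritten value
  -- then sums to total mass one.
  have key : ∀ g : (ι → α) → ℝ≥0∞, ex (iid ι μ) g =
      ∑' b, ∑' r : {j // j ≠ i} → α, (μ b * ∏ j, μ (r j)) *
        g ((Equiv.funSplitAt i α).symm (b, r)) := by
    intro g
    unfold ex
    rw [← (Equiv.funSplitAt i α).symm.tsum_eq, ENNReal.tsum_prod']
    refine tsum_congr fun b => tsum_congr fun r => ?_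
    congr 1
    rw [iid_apply, ← Finset.mul_prod_erase _ _ (Finset.mem_univ i)]
    congr 1
    · simp [Equiv.funSplitAt, Equiv.piSplitAt]
    · rw [← Finset.prod_subtype_of_mem (p := fun j => j ≠ i)] <;> try simp
      · refine Finset.prod_congr ?_ fun j _ => ?_
        · ext j; simp [j.2]
        · simp [j.2]
  rw [key, key]
  have hupd : ∀ b b' (r : {j // j ≠ i} → α),
      Function.update ((Equiv.funSplitAt i α).symm (b, r)) i b' =
        (Equiv.funSplitAt i α).symm (b', r) := by
    intro b b' r
    ext j
    by_cases hj : j = i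
    · subst hj; simp [Equiv.funSplitAt, Equiv.piSplitAt]
    · simp [Equiv.funSplitAt, Equiv.piSplitAt, hj]
  simp only [hupd, mul_assoc, ENNReal.tsum_mul_left]
  rw [ENNReal.tsum_mul_right, μ.tsum_coe, one_mul]
  unfold ex
  simp only [← ENNReal.tsum_mul_left]
  rw [ENNReal.tsum_comm]
  exact tsum_congr fun b => tsum_congr fun r => by ring

theorem ex_iid_marginal {ι : Type} [Fintype ι] (μ : PMF α) (i : ι) (f : α → ℝ≥0∞) :
    ex (iid ι μ) (fun a => f (a i)) = ex μ f := by
  classical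
  rw [ex_iid_resample μ i]
  simp [ex_const]

theorem iid_uniform {ι : Type} [Fintype ι] [DecidableEq ι] [Fintype α] [Nonempty α] :
    PMF.uniformOfFintype (ι → α) = iid ι (PMF.uniformOfFintype α) := by
  ext a
  rw [iid_apply]
  simp [PMF.uniformOfFintype_apply, ENNReal.inv_pow]

theorem ex_iid_unique {ι : Type} [Fintype ι] [Unique ι] (μ : PMF α) (f : (ι → α) → ℝ≥0∞) :
    ex (iid ι μ) f = ex μ fun a => f fun _ => a := by
  unfold ex
  rw [← (Equiv.funUnique ι α).symm.tsum_eq]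
  refine tsum_congr fun a => ?_
  simp only [iid_apply, Fintype.prod_unique]
  rfl

end Expectation

end

section

/-! ### Coefficients in `S[X]/(X^d+1)` -/

section Coefficients

variable {S : Type} [CommRing S] {d : ℕ}

/-- The class of `X`. -/
abbrev rt (S : Type) [CommRing S] (d : ℕ) : CycRing S d := AdjoinRoot.root (X ^ d + 1 : S[X])

theorem coeff_add (x y : CycRing S d) (k : Fin d) : coeff (x + y) k = coeff x k + coeff y k := by
  simp [coeff]

theorem coeff_sub (x y : CycRing S d) (k : Fin d) : coeff (x - y) k = coeff x k - coeff y k := by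
  simp [coeff]

theorem coeff_neg (x : CycRing S d) (k : Fin d) : coeff (-x) k = -coeff x k := by
  simp [coeff]

theorem coeff_zero (k : Fin d) : coeff (0 : CycRing S d) k = 0 := by
  simp [coeff]

theorem coeff_smul (s : S) (x : CycRing S d) (k : Fin d) : coeff (s • x) k = s * coeff x k := by
  simp [coeff]

theorem coeff_sum {ι : Type} (s : Finset ι) (f : ι → CycRing S d) (k : Fin d) :
    coeff (∑ i ∈ s, f i) k = ∑ i ∈ s, coeff (f i) k := by
  classical
  induction s using Finset.induction_on with
  | empty => simp [coeff_zero]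
  | insert i s hi ih => simp [Finset.sum_insert hi, coeff_add, ih]

theorem of_mul_eq_smul (s : S) (x : CycRing S d) : AdjoinRoot.of (X ^ d + 1 : S[X]) s * x = s • x := by
  rw [Algebra.smul_def]
  rfl

theorem ofCoeffs_eq (a : Fin d → S) :
    ofCoeffs a = ∑ i, a i • rt S d ^ (i : ℕ) := by
  simp only [ofCoeffs, of_mul_eq_smul]

theorem coeff_mk_of_degree_lt {f : S[X]} (hf : f.degree < d) (k : Fin d) :
    coeff (AdjoinRoot.mk (X ^ d + 1) f) k = f.coeff k := by
  rcases subsingleton_or_nontrivial S with h | h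
  · exact Subsingleton.elim _ _
  · unfold coeff
    rw [AdjoinRoot.modByMonicHom_mk, (Polynomial.modByMonic_eq_self_iff (monic_cyc S k.pos.ne')).2]
    have : (X ^ d + 1 : S[X]).degree = d := by
      simpa using degree_X_pow_add_C (R := S) k.pos 1
    rwa [this]

theorem coeff_rt_pow (j : ℕ) (hj : j < d) (k : Fin d) :
    coeff (rt S d ^ j) k = if (k : ℕ) = j then 1 else 0 := by
  have h : rt S d ^ j = AdjoinRoot.mk (X ^ d + 1) (X ^ j) := by simp [rt]
  rw [h, coeff_mk_of_degree_lt, coeff_X_pow]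
  exact (degree_X_pow_le j).trans_lt (by exact_mod_cast hj)

theorem coeff_ofCoeffs (a : Fin d → S) (k : Fin d) : coeff (ofCoeffs a) k = a k := by
  rw [ofCoeffs_eq, coeff_sum]
  simp only [coeff_smul, coeff_rt_pow _ (Fin.is_lt _), mul_ite, mul_one, mul_zero]
  rw [Finset.sum_eq_single k]
  · simp
  · intro b _ hb
    simp [Fin.val_inj, hb.symm]
  · simp

theorem ofCoeffs_coeff [NeZero d] (x : CycRing S d) : ofCoeffs (coeff x) = x := by
  rcases subsingleton_or_nontrivial S with h | h
  · have : Subsingleton (CycRing S d) := Module.subsingleton S _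
    exact Subsingleton.elim _ _
  obtain ⟨f, rfl⟩ := AdjoinRoot.mk_surjective x
  have hmon := monic_cyc S (NeZero.ne d)
  have hdeg : (f %ₘ (X ^ d + 1)).degree < d := by
    refine (degree_modByMonic_lt f hmon).trans_eq ?_
    simpa using degree_X_pow_add_C (R := S) (NeZero.pos d) 1
  have hmk : AdjoinRoot.mk (X ^ d + 1) f = AdjoinRoot.mk (X ^ d + 1) (f %ₘ (X ^ d + 1)) := by
    rw [AdjoinRoot.mk_eq_mk]
    exact ⟨f /ₘ (X ^ d + 1), by rw [sub_eq_iff_eq_add, add_comm]; exact (modByMonic_add_div f _).symm⟩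
  rw [hmk]
  set g := f %ₘ (X ^ d + 1)
  have hnat : g.natDegree < d := by
    by_cases hg : g = 0
    · rw [hg, natDegree_zero]; exact NeZero.pos d
    · exact (natDegree_lt_iff_degree_lt hg).2 hdeg
  rw [ofCoeffs_eq]
  simp only [coeff_mk_of_degree_lt hdeg]
  conv_rhs => rw [g.as_sum_range_C_mul_X_pow' (n := d) hnat]
  rw [map_sum, ← Fin.sum_univ_eq_sum_range (fun i => AdjoinRoot.mk (X ^ d + 1) (C (g.coeff i) * X ^ i))]
  refine Finset.sum_congr rfl fun i _ => ?_
  rw [map_mul, map_pow, AdjoinRoot.mk_C, of_mul_eq_smul, AdjoinRoot.mk_X]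

theorem coeff_ext [NeZero d] {x y : CycRing S d} (h : ∀ k, coeff x k = coeff y k) : x = y := by
  rw [← ofCoeffs_coeff x, ← ofCoeffs_coeff y]
  congr 1
  exact funext h

theorem ofCoeffs_add (a b : Fin d → S) : ofCoeffs (a + b) = ofCoeffs a + ofCoeffs b := by
  simp only [ofCoeffs_eq, Pi.add_apply, add_smul, Finset.sum_add_distrib]

theorem coeff_of [NeZero d] (s : S) (k : Fin d) :
    coeff (AdjoinRoot.of (X ^ d + 1 : S[X]) s) k = if k = 0 then s else 0 := by
  have h : AdjoinRoot.of (X ^ d + 1 : S[X]) s = s • rt S d ^ 0 := by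
    rw [← of_mul_eq_smul, pow_zero, mul_one]
  rw [h, coeff_smul, coeff_rt_pow _ (NeZero.pos d)]
  simp only [Fin.val_eq_zero_iff, mul_ite, mul_one, mul_zero]

theorem rt_pow_d : rt S d ^ d = -1 := by
  have h := AdjoinRoot.eval₂_root (X ^ d + 1 : S[X])
  exact eq_neg_of_add_eq_zero_left (by simpa using h)

theorem conj_rt : conj (rt S d) = -rt S d ^ (d - 1) := by
  simp [conj, rt]

theorem conj_rt_mul_rt [NeZero d] : conj (rt S d) * rt S d = 1 := by
  rw [conj_rt, neg_mul, ← pow_succ, Nat.sub_add_cancel (NeZero.pos d), rt_pow_d, neg_neg]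

theorem conj_smul (s : S) (x : CycRing S d) : conj (s • x) = s • conj x := by
  rw [← of_mul_eq_smul, ← of_mul_eq_smul, map_mul]
  congr 1
  simp [conj]

/-- The product is `X^(j-i)` if `i ≤ j`, and `-X^(d-(i-j))` otherwise. In the second case the
exponent lies strictly between `0` and `d`, so there is no constant term. -/
theorem coeff_conj_rt_pow_mul [NeZero d] (i j : Fin d) :
    coeff (conj (rt S d ^ (i : ℕ)) * rt S d ^ (j : ℕ)) 0 = if i = j then 1 else 0 := by
  have hi := i.is_lt
  have hj := j.is_lt
  rw [map_pow]
  rcases le_or_gt (i : ℕ) j with h | h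
  · rw [← Nat.add_sub_cancel' h, pow_add, ← mul_assoc, ← mul_pow, conj_rt_mul_rt, one_pow, one_mul,
      coeff_rt_pow _ (by omega)]
    simp only [Fin.ext_iff, Fin.val_zero]
    congr 1
    apply propext
    omega
  · have h1 : conj (rt S d) ^ (i : ℕ) * rt S d ^ (j : ℕ) = -rt S d ^ (d - (i - j)) := by
      have h2 : conj (rt S d) ^ ((i : ℕ) - j) * rt S d ^ ((i : ℕ) - j) = 1 := by
        rw [← mul_pow, conj_rt_mul_rt, one_pow]
      have h3 : rt S d ^ (d - (i - j)) * rt S d ^ ((i : ℕ) - j) = -1 := by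
        rw [← pow_add, Nat.sub_add_cancel (by omega), rt_pow_d]
      calc conj (rt S d) ^ (i : ℕ) * rt S d ^ (j : ℕ)
          = conj (rt S d) ^ ((i : ℕ) - j) * (conj (rt S d) * rt S d) ^ (j : ℕ) := by
            rw [mul_pow, ← mul_assoc, ← pow_add, Nat.sub_add_cancel h.le]
        _ = conj (rt S d) ^ ((i : ℕ) - j) := by rw [conj_rt_mul_rt, one_pow, mul_one]
        _ = -(conj (rt S d) ^ ((i : ℕ) - j) *
              (rt S d ^ (d - (i - j)) * rt S d ^ ((i : ℕ) - j))) := by rw [h3]; ring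
        _ = -((conj (rt S d) ^ ((i : ℕ) - j) * rt S d ^ ((i : ℕ) - j)) *
              rt S d ^ (d - (i - j))) := by ring
        _ = _ := by rw [h2, one_mul]
    rw [h1, coeff_neg, coeff_rt_pow _ (by omega), if_neg, if_neg, neg_zero]
    · intro h4; rw [h4] at h; exact lt_irrefl _ h
    · simp only [Fin.val_zero]; omega

/-- The constant coefficient of `σ₋₁(x) y` is the inner product of the coefficient vectors. -/
theorem coeff_conj_mul_zero [NeZero d] (x y : CycRing S d) :
    coeff (conj x * y) 0 = ∑ k, coeff x k * coeff y k := by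
  conv_lhs => rw [← ofCoeffs_coeff x, ← ofCoeffs_coeff y]
  rw [ofCoeffs_eq, ofCoeffs_eq, map_sum, Finset.sum_mul_sum, coeff_sum]
  refine Finset.sum_congr rfl fun i _ => ?_
  rw [coeff_sum]
  simp only [conj_smul, smul_mul_smul_comm, coeff_smul, coeff_conj_rt_pow_mul]
  simp

end Coefficients

/-! ### Reduction modulo `q` -/

section Reduction

variable {q d : ℕ}

/-- Reduction modulo `q` as a ring homomorphism. -/
def redHom (q d : ℕ) : CycRing ℤ d →+* CycRing (ZMod q) d :=
  AdjoinRoot.lift ((AdjoinRoot.of (X ^ d + 1 : (ZMod q)[X])).comp (Int.castRingHom (ZMod q)))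
    (rt (ZMod q) d) (by
      have h := AdjoinRoot.eval₂_root (X ^ d + 1 : (ZMod q)[X])
      simpa using h)

theorem redHom_ofCoeffs (a : Fin d → ℤ) : redHom q d (ofCoeffs a) = red q a := by
  simp only [ofCoeffs, red, map_sum, map_mul, map_pow]
  refine Finset.sum_congr rfl fun i _ => ?_
  congr 1
  · exact AdjoinRoot.lift_of _
  · exact congrArg (· ^ (i : ℕ)) (AdjoinRoot.lift_root _)

theorem coeff_red (a : Fin d → ℤ) (k : Fin d) : coeff (red q a) k = (a k : ZMod q) :=
  coeff_ofCoeffs _ _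

theorem coeff_tern {S : Type} [CommRing S] (a : Fin d → SignType) (k : Fin d) :
    coeff (tern S a) k = ((a k : ℤ) : S) :=
  coeff_ofCoeffs _ _

theorem redHom_tern (a : Fin d → SignType) : redHom q d (tern ℤ a) = tern (ZMod q) a := by
  simp [tern, redHom_ofCoeffs, red]

theorem coeff_redHom [NeZero d] (x : CycRing ℤ d) (k : Fin d) :
    coeff (redHom q d x) k = ((coeff x k : ℤ) : ZMod q) := by
  conv_lhs => rw [← ofCoeffs_coeff (S := ℤ) (d := d) x]
  rw [redHom_ofCoeffs, coeff_red]

theorem red_add (a b : Fin d → ℤ) : red q (a + b) = red q a + red q b := by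
  simp only [red, ← ofCoeffs_add]
  congr 1
  ext k
  simp

theorem cent_cast [NeZero q] (x : CycRing (ZMod q) d) (k : Fin d) :
    ((cent x k : ℤ) : ZMod q) = coeff x k := ZMod.coe_valMinAbs _

theorem red_cent [NeZero q] [NeZero d] (x : CycRing (ZMod q) d) : red q (cent x) = x :=
  coeff_ext fun k => by rw [coeff_red, cent_cast]

/-- The centred representative has the least absolute value in its class. Norms modulo `q` are
therefore bounded by the norm of any integer lift, whatever the size of `q`. -/
theorem natAbs_cent_le [NeZero q] {x : CycRing (ZMod q) d} {k : Fin d} {n : ℤ}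
    (h : (n : ZMod q) = coeff x k) : (cent x k).natAbs ≤ n.natAbs := by
  refine ZMod.natAbs_min_of_le_div_two q _ _ ?_ (ZMod.natAbs_valMinAbs_le _)
  rw [h]
  exact cent_cast x k

end Reduction

/-! ### Norms -/

section Norms

/-- The Euclidean norm of an integer vector. -/
def l2Z {ι : Type} [Fintype ι] (a : ι → ℤ) : ℝ := Real.sqrt (∑ i, (a i : ℝ) ^ 2)

variable {ι : Type} [Fintype ι]

theorem l2Z_eq_norm (a : ι → ℤ) : l2Z a = ‖(WithLp.toLp 2 fun i => (a i : ℝ))‖ := by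
  simp [l2Z, EuclideanSpace.norm_eq]

theorem l2Z_nonneg (a : ι → ℤ) : 0 ≤ l2Z a := Real.sqrt_nonneg _

theorem l2Z_sq (a : ι → ℤ) : l2Z a ^ 2 = ∑ i, (a i : ℝ) ^ 2 :=
  Real.sq_sqrt (Finset.sum_nonneg fun _ _ => sq_nonneg _)

theorem l2Z_add_le (a b : ι → ℤ) : l2Z (fun i => a i + b i) ≤ l2Z a + l2Z b := by
  simp only [l2Z_eq_norm]
  refine le_trans (le_of_eq ?_) (norm_add_le _ _)
  congr 1
  ext i
  simp

theorem l2Z_smul (c : ℤ) (a : ι → ℤ) : l2Z (fun i => c * a i) = |(c : ℝ)| * l2Z a := by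
  simp only [l2Z_eq_norm]
  rw [← Real.norm_eq_abs, ← norm_smul]
  congr 1
  ext i
  simp

theorem l2Z_sub_le (a b : ι → ℤ) : l2Z (fun i => a i - b i) ≤ l2Z a + l2Z b := by
  have h := l2Z_add_le a fun i => -1 * b i
  rw [l2Z_smul] at h
  simpa [sub_eq_add_neg] using h

theorem l2Z_sum_le {κ : Type} (s : Finset κ) (a : κ → ι → ℤ) :
    l2Z (fun i => ∑ k ∈ s, a k i) ≤ ∑ k ∈ s, l2Z (a k) := by
  classical
  induction s using Finset.induction_on with
  | empty => simp [l2Z]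
  | insert k s hk ih =>
    simp only [Finset.sum_insert hk]
    exact (l2Z_add_le _ _).trans (by gcongr)

theorem l2Z_mono {a b : ι → ℤ} (h : ∀ i, (a i).natAbs ≤ (b i).natAbs) : l2Z a ≤ l2Z b := by
  refine Real.sqrt_le_sqrt (Finset.sum_le_sum fun i _ => ?_)
  rw [sq_le_sq]
  have := h i
  rw [← Int.cast_abs, ← Int.cast_abs, Int.abs_eq_natAbs, Int.abs_eq_natAbs]
  exact_mod_cast this

theorem l2_eq {q d : ℕ} (v : ι → CycRing (ZMod q) d) :
    l2 v = l2Z fun p : ι × Fin d => cent (v p.1) p.2 := by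
  unfold l2 l2Z
  rw [Fintype.sum_prod_type]

theorem l1_tern_sub_le {q d : ℕ} [NeZero q] (a b : Fin d → SignType) :
    l1 (tern (ZMod q) a - tern (ZMod q) b) ≤
      ∑ k, ((a k : ℤ)).natAbs + ∑ k, ((b k : ℤ)).natAbs := by
  unfold l1
  rw [← Finset.sum_add_distrib]
  refine Finset.sum_le_sum fun k _ => ?_
  refine le_trans (natAbs_cent_le (n := (a k : ℤ) - (b k : ℤ)) ?_) (Int.natAbs_sub_le _ _)
  simp [coeff_sub, coeff_tern]

theorem l2_le_of_cast {q d : ℕ} [NeZero q] {v : ι → CycRing (ZMod q) d} {a : ι × Fin d → ℤ}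
    (h : ∀ i k, ((a (i, k) : ℤ) : ZMod q) = coeff (v i) k) : l2 v ≤ l2Z a := by
  rw [l2_eq]
  exact l2Z_mono fun p => natAbs_cent_le (h p.1 p.2)

theorem l2_sub_le {q d : ℕ} [NeZero q] (v w : ι → CycRing (ZMod q) d) : l2 (v - w) ≤ l2 v + l2 w := by
  rw [l2_eq v, l2_eq w]
  refine le_trans (l2_le_of_cast (fun i k => ?_)) (l2Z_sub_le _ _)
  simp [cent_cast, coeff_sub]

variable {d : ℕ} [NeZero d]

/-- The sum of squares is the constant coefficient of `σ₋₁(x)x`, and `σ₋₁(X)X = 1`: multiplication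
by a power of `X` is an isometry. -/
theorem sum_sq_coeff_rt_pow_mul {S : Type} [CommRing S] (x : CycRing S d) (j : ℕ) :
    ∑ k, (coeff (rt S d ^ j * x) k) ^ 2 = ∑ k, (coeff x k) ^ 2 := by
  simp only [sq]
  rw [← coeff_conj_mul_zero, ← coeff_conj_mul_zero, map_mul, map_pow]
  congr 1
  rw [mul_mul_mul_comm, ← mul_pow, conj_rt_mul_rt, one_pow, one_mul]

theorem l2Z_coeff_rt_pow_mul (v : ι → CycRing ℤ d) (j : ℕ) :
    l2Z (fun p : ι × Fin d => coeff (rt ℤ d ^ j * v p.1) p.2) =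
      l2Z (fun p : ι × Fin d => coeff (v p.1) p.2) := by
  unfold l2Z
  congr 1
  simp only [Fintype.sum_prod_type]
  refine Finset.sum_congr rfl fun i _ => ?_
  exact_mod_cast sum_sq_coeff_rt_pow_mul (v i) j

theorem coeff_mul_eq_sum {S : Type} [CommRing S] (c x : CycRing S d) (k : Fin d) :
    coeff (c * x) k = ∑ i : Fin d, coeff c i * coeff (rt S d ^ (i : ℕ) * x) k := by
  conv_lhs => rw [← ofCoeffs_coeff c]
  rw [ofCoeffs_eq, Finset.sum_mul, coeff_sum]
  simp only [smul_mul_assoc, coeff_smul]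

/-- Write `cv` as the combination of the vectors `X^k v` with the coefficients of `c`; all of these
have the norm of `v`, and the triangle inequality applies. -/
theorem l2Z_coeff_mul_le (c : CycRing ℤ d) (v : ι → CycRing ℤ d) :
    l2Z (fun p : ι × Fin d => coeff (c * v p.1) p.2) ≤
      (∑ k, |((coeff c k : ℤ) : ℝ)|) * l2Z (fun p : ι × Fin d => coeff (v p.1) p.2) := by
  simp only [coeff_mul_eq_sum (S := ℤ) (d := d) c]
  refine (l2Z_sum_le _ _).trans ?_
  rw [Finset.sum_mul]
  refine Finset.sum_le_sum fun k _ => ?_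
  rw [l2Z_smul, l2Z_coeff_rt_pow_mul]

variable {q : ℕ} [NeZero q]

/-- The product over `ℤ` of the centred lifts is a lift of the product, and a lift only increases
the norm. -/
theorem l2_mul_le (c : CycRing (ZMod q) d) (v : ι → CycRing (ZMod q) d) :
    l2 (fun i => c * v i) ≤ l1 c * l2 v := by
  have h := l2Z_coeff_mul_le (ofCoeffs (cent c)) fun i => ofCoeffs (cent (v i))
  simp only [coeff_ofCoeffs] at h
  rw [l2_eq v]
  refine le_trans (l2_le_of_cast (fun i k => ?_)) (h.trans (le_of_eq ?_))
  · rw [← coeff_redHom, map_mul, redHom_ofCoeffs, redHom_ofCoeffs, red_cent, red_cent]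
  · congr 1
    simp only [l1, Nat.cast_sum, Nat.cast_natAbs, Int.cast_abs]

theorem l2_pos {v : ι → CycRing (ZMod q) d} (hv : v ≠ 0) : 0 < l2 v := by
  obtain ⟨i, hi⟩ := Function.ne_iff.1 hv
  have : ∃ k, cent (v i) k ≠ 0 := by
    by_contra! h
    apply hi
    refine coeff_ext fun k => ?_
    rw [← cent_cast, h k, Pi.zero_apply, coeff_zero, Int.cast_zero]
  obtain ⟨k, hk⟩ := this
  unfold l2
  refine Real.sqrt_pos.2 (Finset.sum_pos' (fun _ _ => Finset.sum_nonneg fun _ _ => sq_nonneg _)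
    ⟨i, Finset.mem_univ _, Finset.sum_pos' (fun _ _ => sq_nonneg _)
      ⟨k, Finset.mem_univ _, by positivity⟩⟩)

end Norms

end

section

/-! ### Discrete Gaussians -/

section Gauss

theorem summable_gauss {s : ℝ} (hs : 0 < s) :
    Summable fun z : ℤ => Real.exp (-(z : ℝ) ^ 2 / (2 * s ^ 2)) := by
  refine (ENNReal.summable_toReal (gauss_ne_top s hs)).congr fun z => ?_
  rw [gaussWeight, ENNReal.toReal_ofReal (Real.exp_pos _).le]

theorem summable_gauss_pi {a : ℝ} (ha : 0 < a) :
    Summable fun z : ℤ => Real.exp (-Real.pi * a * (z : ℝ) ^ 2) := by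
  have hpos : 0 < 1 / (2 * Real.pi * a) := by positivity
  refine (summable_gauss (s := Real.sqrt (1 / (2 * Real.pi * a))) (by positivity)).congr
    fun z => ?_
  rw [Real.sq_sqrt hpos.le]
  congr 1
  field_simp

/-- Domination by a Gaussian of twice the variance: `(z-c)² ≥ z²/2 - c²`, because `(z-2c)² ≥ 0`. -/
theorem summable_gauss_shift {s : ℝ} (hs : 0 < s) (c : ℝ) :
    Summable fun z : ℤ => Real.exp (-((z : ℝ) - c) ^ 2 / (2 * s ^ 2)) := by
  have h := (summable_gauss (s := Real.sqrt 2 * s) (by positivity)).mul_left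
    (Real.exp (c ^ 2 / (2 * s ^ 2)))
  refine Summable.of_nonneg_of_le (fun z => (Real.exp_pos _).le) (fun z => ?_) h
  rw [← Real.exp_add, Real.exp_le_exp, mul_pow, Real.sq_sqrt (by norm_num)]
  rw [show -(z : ℝ) ^ 2 / (2 * (2 * s ^ 2)) = (-(z : ℝ) ^ 2 / 2) / (2 * s ^ 2) by field_simp,
    ← add_div]
  gcongr
  nlinarith [sq_nonneg ((z : ℝ) - 2 * c)]

/-- By Poisson summation the shifted sum is a Fourier series in `c` with positive coefficients,
hence largest in absolute value at `c = 0`. No lower bound on `s` is needed. -/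
theorem tsum_gauss_shift_le {s : ℝ} (hs : 0 < s) (c : ℝ) :
    ∑' z : ℤ, Real.exp (-((z : ℝ) - c) ^ 2 / (2 * s ^ 2)) ≤
      ∑' z : ℤ, Real.exp (-(z : ℝ) ^ 2 / (2 * s ^ 2)) := by
  set a : ℝ := 2 * Real.pi * s ^ 2 with ha
  have hpi := Real.pi_pos
  have hapos : 0 < a := by positivity
  have hdiv : Real.pi / a = 1 / (2 * s ^ 2) := by rw [ha]; field_simp
  have h0 := Real.tsum_exp_neg_mul_int_sq hapos
  -- With linear parameter `ic`, the transformed summand is centred at `n + i(ic) = n - c`, while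
  -- the other side only acquires phases.
  have hc := Complex.tsum_exp_neg_quadratic (a := (a : ℂ)) (by simpa using hapos) (Complex.I * c)
  have e1 : ∑' z : ℤ, Real.exp (-(z : ℝ) ^ 2 / (2 * s ^ 2)) =
      ∑' n : ℤ, Real.exp (-Real.pi / a * (n : ℝ) ^ 2) := by
    refine tsum_congr fun z => ?_
    rw [show -Real.pi / a = -(1 / (2 * s ^ 2)) by rw [neg_div, hdiv]]
    congr 1; ring
  have e2 : ((∑' z : ℤ, Real.exp (-((z : ℝ) - c) ^ 2 / (2 * s ^ 2)) : ℝ) : ℂ) =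
      ∑' n : ℤ, Complex.exp (-Real.pi / a * (n + Complex.I * (Complex.I * c)) ^ 2) := by
    rw [Complex.ofReal_tsum]
    refine tsum_congr fun z => ?_
    rw [Complex.ofReal_exp]
    congr 1
    rw [← mul_assoc, Complex.I_mul_I, show (-Real.pi / a : ℂ) = ((-(1 / (2 * s ^ 2)) : ℝ) : ℂ) by
      rw [← hdiv]; push_cast; ring]
    push_cast
    ring
  rw [← e2] at hc
  rw [← e1] at h0
  have hnorm : ‖(1 / (a : ℂ) ^ (1 / 2 : ℂ))‖ = 1 / a ^ (1 / 2 : ℝ) := by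
    rw [norm_div, norm_one, Complex.norm_cpow_eq_rpow_re_of_pos hapos]
    norm_num
  have hS : 0 ≤ ∑' z : ℤ, Real.exp (-((z : ℝ) - c) ^ 2 / (2 * s ^ 2)) :=
    tsum_nonneg fun _ => (Real.exp_pos _).le
  have hle : ‖∑' n : ℤ, Complex.exp (-Real.pi * a * n ^ 2 + 2 * Real.pi * (Complex.I * c) * n)‖ ≤
      ∑' n : ℤ, Real.exp (-Real.pi * a * (n : ℝ) ^ 2) := by
    have hterm : ∀ n : ℤ, ‖Complex.exp (-Real.pi * a * n ^ 2 + 2 * Real.pi * (Complex.I * c) * n)‖ =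
        Real.exp (-Real.pi * a * (n : ℝ) ^ 2) := by
      intro n
      rw [Complex.norm_exp]
      congr 1
      rw [show (-Real.pi * a * n ^ 2 + 2 * Real.pi * (Complex.I * c) * n : ℂ) =
        ((-Real.pi * a * (n : ℝ) ^ 2 : ℝ) : ℂ) + ((2 * Real.pi * c * n : ℝ) : ℂ) * Complex.I by
          push_cast; ring, Complex.add_re, Complex.re_ofReal_mul, Complex.I_re, mul_zero, add_zero, Complex.ofReal_re]
    refine (norm_tsum_le_tsum_norm ?_).trans (le_of_eq (tsum_congr hterm))
    exact (summable_gauss_pi hapos).congr fun n => (hterm n).symm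
  rw [hc, norm_mul, hnorm, Complex.norm_real, Real.norm_of_nonneg hS, h0] at hle
  exact le_of_mul_le_mul_left hle (by positivity)

/-- Poisson summation on both sides: the prefactors have ratio `√2`, and the dual sum belonging to
the wider Gaussian is termwise smaller. -/
theorem tsum_gauss_wide_le {s : ℝ} (hs : 0 < s) :
    ∑' z : ℤ, Real.exp (-(z : ℝ) ^ 2 / (4 * s ^ 2)) ≤
      Real.sqrt 2 * ∑' z : ℤ, Real.exp (-(z : ℝ) ^ 2 / (2 * s ^ 2)) := by
  have hpi := Real.pi_pos
  have h1 := Real.tsum_exp_neg_mul_int_sq (a := 1 / (4 * Real.pi * s ^ 2)) (by positivity)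
  have h2 := Real.tsum_exp_neg_mul_int_sq (a := 1 / (2 * Real.pi * s ^ 2)) (by positivity)
  have e1 : ∀ n : ℤ, -Real.pi * (1 / (4 * Real.pi * s ^ 2)) * (n : ℝ) ^ 2 =
      -(n : ℝ) ^ 2 / (4 * s ^ 2) := fun n => by field_simp
  have e2 : ∀ n : ℤ, -Real.pi * (1 / (2 * Real.pi * s ^ 2)) * (n : ℝ) ^ 2 =
      -(n : ℝ) ^ 2 / (2 * s ^ 2) := fun n => by field_simp
  simp only [e1] at h1
  simp only [e2] at h2
  rw [h1, h2, ← Real.sqrt_eq_rpow, ← Real.sqrt_eq_rpow, ← mul_assoc]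
  have hc : 1 / Real.sqrt (1 / (4 * Real.pi * s ^ 2)) =
      Real.sqrt 2 * (1 / Real.sqrt (1 / (2 * Real.pi * s ^ 2))) := by
    simp only [one_div, Real.sqrt_inv, inv_inv]
    rw [← Real.sqrt_mul (by norm_num)]
    congr 1
    ring
  rw [hc]
  gcongr 3 with n
  · have := summable_gauss_pi (a := 4 * Real.pi * s ^ 2) (by positivity)
    refine this.congr fun n => ?_
    congr 1
    field_simp
  · have := summable_gauss_pi (a := 2 * Real.pi * s ^ 2) (by positivity)
    refine this.congr fun n => ?_
    congr 1
    field_simp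
  · rw [neg_div, neg_div, neg_mul, neg_mul, neg_le_neg_iff]
    gcongr
    norm_num

theorem ex_dgauss {s : ℝ} (hs : 0 < s) (f : ℤ → ℝ) (hf : ∀ z, 0 ≤ f z)
    (hsum : Summable fun z : ℤ => Real.exp (-(z : ℝ) ^ 2 / (2 * s ^ 2)) * f z) :
    ex (dgauss s hs) (fun z => ENNReal.ofReal (f z)) =
      ENNReal.ofReal ((∑' z : ℤ, Real.exp (-(z : ℝ) ^ 2 / (2 * s ^ 2)) * f z) /
        ∑' z : ℤ, Real.exp (-(z : ℝ) ^ 2 / (2 * s ^ 2))) := by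
  have hpos : 0 < ∑' z : ℤ, Real.exp (-(z : ℝ) ^ 2 / (2 * s ^ 2)) :=
    (summable_gauss hs).tsum_pos (fun _ => (Real.exp_pos _).le) 0 (Real.exp_pos _)
  unfold ex dgauss
  simp only [PMF.normalize_apply]
  rw [div_eq_mul_inv, ENNReal.ofReal_mul (tsum_nonneg fun z => mul_nonneg (Real.exp_pos _).le (hf z)),
    ENNReal.ofReal_inv_of_pos hpos,
    ENNReal.ofReal_tsum_of_nonneg (fun z => mul_nonneg (Real.exp_pos _).le (hf z)) hsum,
    ENNReal.ofReal_tsum_of_nonneg (fun z => (Real.exp_pos _).le) (summable_gauss hs),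
    ← ENNReal.tsum_mul_right]
  refine tsum_congr fun z => ?_
  rw [ENNReal.ofReal_mul (Real.exp_pos _).le]
  unfold gaussWeight
  ring

/-- The discrete Gaussian is subgaussian. -/
theorem ex_dgauss_exp_le {s : ℝ} (hs : 0 < s) (t : ℝ) :
    ex (dgauss s hs) (fun z => ENNReal.ofReal (Real.exp (t * z))) ≤
      ENNReal.ofReal (Real.exp (s ^ 2 * t ^ 2 / 2)) := by
  have hpos : 0 < ∑' z : ℤ, Real.exp (-(z : ℝ) ^ 2 / (2 * s ^ 2)) :=
    (summable_gauss hs).tsum_pos (fun _ => (Real.exp_pos _).le) 0 (Real.exp_pos _)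
  -- Completing the square: the exponential tilt is a shift of the Gaussian by `s²t`, and shifted
  -- sums are controlled by `tsum_gauss_shift_le`.
  have e : ∀ z : ℤ, Real.exp (-(z : ℝ) ^ 2 / (2 * s ^ 2)) * Real.exp (t * z) =
      Real.exp (s ^ 2 * t ^ 2 / 2) * Real.exp (-((z : ℝ) - s ^ 2 * t) ^ 2 / (2 * s ^ 2)) := by
    intro z
    rw [← Real.exp_add, ← Real.exp_add]
    congr 1
    field_simp
    ring
  rw [ex_dgauss hs _ fun z => (Real.exp_pos _).le]
  · simp only [e]
    apply ENNReal.ofReal_le_ofReal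
    rw [tsum_mul_left, mul_div_assoc]
    refine mul_le_of_le_one_right (Real.exp_pos _).le ?_
    rw [div_le_one hpos]
    exact tsum_gauss_shift_le hs _
  · simp only [e]
    exact (summable_gauss_shift hs _).mul_left _

/-- The factor `exp(z²/(4s²))` halves the exponent of the weight, so the mean is the ratio of the
two sums of `tsum_gauss_wide_le`. This is the moment behind the tail bound for the Euclidean norm.
-/
theorem ex_dgauss_exp_sq_le {s : ℝ} (hs : 0 < s) :
    ex (dgauss s hs) (fun z => ENNReal.ofReal (Real.exp ((z : ℝ) ^ 2 / (4 * s ^ 2)))) ≤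
      ENNReal.ofReal (Real.sqrt 2) := by
  have hpos : 0 < ∑' z : ℤ, Real.exp (-(z : ℝ) ^ 2 / (2 * s ^ 2)) :=
    (summable_gauss hs).tsum_pos (fun _ => (Real.exp_pos _).le) 0 (Real.exp_pos _)
  have e : ∀ z : ℤ, Real.exp (-(z : ℝ) ^ 2 / (2 * s ^ 2)) * Real.exp ((z : ℝ) ^ 2 / (4 * s ^ 2)) =
      Real.exp (-(z : ℝ) ^ 2 / (4 * s ^ 2)) := by
    intro z
    rw [← Real.exp_add]
    congr 1
    field_simp
    ring
  rw [ex_dgauss hs _ fun z => (Real.exp_pos _).le]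
  · simp only [e]
    apply ENNReal.ofReal_le_ofReal
    rw [div_le_iff₀ hpos]
    exact tsum_gauss_wide_le hs
  · simp only [e]
    refine (summable_gauss (s := Real.sqrt 2 * s) (by positivity)).congr fun z => ?_
    rw [mul_pow, Real.sq_sqrt (by norm_num)]
    congr 1
    ring

variable {ι : Type} [Fintype ι]

theorem ex_iid_dgauss_exp_inner_le {s : ℝ} (hs : 0 < s) (t : ι → ℝ) :
    ex (iid ι (dgauss s hs)) (fun z => ENNReal.ofReal (Real.exp (∑ i, t i * z i))) ≤
      ENNReal.ofReal (Real.exp (s ^ 2 * (∑ i, t i ^ 2) / 2)) := by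
  simp only [Real.exp_sum, ENNReal.ofReal_prod_of_nonneg fun i _ => (Real.exp_pos _).le]
  rw [ex_iid_prod _ fun i (z : ℤ) => ENNReal.ofReal (Real.exp (t i * z))]
  rw [Finset.mul_sum, Finset.sum_div, Real.exp_sum,
    ENNReal.ofReal_prod_of_nonneg fun i _ => (Real.exp_pos _).le]
  exact Finset.prod_le_prod' fun i _ => ex_dgauss_exp_le hs (t i)

/-- Tail bound for the Euclidean norm of a discrete Gaussian vector. -/
theorem dgauss_tail_l2 {s : ℝ} (hs : 0 < s) :
    ex (iid ι (dgauss s hs))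
      ({z | s * Real.sqrt (2 * Fintype.card ι) < l2Z z}.indicator 1) ≤
      ENNReal.ofReal ((Real.sqrt 2 * Real.exp (-(1 / 2))) ^ Fintype.card ι) := by
  -- Markov's inequality for `exp(‖z‖²/(4s²))`: with `k` coordinates, the threshold `‖z‖² = 2ks²`
  -- contributes `e^(-k/2)`, and the moment is at most `√2^k`.
  have h1 : ∀ z : ι → ℤ, ({z | s * Real.sqrt (2 * Fintype.card ι) < l2Z z}.indicator 1 z : ℝ≥0∞) ≤
      ENNReal.ofReal (Real.exp (-(1 / 2)) ^ Fintype.card ι) *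
        ∏ i, ENNReal.ofReal (Real.exp ((z i : ℝ) ^ 2 / (4 * s ^ 2))) := by
    intro z
    by_cases hz : s * Real.sqrt (2 * Fintype.card ι) < l2Z z
    · rw [Set.indicator_of_mem (by exact hz), Pi.one_apply,
        ← ENNReal.ofReal_prod_of_nonneg fun i _ => (Real.exp_pos _).le, ← Real.exp_sum,
        ← ENNReal.ofReal_mul (by positivity), ← Real.exp_nat_mul, ← Real.exp_add,
        ← ENNReal.ofReal_one]
      apply ENNReal.ofReal_le_ofReal
      rw [Real.one_le_exp_iff, ← Finset.sum_div, ← l2Z_sq]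
      have h2 : (s * Real.sqrt (2 * Fintype.card ι)) ^ 2 ≤ l2Z z ^ 2 := by gcongr
      rw [mul_pow, Real.sq_sqrt (by positivity)] at h2
      have h3 : (Fintype.card ι : ℝ) / 2 ≤ l2Z z ^ 2 / (4 * s ^ 2) := by
        rw [le_div_iff₀ (by positivity)]
        linarith
      linarith
    · rw [Set.indicator_of_notMem (by exact hz)]
      exact zero_le
  refine (ex_mono _ h1).trans ?_
  rw [ex_mul_left, ex_iid_prod _ fun _ (z : ℤ) => ENNReal.ofReal (Real.exp ((z : ℝ) ^ 2 / (4 * s ^ 2))),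
    mul_pow, mul_comm (Real.sqrt 2 ^ _), ENNReal.ofReal_mul (by positivity),
    ENNReal.ofReal_pow (Real.sqrt_nonneg 2)]
  gcongr
  refine (Finset.prod_le_prod' fun i _ => ex_dgauss_exp_sq_le hs).trans ?_
  simp

/-- Chernoff with parameter `16/s` for each sign: the threshold contributes `e^(-256)` and the
subgaussian moment `e^128`. The value `16 s` is `√(2·128) s`, the verifier's bound for `z₃`. -/
theorem dgauss_tail_abs {s : ℝ} (hs : 0 < s) :
    ex (dgauss s hs) ({z : ℤ | 16 * s < |(z : ℝ)|}.indicator 1) ≤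
      ENNReal.ofReal (2 * Real.exp (-128)) := by
  have h1 : ∀ z : ℤ, ({z : ℤ | 16 * s < |(z : ℝ)|}.indicator 1 z : ℝ≥0∞) ≤
      ENNReal.ofReal (Real.exp (-256)) * (ENNReal.ofReal (Real.exp ((16 / s) * z)) +
        ENNReal.ofReal (Real.exp ((-(16 / s)) * z))) := by
    intro z
    by_cases hz : 16 * s < |(z : ℝ)|
    · rw [Set.indicator_of_mem (by exact hz), Pi.one_apply, mul_add,
        ← ENNReal.ofReal_mul (Real.exp_pos _).le, ← ENNReal.ofReal_mul (Real.exp_pos _).le,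
        ← Real.exp_add, ← Real.exp_add, ← ENNReal.ofReal_one]
      have key : ∀ x : ℝ, 16 * s < x → 1 ≤ Real.exp (-256 + 16 / s * x) := by
        intro x hx
        rw [Real.one_le_exp_iff]
        have : 16 / s * (16 * s) ≤ 16 / s * x := by gcongr
        have e : 16 / s * (16 * s) = 256 := by field_simp; norm_num
        linarith
      rcases lt_abs.1 hz with h | h
      · exact (ENNReal.ofReal_le_ofReal (key _ h)).trans le_self_add
      · refine (ENNReal.ofReal_le_ofReal (key _ h)).trans ?_
        rw [mul_neg, ← neg_mul]
        exact le_add_self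
    · rw [Set.indicator_of_notMem (by exact hz)]
      exact zero_le
  refine (ex_mono _ h1).trans ?_
  rw [ex_mul_left, ex_add]
  have h2 := ex_dgauss_exp_le hs (16 / s)
  have h3 := ex_dgauss_exp_le hs (-(16 / s))
  have e : s ^ 2 * (16 / s) ^ 2 / 2 = 128 := by field_simp; norm_num
  rw [neg_sq, e] at h3
  rw [e] at h2
  calc _ ≤ ENNReal.ofReal (Real.exp (-256)) *
        (ENNReal.ofReal (Real.exp 128) + ENNReal.ofReal (Real.exp 128)) := by gcongr
    _ = _ := by
      rw [← ENNReal.ofReal_add (by positivity) (by positivity), ← ENNReal.ofReal_mul (by positivity),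
        ← two_mul, mul_left_comm, ← Real.exp_add]
      norm_num

theorem dgauss_tail_sup {s : ℝ} (hs : 0 < s) :
    ex (iid ι (dgauss s hs)) ({z | ∃ i, 16 * s < |(z i : ℝ)|}.indicator 1) ≤
      ENNReal.ofReal (Fintype.card ι * 2 * Real.exp (-128)) := by
  have h1 : ∀ z : ι → ℤ, ({z : ι → ℤ | ∃ i, 16 * s < |(z i : ℝ)|}.indicator 1 z : ℝ≥0∞) ≤
      ∑ i, {z : ℤ | 16 * s < |(z : ℝ)|}.indicator 1 (z i) := by
    intro z
    by_cases hz : ∃ i, 16 * s < |(z i : ℝ)|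
    · obtain ⟨i, hi⟩ := hz
      rw [Set.indicator_of_mem (by exact ⟨i, hi⟩)]
      refine le_trans ?_ (Finset.single_le_sum (fun _ _ => zero_le) (Finset.mem_univ i))
      rw [Set.indicator_of_mem (by exact hi)]
      simp
    · rw [Set.indicator_of_notMem (by exact hz)]
      exact zero_le
  refine (ex_mono _ h1).trans ?_
  rw [ex_finsetSum]
  calc _ ≤ ∑ i : ι, ENNReal.ofReal (2 * Real.exp (-128)) := by
        refine Finset.sum_le_sum fun i _ => ?_
        rw [ex_iid_marginal _ i fun z : ℤ => ({z : ℤ | 16 * s < |(z : ℝ)|}.indicator 1 z : ℝ≥0∞)]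
        exact dgauss_tail_abs hs
    _ = _ := by
      rw [Finset.sum_const, Finset.card_univ, nsmul_eq_mul, mul_assoc,
        ENNReal.ofReal_mul (Nat.cast_nonneg (Fintype.card ι)), ENNReal.ofReal_natCast]

end Gauss

end

section

/-! ### Rejection sampling -/

section Rejection

variable {ι : Type} [Fintype ι]

theorem ex_coin (t : ℝ) (h0 : 0 ≤ t) (h1 : t ≤ 1) (c : ℝ≥0∞) :
    ex (coin t h0 h1) (fun b => if b = true then c else 0) = ENNReal.ofReal t * c := by
  rw [ex_fintype]
  simp [coin]

/-- The logarithm of the ratio of the densities of a shifted and a centered Gaussian at `z`. -/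
def rejExp (s : ℝ) (v z : ι → ℤ) : ℝ :=
  (-2 * ∑ i, (z i : ℝ) * (v i : ℝ) + ∑ i, (v i : ℝ) ^ 2) / (2 * s ^ 2)

/-- The density of the accepted samples in rejection sampling. -/
def accDens (s : ℝ) (hs : 0 < s) (v z : ι → ℤ) : ℝ≥0∞ :=
  iid ι (dgauss s hs) z * ENNReal.ofReal (min (Real.exp (-rejExp s v z)) (1 / 3))

/-- The sum of a function weighted by the density of the accepted samples. -/
def accSum (s : ℝ) (hs : 0 < s) (v : ι → ℤ) (F : (ι → ℤ) → ℝ≥0∞) : ℝ≥0∞ :=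
  ∑' z, accDens s hs v z * F z

/-- Since `v` is integral, the shifted and the centred Gaussian have the same normalising constant,
so only the ratio of weights remains. -/
theorem iid_dgauss_sub {s : ℝ} (hs : 0 < s) (v z : ι → ℤ) :
    iid ι (dgauss s hs) (z - v) =
      iid ι (dgauss s hs) z * ENNReal.ofReal (Real.exp (-rejExp s v z)) := by
  have h : -rejExp s v z = ∑ i, (2 * (z i : ℝ) * v i - (v i : ℝ) ^ 2) / (2 * s ^ 2) := by
    rw [← Finset.sum_div, Finset.sum_sub_distrib, rejExp, ← neg_div]
    simp only [mul_assoc, ← Finset.mul_sum]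
    ring
  rw [h, Real.exp_sum, ENNReal.ofReal_prod_of_nonneg fun i _ => (Real.exp_pos _).le,
    iid_apply, iid_apply, ← Finset.prod_mul_distrib]
  refine Finset.prod_congr rfl fun i _ => ?_
  unfold dgauss
  rw [PMF.normalize_apply, PMF.normalize_apply, mul_right_comm]
  congr 1
  unfold gaussWeight
  rw [← ENNReal.ofReal_mul (Real.exp_pos _).le, ← Real.exp_add]
  congr 2
  rw [← add_div]
  congr 1
  rw [Pi.sub_apply, Int.cast_sub]
  ring

/-- After the change of variables `z = y + v`, the weight of `z` is the shifted Gaussian times the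
acceptance probability, which is exactly `accDens`. The secret shift survives only in the minimum.
-/
theorem ex_rejection {s : ℝ} (hs : 0 < s) (v : ι → ℤ) (F : (ι → ℤ) → ℝ≥0∞) :
    ex (iid ι (dgauss s hs)) (fun y => ex (rej (y + v) v s) fun b =>
      if b = true then F (y + v) else 0) = accSum s hs v F := by
  unfold accSum
  nth_rewrite 1 [ex]
  rw [← (Equiv.addRight v).tsum_eq fun z => accDens s hs v z * F z]
  refine tsum_congr fun y => ?_
  rw [Equiv.coe_addRight]
  unfold rej
  rw [ex_coin, ← mul_assoc]
  congr 1
  have h := iid_dgauss_sub hs v (y + v)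
  rw [add_sub_cancel_right] at h
  rw [h, accDens, mul_assoc, ← ENNReal.ofReal_mul (Real.exp_pos _).le]
  congr 2
  -- Here `e^(-E) · min(1, e^E/3) = min(e^(-E), 1/3)` with `E = rejExp s v (y + v)`.
  rw [mul_min_of_nonneg _ _ (Real.exp_pos _).le, mul_one]
  congr 1
  rw [mul_left_comm]
  change 1 / 3 * (Real.exp (-rejExp s v (y + v)) * Real.exp (rejExp s v (y + v))) = _
  rw [← Real.exp_add, neg_add_cancel, Real.exp_zero, mul_one]

/-- The cap `1/3` holds pointwise and without error term. Hence the deviation from the ideal law is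
governed by the missing mass alone. -/
theorem accSum_le {s : ℝ} (hs : 0 < s) (v : ι → ℤ) (F : (ι → ℤ) → ℝ≥0∞) :
    accSum s hs v F ≤ 3⁻¹ * ex (iid ι (dgauss s hs)) F := by
  unfold accSum ex
  rw [← ENNReal.tsum_mul_left]
  refine ENNReal.tsum_le_tsum fun z => ?_
  rw [accDens, mul_right_comm, mul_comm 3⁻¹]
  gcongr
  refine (ENNReal.ofReal_le_ofReal (min_le_right _ _)).trans ?_
  rw [one_div, ENNReal.ofReal_inv_of_pos (by norm_num)]
  simp

/-- The numerical input of `accSum_one_ge`: `131` is the Chernoff exponent there and `72` bounds the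
exponent of the resulting moment. -/
theorem exp_seventy_two_le : Real.exp 72 * 2 ^ 103 ≤ 3 ^ 131 := by
  have h : Real.exp 72 = Real.exp 1 ^ 72 := by rw [← Real.exp_nat_mul]; norm_num
  rw [h]
  calc Real.exp 1 ^ 72 * 2 ^ 103 ≤ 2.7182818286 ^ 72 * 2 ^ 103 := by
        gcongr
        exact Real.exp_one_lt_d9.le
    _ ≤ 3 ^ 131 := by norm_num

/-- The density falls short of `1/3` only where `exp(rejExp) > 3`. The indicator of that event is
bounded by `(exp(rejExp)/3)^131`, whose mean is a Gaussian moment of a linear form. The exponent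
`131` is close to the optimum for `s = 11‖v‖`. -/
theorem accSum_one_ge {s : ℝ} (hs : 0 < s) (v : ι → ℤ)
    (hv : 121 * ∑ i, (v i : ℝ) ^ 2 ≤ s ^ 2) :
    3⁻¹ ≤ accSum s hs v (fun _ => 1) + 3⁻¹ * (2 ^ 103)⁻¹ := by
  set D := iid ι (dgauss s hs)
  have h1 : ∀ z, D z * 3⁻¹ ≤ accDens s hs v z * 1 +
      3⁻¹ * (D z * ENNReal.ofReal (Real.exp (131 * rejExp s v z) / 3 ^ 131)) := by
    intro z
    have h2 : (1 / 3 : ℝ) ≤ min (Real.exp (-rejExp s v z)) (1 / 3) +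
        1 / 3 * (Real.exp (131 * rejExp s v z) / 3 ^ 131) := by
      rcases le_total (1 / 3) (Real.exp (-rejExp s v z)) with h | h
      · rw [min_eq_right h]
        have : 0 < Real.exp (131 * rejExp s v z) := Real.exp_pos _
        linarith [div_pos this (by positivity : (0 : ℝ) < 3 ^ 131)]
      · have h3 : 3 ≤ Real.exp (rejExp s v z) := by
          rw [Real.exp_neg, ← one_div] at h
          exact (one_div_le_one_div (Real.exp_pos _) (by norm_num)).1 h
        have h4 : 1 ≤ Real.exp (131 * rejExp s v z) / 3 ^ 131 := by
          rw [one_le_div (by positivity), show (131 : ℝ) = ((131 : ℕ) : ℝ) by norm_num,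
            Real.exp_nat_mul]
          gcongr
        have : 0 ≤ min (Real.exp (-rejExp s v z)) (1 / 3) :=
          le_min (Real.exp_pos _).le (by norm_num)
        linarith
    have h5 := ENNReal.ofReal_le_ofReal h2
    rw [ENNReal.ofReal_add (le_min (Real.exp_pos _).le (by norm_num)) (by positivity),
      ENNReal.ofReal_mul (by norm_num)] at h5
    have e : ENNReal.ofReal (1 / 3) = 3⁻¹ := by
      rw [one_div, ENNReal.ofReal_inv_of_pos (by norm_num)]; simp
    rw [e] at h5
    rw [accDens, mul_one, mul_left_comm, ← mul_add]
    gcongr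
  have h6 : ex D (fun _ => 3⁻¹) ≤ accSum s hs v (fun _ => 1) +
      3⁻¹ * ex D (fun z => ENNReal.ofReal (Real.exp (131 * rejExp s v z) / 3 ^ 131)) := by
    unfold accSum ex
    rw [← ENNReal.tsum_mul_left, ← ENNReal.tsum_add]
    exact ENNReal.tsum_le_tsum h1
  rw [ex_const] at h6
  refine h6.trans ?_
  gcongr
  have e : ∀ z : ι → ℤ, ENNReal.ofReal (Real.exp (131 * rejExp s v z) / 3 ^ 131) =
      ENNReal.ofReal (Real.exp (131 * (∑ i, (v i : ℝ) ^ 2) / (2 * s ^ 2)) / 3 ^ 131) *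
        ENNReal.ofReal (Real.exp (∑ i, (-131 * v i / s ^ 2) * z i)) := by
    intro z
    rw [← ENNReal.ofReal_mul (by positivity), div_mul_eq_mul_div, ← Real.exp_add]
    congr 3
    have : ∑ i, (-131 * (v i : ℝ) / s ^ 2) * z i = -131 / s ^ 2 * ∑ i, (z i : ℝ) * v i := by
      rw [Finset.mul_sum]
      exact Finset.sum_congr rfl fun i _ => by ring
    rw [this, rejExp]
    field_simp
    ring
  simp only [e]
  rw [ex_mul_left]
  calc _ ≤ ENNReal.ofReal (Real.exp (131 * (∑ i, (v i : ℝ) ^ 2) / (2 * s ^ 2)) / 3 ^ 131) *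
        ENNReal.ofReal (Real.exp (s ^ 2 * (∑ i, (-131 * (v i : ℝ) / s ^ 2) ^ 2) / 2)) := by
        gcongr
        exact ex_iid_dgauss_exp_inner_le hs _
    _ ≤ ENNReal.ofReal ((2 ^ 103)⁻¹) := by
        rw [← ENNReal.ofReal_mul (by positivity), div_mul_eq_mul_div, ← Real.exp_add]
        apply ENNReal.ofReal_le_ofReal
        have h7 : ∑ i, (-131 * (v i : ℝ) / s ^ 2) ^ 2 = 17161 / s ^ 4 * ∑ i, (v i : ℝ) ^ 2 := by
          rw [Finset.mul_sum]
          exact Finset.sum_congr rfl fun i _ => by ring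
        -- The exponent is `(131 + 131²)/2 · ‖v‖²/s² = 8646 ‖v‖²/s²`, and `8646/121 < 72`.
        have h8 : 131 * (∑ i, (v i : ℝ) ^ 2) / (2 * s ^ 2) +
            s ^ 2 * (∑ i, (-131 * (v i : ℝ) / s ^ 2) ^ 2) / 2 ≤ 72 := by
          rw [h7]
          have : 131 * (∑ i, (v i : ℝ) ^ 2) / (2 * s ^ 2) +
            s ^ 2 * (17161 / s ^ 4 * ∑ i, (v i : ℝ) ^ 2) / 2 =
              8646 * (∑ i, (v i : ℝ) ^ 2) / s ^ 2 := by
            field_simp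
            ring
          rw [this, div_le_iff₀ (by positivity)]
          nlinarith [sq_nonneg s]
        rw [div_le_iff₀ (by positivity), ← div_eq_inv_mul, le_div_iff₀ (by positivity)]
        refine le_trans ?_ exp_seventy_two_le
        gcongr
    _ = _ := by
        rw [ENNReal.ofReal_inv_of_pos (by positivity), ENNReal.ofReal_pow (by norm_num)]
        simp

end Rejection

/-! ### Random projections -/

section Projection

open MeasureTheory

theorem lintegral_exp_neg_sq (b : ℝ) (hb : 0 < b) (a : ℝ) :
    ∫⁻ g : ℝ, ENNReal.ofReal (Real.exp (-b * (g - a) ^ 2)) =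
      ENNReal.ofReal (Real.sqrt (Real.pi / b)) := by
  rw [lintegral_sub_right_eq_self (μ := volume) (fun g => ENNReal.ofReal (Real.exp (-b * g ^ 2))) a,
    ← ofReal_integral_eq_lintegral_ofReal (integrable_exp_neg_mul_sq hb)
    (Filter.Eventually.of_forall fun _ => (Real.exp_pos _).le), integral_gaussian]

variable {ι : Type} [Fintype ι]

theorem ex_bin1 (f : SignType → ℝ) (hf : ∀ r, 0 ≤ f r) :
    ex bin1 (fun r => ENNReal.ofReal (f r)) =
      ENNReal.ofReal (1 / 2 * f 0 + 1 / 4 * f 1 + 1 / 4 * f (-1)) := by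
  rw [ex_fintype]
  have hu : (Finset.univ : Finset SignType) = {0, 1, -1} := by decide
  rw [hu, Finset.sum_insert (by decide), Finset.sum_insert (by decide), Finset.sum_singleton]
  have h1 := hf 0
  have h2 := hf 1
  have h3 := hf (-1)
  rw [ENNReal.ofReal_add (by positivity) (by positivity),
    ENNReal.ofReal_add (by positivity) (by positivity), ENNReal.ofReal_mul (by norm_num),
    ENNReal.ofReal_mul (by norm_num), ENNReal.ofReal_mul (by norm_num), add_assoc]
  simp only [bin1, ternary, PMF.ofFintype_apply, if_true,
    if_neg (show ¬((-1 : SignType) = 0) by decide), if_neg (show ¬((1 : SignType) = 0) by decide)]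
  norm_num

/-- `Bin₁` is the sum of two independent signs `±1/2`, so its moment generating function is
`cosh²(t/2)`; then `cosh x ≤ exp(x²/2)`. -/
theorem ex_bin1_exp_le (t : ℝ) :
    ex bin1 (fun r => ENNReal.ofReal (Real.exp (t * ((r : ℤ) : ℝ)))) ≤
      ENNReal.ofReal (Real.exp (t ^ 2 / 4)) := by
  rw [ex_bin1 _ fun _ => (Real.exp_pos _).le]
  apply ENNReal.ofReal_le_ofReal
  have h := Real.cosh_le_exp_half_sq (t / 2)
  have h2 : Real.cosh (t / 2) ^ 2 ≤ Real.exp ((t / 2) ^ 2 / 2) ^ 2 := by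
    gcongr
  rw [← Real.exp_nat_mul] at h2
  have h3 : 1 / 2 * Real.exp (t * (((0 : SignType) : ℤ) : ℝ)) +
      1 / 4 * Real.exp (t * (((1 : SignType) : ℤ) : ℝ)) +
      1 / 4 * Real.exp (t * (((-1 : SignType) : ℤ) : ℝ)) = Real.cosh (t / 2) ^ 2 := by
    have e1 : Real.exp t = Real.exp (t / 2) ^ 2 := by rw [← Real.exp_nat_mul]; congr 1; push_cast; ring
    have e2 : Real.exp (-t) = Real.exp (-(t / 2)) ^ 2 := by
      rw [← Real.exp_nat_mul]; congr 1; push_cast; ring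
    have e3 : Real.exp (t / 2) * Real.exp (-(t / 2)) = 1 := by rw [← Real.exp_add]; simp
    rw [Real.cosh_eq]
    simp only [SignType.coe_zero, SignType.coe_one, SignType.coe_neg_one, Int.cast_zero, Int.cast_one,
      Int.cast_neg, mul_zero, mul_one, Real.exp_zero, mul_neg]
    rw [e1, e2]
    linear_combination (-1 / 2) * e3
  rw [h3]
  refine h2.trans (le_of_eq ?_)
  congr 1
  push_cast
  ring

/-- Gaussian linearisation: `√(2π) e^(x²/2)` is the integral of `e^(-g²/2+gx)` over `g`. For fixed
`g` the integrand is an exponential of a linear form in independent entries, at most `e^(g²/4)` on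
average, so the integral is at most `√(4π)`, a factor `√2` more than `√(2π)`. -/
theorem ex_bin1_exp_inner_sq_le (l : ι → ℤ) (B : ℝ) (hB : 0 < B)
    (hl : ∑ i, (l i : ℝ) ^ 2 ≤ B ^ 2) :
    ex (iid ι bin1) (fun r => ENNReal.ofReal
      (Real.exp ((∑ i, ((r i : ℤ) : ℝ) * l i) ^ 2 / (2 * B ^ 2)))) ≤ ENNReal.ofReal (Real.sqrt 2) := by
  classical
  have hpi := Real.pi_pos
  have hc : ENNReal.ofReal (Real.sqrt (2 * Real.pi)) ≠ 0 := by
    rw [Ne, ENNReal.ofReal_eq_zero, not_le]; positivity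
  rw [← ENNReal.mul_le_mul_iff_right hc ENNReal.ofReal_ne_top, ← ex_mul_left]
  have h1 : ∀ r : ι → SignType, ENNReal.ofReal (Real.sqrt (2 * Real.pi)) * ENNReal.ofReal
      (Real.exp ((∑ i, ((r i : ℤ) : ℝ) * l i) ^ 2 / (2 * B ^ 2))) =
      ∫⁻ g : ℝ, ENNReal.ofReal (Real.exp (-(1 / 2) * g ^ 2)) *
        ∏ i, ENNReal.ofReal (Real.exp ((g * l i / B) * ((r i : ℤ) : ℝ))) := by
    intro r
    have h := lintegral_exp_neg_sq (1 / 2) (by norm_num) ((∑ i, ((r i : ℤ) : ℝ) * l i) / B)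
    rw [show Real.pi / (1 / 2) = 2 * Real.pi by ring] at h
    rw [← h, ← lintegral_mul_const _ (by fun_prop)]
    refine lintegral_congr fun g => ?_
    rw [← ENNReal.ofReal_prod_of_nonneg fun i _ => (Real.exp_pos _).le,
      ← ENNReal.ofReal_mul (Real.exp_pos _).le, ← ENNReal.ofReal_mul (Real.exp_pos _).le,
      ← Real.exp_sum, ← Real.exp_add, ← Real.exp_add]
    congr 2
    have : ∑ i, g * l i / B * ((r i : ℤ) : ℝ) = g / B * ∑ i, ((r i : ℤ) : ℝ) * l i := by
      rw [Finset.mul_sum]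
      exact Finset.sum_congr rfl fun i _ => by ring
    rw [this]
    field_simp
    ring
  simp only [h1]
  rw [ex_fintype]
  simp only [← lintegral_const_mul' _ _ (PMF.apply_ne_top _ _)]
  rw [← lintegral_finsetSum _ fun r _ => by fun_prop]
  have h2 : ∀ g : ℝ, ∑ r : ι → SignType, iid ι bin1 r *
      (ENNReal.ofReal (Real.exp (-(1 / 2) * g ^ 2)) *
        ∏ i, ENNReal.ofReal (Real.exp ((g * l i / B) * ((r i : ℤ) : ℝ)))) ≤
      ENNReal.ofReal (Real.exp (-(1 / 4) * (g - 0) ^ 2)) := by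
    intro g
    rw [← ex_fintype, ex_mul_left,
      ex_iid_prod _ fun i (r : SignType) => ENNReal.ofReal (Real.exp ((g * l i / B) * ((r : ℤ) : ℝ)))]
    calc _ ≤ ENNReal.ofReal (Real.exp (-(1 / 2) * g ^ 2)) *
          ∏ i, ENNReal.ofReal (Real.exp ((g * l i / B) ^ 2 / 4)) := by
          gcongr with i
          exact ex_bin1_exp_le _
      _ = ENNReal.ofReal (Real.exp (-(1 / 2) * g ^ 2 + ∑ i, (g * l i / B) ^ 2 / 4)) := by
          rw [← ENNReal.ofReal_prod_of_nonneg fun i _ => (Real.exp_pos _).le,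
            ← ENNReal.ofReal_mul (Real.exp_pos _).le, ← Real.exp_sum, ← Real.exp_add]
      _ ≤ _ := by
          apply ENNReal.ofReal_le_ofReal
          rw [Real.exp_le_exp]
          have : ∑ i, (g * (l i : ℝ) / B) ^ 2 / 4 = g ^ 2 / (4 * B ^ 2) * ∑ i, (l i : ℝ) ^ 2 := by
            rw [Finset.mul_sum]
            exact Finset.sum_congr rfl fun i _ => by ring
          rw [this]
          have h3 : g ^ 2 / (4 * B ^ 2) * ∑ i, (l i : ℝ) ^ 2 ≤ g ^ 2 / (4 * B ^ 2) * B ^ 2 := by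
            gcongr
          have h4 : g ^ 2 / (4 * B ^ 2) * B ^ 2 = g ^ 2 / 4 := by field_simp
          linarith [sq_nonneg g]
  refine (lintegral_mono h2).trans (le_of_eq ?_)
  rw [lintegral_exp_neg_sq _ (by norm_num), ← ENNReal.ofReal_mul (Real.sqrt_nonneg _),
    ← Real.sqrt_mul (by positivity)]
  congr 2
  ring

/-- The numerical input of `projection_tail`, through `2^238 ≤ e^168`; this is where the constant
`337` is used. -/
theorem two_pow_le_exp : (2 : ℝ) ^ 128 * Real.exp (-(337 / 2)) ≤ (2 ^ 110)⁻¹ := by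
  have h : (2 : ℝ) ^ 238 ≤ Real.exp 168 := by
    have e : Real.exp 168 = Real.exp 1 ^ 168 := by rw [← Real.exp_nat_mul]; norm_num
    rw [e]
    calc (2 : ℝ) ^ 238 ≤ 2.7182818283 ^ 168 := by norm_num
      _ ≤ _ := by gcongr; exact Real.exp_one_gt_d9.le
  have h2 : Real.exp (-(337 / 2)) ≤ (Real.exp 168)⁻¹ := by
    rw [← Real.exp_neg, Real.exp_le_exp]
    norm_num
  calc (2 : ℝ) ^ 128 * Real.exp (-(337 / 2)) ≤ 2 ^ 128 * (2 ^ 238)⁻¹ := by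
        gcongr
        exact h2.trans (by gcongr)
    _ = _ := by norm_num

/-- A random ternary projection to dimension 256 does not expand vectors by more than `√337`. -/
theorem projection_tail {J : Type} [Fintype J] (hJ : Fintype.card J = 256) (l : ι → ℤ) (B : ℝ)
    (hB : 0 < B) (hl : ∑ i, (l i : ℝ) ^ 2 ≤ B ^ 2) :
    ex (iid J (iid ι bin1))
      ({r | 337 * B ^ 2 < ∑ j, (∑ i, ((r j i : ℤ) : ℝ) * l i) ^ 2}.indicator 1) ≤ (2 ^ 110)⁻¹ := by
  -- Markov's inequality for `exp(‖Rl‖²/(2B²))`: the threshold contributes `e^(-337/2)`, and the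
  -- `256` independent rows give the moment `√2^256 = 2^128`.
  have h1 : ∀ r : J → ι → SignType,
      ({r | 337 * B ^ 2 < ∑ j, (∑ i, ((r j i : ℤ) : ℝ) * l i) ^ 2}.indicator 1 r : ℝ≥0∞) ≤
      ENNReal.ofReal (Real.exp (-(337 / 2))) * ∏ j, ENNReal.ofReal
        (Real.exp ((∑ i, ((r j i : ℤ) : ℝ) * l i) ^ 2 / (2 * B ^ 2))) := by
    intro r
    by_cases hr : 337 * B ^ 2 < ∑ j, (∑ i, ((r j i : ℤ) : ℝ) * l i) ^ 2
    · rw [Set.indicator_of_mem (by exact hr), Pi.one_apply,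
        ← ENNReal.ofReal_prod_of_nonneg fun i _ => (Real.exp_pos _).le, ← Real.exp_sum,
        ← ENNReal.ofReal_mul (by positivity), ← Real.exp_add, ← ENNReal.ofReal_one]
      apply ENNReal.ofReal_le_ofReal
      rw [Real.one_le_exp_iff, ← Finset.sum_div]
      have : 337 / 2 ≤ (∑ j, (∑ i, ((r j i : ℤ) : ℝ) * l i) ^ 2) / (2 * B ^ 2) := by
        rw [le_div_iff₀ (by positivity)]
        linarith
      linarith
    · rw [Set.indicator_of_notMem (by exact hr)]
      exact zero_le
  refine (ex_mono _ h1).trans ?_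
  rw [ex_mul_left, ex_iid_prod _ fun _ (r : ι → SignType) => ENNReal.ofReal
    (Real.exp ((∑ i, ((r i : ℤ) : ℝ) * l i) ^ 2 / (2 * B ^ 2)))]
  calc _ ≤ ENNReal.ofReal (Real.exp (-(337 / 2))) * ENNReal.ofReal (Real.sqrt 2) ^ 256 := by
        gcongr
        refine (Finset.prod_le_prod' fun j _ => ex_bin1_exp_inner_sq_le l B hB hl).trans ?_
        simp [hJ]
    _ ≤ ENNReal.ofReal ((2 ^ 110)⁻¹) := by
        rw [← ENNReal.ofReal_pow (Real.sqrt_nonneg 2), ← ENNReal.ofReal_mul (Real.exp_pos _).le]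
        apply ENNReal.ofReal_le_ofReal
        rw [show 256 = 2 * 128 by norm_num, pow_mul, Real.sq_sqrt (by norm_num), mul_comm]
        exact two_pow_le_exp
    _ = _ := by
        rw [ENNReal.ofReal_inv_of_pos (by positivity), ENNReal.ofReal_pow (by norm_num)]
        simp

end Projection

end

section

variable {P : Params}

/-! ### Algebra of the verification equations -/

section Algebra

theorem evec_conj_dotProduct (j : P.J) (y : P.E → P.Rq) :
    (fun a => conj (evec j a)) ⬝ᵥ y = conj (rt (ZMod P.q) P.d ^ (j.2 : ℕ)) * y j.1 := by
  unfold dotProduct evec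
  rw [Finset.sum_eq_single j.1]
  · simp [rt]
  · intro b _ hb
    simp [hb]
  · simp

theorem coeff_conj_evec_dotProduct (j : P.J) (y : P.E → P.Rq) :
    coeff ((fun a => conj (evec j a)) ⬝ᵥ y) 0 = coeff (y j.1) j.2 := by
  rw [evec_conj_dotProduct, coeff_conj_mul_zero]
  simp only [coeff_rt_pow _ (Fin.is_lt j.2), Fin.val_inj, ite_mul, one_mul, zero_mul]
  simp

theorem coeff_conj_rvec_dotProduct (R : ChR P) (j : P.J) (l : Fin 2 → P.Rq) :
    coeff ((fun b => conj (rvec R j b)) ⬝ᵥ l) 0 =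
      ∑ b, ∑ k, ((R j b k : ℤ) : ZMod P.q) * coeff (l b) k := by
  unfold dotProduct
  rw [coeff_sum]
  refine Finset.sum_congr rfl fun b _ => ?_
  rw [coeff_conj_mul_zero]
  simp only [rvec, coeff_tern]

/-- The left-hand side of the equations for the coefficients of `z₃`. -/
def projErr (x : Stmt P) (R : ChR P) (m : P.MIdx → P.Rq) (y z : P.E → P.Rq) (j : P.J) : ZMod P.q :=
  (∑ b, ∑ k, ((R j b k : ℤ) : ZMod P.q) * coeff (x.ell m b) k) + coeff (y j.1) j.2 -
    coeff (z j.1) j.2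

/-- Grouping by `j` exhibits the relation as a combination, with scalars `d_j`, of ring elements
whose constant coefficients are the single entries of `Rℓ + y - z`. -/
theorem linear_relation_eq (x : Stmt P) (R : ChR P) (dd : ChD P) (m : P.MIdx → P.Rq)
    (y z : P.E → P.Rq) :
    rowC x R dd ⬝ᵥ m + rowE dd ⬝ᵥ y - affine x R z dd =
      ∑ j, dd j • ((fun b => conj (rvec R j b)) ⬝ᵥ x.ell m +
        (fun a => conj (evec j a)) ⬝ᵥ (y - z)) := by
  unfold rowC rowE affine Stmt.ell
  rw [sum_dotProduct, sum_dotProduct, ← Finset.sum_add_distrib, ← Finset.sum_sub_distrib]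
  refine Finset.sum_congr rfl fun j _ => ?_
  rw [smul_dotProduct, smul_dotProduct, ← smul_add, ← smul_sub, ← Matrix.dotProduct_mulVec,
    dotProduct_sub, dotProduct_sub]
  congr 1
  abel

theorem coeff_linear_relation (x : Stmt P) (R : ChR P) (dd : ChD P) (m : P.MIdx → P.Rq)
    (y z : P.E → P.Rq) :
    coeff (rowC x R dd ⬝ᵥ m + rowE dd ⬝ᵥ y - affine x R z dd) 0 =
      ∑ j, dd j * projErr x R m y z j := by
  rw [linear_relation_eq, coeff_sum]
  refine Finset.sum_congr rfl fun j _ => ?_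
  rw [coeff_smul, coeff_add, coeff_conj_rvec_dotProduct, coeff_conj_evec_dotProduct, Pi.sub_apply,
    coeff_sub, projErr, add_sub_assoc]

theorem matT_mulVec (x : Stmt P) (R : ChR P) (dd : ChD P) (a : P.MIdx → P.Rq) (b : P.E → P.Rq)
    (e : Unit → P.Rq) :
    matT x R dd *ᵥ Sum.elim a (Sum.elim b e) =
      Sum.elim (x.ATilde *ᵥ a) fun _ => rowC x R dd ⬝ᵥ a + (rowE dd ⬝ᵥ b + e ()) := by
  unfold matT
  rw [Matrix.fromBlocks_mulVec]
  simp only [Sum.elim_comp_inl, Sum.elim_comp_inr, Matrix.zero_mulVec, add_zero]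
  congr 1
  ext u
  simp [Matrix.mulVec, Matrix.replicateRow, dotProduct]

end Algebra

/-! ### The honest transcript -/

section Honest

/-- The integer vector `ca`. -/
def chalMul {ι : Type} {d : ℕ} (c : Fin d → SignType) (a : ι → Fin d → SignType) :
    ι × Fin d → ℤ := fun i => coeff (tern ℤ c * tern ℤ (a i.1)) i.2

/-- The integer vector `Rℓ`. -/
def projVec (x : Stmt P) (m : P.MIdx → Fin P.d → SignType) (R : ChR P) : P.J → ℤ :=
  fun j => ∑ b, ∑ k, (R j b k : ℤ) * cent (x.ell (fun i => tern (ZMod P.q) (m i)) b) k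

/-- Reduction modulo `q` of a vector of integer polynomials. -/
def redVec {ι : Type} (q : ℕ) {d : ℕ} (a : ι × Fin d → ℤ) : ι → CycRing (ZMod q) d :=
  fun i => red q fun k => a (i, k)

/-- A vector of ternary polynomials. -/
def ternVec {ι : Type} (q : ℕ) {d : ℕ} (a : ι → Fin d → SignType) : ι → CycRing (ZMod q) d :=
  fun i => tern (ZMod q) (a i)

theorem redVec_add {ι : Type} {q d : ℕ} (a b : ι × Fin d → ℤ) :
    redVec q (a + b) = redVec q a + redVec q b := by
  ext i
  exact red_add (fun k => a (i, k)) fun k => b (i, k)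

theorem redVec_chalMul {ι : Type} {q d : ℕ} [NeZero d] (c : Fin d → SignType)
    (a : ι → Fin d → SignType) :
    redVec q (chalMul c a) = tern (ZMod q) c • ternVec q a := by
  ext i
  change red q (coeff (tern ℤ c * tern ℤ (a i))) = _
  rw [← redHom_ofCoeffs, ofCoeffs_coeff (S := ℤ), map_mul, redHom_tern, redHom_tern]
  rfl

/-- The transcript of the honest execution with the given random choices. -/
def honestTr (pp : PP P) (x : Stmt P) (m : P.MIdx → Fin P.d → SignType)
    (sT : Fin P.n → Fin P.d → SignType) (g0 : P.Rq) (y1 : P.MIdx × Fin P.d → ℤ)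
    (y2 : Fin P.n × Fin P.d → ℤ) (y3 : P.J → ℤ) (R : ChR P) (dd : ChD P) (c : ChC P) :
    Transcript P :=
  let g : P.Rq := g0 - AdjoinRoot.of _ (coeff g0 0)
  let z3 := redVec P.q (y3 + projVec x m R)
  ⟨⟨pp.A3 *ᵥ ternVec P.q m + pp.A4 *ᵥ ternVec P.q sT, pp.B1 *ᵥ ternVec P.q sT + redVec P.q y3,
      pp.B2 ⬝ᵥ ternVec P.q sT + g⟩, R, z3, dd,
    ⟨g + (rowC x R dd ⬝ᵥ ternVec P.q m + rowE dd ⬝ᵥ redVec P.q y3 - affine x R z3 dd),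
      pp.A3 *ᵥ redVec P.q y1 + pp.A4 *ᵥ redVec P.q y2,
      matT x R dd *ᵥ Sum.elim (redVec P.q y1) (Sum.elim (-(pp.B1 *ᵥ redVec P.q y2))
        fun _ => -(pp.B2 ⬝ᵥ redVec P.q y2))⟩, c,
    ⟨redVec P.q (y1 + chalMul c m), redVec P.q (y2 + chalMul c sT)⟩⟩

variable (pp : PP P) (x : Stmt P) (m : P.MIdx → Fin P.d → SignType)
  (sT : Fin P.n → Fin P.d → SignType) (g0 : P.Rq) (y1 : P.MIdx × Fin P.d → ℤ)
  (y2 : Fin P.n × Fin P.d → ℤ) (y3 : P.J → ℤ) (R : ChR P) (dd : ChD P) (c : ChC P)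

/-- The prover computes `Rℓ` over `ℤ` from centred coefficients; reduced modulo `q` it agrees with
the product of residues, so no smallness of `ℓ` is involved. -/
theorem projErr_honest (j : P.J) :
    projErr x R (ternVec P.q m) (redVec P.q y3) (redVec P.q (y3 + projVec x m R)) j = 0 := by
  unfold projErr redVec
  rw [coeff_red, coeff_red, Pi.add_apply, Int.cast_add, projVec]
  simp only [Int.cast_sum, Int.cast_mul, cent_cast]
  rw [← sub_sub, sub_eq_zero, add_sub_cancel_right]
  rfl

theorem honestTr_coeff_h : coeff (honestTr pp x m sT g0 y1 y2 y3 R dd c).m3.h 0 = 0 := by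
  simp only [honestTr]
  rw [coeff_add, coeff_linear_relation, coeff_sub, coeff_of]
  simp [projErr_honest]

theorem honestTr_w :
    let t := honestTr pp x m sT g0 y1 y2 y3 R dd c
    pp.A3 *ᵥ t.m4.z1 + pp.A4 *ᵥ t.m4.z2 = t.m3.w + tern (ZMod P.q) t.c • t.m1.f := by
  simp only [honestTr, redVec_add, redVec_chalMul, Matrix.mulVec_add, Matrix.mulVec_smul, smul_add]
  abel

/-- The argument of `T` equals `(y₁, -B'y₂, -B''y₂) + c(m, y₃, g)`, and `T(m, y₃, g)` is `(u, h +
affine)` by the choice of `h` and `Ãm = u`. -/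
theorem honestTr_v (hm : x.ATilde *ᵥ ternVec P.q m = x.u) :
    let t := honestTr pp x m sT g0 y1 y2 y3 R dd c
    let c := tern (ZMod P.q) t.c
    t.m3.v = matT x t.R t.dd *ᵥ Sum.elim t.m4.z1
      (Sum.elim (c • t.m1.u1 - pp.B1 *ᵥ t.m4.z2) fun _ => c * t.m1.u2 - pp.B2 ⬝ᵥ t.m4.z2)
    - c • Sum.elim x.u fun _ => t.m3.h + affine x t.R t.z3 t.dd := by
  simp only [honestTr]
  rw [redVec_add y1, redVec_add y2, redVec_chalMul, redVec_chalMul]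
  simp only [Matrix.mulVec_add, Matrix.mulVec_smul, matT_mulVec, dotProduct_add, dotProduct_smul,
    dotProduct_sub, dotProduct_neg, smul_add, hm, smul_eq_mul]
  ext i
  rcases i with i | i
  · simp
  · simp only [Sum.elim_inr, Pi.sub_apply, Pi.smul_apply, smul_eq_mul]
    ring

end Honest

end

section

variable {P : Params}

/-! ### The distribution of honest transcripts -/

theorem ex_ite_bool {α : Type} (b : Bool) (μ ν : PMF α) (f : α → ℝ≥0∞) :
    ex (if b = true then μ else ν) f = if b = true then ex μ f else ex ν f := by
  split_ifs <;> rfl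

theorem ex_guard (r : PMF Bool) (X : ℝ≥0∞) :
    ex r (fun b => if b = true then X else 0) = r true * X := by
  simp [ex_fintype]

theorem ex_guard_and (r r' : PMF Bool) (X : ℝ≥0∞) :
    ex r (fun b => ex r' fun b' => if (b && b') = true then X else 0) =
      r true * (r' true * X) := by
  rw [← ex_guard r', ← ex_guard r]
  congr 1
  ext b
  cases b
  · simp [ex_const]
  · simp

/-- Moving the Gaussian samples of the honest execution next to the rejection steps. -/
theorem ex_reorder {α₁ α₂ α₃ ρ δ γ : Type} (A₁ : PMF α₁) (A₂ : PMF α₂) (A₃ : PMF α₃) (μR : PMF ρ)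
    (μd : PMF δ) (μc : PMF γ) (r₁ : α₁ → γ → PMF Bool) (r₂ : α₂ → γ → PMF Bool)
    (r₃ : α₃ → ρ → PMF Bool) (H : α₁ → α₂ → α₃ → ρ → δ → γ → ℝ≥0∞) :
    ex A₁ (fun y₁ => ex A₂ fun y₂ => ex A₃ fun y₃ => ex μR fun R => ex (r₃ y₃ R) fun b₃ =>
      if b₃ = true then ex μd fun d => ex μc fun c => ex (r₁ y₁ c) fun b₁ => ex (r₂ y₂ c) fun b₂ =>
        if (b₁ && b₂) = true then H y₁ y₂ y₃ R d c else 0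
      else 0) =
    ex μR fun R => ex μd fun d => ex μc fun c => ex A₁ fun y₁ => ex (r₁ y₁ c) fun b₁ =>
      if b₁ = true then ex A₂ fun y₂ => ex (r₂ y₂ c) fun b₂ =>
        if b₂ = true then ex A₃ fun y₃ => ex (r₃ y₃ R) fun b₃ =>
          if b₃ = true then H y₁ y₂ y₃ R d c else 0
        else 0
      else 0 := by
  -- An abort contributes zero, so each rejection step becomes a scalar weight; after that all
  -- independent samples may be exchanged.
  simp only [ex_guard, ex_guard_and, ← ex_mul_left]
  simp only [ex_comm A₃ μR, ex_comm A₃ μd, ex_comm A₃ μc, ex_comm A₂ μR, ex_comm A₂ μd,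
    ex_comm A₂ μc, ex_comm A₁ μR, ex_comm A₁ μd, ex_comm A₁ μc]
  simp only [mul_left_comm (r₃ _ _ true)]

/-- Challenges for the projection. -/
abbrev distR (P : Params) : PMF (ChR P) := iid P.J (iid (Fin 2) (iid (Fin P.d) bin1))

/-- Challenges for the linear combination. -/
abbrev distD (P : Params) : PMF (ChD P) := iid P.J (PMF.uniformOfFintype (ZMod P.q))

/-- The distribution of `y₁`. -/
abbrev distY1 (P : Params) : PMF (P.MIdx × Fin P.d → ℤ) := iid _ (dgauss P.s1 P.s1_pos)

/-- The distribution of `y₂`. -/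
abbrev distY2 (P : Params) : PMF (Fin P.n × Fin P.d → ℤ) := iid _ (dgauss P.s2 P.s2_pos)

/-- The distribution of `y₃`. -/
abbrev distY3 (P : Params) : PMF (P.J → ℤ) := iid _ (dgauss P.s3 P.s3_pos)

/-- The distribution of the randomness of commitments. -/
abbrev distS (P : Params) : PMF (Fin P.n → Fin P.d → SignType) := iid (Fin P.n) (iid (Fin P.d) P.χ)

/-- The honest transcript as a function of the responses. -/
def honestTrZ (pp : PP P) (x : Stmt P) (m : P.MIdx → Fin P.d → SignType)
    (sT : Fin P.n → Fin P.d → SignType) (g0 : P.Rq) (R : ChR P) (dd : ChD P) (c : ChC P)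
    (z1 : P.MIdx × Fin P.d → ℤ) (z2 : Fin P.n × Fin P.d → ℤ) (z3 : P.J → ℤ) : Transcript P :=
  honestTr pp x m sT g0 (z1 - chalMul c m) (z2 - chalMul c sT) (z3 - projVec x m R) R dd c

/-- Aborts have weight zero, which makes the honest run a subprobability measure. Expressing the
masks through the responses turns each rejection step into an `accSum`, ready for upper and lower
bounds. -/
theorem ex_honestRun (pp : PP P) (x : Stmt P) (m : P.MIdx → Fin P.d → SignType)
    (G : Transcript P → ℝ≥0∞) :
    ex (honestRun pp x m) (fun o => o.elim 0 G) =
      ex (distS P) fun sT => ex P.unif fun g0 => ex (distR P) fun R => ex (distD P) fun dd =>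
        ex P.chal fun c => accSum P.s1 P.s1_pos (chalMul c m) fun z1 =>
          accSum P.s2 P.s2_pos (chalMul c sT) fun z2 =>
            accSum P.s3 P.s3_pos (projVec x m R) fun z3 =>
              G (honestTrZ pp x m sT g0 R dd c z1 z2 z3) := by
  unfold honestRun
  simp only [ex_bind', ex_ite_bool, ex_pure', Option.elim_none, Option.elim_some]
  congr 1; ext sT
  congr 1; ext g0
  refine (ex_reorder (distY1 P) (distY2 P) (distY3 P) (distR P) (distD P) P.chal
    (fun y1 c => rej (y1 + chalMul c m) (chalMul c m) P.s1)
    (fun y2 c => rej (y2 + chalMul c sT) (chalMul c sT) P.s2)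
    (fun y3 R => rej (y3 + projVec x m R) (projVec x m R) P.s3)
    (fun y1 y2 y3 R dd c => G (honestTr pp x m sT g0 y1 y2 y3 R dd c))).trans ?_
  congr 1; ext R
  congr 1; ext dd
  congr 1; ext c
  rw [← ex_rejection]
  congr 1; ext y1
  congr 1; ext b1
  congr 1
  rw [← ex_rejection]
  congr 1; ext y2
  congr 1; ext b2
  congr 1
  rw [← ex_rejection]
  congr 1; ext y3
  congr 1; ext b3
  congr 1
  simp only [honestTrZ, add_sub_cancel_right]

theorem accSum_const {ι : Type} [Fintype ι] {s : ℝ} (hs : 0 < s) (v : ι → ℤ) (c : ℝ≥0∞) :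
    accSum s hs v (fun _ => c) = accSum s hs v (fun _ => 1) * c := by
  unfold accSum
  rw [← ENNReal.tsum_mul_right]
  simp

/-- The average over honest transcripts with independent Gaussian responses. -/
def exIdeal (pp : PP P) (x : Stmt P) (m : P.MIdx → Fin P.d → SignType)
    (G : Transcript P → ℝ≥0∞) : ℝ≥0∞ :=
  ex (distS P) fun sT => ex P.unif fun g0 => ex (distR P) fun R => ex (distD P) fun dd =>
    ex P.chal fun c => ex (distY1 P) fun z1 => ex (distY2 P) fun z2 => ex (distY3 P) fun z3 =>
      G (honestTrZ pp x m sT g0 R dd c z1 z2 z3)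

/-- One factor `1/3` for each rejection step. In `exIdeal` the responses are independent of the
secrets; the masks have become functions of the responses. -/
theorem ex_honestRun_le (pp : PP P) (x : Stmt P) (m : P.MIdx → Fin P.d → SignType)
    (G : Transcript P → ℝ≥0∞) :
    ex (honestRun pp x m) (fun o => o.elim 0 G) ≤ 27⁻¹ * exIdeal pp x m G := by
  rw [ex_honestRun, exIdeal]
  have h27 : (27⁻¹ : ℝ≥0∞) = 3⁻¹ * (3⁻¹ * 3⁻¹) := by
    rw [← ENNReal.mul_inv (by simp) (by simp), ← ENNReal.mul_inv (by simp) (by simp)]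
    norm_num
  simp only [← ex_mul_left]
  refine ex_mono _ fun sT => ex_mono _ fun g0 => ex_mono _ fun R => ex_mono _ fun dd =>
    ex_mono _ fun c => ?_
  refine (accSum_le _ _ _).trans ?_
  simp only [h27, mul_assoc, ex_mul_left]
  gcongr
  rw [← ex_mul_left, ← ex_mul_left]
  refine ex_mono _ fun z1 => (accSum_le _ _ _).trans ?_
  gcongr
  rw [← ex_mul_left]
  exact ex_mono _ fun z2 => accSum_le _ _ _

/-! ### Norms of the shifts -/

theorem sum_sq_tern_le {ι : Type} [Fintype ι] (a : ι → SignType) :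
    ∑ i, (((a i : ℤ)) : ℝ) ^ 2 ≤ Fintype.card ι := by
  calc ∑ i, (((a i : ℤ)) : ℝ) ^ 2 ≤ ∑ _ : ι, (1 : ℝ) := by
        refine Finset.sum_le_sum fun i _ => ?_
        cases a i <;> simp
    _ = _ := by simp

theorem sum_sq_chalMul_le {ι : Type} [Fintype ι] {c : Fin P.d → SignType} (hc : c ∈ P.chalSet)
    (a : ι → Fin P.d → SignType) :
    ∑ i, (chalMul c a i : ℝ) ^ 2 ≤ P.ω ^ 2 * (Fintype.card ι * P.d) := by
  have h := l2Z_coeff_mul_le (tern ℤ c) fun i => tern ℤ (a i)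
  change l2Z (chalMul c a) ≤ _ at h
  rw [← l2Z_sq]
  have h1 : ∑ k, |((coeff (tern ℤ c) k : ℤ) : ℝ)| ≤ P.ω := by
    have : ∑ i, ((c i : ℤ)).natAbs ≤ P.ω := hc
    have h2 : ((∑ i, ((c i : ℤ)).natAbs : ℕ) : ℝ) ≤ P.ω := by exact_mod_cast this
    refine le_trans (le_of_eq ?_) h2
    rw [Nat.cast_sum]
    refine Finset.sum_congr rfl fun k _ => ?_
    rw [coeff_tern, Nat.cast_natAbs, Int.cast_abs]
    simp
  calc l2Z (chalMul c a) ^ 2 ≤ (P.ω * l2Z (fun p : ι × Fin P.d => coeff (tern ℤ (a p.1)) p.2)) ^ 2 := by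
        gcongr
        · exact l2Z_nonneg _
        · refine h.trans ?_
          gcongr
          exact l2Z_nonneg _
    _ ≤ _ := by
        rw [mul_pow, l2Z_sq]
        gcongr
        simp only [coeff_tern]
        refine (sum_sq_tern_le fun p : ι × Fin P.d => a p.1 p.2).trans (le_of_eq ?_)
        simp

theorem mem_chalSet_of_mem_support {c : ChC P} (hc : c ∈ P.chal.support) : c ∈ P.chalSet := by
  rw [Params.chal, PMF.support_filter] at hc
  exact hc.1

theorem card_J (P : Params) : Fintype.card P.J = 256 := by
  simp [Nat.div_mul_cancel P.d_dvd]

theorem card_MIdx (P : Params) : Fintype.card P.MIdx = 4 * P.κ + 2 * P.lam + 6 := by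
  simp
  ring

/-- The right-hand side is `121` times the bound of `sum_sq_chalMul_le`, so the standard deviation
is eleven times the largest norm of `cm`, as `accSum_one_ge` requires. -/
theorem s1_sq (P : Params) : P.s1 ^ 2 = 121 * (P.ω ^ 2 * (Fintype.card P.MIdx * P.d)) := by
  rw [Params.s1, mul_pow, Real.sq_sqrt (by positivity), card_MIdx]
  push_cast
  ring

theorem s2_sq (P : Params) : P.s2 ^ 2 = 121 * (P.ω ^ 2 * (Fintype.card (Fin P.n) * P.d)) := by
  rw [Params.s2, mul_pow, Real.sq_sqrt (by positivity), Fintype.card_fin]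
  push_cast
  ring

theorem iid_curry {α ι κ : Type} [Fintype ι] [Fintype κ] (μ : PMF α) :
    iid ι (iid κ μ) = (iid (ι × κ) μ).map fun a i k => a (i, k) :=
  pmf_ext_ex fun f => by rw [ex_map, ex_iid_curry]

/-- The factor `11√337` in `s₃` splits: `√337` covers the expansion by the projection, `11` is for
the rejection step, and the remaining factor is the honest bound for `‖ℓ‖`. -/
theorem projVec_tail (x : Stmt P) (m : P.MIdx → Fin P.d → SignType) (hx : HonestRel x m) :
    ex (distR P) ({R | ¬ 121 * ∑ j, (projVec x m R j : ℝ) ^ 2 ≤ P.s3 ^ 2}.indicator 1) ≤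
      (2 ^ 110)⁻¹ := by
  set B : ℝ := 2 * (P.κ + P.lam + 3) * P.d with hB
  have hd : (0 : ℝ) < P.d := by exact_mod_cast P.d_pos
  have hBpos : 0 < B := by positivity
  set l : Fin 2 × Fin P.d → ℤ := fun p => cent (x.ell (fun i => tern (ZMod P.q) (m i)) p.1) p.2
  have hl : ∑ i, (l i : ℝ) ^ 2 ≤ B ^ 2 := by
    have := hx.2
    rw [l2_eq] at this
    rw [← l2Z_sq]
    gcongr
    exact l2Z_nonneg _
  have h := projection_tail (card_J P) l B hBpos hl
  rw [distR, iid_curry (ι := Fin 2), iid_map, ex_map]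
  refine le_trans (ex_mono _ fun R => ?_) h
  have e1 : P.s3 ^ 2 = 121 * (337 * B ^ 2) := by
    rw [Params.s3, mul_pow, mul_pow, Real.sq_sqrt (by norm_num)]
    ring
  have e2 : ∀ j, (projVec x m (fun j b k => R j (b, k)) j : ℝ) = ∑ i, ((R j i : ℤ) : ℝ) * l i := by
    intro j
    rw [projVec, Fintype.sum_prod_type]
    push_cast
    rfl
  by_cases hR : 121 * ∑ j, (projVec x m (fun j b k => R j (b, k)) j : ℝ) ^ 2 ≤ P.s3 ^ 2
  · rw [Set.indicator_of_notMem (by exact not_not.2 hR)]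
    exact zero_le
  · rw [Set.indicator_of_mem (by exact hR), Set.indicator_of_mem]
    · simp
    · simp only [e1, e2, not_le] at hR
      exact lt_of_mul_lt_mul_left hR (by norm_num)

/-- A lower bound for the probability that a rejection step does not abort. -/
def okBound : ℝ≥0∞ := 3⁻¹ * (1 - (2 ^ 103)⁻¹)

theorem okBound_le_accSum {ι : Type} [Fintype ι] {s : ℝ} (hs : 0 < s) (v : ι → ℤ)
    (hv : 121 * ∑ i, (v i : ℝ) ^ 2 ≤ s ^ 2) : okBound ≤ accSum s hs v fun _ => 1 := by
  rw [okBound, ENNReal.mul_sub (by simp), mul_one, tsub_le_iff_right]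
  exact accSum_one_ge hs v hv

theorem honestRun_nonabort_ge (pp : PP P) (x : Stmt P) (m : P.MIdx → Fin P.d → SignType)
    (hx : HonestRel x m) :
    okBound ^ 3 * (1 - (2 ^ 110)⁻¹) ≤ ex (honestRun pp x m) fun o => o.elim 0 fun _ => 1 := by
  rw [ex_honestRun]
  refine le_ex_const _ fun sT => le_ex_const _ fun g0 => ?_
  have hR : okBound * (1 - (2 ^ 110)⁻¹) ≤
      ex (distR P) fun R => accSum P.s3 P.s3_pos (projVec x m R) fun _ => 1 := by
    -- Adding `okBound` times the indicator of the atypical `R` makes the bound hold pointwise.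
    have h1 : okBound ≤ ex (distR P) fun R => (accSum P.s3 P.s3_pos (projVec x m R) fun _ => 1) +
        okBound * {R | ¬ 121 * ∑ j, (projVec x m R j : ℝ) ^ 2 ≤ P.s3 ^ 2}.indicator 1 R := by
      refine le_ex_const _ fun R => ?_
      by_cases h : 121 * ∑ j, (projVec x m R j : ℝ) ^ 2 ≤ P.s3 ^ 2
      · exact (okBound_le_accSum P.s3_pos _ h).trans le_self_add
      · rw [Set.indicator_of_mem (by exact h)]
        simp
    rw [ex_add, ex_mul_left] at h1
    rw [ENNReal.mul_sub (by simp [okBound, ENNReal.mul_eq_top]), mul_one, tsub_le_iff_right]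
    refine h1.trans ?_
    gcongr
    exact projVec_tail x m hx
  calc okBound ^ 3 * (1 - (2 ^ 110)⁻¹) = okBound * (1 - (2 ^ 110)⁻¹) * (okBound * okBound) := by ring
    _ ≤ (ex (distR P) fun R => accSum P.s3 P.s3_pos (projVec x m R) fun _ => 1) *
        (okBound * okBound) := by gcongr
    _ = ex (distR P) fun R => okBound * (okBound *
        accSum P.s3 P.s3_pos (projVec x m R) fun _ => 1) := by
        rw [← ex_mul_right]
        congr 1; ext R; ring
    _ ≤ _ := by
        refine ex_mono _ fun R => le_ex_const _ fun dd => ?_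
        -- Only challenges in the support are known to satisfy `‖c‖₁ ≤ ω`, so the comparison is
        -- restricted to them.
        refine (ex_const P.chal _).symm.le.trans (ex_mono_support _ fun c hc => ?_)
        have hc' := mem_chalSet_of_mem_support hc
        rw [accSum_const P.s2_pos, accSum_const P.s1_pos]
        gcongr
        · refine okBound_le_accSum P.s1_pos _ ?_
          rw [s1_sq]
          gcongr
          exact sum_sq_chalMul_le hc' m
        · refine okBound_le_accSum P.s2_pos _ ?_
          rw [s2_sq]
          gcongr
          exact sum_sq_chalMul_le hc' sT

/-- Three losses `2^(-103)` from rejection and one loss `2^(-110)` from the projection add up to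
less than `2^(-101)`. -/
theorem nonabort_numeric : (27⁻¹ : ℝ≥0∞) * (1 - (2 ^ 101)⁻¹) ≤ okBound ^ 3 * (1 - (2 ^ 110)⁻¹) := by
  have e : ∀ k : ℕ, (1 - (2 ^ k)⁻¹ : ℝ≥0∞) = ENNReal.ofReal (1 - (2 ^ k)⁻¹) := by
    intro k
    rw [ENNReal.ofReal_sub _ (by positivity), ENNReal.ofReal_inv_of_pos (by positivity),
      ENNReal.ofReal_pow (by norm_num)]
    simp
  have e3 : (3⁻¹ : ℝ≥0∞) = ENNReal.ofReal 3⁻¹ := by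
    rw [ENNReal.ofReal_inv_of_pos (by norm_num)]; simp
  have e27 : (27⁻¹ : ℝ≥0∞) = ENNReal.ofReal 27⁻¹ := by
    rw [ENNReal.ofReal_inv_of_pos (by norm_num)]; simp
  rw [okBound, e, e, e, e3, e27, ← ENNReal.ofReal_mul (by norm_num), ← ENNReal.ofReal_mul (by norm_num),
    ← ENNReal.ofReal_pow (by norm_num), ← ENNReal.ofReal_mul (by norm_num)]
  apply ENNReal.ofReal_le_ofReal
  norm_num

theorem honestRun_nonabort (pp : PP P) (x : Stmt P) (m : P.MIdx → Fin P.d → SignType)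
    (hx : HonestRel x m) :
    27⁻¹ * (1 - (2 ^ 101)⁻¹) ≤ ex (honestRun pp x m) fun o => o.elim 0 fun _ => 1 :=
  nonabort_numeric.trans (honestRun_nonabort_ge pp x m hx)

end

section

variable {P : Params}

/-! ### Completeness -/

theorem ex_option_indicator {α : Type} (μ : PMF (Option α)) (S : Set (Option α)) (p : α → Prop)
    (hnone : none ∉ S) (hsome : ∀ a, some a ∈ S ↔ p a) :
    ex μ (S.indicator 1) = ex μ fun o => o.elim 0 ({a | p a}.indicator 1) := by
  congr 1
  ext o
  cases o with
  | none => simp [hnone]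
  | some a =>
    by_cases h : p a
    · simp [hsome, h]
    · simp [hsome, h]

theorem l2_redVec_le {ι : Type} [Fintype ι] (z : ι × Fin P.d → ℤ) :
    l2 (redVec P.q z) ≤ l2Z z :=
  l2_le_of_cast fun i k => (coeff_red (fun k => z (i, k)) k).symm

theorem linf_redVec_le {z : P.J → ℤ} {B : ℝ} (h : ∀ j, |(z j : ℝ)| ≤ B) :
    (linf (redVec P.q z) : ℝ) ≤ B := by
  have hB : 0 ≤ B := (abs_nonneg _).trans (h (⟨0, Nat.div_pos (Nat.le_of_dvd (by norm_num) P.d_dvd)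
    P.d_pos⟩, ⟨0, P.d_pos⟩))
  have : linf (redVec P.q z) ≤ ⌊B⌋₊ := by
    refine Finset.sup_le fun j _ => ?_
    refine le_trans (natAbs_cent_le (n := z j)
      (coeff_red (fun k => z (j.1, k)) j.2).symm) (Nat.le_floor ?_)
    rw [Nat.cast_natAbs, Int.cast_abs]
    exact h j
  exact le_trans (by exact_mod_cast this) (Nat.floor_le hB)

/-- Puts the verifier's bound in the form `s√(2k)` with `k` the number of integer coefficients, the
threshold of `dgauss_tail_l2`. -/
theorem bound1_eq (P : Params) :
    P.bound1 = P.s1 * Real.sqrt (2 * Fintype.card (P.MIdx × Fin P.d)) := by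
  rw [Params.bound1, Fintype.card_prod, card_MIdx, Fintype.card_fin]
  congr 2
  push_cast
  ring

theorem bound2_eq (P : Params) :
    P.bound2 = P.s2 * Real.sqrt (2 * Fintype.card (Fin P.n × Fin P.d)) := by
  rw [Params.bound2, Fintype.card_prod, Fintype.card_fin, Fintype.card_fin]
  congr 2
  push_cast
  ring

theorem bound3_eq (P : Params) : P.bound3 = 16 * P.s3 := by
  rw [Params.bound3, show (2 * 128 : ℝ) = 16 ^ 2 by norm_num, Real.sqrt_sq (by norm_num)]

theorem honestTrZ_accepts {pp : PP P} {x : Stmt P} {m : P.MIdx → Fin P.d → SignType}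
    (hx : HonestRel x m) {sT : Fin P.n → Fin P.d → SignType} {g0 : P.Rq} {R : ChR P} {dd : ChD P}
    {c : ChC P} {z1 : P.MIdx × Fin P.d → ℤ} {z2 : Fin P.n × Fin P.d → ℤ} {z3 : P.J → ℤ}
    (h1 : l2Z z1 ≤ P.bound1) (h2 : l2Z z2 ≤ P.bound2) (h3 : ∀ j, |(z3 j : ℝ)| ≤ P.bound3) :
    Accepts pp x (honestTrZ pp x m sT g0 R dd c z1 z2 z3) := by
  refine ⟨?_, ?_, ?_, honestTr_coeff_h .., honestTr_w .., honestTr_v _ _ _ _ _ _ _ _ _ _ _ hx.1⟩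
  · simp only [honestTrZ, honestTr, sub_add_cancel]
    exact (l2_redVec_le z1).trans h1
  · simp only [honestTrZ, honestTr, sub_add_cancel]
    exact (l2_redVec_le z2).trans h2
  · simp only [honestTrZ, honestTr, sub_add_cancel]
    exact linf_redVec_le h3

/-- The tail bound for the Euclidean norm in dimension `k`. -/
def tailBound (k : ℕ) : ℝ := (Real.sqrt 2 * Real.exp (-(1 / 2))) ^ k

/-- The algebraic checks never fail, so a union bound over the three norm checks suffices. The bound
is uniform in everything except the Gaussian responses. -/
theorem exIdeal_not_accepts_le (pp : PP P) (x : Stmt P) (m : P.MIdx → Fin P.d → SignType)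
    (hx : HonestRel x m) :
    exIdeal pp x m ({t | ¬ Accepts pp x t}.indicator 1) ≤
      ENNReal.ofReal (tailBound (Fintype.card (P.MIdx × Fin P.d))) +
        (ENNReal.ofReal (tailBound (Fintype.card (Fin P.n × Fin P.d))) +
          ENNReal.ofReal (256 * 2 * Real.exp (-128))) := by
  refine ex_le_const _ fun sT => ex_le_const _ fun g0 => ex_le_const _ fun R =>
    ex_le_const _ fun dd => ex_le_const _ fun c => ?_
  have h1 := dgauss_tail_l2 (ι := P.MIdx × Fin P.d) P.s1_pos
  have h2 := dgauss_tail_l2 (ι := Fin P.n × Fin P.d) P.s2_pos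
  have h3 := dgauss_tail_sup (ι := P.J) P.s3_pos
  rw [← bound1_eq] at h1
  rw [← bound2_eq] at h2
  rw [← bound3_eq, card_J] at h3
  push_cast at h3
  calc _ ≤ ex (distY1 P) fun z1 => ex (distY2 P) fun z2 => ex (distY3 P) fun z3 =>
        {z | P.bound1 < l2Z z}.indicator 1 z1 + ({z | P.bound2 < l2Z z}.indicator 1 z2 +
          {z : P.J → ℤ | ∃ i, P.bound3 < |(z i : ℝ)|}.indicator 1 z3) := by
        refine ex_mono _ fun z1 => ex_mono _ fun z2 => ex_mono _ fun z3 => ?_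
        by_cases b1 : P.bound1 < l2Z z1
        · rw [Set.indicator_of_mem (s := {z | P.bound1 < l2Z z}) (by exact b1)]
          exact (Set.indicator_le_self' (by simp) _).trans le_self_add
        by_cases b2 : P.bound2 < l2Z z2
        · rw [Set.indicator_of_mem (s := {z | P.bound2 < l2Z z}) (by exact b2)]
          exact (Set.indicator_le_self' (by simp) _).trans (le_self_add.trans le_add_self)
        by_cases b3 : ∃ i, P.bound3 < |(z3 i : ℝ)|
        · rw [Set.indicator_of_mem (s := {z : P.J → ℤ | ∃ i, P.bound3 < |(z i : ℝ)|}) (by exact b3)]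
          exact (Set.indicator_le_self' (by simp) _).trans (le_add_self.trans le_add_self)
        · push Not at b1 b2 b3
          rw [Set.indicator_of_notMem]
          · exact zero_le
          · exact not_not.2 (honestTrZ_accepts hx b1 b2 b3)
    _ = _ := by simp only [ex_add, ex_const]
    _ ≤ _ := add_le_add h1 (add_le_add h2 h3)

theorem tailBound_le {k : ℕ} (hk : k ≠ 0) :
    tailBound k ≤ 2 ^ (-((k : ℝ) / 8)) * (1 - (2 ^ 101)⁻¹) := by
  -- The slack `0.95` pays for the factor `1 - 2^(-101)`, which comes from conditioning on
  -- non-abort. Taking eighth powers removes the roots.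
  have hbase : Real.sqrt 2 * Real.exp (-(1 / 2)) ≤ (2 : ℝ) ^ (-(1 / 8) : ℝ) * 0.95 := by
    refine le_of_pow_le_pow_left₀ (n := 8) (by norm_num) (by positivity) ?_
    rw [mul_pow, mul_pow, ← Real.rpow_mul_natCast (by norm_num), ← Real.exp_nat_mul,
      show 8 = 2 * 4 by norm_num, pow_mul, Real.sq_sqrt (by norm_num)]
    have h4 : Real.exp ((2 * 4 : ℕ) * (-(1 / 2))) ≤ (2.718 ^ 4)⁻¹ := by
      rw [show ((2 * 4 : ℕ) : ℝ) * (-(1 / 2)) = -((4 : ℕ) * 1) by norm_num, Real.exp_neg,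
        Real.exp_nat_mul]
      gcongr
      exact le_trans (by norm_num) Real.exp_one_gt_d9.le
    have h8 : (2 : ℝ) ^ (-(1 / 8) * ((2 * 4 : ℕ) : ℝ)) = 1 / 2 := by
      rw [show (-(1 / 8) * ((2 * 4 : ℕ) : ℝ)) = -1 by norm_num, Real.rpow_neg_one]
      norm_num
    rw [h8]
    calc _ ≤ (2 : ℝ) ^ 4 * (2.718 ^ 4)⁻¹ := by gcongr
      _ ≤ _ := by norm_num
  unfold tailBound
  calc _ ≤ ((2 : ℝ) ^ (-(1 / 8) : ℝ) * 0.95) ^ k := by gcongr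
    _ = 2 ^ (-((k : ℝ) / 8)) * 0.95 ^ k := by
        rw [mul_pow, ← Real.rpow_mul_natCast (by norm_num)]
        congr 2
        ring
    _ ≤ _ := by
        gcongr
        exact (pow_le_of_le_one (by norm_num) (by norm_num) hk).trans (by norm_num)

theorem completenessError_ge (P : Params) :
    tailBound (Fintype.card (P.MIdx × Fin P.d)) + (tailBound (Fintype.card (Fin P.n × Fin P.d)) +
      256 * 2 * Real.exp (-128)) ≤ completenessError P * (1 - (2 ^ 101)⁻¹) := by
  have hd := P.d_pos
  have h1 := tailBound_le (k := Fintype.card (P.MIdx × Fin P.d)) (by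
    rw [Fintype.card_prod, card_MIdx, Fintype.card_fin]; positivity)
  have h2 := tailBound_le (k := Fintype.card (Fin P.n × Fin P.d)) (by
    rw [Fintype.card_prod, Fintype.card_fin, Fintype.card_fin]; positivity)
  have e1 : -((Fintype.card (P.MIdx × Fin P.d) : ℝ) / 8) =
      -((2 * P.κ + P.lam + 3 : ℝ) * P.d / 4) := by
    rw [Fintype.card_prod, card_MIdx, Fintype.card_fin]
    push_cast
    ring
  have e2 : -((Fintype.card (Fin P.n × Fin P.d) : ℝ) / 8) = -((P.κ + P.lam + 3 : ℝ) * P.d / 8) := by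
    rw [Fintype.card_prod, Fintype.card_fin, Fintype.card_fin]
    push_cast
    ring
  rw [e1] at h1
  rw [e2] at h2
  -- The union bound for `z₃` has no slack of its own; the summand `2^(-100)` of the error makes up
  -- for the conditioning.
  have h3 : 256 * 2 * Real.exp (-128) ≤
      (256 * 2 * Real.exp (-128) + 2 ^ (-100 : ℝ)) * (1 - (2 ^ 101)⁻¹) := by
    have : Real.exp (-128) ≤ 2⁻¹ ^ 128 := by
      rw [show (-128 : ℝ) = (128 : ℕ) * (-1) by norm_num, Real.exp_nat_mul, Real.exp_neg]
      gcongr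
      exact le_trans (by norm_num) Real.exp_one_gt_d9.le
    rw [show (-100 : ℝ) = ((-100 : ℤ) : ℝ) by norm_num, Real.rpow_intCast]
    norm_num at this ⊢
    linarith
  unfold completenessError
  linarith

theorem complete (P : Params) : Complete P := by
  intro pp x m hx
  set A := ex (honestRun pp x m) fun o => o.elim 0 ({t | Accepts pp x t}.indicator 1) with hA
  set B := ex (honestRun pp x m) fun o => o.elim 0 ({t | ¬ Accepts pp x t}.indicator 1) with hB
  have hN := honestRun_nonabort pp x m hx
  have e1 : Pr (honestRun pp x m) {t | t ≠ none} = (A + B).toReal := by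
    rw [Pr_eq_ex, ex_option_indicator _ _ (fun _ => True) (by simp) (by simp), hA, hB, ← ex_add]
    congr 2
    ext o
    cases o with
    | none => simp
    | some t => by_cases h : Accepts pp x t <;> simp [h]
  have e2 : Pr (honestRun pp x m) {t | ∃ t', t = some t' ∧ Accepts pp x t'} = A.toReal := by
    rw [Pr_eq_ex, ex_option_indicator _ _ (Accepts pp x) (by simp) (by simp)]
  have hsum : (ex (honestRun pp x m) fun o => o.elim 0 fun _ => 1) = A + B := by
    rw [hA, hB, ← ex_add]
    congr 1
    ext o
    cases o with
    | none => simp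
    | some t => by_cases h : Accepts pp x t <;> simp [h]
  rw [hsum] at hN
  have hABle : A + B ≤ 1 := by
    rw [← hsum]
    exact ex_le_const _ fun o => by cases o <;> simp
  have hAt : A ≠ ⊤ := ((le_self_add.trans hABle).trans_lt ENNReal.one_lt_top).ne
  have hBt : B ≠ ⊤ := ((le_add_self.trans hABle).trans_lt ENNReal.one_lt_top).ne
  have hT : ∀ k, 0 ≤ tailBound k := fun k => by unfold tailBound; positivity
  -- The weight `B` of non-aborting but rejected runs is at most `error · (1 - 2^(-101))/27`, that
  -- is, at most `error` times the lower bound for the total weight `A + B`.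
  have hBle : B ≤ ENNReal.ofReal (27⁻¹ * (completenessError P * (1 - (2 ^ 101)⁻¹))) := by
    refine (ex_honestRun_le pp x m _).trans ?_
    rw [ENNReal.ofReal_mul (by norm_num), ENNReal.ofReal_inv_of_pos (by norm_num),
      ENNReal.ofReal_ofNat]
    gcongr
    refine (exIdeal_not_accepts_le pp x m hx).trans ?_
    rw [← ENNReal.ofReal_add (hT _) (by positivity),
      ← ENNReal.ofReal_add (hT _) (add_nonneg (hT _) (by positivity))]
    exact ENNReal.ofReal_le_ofReal (completenessError_ge P)
  have hce : 0 ≤ completenessError P := by unfold completenessError; positivity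
  have hBr : B.toReal ≤ 27⁻¹ * (completenessError P * (1 - (2 ^ 101)⁻¹)) :=
    ENNReal.toReal_le_of_le_ofReal (mul_nonneg (by norm_num) (mul_nonneg hce (by norm_num))) hBle
  have hNr : 27⁻¹ * (1 - (2 ^ 101)⁻¹) ≤ A.toReal + B.toReal := by
    rw [← ENNReal.toReal_add hAt hBt]
    refine le_trans (le_of_eq ?_) (ENNReal.toReal_mono (by finiteness) hN)
    rw [ENNReal.toReal_mul, ENNReal.toReal_sub_of_le
      (ENNReal.inv_le_one.2 (one_le_pow₀ (by norm_num))) (by simp)]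
    simp
  rw [e1, e2, ENNReal.toReal_add hAt hBt]
  constructor
  · refine le_trans ?_ hNr
    rw [show (-100 : ℝ) = ((-100 : ℤ) : ℝ) by norm_num, Real.rpow_intCast]
    norm_num
  · have := mul_le_mul_of_nonneg_left hNr hce
    linarith

end

section

/-! ### Invertibility of challenge differences -/

section Units

variable (P : Params)

theorem l_pos : 0 < P.l := Nat.pos_of_dvd_of_pos P.l_dvd P.d_pos

/-- `l` divides `256`, hence is a power of two. -/
theorem coprime_l_odd (j : ℕ) : Nat.Coprime P.l (2 * j + 1) := by
  have h : P.l ∣ 2 ^ 8 := P.l_dvd.trans (by simpa using P.d_dvd)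
  refine Nat.Coprime.coprime_dvd_left h (Nat.Coprime.pow_left 8 ?_)
  simp

theorem zeta_pow_l : P.ζ ^ P.l = -1 := by
  have h1 : (P.ζ ^ P.l) ^ 2 = 1 := by
    rw [← pow_mul, mul_comm]; exact P.ζ_prim.pow_eq_one
  rcases eq_or_eq_neg_of_sq_eq_sq _ 1 (h1.trans (one_pow 2).symm) with h | h
  · have := Nat.le_of_dvd (l_pos P) (P.ζ_prim.dvd_of_pow_eq_one _ h)
    have := l_pos P
    omega
  · exact h

theorem X_pow_l_add_one_eq :
    (X ^ P.l + 1 : (ZMod P.q)[X]) = ∏ j : Fin P.l, (X - C (P.ζ ^ (2 * (j : ℕ) + 1))) := by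
  have hinj : Function.Injective fun j : Fin P.l => P.ζ ^ (2 * (j : ℕ) + 1) := by
    intro i j hij
    have := P.ζ_prim.pow_inj (i := 2 * (i : ℕ) + 1) (j := 2 * (j : ℕ) + 1) (by omega) (by omega) hij
    exact Fin.ext (by omega)
  refine eq_of_monic_of_dvd_of_natDegree_le
    (monic_prod_of_monic _ _ fun j _ => monic_X_sub_C _)
    (monic_cyc (ZMod P.q) (l_pos P).ne') ?_ ?_
  · refine Fintype.prod_dvd_of_coprime (pairwise_coprime_X_sub_C hinj) fun j => ?_
    rw [dvd_iff_isRoot]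
    simp only [IsRoot, eval_add, eval_pow, eval_X, eval_one]
    rw [← pow_mul, mul_comm, pow_mul, zeta_pow_l, Odd.neg_one_pow ⟨_, rfl⟩]
    ring
  · rw [natDegree_prod_of_monic _ _ fun j _ => monic_X_sub_C _]
    simp only [natDegree_X_sub_C]
    have : (X ^ P.l + 1 : (ZMod P.q)[X]).natDegree = P.l := by
      simpa using natDegree_X_pow_add_C (n := P.l) (r := (1 : ZMod P.q))
    rw [this]
    simp

/-- `d/l`. -/
abbrev Params.k : ℕ := P.d / P.l

theorem l_mul_k : P.l * P.k = P.d := Nat.mul_div_cancel' P.l_dvd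

theorem k_pos : 0 < P.k := Nat.div_pos (Nat.le_of_dvd P.d_pos P.l_dvd) (l_pos P)

/-- Substitute `X^(d/l)` for `X` in the splitting of `X^l + 1` into linear factors. -/
theorem X_pow_d_add_one_eq :
    (X ^ P.d + 1 : (ZMod P.q)[X]) = ∏ j : Fin P.l, (X ^ P.k - C (P.ζ ^ (2 * (j : ℕ) + 1))) := by
  have h := congrArg (expand (ZMod P.q) P.k) (X_pow_l_add_one_eq P)
  simp only [map_prod, map_sub, map_add, map_pow (expand (ZMod P.q) P.k), expand_X, expand_C,
    map_one] at h
  rw [← h, ← pow_mul, mul_comm, l_mul_k]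

/-- A polynomial divisible by none of the irreducible factors is coprime to `X^d + 1`, and Bézout
gives an inverse. -/
theorem exists_dvd_of_not_isUnit {f : (ZMod P.q)[X]}
    (hf : ¬ IsUnit (AdjoinRoot.mk (X ^ P.d + 1) f)) :
    ∃ j < P.l, (X ^ P.k - C (P.ζ ^ (2 * j + 1))) ∣ f := by
  by_contra! h
  apply hf
  have hcop : IsCoprime f (X ^ P.d + 1) := by
    rw [X_pow_d_add_one_eq]
    refine IsCoprime.prod_right fun j _ => ?_
    exact ((P.splits j j.2).coprime_iff_not_dvd.2 (h j j.2)).symm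
  obtain ⟨a, b, hab⟩ := hcop
  have h1 := congrArg (AdjoinRoot.mk (X ^ P.d + 1)) hab
  rw [map_add, map_mul, map_mul, AdjoinRoot.mk_self, mul_zero, add_zero, map_one] at h1
  exact IsUnit.of_mul_eq_one_right _ h1

/-- The coefficient indices, sorted by residues modulo `d/l`. -/
def splitIdx : Fin P.k × Fin P.l ≃ Fin P.d :=
  (Equiv.prodComm _ _).trans (finProdFinEquiv.trans (finCongr (l_mul_k P)))

theorem splitIdx_val (p : Fin P.k × Fin P.l) :
    (splitIdx P p : ℕ) = p.1 + P.k * p.2 := rfl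

/-- Modulo `X^k - r` every `X^k` may be replaced by `r`. The remainder has degree below `k` and its
coefficients are the displayed sums, so divisibility makes them vanish. -/
theorem coeffs_of_dvd {r : ZMod P.q} {a : Fin P.d → ZMod P.q}
    (h : (X ^ P.k - C r) ∣ ∑ i, C (a i) * (X : (ZMod P.q)[X]) ^ (i : ℕ)) (i : Fin P.k) :
    ∑ t : Fin P.l, a (splitIdx P (i, t)) * r ^ (t : ℕ) = 0 := by
  set g : (ZMod P.q)[X] := ∑ i : Fin P.k,
    C (∑ t : Fin P.l, a (splitIdx P (i, t)) * r ^ (t : ℕ)) * X ^ (i : ℕ) with hg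
  have hdvd : (X ^ P.k - C r) ∣ g := by
    have h2 : (X ^ P.k - C r) ∣ (∑ i, C (a i) * (X : (ZMod P.q)[X]) ^ (i : ℕ)) - g := by
      rw [← (splitIdx P).sum_comp, Fintype.sum_prod_type, hg, ← Finset.sum_sub_distrib]
      refine Finset.dvd_sum fun i _ => ?_
      rw [map_sum, Finset.sum_mul, ← Finset.sum_sub_distrib]
      refine Finset.dvd_sum fun t _ => ?_
      rw [splitIdx_val, pow_add, pow_mul, C_mul, C_pow]
      have := sub_dvd_pow_sub_pow (X ^ P.k : (ZMod P.q)[X]) (C r) t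
      refine this.trans ⟨C (a (splitIdx P (i, t))) * X ^ (i : ℕ), by ring⟩
    have := dvd_sub h h2
    rwa [sub_sub_cancel] at this
  have hdeg : g.degree < (X ^ P.k - C r).degree := by
    rw [degree_X_pow_sub_C (k_pos P)]
    refine (degree_sum_le _ _).trans_lt ?_
    rw [Finset.sup_lt_iff (by exact WithBot.bot_lt_coe _)]
    intro i _
    exact (degree_C_mul_X_pow_le _ _).trans_lt (by exact_mod_cast i.2)
  have h0 : g = 0 := by
    by_contra h0
    exact not_lt.2 (degree_le_of_dvd hdvd h0) hdeg
  have hc := congrArg (fun f => f.coeff (i : ℕ)) h0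
  simp only [hg, finsetSum_coeff, coeff_C_mul, coeff_X_pow, Polynomial.coeff_zero] at hc
  rw [Finset.sum_eq_single i] at hc
  · simpa using hc
  · intro b _ hb
    rw [if_neg (fun h => hb (Fin.ext h.symm)), mul_zero]
  · simp

/-- A non-unit difference vanishes in some NTT component. The right-hand sides depend on `a` alone,
so for fixed `a` this is an event about `b` with a prescribed value. -/
theorem exists_of_not_isUnit_sub {a b : ChC P}
    (h : ¬ IsUnit (tern (ZMod P.q) a - tern (ZMod P.q) b : P.Rq)) :
    ∃ j : Fin P.l, ∀ i : Fin P.k,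
      ∑ t : Fin P.l, ((b (splitIdx P (i, t)) : ℤ) : ZMod P.q) * (P.ζ ^ (2 * (j : ℕ) + 1)) ^ (t : ℕ) =
      ∑ t : Fin P.l, ((a (splitIdx P (i, t)) : ℤ) : ZMod P.q) * (P.ζ ^ (2 * (j : ℕ) + 1)) ^ (t : ℕ) := by
  have e : (tern (ZMod P.q) a - tern (ZMod P.q) b : P.Rq) = AdjoinRoot.mk (X ^ P.d + 1)
      (∑ i, C (((a i : ℤ) : ZMod P.q) - ((b i : ℤ) : ZMod P.q)) * X ^ (i : ℕ)) := by
    simp only [tern, ofCoeffs, map_sum, map_mul, map_pow, AdjoinRoot.mk_C, AdjoinRoot.mk_X,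
      map_sub, sub_mul, Finset.sum_sub_distrib]
  rw [e] at h
  obtain ⟨j, hj, hdvd⟩ := exists_dvd_of_not_isUnit P h
  refine ⟨⟨j, hj⟩, fun i => ?_⟩
  have := coeffs_of_dvd P hdvd i
  simp only [sub_mul, Finset.sum_sub_distrib] at this
  exact (sub_eq_zero.1 this).symm

/-- The characteristic function of a challenge coefficient. -/
def chalChar (x : ZMod P.q) : ℝ := P.p + (1 - P.p) * Real.cos (2 * Real.pi * (x.val : ℝ) / P.q)

theorem stdAddChar_add_neg (x : ZMod P.q) :
    ZMod.stdAddChar x + ZMod.stdAddChar (-x) =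
      ((2 * Real.cos (2 * Real.pi * (x.val : ℝ) / P.q) : ℝ) : ℂ) := by
  rw [AddChar.map_neg_eq_conj, Complex.add_conj, ZMod.stdAddChar_apply, ZMod.toCircle_apply]
  congr 2
  rw [show (2 * Real.pi * Complex.I * x.val / P.q : ℂ) =
    ((2 * Real.pi * (x.val : ℝ) / P.q : ℝ) : ℂ) * Complex.I by push_cast; ring,
    Complex.exp_ofReal_mul_I_re]

theorem chalChar_neg (x : ZMod P.q) : chalChar P (-x) = chalChar P x := by
  have h1 := stdAddChar_add_neg P x
  have h2 := stdAddChar_add_neg P (-x)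
  rw [neg_neg, add_comm, h1] at h2
  have h3 := Complex.ofReal_injective h2
  unfold chalChar
  linear_combination (-(1 - P.p) / 2) * h3

theorem chalChar_mul_zeta_pow (y : ZMod P.q) (n : ℕ) :
    chalChar P (y * P.ζ ^ n) = chalChar P (y * P.ζ ^ (n % P.l)) := by
  conv_lhs => rw [← Nat.div_add_mod n P.l, pow_add, pow_mul, zeta_pow_l]
  rcases neg_one_pow_eq_or (ZMod P.q) (n / P.l) with h | h
  · rw [h, one_mul]
  · rw [h, neg_one_mul, mul_neg, chalChar_neg]

/-- As `ζ^l = -1` and the characteristic function is even, exponents of `ζ` matter only modulo `l`.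
Multiplication by the odd number `2j+1` permutes the residues modulo `l`, so all components share
one bound. -/
theorem prod_chalChar (y : ZMod P.q) (j : ℕ) :
    ∏ t : Fin P.l, |chalChar P (y * (P.ζ ^ (2 * j + 1)) ^ (t : ℕ))| =
      ∏ t ∈ Finset.range P.l, |chalChar P (y * P.ζ ^ t)| := by
  rw [Fin.prod_univ_eq_prod_range (fun t => |chalChar P (y * (P.ζ ^ (2 * j + 1)) ^ t)|)]
  have himg : (Finset.range P.l).image (fun t => (2 * j + 1) * t % P.l) = Finset.range P.l := by
    refine Finset.eq_of_subset_of_card_le ?_ ?_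
    · intro s hs
      obtain ⟨t, _, rfl⟩ := Finset.mem_image.1 hs
      exact Finset.mem_range.2 (Nat.mod_lt _ (l_pos P))
    · rw [Finset.card_image_of_injOn]
      intro s hs t ht hst
      have h1 : s ≡ t [MOD P.l] := Nat.ModEq.cancel_left_of_coprime (coprime_l_odd P j) hst
      have hs' := Finset.mem_range.1 hs
      have ht' := Finset.mem_range.1 ht
      rwa [Nat.ModEq, Nat.mod_eq_of_lt hs', Nat.mod_eq_of_lt ht'] at h1
  conv_rhs => rw [← himg]
  rw [Finset.prod_image]
  · refine Finset.prod_congr rfl fun t _ => ?_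
    rw [← pow_mul, chalChar_mul_zeta_pow]
  · intro s hs t ht hst
    have h1 : s ≡ t [MOD P.l] := Nat.ModEq.cancel_left_of_coprime (coprime_l_odd P j) hst
    have hs' := Finset.mem_range.1 hs
    have ht' := Finset.mem_range.1 ht
    rwa [Nat.ModEq, Nat.mod_eq_of_lt hs', Nat.mod_eq_of_lt ht'] at h1

/-- The isolated summand `1/q` of the definition is the term `y = 0`, where every factor is one. -/
theorem nttBound_eq (j : ℕ) :
    P.nttBound = 1 / P.q * ∑ y : ZMod P.q,
      ∏ t : Fin P.l, |chalChar P (y * (P.ζ ^ (2 * j + 1)) ^ (t : ℕ))| := by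
  simp only [prod_chalChar]
  rw [← Finset.add_sum_erase _ _ (Finset.mem_univ 0), mul_add, Params.nttBound]
  congr 1
  · simp [chalChar]
  · congr 1
    refine Finset.sum_bij' (fun u _ => (u : ZMod P.q))
      (fun y hy => Units.mk0 y (Finset.ne_of_mem_erase hy)) ?_ ?_ ?_ ?_ ?_
    · intro u _; simp
    · intro y _; simp
    · intro u _; ext; simp
    · intro y _; simp
    · intro u _; rfl

theorem ternary_toReal (a : SignType) :
    (ternary P.p P.p_pos.le P.p_lt.le a).toReal = if a = 0 then P.p else (1 - P.p) / 2 := by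
  have h1 := P.p_pos.le
  have h2 := P.p_lt.le
  rw [ternary, PMF.ofFintype_apply]
  split_ifs
  · exact ENNReal.toReal_ofReal h1
  · exact ENNReal.toReal_ofReal (by linarith)

theorem sum_signType (f : SignType → ℂ) : ∑ a, f a = f 0 + f 1 + f (-1) := by
  have hu : (Finset.univ : Finset SignType) = {0, 1, -1} := by decide
  rw [hu, Finset.sum_insert (by decide), Finset.sum_insert (by decide), Finset.sum_singleton]
  ring

theorem sum_ternary_stdAddChar (x : ZMod P.q) :
    ∑ a : SignType, (((ternary P.p P.p_pos.le P.p_lt.le a).toReal : ℝ) : ℂ) *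
      ZMod.stdAddChar (((a : ℤ) : ZMod P.q) * x) = ((chalChar P x : ℝ) : ℂ) := by
  rw [sum_signType]
  simp only [ternary_toReal, if_true, if_neg (show ¬((-1 : SignType) = 0) by decide),
    if_neg (show ¬((1 : SignType) = 0) by decide)]
  have h := stdAddChar_add_neg P x
  simp only [SignType.coe_zero, SignType.coe_one, SignType.coe_neg_one, Int.cast_zero, Int.cast_one,
    Int.cast_neg, zero_mul, one_mul, neg_mul, AddChar.map_zero_eq_one, mul_one]
  rw [add_assoc, ← mul_add, h, chalChar]
  push_cast
  ring

theorem addChar_sum {A ι : Type} [AddCommGroup A] (ψ : AddChar A ℂ) (s : Finset ι) (f : ι → A) :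
    ψ (∑ i ∈ s, f i) = ∏ i ∈ s, ψ (f i) := by
  classical
  induction s using Finset.induction_on with
  | empty => simp
  | insert i s hi ih => rw [Finset.sum_insert hi, Finset.prod_insert hi, AddChar.map_add_eq_mul, ih]

/-- The bound for the probability of a value of a coefficient of an NTT component. -/
theorem ntt_coeff_prob_le (j : ℕ) (b : ZMod P.q) :
    ex (iid (Fin P.l) (ternary P.p P.p_pos.le P.p_lt.le))
      ({a | ∑ t : Fin P.l, ((a t : ℤ) : ZMod P.q) * (P.ζ ^ (2 * j + 1)) ^ (t : ℕ) = b}.indicator 1) ≤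
      ENNReal.ofReal P.nttBound := by
  classical
  set r := P.ζ ^ (2 * j + 1)
  set μ := ternary P.p P.p_pos.le P.p_lt.le
  set E : ℝ≥0∞ := ex (iid (Fin P.l) μ)
    ({a | ∑ t : Fin P.l, ((a t : ℤ) : ZMod P.q) * r ^ (t : ℕ) = b}.indicator 1) with hE
  have hEt : E ≠ ⊤ := ex_indicator_ne_top _ _
  rw [← ENNReal.ofReal_toReal hEt]
  apply ENNReal.ofReal_le_ofReal
  have hq : (0 : ℝ) < P.q := by exact_mod_cast P.q_prime.pos
  have hEr : E.toReal = ∑ a : Fin P.l → SignType, (∏ t, (μ (a t)).toReal) *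
      if ∑ t : Fin P.l, ((a t : ℤ) : ZMod P.q) * r ^ (t : ℕ) - b = 0 then 1 else 0 := by
    rw [hE, ex_fintype, ENNReal.toReal_sum]
    · refine Finset.sum_congr rfl fun a _ => ?_
      rw [ENNReal.toReal_mul, iid_apply, ENNReal.toReal_prod]
      congr 1
      by_cases h : ∑ t : Fin P.l, ((a t : ℤ) : ZMod P.q) * r ^ (t : ℕ) = b
      · rw [Set.indicator_of_mem (by exact h), if_pos (sub_eq_zero.2 h)]; simp
      · rw [Set.indicator_of_notMem (by exact h), if_neg (fun h' => h (sub_eq_zero.1 h'))]; simp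
    · intro a _
      refine ENNReal.mul_ne_top (PMF.apply_ne_top _ _) ?_
      exact ((Set.indicator_le_self' (by simp) _ : _ ≤ (1 : (Fin P.l → SignType) → ℝ≥0∞) a).trans_lt
        ENNReal.one_lt_top).ne
  -- Fourier inversion on `ℤ_q`: `q · Pr[S = b]` is the sum over `y` of `ψ(-yb) E[ψ(yS)]`, and
  -- independence of the coefficients factors the expectation. Absolute values then remove the
  -- dependence on `b`.
  have hfour : ((P.q * E.toReal : ℝ) : ℂ) = ∑ y : ZMod P.q, ZMod.stdAddChar (y * -b) *
      ∏ t : Fin P.l, ((chalChar P (y * r ^ (t : ℕ)) : ℝ) : ℂ) := by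
    rw [hEr]
    have hprod : ∀ y : ZMod P.q, ∏ t : Fin P.l, ((chalChar P (y * r ^ (t : ℕ)) : ℝ) : ℂ) =
        ∑ a : Fin P.l → SignType, ∏ t, ((((μ (a t)).toReal : ℝ) : ℂ) *
          ZMod.stdAddChar (((a t : ℤ) : ZMod P.q) * (y * r ^ (t : ℕ)))) := by
      intro y
      simp only [← sum_ternary_stdAddChar]
      rw [Finset.prod_univ_sum, Fintype.piFinset_univ]
    simp only [hprod, Finset.mul_sum]
    rw [Finset.sum_comm]
    rw [Complex.ofReal_sum]
    refine Finset.sum_congr rfl fun a _ => ?_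
    have hs := AddChar.sum_mulShift (∑ t : Fin P.l, ((a t : ℤ) : ZMod P.q) * r ^ (t : ℕ) - b)
      (ZMod.isPrimitive_stdAddChar P.q)
    have e : ∀ y : ZMod P.q, ZMod.stdAddChar (y * -b) * ∏ t, ((((μ (a t)).toReal : ℝ) : ℂ) *
          ZMod.stdAddChar (((a t : ℤ) : ZMod P.q) * (y * r ^ (t : ℕ)))) =
        (∏ t, (((μ (a t)).toReal : ℝ) : ℂ)) *
          ZMod.stdAddChar (y * (∑ t : Fin P.l, ((a t : ℤ) : ZMod P.q) * r ^ (t : ℕ) - b)) := by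
      intro y
      rw [Finset.prod_mul_distrib, mul_left_comm]
      congr 1
      rw [← addChar_sum, ← AddChar.map_add_eq_mul]
      congr 1
      rw [mul_sub, Finset.mul_sum, mul_neg, neg_add_eq_sub]
      congr 1
      exact Finset.sum_congr rfl fun t _ => by ring
    simp only [e]
    rw [← Finset.mul_sum, hs, ZMod.card, Complex.ofReal_mul, Complex.ofReal_mul, Complex.ofReal_prod, mul_left_comm]
    congr 1
    split_ifs <;> simp
  rw [nttBound_eq P j, one_div, ← div_eq_inv_mul, le_div_iff₀ hq, mul_comm]
  have h0 : 0 ≤ P.q * E.toReal := mul_nonneg hq.le ENNReal.toReal_nonneg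
  calc P.q * E.toReal = ‖((P.q * E.toReal : ℝ) : ℂ)‖ := by
        rw [Complex.norm_real, Real.norm_of_nonneg h0]
    _ ≤ ∑ y : ZMod P.q, ‖ZMod.stdAddChar (y * -b) *
          ∏ t : Fin P.l, ((chalChar P (y * r ^ (t : ℕ)) : ℝ) : ℂ)‖ := by
        rw [hfour]; exact norm_sum_le _ _
    _ = _ := by
        refine Finset.sum_congr rfl fun y _ => ?_
        rw [norm_mul, norm_prod, ZMod.stdAddChar_apply, Circle.norm_coe, one_mul]
        simp only [Complex.norm_real, Real.norm_eq_abs]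
        rfl

/-- The `d/l` coefficients of a component are functions of disjoint blocks of challenge
coefficients, hence independent. -/
theorem ntt_component_prob_le (j : ℕ) (b : Fin P.k → ZMod P.q) :
    ex P.chalCoeffs ({a | ∀ i : Fin P.k, ∑ t : Fin P.l, ((a (splitIdx P (i, t)) : ℤ) : ZMod P.q) *
      (P.ζ ^ (2 * j + 1)) ^ (t : ℕ) = b i}.indicator 1) ≤ ENNReal.ofReal P.nttBound ^ P.k := by
  classical
  set r := P.ζ ^ (2 * j + 1)
  rw [Params.chalCoeffs, ex_iid_equiv (splitIdx P), ex_iid_curry]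
  have h : ∀ a : Fin P.k → Fin P.l → SignType,
      ({a : ChC P | ∀ i : Fin P.k, ∑ t : Fin P.l, ((a (splitIdx P (i, t)) : ℤ) : ZMod P.q) *
        r ^ (t : ℕ) = b i}.indicator 1
          ((fun p : Fin P.k × Fin P.l => a p.1 p.2) ∘ (splitIdx P).symm) : ℝ≥0∞) =
      ∏ i, {a : Fin P.l → SignType |
        ∑ t : Fin P.l, ((a t : ℤ) : ZMod P.q) * r ^ (t : ℕ) = b i}.indicator 1 (a i) := by
    intro a
    simp only [Set.indicator_apply, Set.mem_ofPred_eq, Pi.one_apply, Finset.prod_ite_zero,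
      Finset.prod_const_one]
    simp
  simp only [h]
  rw [ex_iid_prod _ fun i => {a : Fin P.l → SignType |
        ∑ t : Fin P.l, ((a t : ℤ) : ZMod P.q) * r ^ (t : ℕ) = b i}.indicator 1]
  refine (Finset.prod_le_prod' fun i _ => ntt_coeff_prob_le P j (b i)).trans ?_
  simp

/-- A challenge differs from a fixed one by a unit, except with small probability. -/
theorem not_isUnit_prob_le {K : ℝ} (hK : P.NearUniform K) (c : ChC P) :
    ex P.chal ({c' | ¬ IsUnit (tern (ZMod P.q) c - tern (ZMod P.q) c' : P.Rq)}.indicator 1) ≤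
      ENNReal.ofReal (K * (P.l / (P.q : ℝ) ^ (P.d / P.l))) := by
  classical
  set S : Set (ChC P) := {c' | ¬ IsUnit (tern (ZMod P.q) c - tern (ZMod P.q) c' : P.Rq)}
  have hM : 0 ≤ P.nttBound := by
    rw [nttBound_eq P 0]; positivity
  -- Union bound over the `l` components, still for unconditioned coefficients.
  have h1 : ex P.chalCoeffs (S.indicator 1) ≤ P.l * ENNReal.ofReal P.nttBound ^ P.k := by
    calc ex P.chalCoeffs (S.indicator 1) ≤ ex P.chalCoeffs fun a => ∑ j : Fin P.l,
          {a : ChC P | ∀ i : Fin P.k, ∑ t : Fin P.l, ((a (splitIdx P (i, t)) : ℤ) : ZMod P.q) *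
            (P.ζ ^ (2 * (j : ℕ) + 1)) ^ (t : ℕ) = ∑ t : Fin P.l,
              ((c (splitIdx P (i, t)) : ℤ) : ZMod P.q) *
                (P.ζ ^ (2 * (j : ℕ) + 1)) ^ (t : ℕ)}.indicator 1 a := by
          refine ex_mono _ fun a => ?_
          by_cases ha : a ∈ S
          · obtain ⟨j, hj⟩ := exists_of_not_isUnit_sub P ha
            rw [Set.indicator_of_mem ha]
            refine le_trans ?_ (Finset.single_le_sum (fun _ _ => zero_le) (Finset.mem_univ j))
            rw [Set.indicator_of_mem (by exact hj)]
          · rw [Set.indicator_of_notMem ha]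
            exact zero_le
      _ ≤ ∑ j : Fin P.l, ENNReal.ofReal P.nttBound ^ P.k := by
          rw [ex_finsetSum]
          exact Finset.sum_le_sum fun j _ => ntt_component_prob_le P j _
      _ = _ := by simp
  set Z : ℝ≥0∞ := ex P.chalCoeffs (P.chalSet.indicator 1) with hZ
  have hZ' : Z = ∑' a, P.chalSet.indicator P.chalCoeffs a := by
    rw [hZ, ex]
    refine tsum_congr fun a => ?_
    by_cases h : a ∈ P.chalSet <;> simp [h]
  have hZt : Z ≠ ⊤ := ex_indicator_ne_top _ _
  have hZ0 : Z ≠ 0 := by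
    obtain ⟨a, ha, hs⟩ := P.chal_nonempty
    intro h0
    rw [hZ', ENNReal.tsum_eq_zero] at h0
    have := h0 a
    rw [Set.indicator_of_mem ha] at this
    exact hs this
  -- Conditioning on `‖c‖₁ ≤ ω` costs the inverse of its probability `Z`, which is the last factor
  -- in `NearUniform`.
  have h2 : ex P.chal (S.indicator 1) ≤ ex P.chalCoeffs (S.indicator 1) * Z⁻¹ := by
    unfold ex
    rw [← ENNReal.tsum_mul_right]
    refine ENNReal.tsum_le_tsum fun a => ?_
    rw [Params.chal, PMF.filter_apply, ← hZ', mul_right_comm]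
    gcongr
    exact Set.indicator_le_self' (by simp) _
  refine h2.trans ?_
  rw [← div_eq_mul_inv]
  refine ENNReal.div_le_of_le_mul (h1.trans ?_)
  have h3 : P.nttBound ^ P.k ≤ K / (P.q : ℝ) ^ P.k * Z.toReal := by
    have := hK
    rw [Params.NearUniform, Pr_eq_ex] at this
    exact this
  have hq : (0 : ℝ) < P.q := by exact_mod_cast P.q_prime.pos
  have hZr : 0 < Z.toReal := ENNReal.toReal_pos hZ0 hZt
  have hKq : 0 ≤ K / (P.q : ℝ) ^ P.k := by
    have : 0 ≤ K / (P.q : ℝ) ^ P.k * Z.toReal := le_trans (by positivity) h3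
    exact nonneg_of_mul_nonneg_left this hZr
  calc (P.l : ℝ≥0∞) * ENNReal.ofReal P.nttBound ^ P.k
      = ENNReal.ofReal (P.l * P.nttBound ^ P.k) := by
        rw [ENNReal.ofReal_mul (by positivity), ENNReal.ofReal_natCast, ENNReal.ofReal_pow hM]
    _ ≤ ENNReal.ofReal (P.l * (K / (P.q : ℝ) ^ P.k * Z.toReal)) := by
        apply ENNReal.ofReal_le_ofReal
        gcongr
    _ = ENNReal.ofReal (K * (P.l / (P.q : ℝ) ^ (P.d / P.l))) * Z := by
        rw [← mul_assoc, ENNReal.ofReal_mul (by positivity), ENNReal.ofReal_toReal hZt]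
        congr 2
        simp only [Params.k]
        ring

end Units

end

section

variable {P : Params}

/-! ### Weak openings -/

section Openings

/-- The difference of the challenges of two transcripts. -/
def cbar (t t' : Transcript P) : P.Rq := tern (ZMod P.q) t.c - tern (ZMod P.q) t'.c

/-- The message extracted from two transcripts. -/
def openM (t t' : Transcript P) : P.MIdx → P.Rq :=
  fun i => Ring.inverse (cbar t t') * (t.m4.z1 i - t'.m4.z1 i)

/-- The randomness extracted from two transcripts. -/
def openS (t t' : Transcript P) : Fin P.n → P.Rq :=
  fun i => Ring.inverse (cbar t t') * (t.m4.z2 i - t'.m4.z2 i)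

/-- The Module-SIS candidate extracted from two pairs of transcripts. -/
def sisVec (t₁ t₁' t₂ t₂' : Transcript P) : P.MIdx ⊕ Fin P.n → P.Rq := fun i =>
  cbar t₁ t₁' * cbar t₂ t₂' * (Sum.elim (openM t₁ t₁') (openS t₁ t₁') i -
    Sum.elim (openM t₂ t₂') (openS t₂ t₂') i)

/-- Two accepting transcripts with the same commitments and challenges whose last challenges differ
by a unit. -/
structure Opens (pp : PP P) (x : Stmt P) (t t' : Transcript P) : Prop where
  acc : Accepts pp x t
  acc' : Accepts pp x t'
  mem : t.c ∈ P.chalSet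
  mem' : t'.c ∈ P.chalSet
  unit : IsUnit (cbar t t')
  m1 : t'.m1 = t.m1
  m3 : t'.m3 = t.m3
  R : t'.R = t.R
  dd : t'.dd = t.dd
  z3 : t'.z3 = t.z3

variable {pp : PP P} {x : Stmt P} {t t' : Transcript P}

theorem l1_cbar_le (h : t.c ∈ P.chalSet) (h' : t'.c ∈ P.chalSet) : l1 (cbar t t') ≤ 2 * P.ω := by
  have h1 : ∑ i, ((t.c i : ℤ)).natAbs ≤ P.ω := h
  have h2 : ∑ i, ((t'.c i : ℤ)).natAbs ≤ P.ω := h'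
  have := l1_tern_sub_le (q := P.q) t.c t'.c
  unfold cbar
  omega

theorem Opens.cbar_mul_openM (h : Opens pp x t t') :
    cbar t t' • openM t t' = t.m4.z1 - t'.m4.z1 := by
  ext i
  simp [openM, Ring.mul_inverse_cancel_left _ _ h.unit]

theorem Opens.cbar_mul_openS (h : Opens pp x t t') :
    cbar t t' • openS t t' = t.m4.z2 - t'.m4.z2 := by
  ext i
  simp [openS, Ring.mul_inverse_cancel_left _ _ h.unit]

theorem smul_left_cancel_of_isUnit {ι R : Type} [CommRing R] {c : R} (hc : IsUnit c) {v w : ι → R}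
    (h : c • v = c • w) : v = w := by
  ext i
  exact hc.mul_left_cancel (congrFun h i)

/-- Subtracting the two verification equations cancels `w` and leaves the claim multiplied by the
unit `cbar`. -/
theorem Opens.commit (h : Opens pp x t t') :
    pp.A3 *ᵥ openM t t' + pp.A4 *ᵥ openS t t' = t.m1.f := by
  refine smul_left_cancel_of_isUnit h.unit ?_
  obtain ⟨-, -, -, -, h5, -⟩ := h.acc
  obtain ⟨-, -, -, -, h5', -⟩ := h.acc'
  rw [h.m1, h.m3] at h5'
  rw [smul_add, ← Matrix.mulVec_smul, ← Matrix.mulVec_smul, h.cbar_mul_openM, h.cbar_mul_openS,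
    Matrix.mulVec_sub, Matrix.mulVec_sub, sub_add_sub_comm, h5, h5', cbar, sub_smul]
  abel

/-- Again the difference of two verification equations; `v` cancels, since both transcripts share
the third message and the earlier challenges. -/
theorem Opens.linear (h : Opens pp x t t') :
    matT x t.R t.dd *ᵥ Sum.elim (openM t t') (Sum.elim (t.m1.u1 - pp.B1 *ᵥ openS t t')
      fun _ => t.m1.u2 - pp.B2 ⬝ᵥ openS t t') =
      Sum.elim x.u fun _ => t.m3.h + affine x t.R t.z3 t.dd := by
  refine smul_left_cancel_of_isUnit h.unit ?_
  obtain ⟨-, -, -, -, -, h6⟩ := h.acc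
  obtain ⟨-, -, -, -, -, h6'⟩ := h.acc'
  rw [h.m1, h.m3, h.R, h.dd, h.z3, h6] at h6'
  have e : cbar t t' • (Sum.elim (openM t t') (Sum.elim (t.m1.u1 - pp.B1 *ᵥ openS t t')
      fun _ => t.m1.u2 - pp.B2 ⬝ᵥ openS t t') : P.MIdx ⊕ (P.E ⊕ Unit) → P.Rq) =
      Sum.elim t.m4.z1 (Sum.elim (tern (ZMod P.q) t.c • t.m1.u1 - pp.B1 *ᵥ t.m4.z2)
        fun _ => tern (ZMod P.q) t.c * t.m1.u2 - pp.B2 ⬝ᵥ t.m4.z2) -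
      Sum.elim t'.m4.z1 (Sum.elim (tern (ZMod P.q) t'.c • t.m1.u1 - pp.B1 *ᵥ t'.m4.z2)
        fun _ => tern (ZMod P.q) t'.c * t.m1.u2 - pp.B2 ⬝ᵥ t'.m4.z2) := by
    have hB1 : cbar t t' • (pp.B1 *ᵥ openS t t') = pp.B1 *ᵥ t.m4.z2 - pp.B1 *ᵥ t'.m4.z2 := by
      rw [← Matrix.mulVec_smul, h.cbar_mul_openS, Matrix.mulVec_sub]
    have hB2 : cbar t t' * (pp.B2 ⬝ᵥ openS t t') = pp.B2 ⬝ᵥ t.m4.z2 - pp.B2 ⬝ᵥ t'.m4.z2 := by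
      rw [← smul_eq_mul, ← dotProduct_smul, h.cbar_mul_openS, dotProduct_sub]
    ext i
    rcases i with i | i | i
    · exact congrFun h.cbar_mul_openM i
    · have := congrFun hB1 i
      simp only [Pi.smul_apply, smul_eq_mul, Pi.sub_apply] at this
      simp only [Pi.smul_apply, smul_eq_mul, Pi.sub_apply, Sum.elim_inr, Sum.elim_inl, mul_sub, this]
      rw [cbar]
      ring
    · simp only [Pi.smul_apply, smul_eq_mul, Pi.sub_apply, Sum.elim_inr, mul_sub, hB2]
      rw [cbar]
      ring
  rw [← Matrix.mulVec_smul, e, Matrix.mulVec_sub, cbar, sub_smul]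
  rw [sub_eq_sub_iff_sub_eq_sub] at h6'
  exact h6'

theorem Opens.pubkey (h : Opens pp x t t') : x.ATilde *ᵥ openM t t' = x.u := by
  have := h.linear
  rw [matT_mulVec] at this
  ext i
  exact congrFun this (Sum.inl i)

/-- The last row of `Opens.linear` at the constant coefficient, where `h` vanishes. The result is
affine in the challenge `d`, and once the opening is fixed its coefficients depend only on `R` and
the first two messages. -/
theorem Opens.coeff_relation (h : Opens pp x t t') :
    ∑ j, t.dd j * projErr x t.R (openM t t') (t.m1.u1 - pp.B1 *ᵥ openS t t') t.z3 j +
      coeff (t.m1.u2 - pp.B2 ⬝ᵥ openS t t') 0 = 0 := by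
  have h1 := h.linear
  rw [matT_mulVec] at h1
  have h2 := congrFun h1 (Sum.inr ())
  simp only [Sum.elim_inr] at h2
  obtain ⟨-, -, -, h4, -⟩ := h.acc
  rw [← coeff_linear_relation, ← coeff_add, ← h4]
  congr 1
  linear_combination h2

theorem Opens.l2_openM_le (h : Opens pp x t t') :
    l2 (fun i => cbar t t' * openM t t' i) ≤ 2 * P.bound1 := by
  change l2 (cbar t t' • openM t t') ≤ _
  rw [h.cbar_mul_openM]
  linarith [l2_sub_le t.m4.z1 t'.m4.z1, h.acc.1, h.acc'.1]

theorem Opens.l2_openS_le (h : Opens pp x t t') :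
    l2 (fun i => cbar t t' * openS t t' i) ≤ 2 * P.bound2 := by
  change l2 (cbar t t' • openS t t') ≤ _
  rw [h.cbar_mul_openS]
  linarith [l2_sub_le t.m4.z2 t'.m4.z2, h.acc.2.1, h.acc'.2.1]

theorem Opens.relPoE (h : Opens pp x t t')
    (hl : (linf (x.ell (openM t t')) : ℝ) ≤ 2 * P.bound3) :
    RelPoE pp x t.m1.f (cbar t t') (openM t t') (openS t t') :=
  ⟨l1_cbar_le h.mem h.mem', h.unit, h.commit, h.l2_openM_le, h.l2_openS_le, h.pubkey, hl⟩

/-- Since `ab(v - w) = b(av) - a(bw)`, only the known short vectors `av` and `bw` occur, each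
multiplied by an element of `ℓ₁` norm at most `2ω`. This is the origin of the factor `8ω` in
`msisBound`. -/
theorem l2_cross_le {ι : Type} [Fintype ι] {a b : P.Rq} {v w : ι → P.Rq} {B : ℝ}
    (ha : l1 a ≤ 2 * P.ω) (hb : l1 b ≤ 2 * P.ω)
    (hv : l2 (fun i => a * v i) ≤ 2 * B) (hw : l2 (fun i => b * w i) ≤ 2 * B) :
    l2 (fun i => a * b * (v i - w i)) ≤ 8 * P.ω * B := by
  have e : (fun i => a * b * (v i - w i)) =
      (fun i => b * (a * v i)) - fun i => a * (b * w i) := by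
    ext i; simp only [Pi.sub_apply]; ring
  have ha' : (l1 a : ℝ) ≤ 2 * P.ω := by exact_mod_cast ha
  have hb' : (l1 b : ℝ) ≤ 2 * P.ω := by exact_mod_cast hb
  have h1 : l2 (fun i => b * (a * v i)) ≤ 2 * P.ω * (2 * B) :=
    (l2_mul_le b fun i => a * v i).trans (by gcongr; exact Real.sqrt_nonneg _)
  have h2 : l2 (fun i => a * (b * w i)) ≤ 2 * P.ω * (2 * B) :=
    (l2_mul_le a fun i => b * w i).trans (by gcongr; exact Real.sqrt_nonneg _)
  rw [e]
  linarith [l2_sub_le (fun i => b * (a * v i)) fun i => a * (b * w i)]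

theorem l2_sum_sq {ι κ : Type} [Fintype ι] [Fintype κ] (v : ι ⊕ κ → P.Rq) :
    l2 v = Real.sqrt (l2 (fun i => v (Sum.inl i)) ^ 2 + l2 (fun i => v (Sum.inr i)) ^ 2) := by
  have hn : ∀ {μ : Type} [Fintype μ] (w : μ → P.Rq), 0 ≤ ∑ i, ∑ k, ((cent (w i) k : ℤ) : ℝ) ^ 2 :=
    fun w => Finset.sum_nonneg fun _ _ => Finset.sum_nonneg fun _ _ => sq_nonneg _
  unfold l2
  rw [Real.sq_sqrt (hn _), Real.sq_sqrt (hn _), Fintype.sum_sum_type]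

/-- Both openings commit to the same `f`, so their difference lies in the kernel of `[A₃ | A₄]`.
Multiplying by both challenge differences makes it short, and these are units, so it stays nonzero.
-/
theorem msis_of_opens {t₁ t₁' t₂ t₂' : Transcript P} (h₁ : Opens pp x t₁ t₁')
    (h₂ : Opens pp x t₂ t₂') (hm1 : t₂.m1 = t₁.m1)
    (hne : ¬ (openM t₂ t₂' = openM t₁ t₁' ∧ openS t₂ t₂' = openS t₁ t₁')) :
    MSISSolution (Matrix.fromCols pp.A3 pp.A4) (msisBound P) (sisVec t₁ t₁' t₂ t₂') := by
  refine ⟨?_, ?_, ?_⟩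
  · have e : sisVec t₁ t₁' t₂ t₂' = (cbar t₁ t₁' * cbar t₂ t₂') •
        (Sum.elim (openM t₁ t₁') (openS t₁ t₁') - Sum.elim (openM t₂ t₂') (openS t₂ t₂')) := rfl
    rw [e, Matrix.mulVec_smul, Matrix.mulVec_sub, Matrix.fromCols_mulVec, Matrix.fromCols_mulVec]
    simp only [Sum.elim_comp_inl, Sum.elim_comp_inr]
    rw [h₁.commit, h₂.commit, hm1, sub_self, smul_zero]
  · refine l2_pos fun h0 => hne ?_
    have hz : ∀ i, Sum.elim (openM t₂ t₂') (openS t₂ t₂') i =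
        Sum.elim (openM t₁ t₁') (openS t₁ t₁') i := by
      intro i
      have h1 := congrFun h0 i
      have h2 : cbar t₁ t₁' * cbar t₂ t₂' * (Sum.elim (openM t₁ t₁') (openS t₁ t₁') i -
        Sum.elim (openM t₂ t₂') (openS t₂ t₂') i) = cbar t₁ t₁' * cbar t₂ t₂' * 0 := by
        rw [mul_zero]; exact h1
      exact (sub_eq_zero.1 ((h₁.unit.mul h₂.unit).mul_left_cancel h2)).symm
    exact ⟨funext fun i => hz (Sum.inl i), funext fun i => hz (Sum.inr i)⟩
  · rw [l2_sum_sq, msisBound, ← Real.sqrt_sq (show 0 ≤ 8 * (P.ω : ℝ) by positivity),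
      ← Real.sqrt_mul (sq_nonneg _)]
    apply Real.sqrt_le_sqrt
    have hc₁ := l1_cbar_le h₁.mem h₁.mem'
    have hc₂ := l1_cbar_le h₂.mem h₂.mem'
    have h1 := l2_cross_le hc₁ hc₂ h₁.l2_openM_le h₂.l2_openM_le
    have h2 := l2_cross_le hc₁ hc₂ h₁.l2_openS_le h₂.l2_openS_le
    rw [mul_add, ← mul_pow, ← mul_pow]
    gcongr
    · exact Real.sqrt_nonneg _
    · exact h1
    · exact Real.sqrt_nonneg _
    · exact h2

end Openings

/-! ### Consistency of a fixed opening -/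

section Consistency

/-- A nontrivial affine relation holds with probability at most `1/q`. -/
theorem linear_relation_prob_le (e : P.J → ZMod P.q) (he : e ≠ 0) (b : ZMod P.q) :
    ex (distD P) ({dd | ∑ j, dd j * e j + b = 0}.indicator 1) ≤ ((P.q : ℕ) : ℝ≥0∞)⁻¹ := by
  classical
  obtain ⟨j, hj⟩ := Function.ne_iff.1 he
  rw [Pi.zero_apply] at hj
  -- With all scalars but `d_j` fixed and `e_j ≠ 0`, a single value of `d_j` solves the relation.
  rw [distD, ex_iid_resample _ j]
  refine ex_le_const _ fun dd => ?_
  set a₀ : ZMod P.q := -(∑ i ∈ Finset.univ.erase j, dd i * e i + b) / e j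
  calc _ ≤ ex (PMF.uniformOfFintype (ZMod P.q)) fun a => if a = a₀ then 1 else 0 := by
        refine ex_mono _ fun a => ?_
        by_cases h : ∑ i, Function.update dd j a i * e i + b = 0
        · rw [if_pos]
          · exact Set.indicator_le_self' (by simp) _
          · rw [← Finset.add_sum_erase _ _ (Finset.mem_univ j), Function.update_self,
              Finset.sum_congr rfl fun i hi => by
                rw [Function.update_of_ne (Finset.ne_of_mem_erase hi)]] at h
            rw [eq_div_iff hj]
            linear_combination h
        · rw [Set.indicator_of_notMem (by exact h)]
          exact zero_le
    _ = _ := by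
        rw [ex_fintype]
        simp

theorem cent_sub_natAbs_le {q : ℕ} [NeZero q] (a b : ZMod q) :
    (a - b).valMinAbs.natAbs ≤ a.valMinAbs.natAbs + b.valMinAbs.natAbs := by
  have := ZMod.natAbs_valMinAbs_add_le a (-b)
  rw [← sub_eq_add_neg] at this
  refine this.trans ((Int.natAbs_add_le _ _).trans ?_)
  rw [ZMod.natAbs_valMinAbs_neg]

theorem bin1_apply_zero : bin1 0 = 2⁻¹ := by
  rw [bin1, ternary, PMF.ofFintype_apply, if_pos rfl, one_div,
    ENNReal.ofReal_inv_of_pos (by norm_num)]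
  simp

/-- A random ternary multiple of a large residue is small after an affine shift with probability at
most `1/2`. -/
theorem bin1_small_prob_le {q : ℕ} [NeZero q] (a b : ZMod q) (B : ℝ)
    (ha : 2 * B < (a.valMinAbs.natAbs : ℝ)) :
    ex bin1 ({r : SignType | (((((r : ℤ) : ZMod q) * a + b).valMinAbs.natAbs : ℕ) : ℝ) ≤ B}.indicator 1) ≤
      2⁻¹ := by
  classical
  set S : Set SignType :=
    {r : SignType | (((((r : ℤ) : ZMod q) * a + b).valMinAbs.natAbs : ℕ) : ℝ) ≤ B} with hS
  -- The values at `0` and at `±1` differ by `±a`, which is longer than `2B`, so they cannot both be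
  -- short. The events `r = 0` and `r = ±1` each have probability `1/2`.
  have hdis : ∀ r : SignType, r ≠ 0 → 0 ∈ S → r ∉ S := by
    intro r hr h0 h1
    have h0' : ((b.valMinAbs.natAbs : ℕ) : ℝ) ≤ B := by simpa [hS] using h0
    have h2 : ((((r : ℤ) : ZMod q) * a).valMinAbs.natAbs : ℝ) ≤ 2 * B := by
      have h3 := cent_sub_natAbs_le (((r : ℤ) : ZMod q) * a + b) b
      rw [add_sub_cancel_right] at h3
      have h1' : (((((r : ℤ) : ZMod q) * a + b).valMinAbs.natAbs : ℕ) : ℝ) ≤ B := h1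
      calc _ ≤ (((((r : ℤ) : ZMod q) * a + b).valMinAbs.natAbs + b.valMinAbs.natAbs : ℕ) : ℝ) := by
            exact_mod_cast h3
        _ ≤ 2 * B := by rw [Nat.cast_add]; linarith
    have h4 : (((r : ℤ) : ZMod q) * a).valMinAbs.natAbs = a.valMinAbs.natAbs := by
      cases r
      · exact absurd rfl hr
      · simp [ZMod.natAbs_valMinAbs_neg]
      · simp
    rw [h4] at h2
    linarith
  have hsum : bin1 0 + (bin1 1 + bin1 (-1)) = 1 := by
    have h := bin1.tsum_coe
    rw [tsum_fintype] at h
    have hu : (Finset.univ : Finset SignType) = {0, 1, -1} := by decide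
    rw [hu, Finset.sum_insert (by decide), Finset.sum_insert (by decide), Finset.sum_singleton] at h
    exact h
  have hhalf : bin1 1 + bin1 (-1) = 2⁻¹ := by
    rw [bin1_apply_zero] at hsum
    have h2 : (2⁻¹ : ℝ≥0∞) + 2⁻¹ = 1 := ENNReal.inv_two_add_inv_two
    rw [← h2] at hsum
    exact (ENNReal.add_right_inj (by simp)).1 hsum
  rw [ex_fintype]
  have hu : (Finset.univ : Finset SignType) = {0, 1, -1} := by decide
  rw [hu, Finset.sum_insert (by decide), Finset.sum_insert (by decide), Finset.sum_singleton]
  by_cases h0 : (0 : SignType) ∈ S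
  · rw [Set.indicator_of_mem h0, Set.indicator_of_notMem (hdis 1 (by decide) h0),
      Set.indicator_of_notMem (hdis (-1) (by decide) h0), bin1_apply_zero]
    simp
  · rw [Set.indicator_of_notMem h0, mul_zero, zero_add, ← hhalf]
    have hle : ∀ r, S.indicator (1 : SignType → ℝ≥0∞) r ≤ 1 := fun r =>
      Set.indicator_le_self' (by simp) _
    gcongr
    · exact mul_le_of_le_one_right' (hle 1)
    · exact mul_le_of_le_one_right' (hle (-1))

/-- One row of a random projection of a vector with a large coefficient. -/
theorem row_small_prob_le (l : Fin 2 → P.Rq) (b : ZMod P.q) {B : ℝ} (i : Fin 2) (k : Fin P.d)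
    (hl : 2 * B < ((cent (l i) k).natAbs : ℝ)) :
    ex (iid (Fin 2) (iid (Fin P.d) bin1))
      ({r | (((∑ i, ∑ k, ((r i k : ℤ) : ZMod P.q) * coeff (l i) k + b).valMinAbs.natAbs : ℕ) : ℝ) ≤
        B}.indicator 1) ≤ 2⁻¹ := by
  classical
  rw [ex_iid_resample _ i]
  refine ex_le_const _ fun r => ?_
  rw [ex_iid_resample _ k]
  refine ex_le_const _ fun s => ?_
  -- All entries except the one meeting the large coefficient are frozen and moved into the affine
  -- shift.
  set b' : ZMod P.q := (∑ k' ∈ Finset.univ.erase k, ((s k' : ℤ) : ZMod P.q) * coeff (l i) k') +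
    (∑ i' ∈ Finset.univ.erase i, ∑ k', ((r i' k' : ℤ) : ZMod P.q) * coeff (l i') k') + b
  refine le_trans (le_of_eq ?_) (bin1_small_prob_le (coeff (l i) k) b' B hl)
  congr 1
  ext a
  have e : ∑ i', ∑ k', (((Function.update r i (Function.update s k a) i' k' : SignType) : ℤ) :
      ZMod P.q) * coeff (l i') k' + b = ((a : ℤ) : ZMod P.q) * coeff (l i) k + b' := by
    have e1 : ∀ i' ∈ Finset.univ.erase i,
        ∑ k', (((Function.update r i (Function.update s k a) i' k' : SignType) : ℤ) : ZMod P.q) *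
          coeff (l i') k' = ∑ k', ((r i' k' : ℤ) : ZMod P.q) * coeff (l i') k' := fun i' hi' => by
      rw [Function.update_of_ne (Finset.ne_of_mem_erase hi')]
    have e2 : ∀ k' ∈ Finset.univ.erase k,
        (((Function.update s k a k' : SignType) : ℤ) : ZMod P.q) * coeff (l i) k' =
          ((s k' : ℤ) : ZMod P.q) * coeff (l i) k' := fun k' hk' => by
      rw [Function.update_of_ne (Finset.ne_of_mem_erase hk')]
    rw [← Finset.add_sum_erase _ _ (Finset.mem_univ i), Function.update_self,
      Finset.sum_congr rfl e1, ← Finset.add_sum_erase _ _ (Finset.mem_univ k),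
      Function.update_self, Finset.sum_congr rfl e2]
    simp only [b']
    ring
  simp only [Set.indicator_apply, Set.mem_ofPred_eq, e, Pi.one_apply]

theorem exists_lt_of_lt_linf {ι : Type} [Fintype ι] {v : ι → P.Rq} {B : ℝ} (hB : 0 ≤ B)
    (h : B < linf v) : ∃ i k, B < ((cent (v i) k).natAbs : ℝ) := by
  by_contra! h2
  have : linf v ≤ ⌊B⌋₊ := Finset.sup_le fun p _ => Nat.le_floor (h2 p.1 p.2)
  have h3 : (linf v : ℝ) ≤ B := le_trans (by exact_mod_cast this) (Nat.floor_le hB)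
  linarith

theorem natAbs_cent_le_linf {ι : Type} [Fintype ι] (v : ι → P.Rq) (i : ι) (k : Fin P.d) :
    (cent (v i) k).natAbs ≤ linf v :=
  Finset.le_sup (f := fun p : ι × Fin P.d => (cent (v p.1) p.2).natAbs) (Finset.mem_univ (i, k))

/-- An opening whose decryption is not short is consistent with the further messages of a prover
with probability at most `1/q + 2⁻²⁵⁶`. -/
theorem consistent_prob_le (x : Stmt P) (m : P.MIdx → P.Rq) (y : P.E → P.Rq) (b : ZMod P.q)
    (z : ChR P → P.E → P.Rq) (hm : ¬ (linf (x.ell m) : ℝ) ≤ 2 * P.bound3) :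
    ex (distR P) (fun R => ex (distD P) ({dd | (linf (z R) : ℝ) ≤ P.bound3 ∧
      ∑ j, dd j * projErr x R m y (z R) j + b = 0}.indicator 1)) ≤
      ((P.q : ℕ) : ℝ≥0∞)⁻¹ + (2 ^ 256)⁻¹ := by
  classical
  have hB3 : 0 ≤ P.bound3 := by
    rw [bound3_eq]; have := P.s3_pos; positivity
  obtain ⟨i, k, hik⟩ := exists_lt_of_lt_linf (by positivity) (not_le.1 hm)
  set T : P.J → Set (Fin 2 → Fin P.d → SignType) := fun j =>
    {r | (((∑ i, ∑ k, ((r i k : ℤ) : ZMod P.q) * coeff (x.ell m i) k +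
      coeff (y j.1) j.2).valMinAbs.natAbs : ℕ) : ℝ) ≤ P.bound3}
  have h1 : ∀ R : ChR P, ex (distD P) ({dd | (linf (z R) : ℝ) ≤ P.bound3 ∧
      ∑ j, dd j * projErr x R m y (z R) j + b = 0}.indicator 1) ≤
      ((P.q : ℕ) : ℝ≥0∞)⁻¹ + ∏ j, (T j).indicator 1 (R j) := by
    intro R
    -- If all errors vanish and `z₃` is short, then every one of the `256` rows of `Rℓ + y` is
    -- short, an event about `R` alone because `m` and `y` are fixed. Otherwise the relation in `d`
    -- is nontrivial.
    by_cases he : projErr x R m y (z R) = 0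
    · refine le_trans ?_ le_add_self
      by_cases hz : (linf (z R) : ℝ) ≤ P.bound3
      · have hT : ∀ j, R j ∈ T j := by
          intro j
          have h2 := congrFun he j
          rw [projErr, Pi.zero_apply, sub_eq_zero] at h2
          change ((ZMod.valMinAbs _).natAbs : ℝ) ≤ _
          rw [h2]
          refine le_trans ?_ hz
          exact_mod_cast natAbs_cent_le_linf (z R) j.1 j.2
        rw [Finset.prod_congr rfl fun j _ => Set.indicator_of_mem (hT j) 1]
        simp only [Pi.one_apply, Finset.prod_const_one]
        exact ex_indicator_le_one _ _
      · refine ex_le_const _ fun dd => ?_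
        rw [Set.indicator_of_notMem (fun h => hz h.1)]
        exact zero_le
    · refine le_trans ?_ le_self_add
      refine le_trans (ex_mono _ fun dd => ?_) (linear_relation_prob_le _ he b)
      by_cases h3 : (linf (z R) : ℝ) ≤ P.bound3 ∧ ∑ j, dd j * projErr x R m y (z R) j + b = 0
      · rw [Set.indicator_of_mem (by exact h3), Set.indicator_of_mem (by exact h3.2)]
      · rw [Set.indicator_of_notMem (by exact h3)]
        exact zero_le
  refine (ex_mono _ h1).trans ?_
  rw [ex_add, ex_const, distR, ex_iid_prod _ fun j => (T j).indicator 1]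
  gcongr
  refine (Finset.prod_le_prod' fun j _ =>
    row_small_prob_le (x.ell m) (coeff (y j.1) j.2) i k hik).trans ?_
  rw [Finset.prod_const, Finset.card_univ, card_J, ENNReal.inv_pow]

end Consistency

end

section

/-! ### Rewinding: obtaining a good opening or two different openings. -/

section Forking

open Classical in
/-- The indicator of a proposition. -/
def ind (p : Prop) : ℝ≥0∞ := if p then 1 else 0

theorem ind_true {p : Prop} (h : p) : ind p = 1 := if_pos h

theorem ind_false {p : Prop} (h : ¬ p) : ind p = 0 := if_neg h

theorem ind_le_one (p : Prop) : ind p ≤ 1 := by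
  by_cases h : p <;> simp [ind, h]

theorem ind_mono {p q : Prop} (h : p → q) : ind p ≤ ind q := by
  by_cases hp : p
  · rw [ind_true hp, ind_true (h hp)]
  · rw [ind_false hp]; exact zero_le

theorem ind_and (p q : Prop) : ind (p ∧ q) = ind p * ind q := by
  by_cases hp : p <;> by_cases hq : q <;> simp [ind, hp, hq]

theorem ind_le_add {p q r : Prop} (h : p → q ∨ r) : ind p ≤ ind q + ind r := by
  by_cases hp : p
  · rcases h hp with h | h
    · rw [ind_true h]; exact (ind_le_one _).trans le_self_add
    · rw [ind_true h]; exact (ind_le_one _).trans le_add_self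
  · rw [ind_false hp]; exact zero_le

theorem indicator_one_eq_ind {α : Type} (E : Set α) (a : α) :
    E.indicator (1 : α → ℝ≥0∞) a = ind (a ∈ E) := by
  by_cases h : a ∈ E <;> simp [ind, h]

theorem Pr_eq_ex_ind {α : Type} (μ : PMF α) (E : Set α) :
    Pr μ E = (ex μ fun a => ind (a ∈ E)).toReal := by
  rw [Pr_eq_ex, show E.indicator 1 = fun a => ind (a ∈ E) from funext (indicator_one_eq_ind E)]

variable {Ω C W : Type} {ρ : PMF Ω} {τ : PMF C} {V : Ω → C → Prop} {U : C → C → Prop} {κ₀ η : ℝ≥0∞}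

/-- Two independent executions from the same point both succeed with related challenges. -/
theorem ex_pair_ge (hU : ∀ c, ex τ (fun c' => ind (¬ U c c')) ≤ κ₀) (ω : Ω) :
    ex τ (fun c => ind (V ω c)) * (ex τ (fun c => ind (V ω c)) - κ₀) ≤
      ex τ fun c => ex τ fun c' => ind (V ω c ∧ V ω c' ∧ U c c') := by
  rw [← ex_mul_right]
  refine ex_mono _ fun c => ?_
  by_cases hc : V ω c
  -- Given success at `c`, an independent `c'` succeeds and is related to `c` except when it fails
  -- or is unrelated, and the latter has probability at most `κ₀`.
  · rw [ind_true hc, one_mul, tsub_le_iff_right]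
    refine le_trans ?_ (add_le_add_right (hU c) _)
    rw [← ex_add]
    refine ex_mono _ fun c' => ind_le_add fun h => ?_
    by_cases h' : U c c'
    · exact Or.inl ⟨hc, h, h'⟩
    · exact Or.inr h'
  · rw [ind_false hc, zero_mul]
    exact zero_le

theorem ex_pair_ge_sq (hU : ∀ c, ex τ (fun c' => ind (¬ U c c')) ≤ κ₀) (ω : Ω) :
    (ex τ (fun c => ind (V ω c)) - κ₀) ^ 2 ≤
      ex τ fun c => ex τ fun c' => ind (V ω c ∧ V ω c' ∧ U c c') := by
  refine le_trans ?_ (ex_pair_ge hU ω)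
  rw [sq]
  gcongr
  exact tsub_le_self

/-- If every pair of executions at `ω` that succeeds with related challenges yields some `w` with
`ω ∈ G w`, then two independent pairs yield a good `w` or two different ones. -/
theorem forking {w : Ω → C → C → W} {Good : W → Prop} {G : W → Set Ω}
    (hU : ∀ c, ex τ (fun c' => ind (¬ U c c')) ≤ κ₀)
    (hG : ∀ ω c c', V ω c → V ω c' → U c c' → ω ∈ G (w ω c c'))
    (hη : ∀ v, ¬ Good v → ex ρ (fun ω => ind (ω ∈ G v)) ≤ η) :
    (ex ρ (fun ω => ex τ fun c => ind (V ω c)) - (κ₀ + η)) ^ 4 ≤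
      ex ρ fun ω => ex τ fun c => ex τ fun c' => ex ρ fun ω₂ => ex τ fun c₂ => ex τ fun c₂' =>
        ind ((V ω c ∧ V ω c' ∧ U c c') ∧ (Good (w ω c c') ∨
          ((V ω₂ c₂ ∧ V ω₂ c₂' ∧ U c₂ c₂') ∧ w ω₂ c₂ c₂' ≠ w ω c c'))) := by
  set a : Ω → ℝ≥0∞ := fun ω => ex τ fun c => ind (V ω c) with ha
  set γ := ex ρ a - (κ₀ + η) with hγ
  have hγ1 : γ ^ 2 ≤ 1 := by
    refine pow_le_one₀ zero_le (tsub_le_self.trans ?_)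
    exact ex_le_const _ fun ω => ex_le_const _ fun c => ind_le_one _
  -- The bound is proved for a fixed `v`, before any pair is drawn; independence of the second pair
  -- later allows `v` to be the result of the first.
  have hsecond : ∀ v, γ ^ 2 ≤ ex ρ fun ω₂ => ex τ fun c₂ => ex τ fun c₂' =>
      ind (Good v ∨ ((V ω₂ c₂ ∧ V ω₂ c₂' ∧ U c₂ c₂') ∧ w ω₂ c₂ c₂' ≠ v)) := by
    intro v
    by_cases hv : Good v
    · refine hγ1.trans (le_ex_const _ fun _ => le_ex_const _ fun _ => le_ex_const _ fun _ => ?_)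
      rw [ind_true (Or.inl hv)]
    -- Discarding the points of `G v` loses at most `η`, since a bad `v` is consistent with few
    -- points.
    · have h1 : γ ≤ ex ρ fun ω => ind (ω ∉ G v) * (a ω - κ₀) := by
        rw [hγ, ← tsub_tsub]
        refine (tsub_le_tsub_right (ex_tsub ρ a κ₀) η).trans ?_
        rw [tsub_le_iff_right]
        refine le_trans ?_ (add_le_add_right (hη v hv) _)
        rw [← ex_add]
        refine ex_mono _ fun ω => ?_
        by_cases h : ω ∈ G v
        · rw [ind_true h]
          refine le_trans (tsub_le_self.trans ?_) le_add_self
          exact ex_le_const _ fun c => ind_le_one _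
        · rw [ind_true (p := ω ∉ G v) h, one_mul]
          exact le_self_add
      refine (pow_le_pow_left₀ zero_le h1 2).trans ((ex_pow_two _ _).trans (ex_mono _ fun ω => ?_))
      by_cases h : ω ∈ G v
      · rw [ind_false (p := ω ∉ G v) (not_not.2 h), zero_mul, zero_pow two_ne_zero]
        exact zero_le
      · rw [ind_true (p := ω ∉ G v) h, one_mul]
        refine (ex_pair_ge_sq hU ω).trans (ex_mono _ fun c => ex_mono _ fun c' => ind_mono ?_)
        -- Off `G v`, a successful pair cannot yield `v`: its own result always puts the point into
        -- the corresponding set.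
        intro hc
        refine Or.inr ⟨hc, fun he => h ?_⟩
        rw [← he]
        exact hG ω c c' hc.1 hc.2.1 hc.2.2
  have hfirst : γ ^ 2 ≤ ex ρ fun ω => ex τ fun c => ex τ fun c' =>
      ind (V ω c ∧ V ω c' ∧ U c c') := by
    have h1 : γ ≤ ex ρ fun ω => a ω - κ₀ :=
      (tsub_le_tsub_left le_self_add _).trans (ex_tsub ρ a κ₀)
    exact (pow_le_pow_left₀ zero_le h1 2).trans ((ex_pow_two _ _).trans
      (ex_mono _ fun ω => ex_pair_ge_sq hU ω))
  -- One factor `γ²` per pair; `hsecond` is applied with the result of the first pair.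
  calc γ ^ 4 = γ ^ 2 * γ ^ 2 := by ring
    _ ≤ (ex ρ fun ω => ex τ fun c => ex τ fun c' => ind (V ω c ∧ V ω c' ∧ U c c')) * γ ^ 2 := by
        gcongr
    _ ≤ _ := by
        simp_rw [← ex_mul_right, ind_and (_ ∧ _ ∧ _), ex_mul_left]
        refine ex_mono _ fun ω => ex_mono _ fun c => ex_mono _ fun c' => ?_
        gcongr
        exact hsecond (w ω c c')

end Forking

/-! ### From acceptance probability to extraction probability. -/

section Soundness

variable {P : Params} {pp : PP P} {x : Stmt P}

/-- The outputs computed from two pairs of transcripts contain a witness or a Module-SIS solution. -/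
def PairsExtract (pp : PP P) (x : Stmt P) (t₁ t₁' t₂ t₂' : Transcript P) : Prop :=
  RelPoE pp x t₁.m1.f (cbar t₁ t₁') (openM t₁ t₁') (openS t₁ t₁') ∨
  MSISSolution (Matrix.fromCols pp.A3 pp.A4) (msisBound P) (sisVec t₁ t₁' t₂ t₂')

/-- The expectation over two pairs of executions, each with common first two challenges. -/
def exPairs (A : Strategy P) (F : Transcript P → Transcript P → Transcript P → Transcript P → ℝ≥0∞) :
    ℝ≥0∞ :=
  ex (distR P) fun R => ex (distD P) fun dd => ex P.chal fun c => ex P.chal fun c' =>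
    ex (distR P) fun R₂ => ex (distD P) fun dd₂ => ex P.chal fun c₂ => ex P.chal fun c₂' =>
      F (A.transcript R dd c) (A.transcript R dd c') (A.transcript R₂ dd₂ c₂)
        (A.transcript R₂ dd₂ c₂')

/-- For a deterministic prover the first message is fixed, so `forking` applies with the first two
challenges `(R, d)` as the point, the extracted opening as the result, and short decryption as
goodness. The set attached to an opening consists of the challenges consistent with it. -/
theorem exPairs_ge {K : ℝ} (hK : P.NearUniform K) (A : Strategy P) :
    (ex (distR P) (fun R => ex (distD P) fun dd => ex P.chal fun c =>
        ind (Accepts pp x (A.transcript R dd c))) -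
      (ENNReal.ofReal (K * (P.l / (P.q : ℝ) ^ (P.d / P.l))) +
        (((P.q : ℕ) : ℝ≥0∞)⁻¹ + (2 ^ 256)⁻¹))) ^ 4 ≤
      exPairs A fun t₁ t₁' t₂ t₂' => ind (PairsExtract pp x t₁ t₁' t₂ t₂') := by
  set ρ : PMF (ChR P × ChD P) := (distR P).bind fun R => (distD P).map (Prod.mk R) with hρ
  have exρ : ∀ f, ex ρ f = ex (distR P) fun R => ex (distD P) fun dd => f (R, dd) := by
    intro f; rw [hρ, ex_bind]; simp only [ex_map]
  set V : ChR P × ChD P → ChC P → Prop := fun ω c =>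
    Accepts pp x (A.transcript ω.1 ω.2 c) ∧ c ∈ P.chalSet
  set U : ChC P → ChC P → Prop := fun c c' =>
    IsUnit (tern (ZMod P.q) c - tern (ZMod P.q) c' : P.Rq)
  set w : ChR P × ChD P → ChC P → ChC P → (P.MIdx → P.Rq) × (Fin P.n → P.Rq) := fun ω c c' =>
    (openM (A.transcript ω.1 ω.2 c) (A.transcript ω.1 ω.2 c'),
      openS (A.transcript ω.1 ω.2 c) (A.transcript ω.1 ω.2 c'))
  have hopens : ∀ ω c c', V ω c → V ω c' → U c c' →
      Opens pp x (A.transcript ω.1 ω.2 c) (A.transcript ω.1 ω.2 c') := fun ω c c' h h' hu =>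
    ⟨h.1, h'.1, h.2, h'.2, hu, rfl, rfl, rfl, rfl, rfl⟩
  have key := forking (ρ := ρ) (τ := P.chal) (V := V) (U := U) (w := w)
    (Good := fun v => (linf (x.ell v.1) : ℝ) ≤ 2 * P.bound3)
    (G := fun v => {ω | (linf (A.m2 ω.1) : ℝ) ≤ P.bound3 ∧
      ∑ j, ω.2 j * projErr x ω.1 v.1 (A.m1.u1 - pp.B1 *ᵥ v.2) (A.m2 ω.1) j +
        coeff (A.m1.u2 - pp.B2 ⬝ᵥ v.2) 0 = 0})
    (κ₀ := ENNReal.ofReal (K * (P.l / (P.q : ℝ) ^ (P.d / P.l))))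
    (η := ((P.q : ℕ) : ℝ≥0∞)⁻¹ + (2 ^ 256)⁻¹)
    (not_isUnit_prob_le P hK)
    (fun ω c c' h h' hu => ⟨h.1.2.2.1, (hopens ω c c' h h' hu).coeff_relation⟩)
    (fun v hv => by
      refine le_trans (le_of_eq ?_) (consistent_prob_le x v.1 (A.m1.u1 - pp.B1 *ᵥ v.2)
        (coeff (A.m1.u2 - pp.B2 ⬝ᵥ v.2) 0) A.m2 hv)
      simp only [exρ]
      rfl)
  simp only [exρ] at key
  refine le_trans ?_ (key.trans ?_)
  · gcongr
    refine ex_mono _ fun R => ex_mono _ fun dd => ex_mono_support _ fun c hc => ind_mono fun h => ?_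
    exact ⟨h, mem_chalSet_of_mem_support hc⟩
  · refine ex_mono _ fun R => ex_mono _ fun dd => ex_mono _ fun c => ex_mono _ fun c' =>
      ex_mono _ fun R₂ => ex_mono _ fun dd₂ => ex_mono _ fun c₂ => ex_mono _ fun c₂' =>
      ind_mono ?_
    rintro ⟨⟨h, h', hu⟩, hl | ⟨⟨h₂, h₂', hu₂⟩, hne⟩⟩
    · exact Or.inl ((hopens _ c c' h h' hu).relPoE hl)
    · refine Or.inr (msis_of_opens (hopens _ c c' h h' hu) (hopens _ c₂ c₂' h₂ h₂' hu₂) rfl ?_)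
      rintro ⟨e1, e2⟩
      exact hne (Prod.ext e1 e2)

/-- The bound `nttBound` is positive even without cancellation estimates, so a negative `K` is
impossible. This makes `ENNReal.ofReal` of the unit error faithful. -/
theorem Params.NearUniform.nonneg {K : ℝ} (hK : P.NearUniform K) : 0 ≤ K := by
  by_contra! h
  have hq : (0 : ℝ) < P.q := by exact_mod_cast P.q_prime.pos
  have hM : 0 < P.nttBound := by unfold Params.nttBound; positivity
  have h1 : 0 < P.nttBound ^ (P.d / P.l) := by positivity
  have h2 : K / (P.q : ℝ) ^ (P.d / P.l) * Pr P.chalCoeffs P.chalSet ≤ 0 :=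
    mul_nonpos_of_nonpos_of_nonneg (div_nonpos_of_nonpos_of_nonneg h.le (by positivity))
      ENNReal.toReal_nonneg
  exact absurd hK (not_le.2 (h2.trans_lt h1))

/-- An extractor whose success indicator dominates that of the two pairs of executions. -/
theorem accept_sub_pow_le {K : ℝ} (hK : P.NearUniform K) (A : PMF (Strategy P))
    {S : Strategy P → ℝ≥0∞}
    (hS : ∀ A, exPairs A (fun t₁ t₁' t₂ t₂' => ind (PairsExtract pp x t₁ t₁' t₂ t₂')) ≤ S A)
    (hS1 : ∀ A, S A ≤ 1)
    (h : K * (P.l / (P.q : ℝ) ^ (P.d / P.l)) + 1 / P.q + 1 / 2 ^ 256 < acceptProb pp x A) :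
    (acceptProb pp x A - (K * (P.l / (P.q : ℝ) ^ (P.d / P.l)) + 1 / P.q + 1 / 2 ^ 256)) ^ 4 ≤
      (ex A S).toReal := by
  set a : Strategy P → ℝ≥0∞ := fun A => ex (distR P) fun R => ex (distD P) fun dd =>
    ex P.chal fun c => ind (Accepts pp x (A.transcript R dd c))
  set err : ℝ≥0∞ := ENNReal.ofReal (K * (P.l / (P.q : ℝ) ^ (P.d / P.l))) +
        (((P.q : ℕ) : ℝ≥0∞)⁻¹ + (2 ^ 256)⁻¹) with herr
  have hacc : acceptProb pp x A = (ex A a).toReal := by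
    rw [acceptProb, Pr_eq_ex_ind, interact]
    simp only [ex_bind', ex_pure']
    rfl
  have hA1 : ex A a ≤ 1 := ex_le_const _ fun A => ex_le_const _ fun R => ex_le_const _ fun dd =>
    ex_le_const _ fun c => ind_le_one _
  -- The prover's coins are averaged last: truncated subtraction and the fourth power are both
  -- convex.
  have hmain : (ex A a - err) ^ 4 ≤ ex A S := by
    refine (pow_le_pow_left₀ zero_le (ex_tsub A a err) 4).trans
      ((ex_pow_four _ _).trans (ex_mono _ fun A => (exPairs_ge hK A).trans (hS A)))
  have hK0 : 0 ≤ K * (P.l / (P.q : ℝ) ^ (P.d / P.l)) :=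
    mul_nonneg hK.nonneg (by positivity)
  have hq : (P.q : ℝ≥0∞) ≠ 0 := by exact_mod_cast P.q_prime.ne_zero
  have herrR : err.toReal = K * (P.l / (P.q : ℝ) ^ (P.d / P.l)) + 1 / P.q + 1 / 2 ^ 256 := by
    rw [herr, ENNReal.toReal_add (by simp) (by finiteness), ENNReal.toReal_add (by finiteness) (by simp),
      ENNReal.toReal_ofReal hK0, ENNReal.toReal_inv, ENNReal.toReal_inv]
    simp [add_assoc]
  have hlt : err ≤ ex A a := by
    rw [← ENNReal.toReal_le_toReal (by finiteness) (hA1.trans_lt ENNReal.one_lt_top).ne, herrR, ← hacc]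
    exact h.le
  have h2 := ENNReal.toReal_mono ((ex_le_const _ hS1).trans_lt ENNReal.one_lt_top).ne hmain
  rwa [ENNReal.toReal_pow, ENNReal.toReal_sub_of_le hlt (hA1.trans_lt ENNReal.one_lt_top).ne,
    herrR, ← hacc] at h2

end Soundness

end

section

/-! ### Compiling ring computations and sampling into straight-line programs. -/

section Programs

variable {P : Params} {ι V : Type}

theorem runList_append {I S : Type} (step : I → S → PMF S) (l₁ l₂ : List I) (s : S) :
    runList step (l₁ ++ l₂) s = (runList step l₁ s).bind (runList step l₂) := by
  induction l₁ generalizing s with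
  | nil => simp [runList]
  | cons i l ih =>
    simp only [List.cons_append, runList, PMF.bind_bind]
    congr 1
    exact funext fun s' => ih s'

theorem runList_singleton {I S : Type} (step : I → S → PMF S) (i : I) (s : S) :
    runList step [i] s = step i s := by
  change (step i s).bind PMF.pure = _
  exact PMF.bind_pure _

/-- Registers of interest, and temporary registers disjoint from them. -/
structure Layout (V ι : Type) where
  reg : V → ι
  tmp : ℕ → ι
  reg_inj : Function.Injective reg
  tmp_inj : Function.Injective tmp
  disj : ∀ v n, reg v ≠ tmp n

/-- `f` is computed from the registers of interest into any given temporary register, by at most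
`B ^ a` instructions that change only this and later temporary registers. -/
def Comp (L : Layout V ι) (B : ℕ) (f : (V → P.Rq) → P.Rq) (a : ℕ) : Prop :=
  ∀ n, ∃ C : List (Instr P ι), C.length ≤ B ^ a ∧ ∀ st, ∃ st',
    runList Instr.run C st = PMF.pure st' ∧
    (∀ r, (∀ k, n ≤ k → r ≠ L.tmp k) → st' r = st r) ∧ st' (L.tmp n) = f (st ∘ L.reg)

variable {L : Layout V ι} {B : ℕ} {f g : (V → P.Rq) → P.Rq} {a b : ℕ}

theorem Comp.mono (hB : 4 ≤ B) (h : Comp L B f a) (hab : a ≤ b) : Comp L B f b := fun n => by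
  obtain ⟨C, hC, h⟩ := h n
  exact ⟨C, hC.trans (Nat.pow_le_pow_right (by omega) hab), h⟩

theorem Comp.congr (h : Comp L B f a) (hfg : ∀ s, f s = g s) : Comp L B g a := by
  rwa [← funext hfg]

open Classical in
theorem Comp.const (c : P.Rq) : Comp L B (fun _ => c) 0 := fun n => by
  refine ⟨[.const (L.tmp n) c], by simp, fun st => ⟨_, runList_singleton _ _ _, ?_, ?_⟩⟩
  · intro r hr
    exact Function.update_of_ne (hr n le_rfl) _ _
  · simp

/-- A copy takes two instructions: clear the target, then add the source. -/
theorem Comp.reg (hB : 4 ≤ B) (v : V) : Comp (P := P) L B (fun s => s v) 1 := fun n => by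
  classical
  refine ⟨[.const (L.tmp n) 0, .add (L.tmp n) (L.tmp n) (L.reg v)], by simp; omega, fun st => ?_⟩
  refine ⟨Function.update st (L.tmp n) (st (L.reg v)), ?_, ?_, ?_⟩
  · simp only [runList, Instr.run, PMF.pure_bind, Function.update_self,
      Function.update_of_ne (L.disj v n), zero_add]
    congr 1
    ext r
    by_cases h : r = L.tmp n <;> simp [h]
  · intro r hr
    exact Function.update_of_ne (hr n le_rfl) _ _
  · simp

theorem Comp.unary (hB : 4 ≤ B) {φ : P.Rq → P.Rq} (op : ι → ι → Instr P ι)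
    (hop : ∀ r x st, ∃ st', (op r x).run st = PMF.pure st' ∧ (∀ r', r' ≠ r → st' r' = st r') ∧
      st' r = φ (st x)) (h : Comp L B f a) : Comp L B (fun s => φ (f s)) (a + 1) := fun n => by
  obtain ⟨C, hC, h⟩ := h n
  have hB' : 1 ≤ B ^ a := Nat.one_le_pow _ _ (by omega)
  refine ⟨C ++ [op (L.tmp n) (L.tmp n)], ?_, fun st => ?_⟩
  · rw [List.length_append, List.length_singleton, pow_succ]
    nlinarith
  · obtain ⟨st₁, h1, h2, h3⟩ := h st
    obtain ⟨st₂, h4, h5, h6⟩ := hop (L.tmp n) (L.tmp n) st₁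
    refine ⟨st₂, ?_, fun r hr => ?_, ?_⟩
    · rw [runList_append, h1, PMF.pure_bind, runList_singleton, h4]
    · rw [h5 r (hr n le_rfl), h2 r hr]
    · rw [h6, h3]

/-- The second operand is computed from scratch register `n + 1` upwards, so it leaves the first
operand in register `n` untouched. Since `4 ≤ B`, one more exponent pays for both computations and
the operation. -/
theorem Comp.binary (hB : 4 ≤ B) {φ : P.Rq → P.Rq → P.Rq} (op : ι → ι → ι → Instr P ι)
    (hop : ∀ r x y st, ∃ st', (op r x y).run st = PMF.pure st' ∧
      (∀ r', r' ≠ r → st' r' = st r') ∧ st' r = φ (st x) (st y))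
    (hf : Comp L B f a) (hg : Comp L B g b) :
    Comp L B (fun s => φ (f s) (g s)) (max a b + 1) := fun n => by
  obtain ⟨C, hC, h⟩ := (hf.mono hB (le_max_left a b)) n
  obtain ⟨C', hC', h'⟩ := (hg.mono hB (le_max_right a b)) (n + 1)
  have hB' : 1 ≤ B ^ max a b := Nat.one_le_pow _ _ (by omega)
  refine ⟨C ++ (C' ++ [op (L.tmp n) (L.tmp n) (L.tmp (n + 1))]), ?_, fun st => ?_⟩
  · rw [List.length_append, List.length_append, List.length_singleton, pow_succ]
    nlinarith
  · obtain ⟨st₁, h1, h2, h3⟩ := h st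
    obtain ⟨st₂, h4, h5, h6⟩ := h' st₁
    obtain ⟨st₃, h7, h8, h9⟩ := hop (L.tmp n) (L.tmp n) (L.tmp (n + 1)) st₂
    refine ⟨st₃, ?_, fun r hr => ?_, ?_⟩
    · rw [runList_append, h1, PMF.pure_bind, runList_append, h4, PMF.pure_bind,
        runList_singleton, h7]
    · rw [h8 r (hr n le_rfl), h5 r fun k hk => hr k (by omega), h2 r hr]
    · have e : st₁ ∘ L.reg = st ∘ L.reg := funext fun v => h2 _ fun k _ => L.disj v k
      rw [h9, h6, e, h5 _ fun k hk he => by have := L.tmp_inj he; omega, h3]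

open Classical in
theorem Comp.add (hB : 4 ≤ B) (hf : Comp L B f a) (hg : Comp L B g b) :
    Comp L B (fun s => f s + g s) (max a b + 1) :=
  Comp.binary hB (φ := (· + ·)) .add (fun _ _ _ _ => ⟨_, rfl,
    fun _ h => Function.update_of_ne h _ _, Function.update_self _ _ _⟩) hf hg

open Classical in
theorem Comp.mul (hB : 4 ≤ B) (hf : Comp L B f a) (hg : Comp L B g b) :
    Comp L B (fun s => f s * g s) (max a b + 1) :=
  Comp.binary hB (φ := (· * ·)) .mul (fun _ _ _ _ => ⟨_, rfl,
    fun _ h => Function.update_of_ne h _ _, Function.update_self _ _ _⟩) hf hg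

open Classical in
theorem Comp.inv (hB : 4 ≤ B) (hf : Comp L B f a) :
    Comp L B (fun s => Ring.inverse (f s)) (a + 1) :=
  Comp.unary hB (φ := Ring.inverse) .inv (fun _ _ _ => ⟨_, rfl,
    fun _ h => Function.update_of_ne h _ _, Function.update_self _ _ _⟩) hf

open Classical in
theorem Comp.conj (hB : 4 ≤ B) (hf : Comp L B f a) :
    Comp L B (fun s => PoE.conj (f s)) (a + 1) :=
  Comp.unary hB (φ := PoE.conj) .conj (fun _ _ _ => ⟨_, rfl,
    fun _ h => Function.update_of_ne h _ _, Function.update_self _ _ _⟩) hf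

open Classical in
theorem Comp.coeff (hB : 4 ≤ B) (k : Fin P.d) (hf : Comp L B f a) :
    Comp L B (fun s => AdjoinRoot.of _ (PoE.coeff (f s) k)) (a + 1) :=
  Comp.unary hB (φ := fun y => AdjoinRoot.of _ (PoE.coeff y k)) (fun r x => .coeff r x k)
    (fun _ _ _ => ⟨_, rfl, fun _ h => Function.update_of_ne h _ _, Function.update_self _ _ _⟩) hf

theorem Comp.neg (hB : 4 ≤ B) (hf : Comp L B f a) : Comp L B (fun s => -f s) (a + 1) :=
  ((Comp.mul hB (Comp.const (-1)) hf).congr fun _ => neg_one_mul _).mono hB (by simp)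

theorem Comp.sub (hB : 4 ≤ B) (hf : Comp L B f a) (hg : Comp L B g b) :
    Comp L B (fun s => f s - g s) (max a b + 2) :=
  ((Comp.add hB hf (Comp.neg hB hg)).congr fun _ => (sub_eq_add_neg _ _).symm).mono hB (by omega)

-- The accumulator stays in scratch register `n`, and all summands reuse the registers above it.
-- Sums thus cost linearly many instructions, without nesting `Comp.add`.
open Classical in
theorem Comp.listSum {κ : Type} {f : κ → (V → P.Rq) → P.Rq}
    (hf : ∀ i, Comp L B (f i) a) (l : List κ) (n : ℕ) :
    ∃ C : List (Instr P ι), C.length ≤ l.length * (B ^ a + 1) + 1 ∧ ∀ st, ∃ st',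
      runList Instr.run C st = PMF.pure st' ∧
      (∀ r, (∀ k, n ≤ k → r ≠ L.tmp k) → st' r = st r) ∧
      st' (L.tmp n) = (l.map fun i => f i (st ∘ L.reg)).sum := by
  induction l with
  | nil =>
    obtain ⟨C, hC, h⟩ := Comp.const (L := L) (B := B) (0 : P.Rq) n
    exact ⟨C, by simpa using hC, h⟩
  | cons i l ih =>
    obtain ⟨C, hC, h⟩ := ih
    obtain ⟨C', hC', h'⟩ := hf i (n + 1)
    refine ⟨C ++ (C' ++ [.add (L.tmp n) (L.tmp n) (L.tmp (n + 1))]), ?_, fun st => ?_⟩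
    · simp only [List.length_append, List.length_cons, List.length_nil]
      nlinarith
    · obtain ⟨st₁, h1, h2, h3⟩ := h st
      obtain ⟨st₂, h4, h5, h6⟩ := h' st₁
      refine ⟨Function.update st₂ (L.tmp n) (st₂ (L.tmp n) + st₂ (L.tmp (n + 1))), ?_,
        fun r hr => ?_, ?_⟩
      · rw [runList_append, h1, PMF.pure_bind, runList_append, h4, PMF.pure_bind,
          runList_singleton]
        rfl
      · rw [Function.update_of_ne (hr n le_rfl), h5 r fun k hk => hr k (by omega), h2 r hr]
      · have e : st₁ ∘ L.reg = st ∘ L.reg := funext fun v => h2 _ fun k _ => L.disj v k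
        rw [Function.update_self, h6, e, h5 _ fun k hk he => by have := L.tmp_inj he; omega, h3,
          List.map_cons, List.sum_cons, add_comm]

/-- One extra power of `B` counts the summands and another absorbs the constants. -/
theorem Comp.sum (hB : 4 ≤ B) {κ : Type} [Fintype κ] (hκ : Fintype.card κ ≤ B)
    {f : κ → (V → P.Rq) → P.Rq} (hf : ∀ i, Comp L B (f i) a) :
    Comp L B (fun s => ∑ i, f i s) (a + 2) := fun n => by
  obtain ⟨C, hC, h⟩ := Comp.listSum hf (Finset.univ : Finset κ).toList n
  refine ⟨C, hC.trans ?_, fun st => ?_⟩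
  · rw [Finset.length_toList, Finset.card_univ]
    have hB' : 1 ≤ B ^ a := Nat.one_le_pow _ _ (by omega)
    have h1 : B ≤ B * B ^ a := Nat.le_mul_of_pos_right _ hB'
    calc _ ≤ B * (B ^ a + 1) + 1 := by gcongr
      _ ≤ 4 * (B * B ^ a) := by nlinarith
      _ ≤ B * (B * B ^ a) := by gcongr
      _ = _ := by ring
  · obtain ⟨st', h1, h2, h3⟩ := h st
    exact ⟨st', h1, h2, by rw [h3, Finset.sum_map_toList]⟩

/-! ### Probabilistic stages -/

/-- Instructions that contain those of programs; the execution may depend on a parameter. -/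
structure Machine (P : Params) (ι : Type) where
  I : Type
  Θ : Type
  step : Θ → I → (ι → P.Rq) → PMF (ι → P.Rq)
  emb : Instr P ι → I
  step_emb : ∀ θ i s, step θ (emb i) s = i.run s

variable {M : Machine P ι}

/-- The kernel `k` on the registers of interest is executed by at most `B ^ a` instructions. -/
def Impl (M : Machine P ι) (L : Layout V ι) (B : ℕ) (k : M.Θ → (V → P.Rq) → PMF (V → P.Rq))
    (a : ℕ) : Prop :=
  ∃ C : List M.I, C.length ≤ B ^ a ∧
    ∀ θ s, (runList (M.step θ) C s).map (· ∘ L.reg) = k θ (s ∘ L.reg)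

theorem runList_emb (θ : M.Θ) (C : List (Instr P ι)) (s : ι → P.Rq) :
    runList (M.step θ) (C.map M.emb) s = runList Instr.run C s := by
  induction C generalizing s with
  | nil => rfl
  | cons i C ih =>
    simp only [List.map_cons, runList, M.step_emb]
    congr 1
    exact funext fun s' => ih s'

theorem Impl.mono {k : M.Θ → (V → P.Rq) → PMF (V → P.Rq)} (hB : 4 ≤ B) (h : Impl M L B k a)
    (hab : a ≤ b) : Impl M L B k b := by
  obtain ⟨C, hC, h⟩ := h
  exact ⟨C, hC.trans (Nat.pow_le_pow_right (by omega) hab), h⟩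

theorem Impl.seq {k₁ k₂ : M.Θ → (V → P.Rq) → PMF (V → P.Rq)} (hB : 4 ≤ B)
    (h₁ : Impl M L B k₁ a) (h₂ : Impl M L B k₂ b) :
    Impl M L B (fun θ s => (k₁ θ s).bind (k₂ θ)) (max a b + 1) := by
  obtain ⟨C₁, hC₁, h₁⟩ := h₁.mono hB (le_max_left a b)
  obtain ⟨C₂, hC₂, h₂⟩ := h₂.mono hB (le_max_right a b)
  refine ⟨C₁ ++ C₂, ?_, fun θ s => ?_⟩
  · rw [List.length_append, pow_succ]
    nlinarith
  · change _ = (k₁ θ (s ∘ L.reg)).bind (k₂ θ)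
    rw [runList_append, PMF.map_bind, ← h₁ θ s, PMF.bind_map]
    congr 1
    exact funext fun s' => h₂ θ s'

open Classical in
theorem Impl.set (hB : 4 ≤ B) (r : V) (hf : Comp L B f a) :
    Impl M L B (fun _ s => PMF.pure (Function.update s r (f s))) (a + 1) := by
  obtain ⟨C, hC, h⟩ := hf 0
  have hB' : 1 ≤ B ^ a := Nat.one_le_pow _ _ (by omega)
  refine ⟨(C ++ [Instr.const (L.reg r) 0, Instr.add (L.reg r) (L.reg r) (L.tmp 0)]).map M.emb, ?_,
    fun θ s => ?_⟩
  · simp only [List.length_map, List.length_append, List.length_cons, List.length_nil]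
    rw [pow_succ]
    nlinarith
  · obtain ⟨st', h1, h2, h3⟩ := h s
    rw [runList_emb, runList_append, h1, PMF.pure_bind]
    simp only [runList, Instr.run, PMF.pure_bind, Function.update_self,
      Function.update_of_ne (L.disj r 0).symm, zero_add, PMF.pure_map]
    congr 1
    rw [Function.update_idem, Function.update_comp_eq_of_injective _ L.reg_inj, h3]
    congr 1
    exact funext fun v => h2 _ fun k _ => L.disj v k

open Classical in
theorem update_extend_succ {n : ℕ} {r : Fin (n + 1) → V} (hr : Function.Injective r) {α : Type}
    (s : V → α) (x : α) (y : Fin n → α) :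
    Function.extend (r ∘ Fin.succ) y (Function.update s (r 0) x) =
      Function.extend r (Fin.cons x y) s := by
  have hr' : Function.Injective (r ∘ Fin.succ) := hr.comp (Fin.succ_injective n)
  ext v
  by_cases h0 : v = r 0
  · rw [h0, hr.extend_apply, Function.extend_apply', Function.update_self, Fin.cons_zero]
    rintro ⟨i, hi⟩
    exact Fin.succ_ne_zero i (hr hi)
  · by_cases h1 : ∃ i, r (Fin.succ i) = v
    · obtain ⟨i, rfl⟩ := h1
      rw [hr.extend_apply, Fin.cons_succ]
      exact hr'.extend_apply _ _ i
    · have h2 : ¬∃ i, (r ∘ Fin.succ) i = v := h1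
      rw [Function.extend_apply' _ _ _ h2, Function.update_of_ne h0, Function.extend_apply']
      rintro ⟨i, hi⟩
      rcases Fin.eq_zero_or_eq_succ i with rfl | ⟨j, rfl⟩
      · exact h0 hi.symm
      · exact h1 ⟨j, hi⟩

theorem extend_comp_equiv {κ μ α : Type} (e : κ ≃ μ) {r : μ → V} (hr : Function.Injective r)
    (y : κ → α) (s : V → α) : Function.extend (r ∘ e) y s = Function.extend r (y ∘ e.symm) s := by
  classical
  ext v
  by_cases h : ∃ i, r i = v
  · obtain ⟨i, rfl⟩ := h
    have h := (hr.comp e.injective).extend_apply y s (e.symm i)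
    rw [Function.comp_apply, e.apply_symm_apply] at h
    rw [h, hr.extend_apply, Function.comp_apply]
  · rw [Function.extend_apply' _ _ _ h, Function.extend_apply']
    rintro ⟨i, hi⟩
    exact h ⟨e i, hi⟩

open Classical in
/-- Assignments of values that do not depend on the other targets. -/
theorem Impl.setFam (hB : 4 ≤ B) {κ : Type} [Fintype κ] (hκ : Fintype.card κ ≤ B) {r : κ → V}
    (hr : Function.Injective r) {f : κ → (V → P.Rq) → P.Rq} (hf : ∀ i, Comp L B (f i) a)
    (hd : ∀ i j s x, j ≠ i → f i (Function.update s (r j) x) = f i s) :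
    Impl M L B (fun _ s => PMF.pure (Function.extend r (fun i => f i s) s)) (a + 2) := by
  -- The targets are written one after another. As each value ignores the other targets, the outcome
  -- is the simultaneous assignment; a value may still depend on its own target.
  have key : ∀ n (r : Fin n → V) (f : Fin n → (V → P.Rq) → P.Rq), Function.Injective r →
      (∀ i, Comp L B (f i) a) →
      (∀ i j s x, j ≠ i → f i (Function.update s (r j) x) = f i s) →
      ∃ C : List M.I, C.length ≤ n * B ^ (a + 1) ∧ ∀ θ s,
        (runList (M.step θ) C s).map (· ∘ L.reg) =
          PMF.pure (Function.extend r (fun i => f i (s ∘ L.reg)) (s ∘ L.reg)) := by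
    intro n
    induction n with
    | zero =>
      intro r f _ _ _
      refine ⟨[], by simp, fun θ s => ?_⟩
      simp only [runList, PMF.pure_map]
      congr 1
      ext v
      rw [Function.extend_apply']
      rintro ⟨i, _⟩
      exact i.elim0
    | succ n ih =>
      intro r f hr hf hd
      obtain ⟨C₁, hC₁, h₁⟩ := Impl.set (M := M) hB (r 0) (hf 0)
      obtain ⟨C₂, hC₂, h₂⟩ := ih (r ∘ Fin.succ) (fun i => f i.succ)
        (hr.comp (Fin.succ_injective n)) (fun i => hf _)
        (fun i j s x hij => hd _ _ s x fun h => hij (Fin.succ_injective n h))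
      refine ⟨C₁ ++ C₂, ?_, fun θ s => ?_⟩
      · rw [List.length_append]
        nlinarith
      · have h3 := h₁ θ s
        rw [runList_append, PMF.map_bind]
        have h4 : (fun s' => (runList (M.step θ) C₂ s').map (· ∘ L.reg)) =
            (fun t => PMF.pure (Function.extend (r ∘ Fin.succ) (fun i => f i.succ t) t)) ∘
              (· ∘ L.reg) := funext fun s' => h₂ θ s'
        rw [h4, ← PMF.bind_map, h3, PMF.pure_bind]
        congr 1
        simp only [hd _ 0 _ _ (Fin.succ_ne_zero _).symm]
        rw [update_extend_succ hr]
        congr 1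
        ext i
        rcases Fin.eq_zero_or_eq_succ i with rfl | ⟨j, rfl⟩ <;> simp
  set e := Fintype.equivFin κ
  obtain ⟨C, hC, h⟩ := key _ (r ∘ e.symm) (fun i => f (e.symm i)) (hr.comp e.symm.injective)
    (fun i => hf _) (fun i j s x hij => hd _ _ s x fun h => hij (e.symm.injective h))
  refine ⟨C, hC.trans ?_, fun θ s => ?_⟩
  · calc _ ≤ B * B ^ (a + 1) := by gcongr
      _ = _ := by ring
  · rw [h θ s, extend_comp_equiv _ hr]
    congr 2
    ext i
    simp

open Classical in
theorem Impl.sample (r : V) (D : Dist) :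
    Impl M L B (fun _ s => (D.sample P).map (Function.update s r)) 0 := by
  refine ⟨[M.emb (.sample (L.reg r) D)], by simp, fun θ s => ?_⟩
  rw [runList_singleton, M.step_emb, Instr.run, PMF.map_comp]
  congr 1
  exact funext fun x => Function.update_comp_eq_of_injective _ L.reg_inj _ _

theorem ex_iid_succ {α : Type} (n : ℕ) (μ : PMF α) (F : (Fin (n + 1) → α) → ℝ≥0∞) :
    ex (iid (Fin (n + 1)) μ) F = ex μ fun x => ex (iid (Fin n) μ) fun y => F (Fin.cons x y) := by
  unfold ex
  rw [← (Fin.consEquiv fun _ : Fin (n + 1) => α).tsum_eq, ENNReal.tsum_prod']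
  refine tsum_congr fun x => ?_
  rw [← ENNReal.tsum_mul_left]
  refine tsum_congr fun y => ?_
  simp only [Fin.consEquiv_apply, iid_apply, Fin.prod_univ_succ, Fin.cons_zero, Fin.cons_succ]
  rw [mul_assoc]
  rfl

/-- Independent samples written to different registers. -/
theorem Impl.sampleFam {κ : Type} [Fintype κ] (hκ : Fintype.card κ ≤ B) {r : κ → V}
    (hr : Function.Injective r) (D : Dist) :
    Impl M L B (fun _ s => (iid κ (D.sample P)).map fun x => Function.extend r x s) 1 := by
  classical
  have key : ∀ n (r : Fin n → V), Function.Injective r →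
      ∃ C : List M.I, C.length ≤ n ∧ ∀ θ s, (runList (M.step θ) C s).map (· ∘ L.reg) =
        (iid (Fin n) (D.sample P)).map fun x => Function.extend r x (s ∘ L.reg) := by
    intro n
    induction n with
    | zero =>
      intro r _
      refine ⟨[], by simp, fun θ s => pmf_ext_ex fun F => ?_⟩
      simp only [runList, PMF.pure_map, ex_pure, ex_map]
      have : ∀ x : Fin 0 → P.Rq, Function.extend r x (s ∘ L.reg) = s ∘ L.reg := fun x => by
        ext v
        rw [Function.extend_apply']
        rintro ⟨i, _⟩
        exact i.elim0
      simp only [this, ex_const]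
    | succ n ih =>
      intro r hr
      obtain ⟨C₁, hC₁, h₁⟩ := Impl.sample (M := M) (L := L) (B := B) (r 0) D
      obtain ⟨C₂, hC₂, h₂⟩ := ih (r ∘ Fin.succ) (hr.comp (Fin.succ_injective n))
      refine ⟨C₁ ++ C₂, ?_, fun θ s => ?_⟩
      · rw [List.length_append]
        simp at hC₁
        omega
      · have h3 := h₁ θ s
        rw [runList_append, PMF.map_bind]
        have h4 : (fun s' => (runList (M.step θ) C₂ s').map (· ∘ L.reg)) =
            (fun t => (iid (Fin n) (D.sample P)).map fun x =>
              Function.extend (r ∘ Fin.succ) x t) ∘ (· ∘ L.reg) := funext fun s' => h₂ θ s'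
        rw [h4, ← PMF.bind_map, h3]
        refine pmf_ext_ex fun F => ?_
        simp only [ex_bind, ex_map, ex_iid_succ, update_extend_succ hr]
  set e := Fintype.equivFin κ
  obtain ⟨C, hC, h⟩ := key _ (r ∘ e.symm) (hr.comp e.symm.injective)
  refine ⟨C, by rw [pow_one]; exact hC.trans hκ, fun θ s => ?_⟩
  rw [h θ s]
  refine pmf_ext_ex fun F => ?_
  rw [ex_map, ex_map, ex_iid_equiv e.symm]
  simp only [extend_comp_equiv _ hr]

/-! ### Renaming of registers -/

/-- Renaming of the registers of an instruction. -/
def Instr.rename {κ : Type} (φ : ι → κ) : Instr P ι → Instr P κ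
  | .const r x => .const (φ r) x
  | .add r x y => .add (φ r) (φ x) (φ y)
  | .mul r x y => .mul (φ r) (φ x) (φ y)
  | .inv r x => .inv (φ r) (φ x)
  | .conj r x => .conj (φ r) (φ x)
  | .coeff r x k => .coeff (φ r) (φ x) k
  | .lt r x y => .lt (φ r) (φ x) (φ y)
  | .sample r D => .sample (φ r) D

/-- Register updates commute with injective renamings. This allows a distinguisher to be run inside
the register file of the reduction. -/
theorem Instr.run_rename {κ : Type} {φ : ι → κ} (hφ : Function.Injective φ) (i : Instr P ι)
    (s : κ → P.Rq) : ((i.rename φ).run s).map (· ∘ φ) = i.run (s ∘ φ) := by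
  classical
  cases i with
  | sample r D =>
    simp only [rename, run, PMF.map_comp]
    congr 1
    exact funext fun x => Function.update_comp_eq_of_injective _ hφ _ _
  | _ =>
    simp only [rename, run, PMF.pure_map]
    congr 1
    exact Function.update_comp_eq_of_injective _ hφ _ _

theorem runList_rename {κ : Type} {φ : ι → κ} (hφ : Function.Injective φ) (C : List (Instr P ι))
    (s : κ → P.Rq) : (runList Instr.run (C.map (Instr.rename φ)) s).map (· ∘ φ) =
      runList Instr.run C (s ∘ φ) := by
  induction C generalizing s with
  | nil => simp [runList, PMF.pure_map]
  | cons i C ih =>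
    simp only [List.map_cons, runList, PMF.map_bind]
    rw [← Instr.run_rename hφ, PMF.bind_map]
    congr 1
    exact funext fun s' => ih s'

end Programs

end

section

/-! ### Programs acting on encoded abstract states. -/

section Does

variable {P : Params} {ι V T : Type} {M : Machine P ι} {L : Layout V ι} {B : ℕ} {enc : T → V → P.Rq}
  {a b : ℕ}

/-- The kernel `k` on abstract states, encoded as contents of the registers of interest, is executed
by at most `B ^ a` instructions. -/
def Does (M : Machine P ι) (L : Layout V ι) (B : ℕ) (enc : T → V → P.Rq) (k : M.Θ → T → PMF T)
    (a : ℕ) : Prop :=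
  ∃ k' : M.Θ → (V → P.Rq) → PMF (V → P.Rq), Impl M L B k' a ∧
    ∀ θ σ, k' θ (enc σ) = (k θ σ).map enc

theorem Does.mono {k : M.Θ → T → PMF T} (hB : 4 ≤ B) (h : Does M L B enc k a) (hab : a ≤ b) :
    Does M L B enc k b := by
  obtain ⟨k', h, h'⟩ := h
  exact ⟨k', h.mono hB hab, h'⟩

/-- Kernels on raw registers are specified only on encodings; the first one ends in encodings, so
the second specification applies. -/
theorem Does.seq {k₁ k₂ : M.Θ → T → PMF T} (hB : 4 ≤ B) (h₁ : Does M L B enc k₁ a)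
    (h₂ : Does M L B enc k₂ b) :
    Does M L B enc (fun θ σ => (k₁ θ σ).bind (k₂ θ)) (max a b + 1) := by
  obtain ⟨k₁', h₁, h₁'⟩ := h₁
  obtain ⟨k₂', h₂, h₂'⟩ := h₂
  refine ⟨_, h₁.seq hB h₂, fun θ σ => ?_⟩
  rw [h₁', PMF.bind_map, PMF.map_bind]
  congr 1
  exact funext fun σ' => h₂' θ σ'

theorem Does.run {k : M.Θ → T → PMF T} (h : Does M L B enc k a) :
    ∃ C : List M.I, C.length ≤ B ^ a ∧ ∀ θ s σ, s ∘ L.reg = enc σ →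
      (runList (M.step θ) C s).map (· ∘ L.reg) = (k θ σ).map enc := by
  obtain ⟨k', ⟨C, hC, h⟩, h'⟩ := h
  exact ⟨C, hC, fun θ s σ hs => by rw [h, hs, h']⟩

open Classical in
theorem Does.set (hB : 4 ≤ B) (r : V) {f : (V → P.Rq) → P.Rq} (hf : Comp L B f a) {u : T → T}
    (hu : ∀ σ, Function.update (enc σ) r (f (enc σ)) = enc (u σ)) :
    Does M L B enc (fun _ σ => PMF.pure (u σ)) (a + 1) :=
  ⟨_, Impl.set hB r hf, fun θ σ => by rw [hu, PMF.pure_map]⟩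

open Classical in
theorem Does.setFam (hB : 4 ≤ B) {κ : Type} [Fintype κ] (hκ : Fintype.card κ ≤ B) {r : κ → V}
    (hr : Function.Injective r) {f : κ → (V → P.Rq) → P.Rq} (hf : ∀ i, Comp L B (f i) a)
    (hd : ∀ i j s x, j ≠ i → f i (Function.update s (r j) x) = f i s) {u : T → T}
    (hu : ∀ σ, Function.extend r (fun i => f i (enc σ)) (enc σ) = enc (u σ)) :
    Does M L B enc (fun _ σ => PMF.pure (u σ)) (a + 2) :=
  ⟨_, Impl.setFam hB hκ hr hf hd, fun θ σ => by rw [hu, PMF.pure_map]⟩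

open Classical in
theorem Does.sample {r : V} (D : Dist) {α : Type} {μ : PMF α} {dec : α → P.Rq}
    (hμ : D.sample P = μ.map dec) {u : T → α → T}
    (hu : ∀ σ y, Function.update (enc σ) r (dec y) = enc (u σ y)) :
    Does M L B enc (fun _ σ => μ.map (u σ)) 0 := by
  refine ⟨_, Impl.sample r D, fun θ σ => ?_⟩
  rw [hμ, PMF.map_comp, PMF.map_comp]
  congr 1
  exact funext fun y => hu σ y

theorem Does.sampleFam {κ : Type} [Fintype κ] (hκ : Fintype.card κ ≤ B) {r : κ → V}
    (hr : Function.Injective r) (D : Dist) {α : Type} {μ : PMF α} {dec : α → κ → P.Rq}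
    (hμ : iid κ (D.sample P) = μ.map dec) {u : T → α → T}
    (hu : ∀ σ y, Function.extend r (dec y) (enc σ) = enc (u σ y)) :
    Does M L B enc (fun _ σ => μ.map (u σ)) 1 := by
  refine ⟨_, Impl.sampleFam hκ hr D, fun θ σ => ?_⟩
  rw [hμ, PMF.map_comp, PMF.map_comp]
  congr 1
  exact funext fun y => hu σ y

theorem extend_eq {κ α : Type} {r : κ → V} (hr : Function.Injective r) {y : κ → α} {s s' : V → α}
    (h1 : ∀ i, y i = s' (r i)) (h2 : ∀ v, (∀ i, r i ≠ v) → s v = s' v) :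
    Function.extend r y s = s' := by
  ext v
  by_cases h : ∃ i, r i = v
  · obtain ⟨i, rfl⟩ := h
    rw [hr.extend_apply, h1]
  · rw [Function.extend_apply' _ _ _ h, h2 v fun i hi => h ⟨i, hi⟩]

theorem update_eq [DecidableEq V] {α : Type} {r : V} {y : α} {s s' : V → α} (h1 : y = s' r)
    (h2 : ∀ v, r ≠ v → s v = s' v) : Function.update s r y = s' := by
  ext v
  by_cases h : v = r
  · rw [h, Function.update_self, h1]
  · rw [Function.update_of_ne h, h2 v fun h' => h h'.symm]

end Does

/-! ### Program stages that sample or compute the parts of a transcript. -/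

section CoreState

variable (P : Params) (W : Type)

/-- Registers for a commitment key, a statement and a transcript. -/
abbrev Core : Type := (PPVar P ⊕ StmtVar P) ⊕ TVar P

/-- A commitment key, a statement, a transcript, and the contents of further registers. -/
structure CoreState where
  pp : PP P
  x : Stmt P
  t : Transcript P
  w : W → P.Rq

/-- A bound for the number of registers of a family. -/
def Params.bnd : ℕ := (4 * P.size + 1000) ^ 2

variable {P W}

abbrev preg (v : PPVar P) : Core P ⊕ W := Sum.inl (Sum.inl (Sum.inl v))
abbrev sreg (v : StmtVar P) : Core P ⊕ W := Sum.inl (Sum.inl (Sum.inr v))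
abbrev treg (v : TVar P) : Core P ⊕ W := Sum.inl (Sum.inr v)

/-- The contents of the registers in a given state. -/
def CoreState.enc (σ : CoreState P W) : Core P ⊕ W → P.Rq :=
  Sum.elim (Sum.elim (Sum.elim σ.pp.enc σ.x.enc) σ.t.enc) σ.w

theorem le_bnd {a : ℕ} (h : a ≤ 4 * P.size + 1000) : a ≤ P.bnd :=
  h.trans (Nat.le_self_pow two_ne_zero _)

theorem four_le_bnd : 4 ≤ P.bnd := le_bnd (by omega)

theorem card_fin_κ : Fintype.card (Fin P.κ) ≤ P.bnd :=
  le_bnd (by simp only [Fintype.card_fin, Params.size]; omega)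

theorem card_fin_n : Fintype.card (Fin P.n) ≤ P.bnd :=
  le_bnd (by simp only [Fintype.card_fin, Params.size, Params.n]; omega)

theorem card_fin_d : Fintype.card (Fin P.d) ≤ P.bnd :=
  le_bnd (by simp only [Fintype.card_fin, Params.size]; omega)

theorem card_E : Fintype.card P.E ≤ P.bnd :=
  le_bnd (by have := Nat.div_le_self 256 P.d; simp only [Fintype.card_fin]; omega)

theorem card_MIdx_le : Fintype.card P.MIdx ≤ P.bnd :=
  le_bnd (by
    simp only [Fintype.card_prod, Fintype.card_sum, Fintype.card_fin, Params.size, Params.n]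
    omega)

theorem card_J_le : Fintype.card P.J ≤ P.bnd := le_bnd (by rw [card_J]; omega)

theorem card_two_le : Fintype.card (Fin 2) ≤ P.bnd :=
  le_bnd (by simp only [Fintype.card_fin]; omega)

/-! ### Sampling -/

/-- The element without its constant coefficient. -/
def dropConst (y : P.Rq) : P.Rq := y - AdjoinRoot.of _ (coeff y 0)

theorem iid_bin_sample : iid (P.J × Fin 2) (Dist.bin.sample P) =
    (distR P).map fun R p => tern (ZMod P.q) (R p.1 p.2) := by
  refine pmf_ext_ex fun F => ?_
  rw [Dist.sample, ex_iid_map, ex_iid_curry, ex_map]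

theorem iid_curry_map {ι : Type} [Fintype ι] (μ : PMF ℤ) :
    iid ι ((iid (Fin P.d) μ).map (red P.q)) = (iid (ι × Fin P.d) μ).map (redVec P.q) := by
  refine pmf_ext_ex fun F => ?_
  rw [ex_iid_map, ex_map, ex_iid_curry]
  rfl

/-- Scalars of `ℤ_q` cannot be sampled directly; the constant coefficient of a uniform ring element
serves instead. -/
theorem map_coeff_unif : P.unif.map (fun y => coeff y (0 : Fin P.d)) =
    PMF.uniformOfFintype (ZMod P.q) := by
  classical
  refine pmf_ext_ex fun F => ?_
  rw [ex_map, Params.unif, ex_map]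
  simp only [coeff_ofCoeffs]
  rw [iid_uniform]
  exact ex_iid_marginal _ _ _

variable {ι : Type} {M : Machine P ι} {L : Layout (Core P ⊕ W) ι}

theorem injective_treg {κ : Type} {r : κ → TVar P} (hr : Function.Injective r) :
    Function.Injective fun i => (treg (r i) : Core P ⊕ W) :=
  fun _ _ h => hr (Sum.inr_injective (Sum.inl_injective h))

/-! Updates of single components of the transcript. -/

namespace CoreState

variable (σ : CoreState P W)

def setF (y : Fin P.κ → P.Rq) : CoreState P W :=
  { σ with t := { σ.t with m1 := { σ.t.m1 with f := y } } }

def setU1 (y : P.E → P.Rq) : CoreState P W :=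
  { σ with t := { σ.t with m1 := { σ.t.m1 with u1 := y } } }

def setU2 (y : P.Rq) : CoreState P W :=
  { σ with t := { σ.t with m1 := { σ.t.m1 with u2 := y } } }

def setR (y : ChR P) : CoreState P W := { σ with t := { σ.t with R := y } }

def setZ3 (y : Msg2 P) : CoreState P W := { σ with t := { σ.t with z3 := y } }

def setDd (y : ChD P) : CoreState P W := { σ with t := { σ.t with dd := y } }

def setH (y : P.Rq) : CoreState P W :=
  { σ with t := { σ.t with m3 := { σ.t.m3 with h := y } } }

def setW (y : Fin P.κ → P.Rq) : CoreState P W :=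
  { σ with t := { σ.t with m3 := { σ.t.m3 with w := y } } }

def setV (y : (Fin 2 × Fin P.n) ⊕ Unit → P.Rq) : CoreState P W :=
  { σ with t := { σ.t with m3 := { σ.t.m3 with v := y } } }

def setC (y : ChC P) : CoreState P W := { σ with t := { σ.t with c := y } }

def setZ1 (y : P.MIdx → P.Rq) : CoreState P W :=
  { σ with t := { σ.t with m4 := { σ.t.m4 with z1 := y } } }

def setZ2 (y : Fin P.n → P.Rq) : CoreState P W :=
  { σ with t := { σ.t with m4 := { σ.t.m4 with z2 := y } } }

end CoreState

/-- Assignment to transcript registers as an update of the transcript. -/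
theorem extend_treg {κ : Type} {r : κ → TVar P} (hr : Function.Injective r) {y : κ → P.Rq}
    {σ σ' : CoreState P W} (h0 : σ.pp = σ'.pp ∧ σ.x = σ'.x ∧ σ.w = σ'.w)
    (h1 : ∀ i, y i = σ'.t.enc (r i)) (h2 : ∀ v, (∀ i, r i ≠ v) → σ.t.enc v = σ'.t.enc v) :
    Function.extend (fun i => treg (r i)) y σ.enc = σ'.enc := by
  obtain ⟨e1, e2, e3⟩ := h0
  refine extend_eq (injective_treg hr) h1 ?_
  rintro (((v | v) | v) | v) h
  · exact congrArg (fun p => PP.enc p v) e1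
  · exact congrArg (fun p => Stmt.enc p v) e2
  · exact h2 v fun i hi => h i (congrArg treg hi)
  · exact congrFun e3 v

theorem update_treg [DecidableEq (Core P ⊕ W)] {r : TVar P} {y : P.Rq} {σ σ' : CoreState P W}
    (h0 : σ.pp = σ'.pp ∧ σ.x = σ'.x ∧ σ.w = σ'.w) (h1 : y = σ'.t.enc r)
    (h2 : ∀ v, r ≠ v → σ.t.enc v = σ'.t.enc v) :
    Function.update σ.enc (treg r) y = σ'.enc := by
  obtain ⟨e1, e2, e3⟩ := h0
  refine update_eq (r := treg r) (s' := σ'.enc) h1 ?_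
  rintro (((v | v) | v) | v) h
  · exact congrArg (fun p => PP.enc p v) e1
  · exact congrArg (fun p => Stmt.enc p v) e2
  · exact h2 v fun hi => h (congrArg treg hi)
  · exact congrFun e3 v

theorem f_inj : Function.Injective (TVar.f (P := P)) := fun i j h => by simpa using h

theorem extend_f (σ : CoreState P W) (y : Fin P.κ → P.Rq) :
    Function.extend (fun i => treg (TVar.f i)) y σ.enc = (σ.setF y).enc :=
  extend_treg f_inj ⟨rfl, rfl, rfl⟩ (fun _ => rfl) fun v hv => by
    cases v <;> first | rfl | exact absurd rfl (hv _)

theorem u1_inj : Function.Injective (TVar.u1 (P := P)) := fun i j h => by simpa using h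

theorem extend_u1 (σ : CoreState P W) (y : P.E → P.Rq) :
    Function.extend (fun i => treg (TVar.u1 i)) y σ.enc = (σ.setU1 y).enc :=
  extend_treg u1_inj ⟨rfl, rfl, rfl⟩ (fun _ => rfl) fun v hv => by
    cases v <;> first | rfl | exact absurd rfl (hv _)

theorem z3_inj : Function.Injective (TVar.z3 (P := P)) := fun i j h => by simpa using h

theorem extend_z3 (σ : CoreState P W) (y : P.E → P.Rq) :
    Function.extend (fun i => treg (TVar.z3 i)) y σ.enc = (σ.setZ3 y).enc :=
  extend_treg z3_inj ⟨rfl, rfl, rfl⟩ (fun _ => rfl) fun v hv => by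
    cases v <;> first | rfl | exact absurd rfl (hv _)

theorem w_inj : Function.Injective (TVar.w (P := P)) := fun i j h => by simpa using h

theorem extend_w (σ : CoreState P W) (y : Fin P.κ → P.Rq) :
    Function.extend (fun i => treg (TVar.w i)) y σ.enc = (σ.setW y).enc :=
  extend_treg w_inj ⟨rfl, rfl, rfl⟩ (fun _ => rfl) fun v hv => by
    cases v <;> first | rfl | exact absurd rfl (hv _)

theorem v_inj : Function.Injective (TVar.v (P := P)) := fun i j h => by simpa using h

theorem extend_v (σ : CoreState P W) (y : (Fin 2 × Fin P.n) ⊕ Unit → P.Rq) :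
    Function.extend (fun i => treg (TVar.v i)) y σ.enc = (σ.setV y).enc :=
  extend_treg v_inj ⟨rfl, rfl, rfl⟩ (fun _ => rfl) fun v hv => by
    cases v <;> first | rfl | exact absurd rfl (hv _)

theorem z1_inj : Function.Injective (TVar.z1 (P := P)) := fun i j h => by simpa using h

theorem extend_z1 (σ : CoreState P W) (y : P.MIdx → P.Rq) :
    Function.extend (fun i => treg (TVar.z1 i)) y σ.enc = (σ.setZ1 y).enc :=
  extend_treg z1_inj ⟨rfl, rfl, rfl⟩ (fun _ => rfl) fun v hv => by
    cases v <;> first | rfl | exact absurd rfl (hv _)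

theorem z2_inj : Function.Injective (TVar.z2 (P := P)) := fun i j h => by simpa using h

theorem extend_z2 (σ : CoreState P W) (y : Fin P.n → P.Rq) :
    Function.extend (fun i => treg (TVar.z2 i)) y σ.enc = (σ.setZ2 y).enc :=
  extend_treg z2_inj ⟨rfl, rfl, rfl⟩ (fun _ => rfl) fun v hv => by
    cases v <;> first | rfl | exact absurd rfl (hv _)

theorem dd_inj : Function.Injective (TVar.dd (P := P)) := fun i j h => by simpa using h

theorem extend_dd (σ : CoreState P W) (y : ChD P) :
    Function.extend (fun i => treg (TVar.dd i)) (fun j => AdjoinRoot.of _ (y j)) σ.enc = (σ.setDd y).enc :=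
  extend_treg dd_inj ⟨rfl, rfl, rfl⟩ (fun _ => rfl) fun v hv => by
    cases v <;> first | rfl | exact absurd rfl (hv _)

theorem r_inj : Function.Injective fun p : P.J × Fin 2 => TVar.r p.1 p.2 := by
  rintro ⟨j, b⟩ ⟨j', b'⟩ h
  simpa using h

theorem extend_r (σ : CoreState P W) (R : ChR P) :
    Function.extend (fun p : P.J × Fin 2 => treg (TVar.r p.1 p.2))
      (fun p => tern (ZMod P.q) (R p.1 p.2)) σ.enc = (σ.setR R).enc :=
  extend_treg r_inj ⟨rfl, rfl, rfl⟩ (fun _ => rfl) fun v hv => by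
    cases v <;> first | rfl | exact absurd rfl (hv (_, _))

theorem update_u2 [DecidableEq (Core P ⊕ W)] (σ : CoreState P W) (y : P.Rq) :
    Function.update σ.enc (treg .u2) y = (σ.setU2 y).enc :=
  update_treg ⟨rfl, rfl, rfl⟩ rfl fun v hv => by
    cases v <;> first | rfl | exact absurd rfl hv

theorem update_h [DecidableEq (Core P ⊕ W)] (σ : CoreState P W) (y : P.Rq) :
    Function.update σ.enc (treg .h) y = (σ.setH y).enc :=
  update_treg ⟨rfl, rfl, rfl⟩ rfl fun v hv => by
    cases v <;> first | rfl | exact absurd rfl hv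

theorem update_c [DecidableEq (Core P ⊕ W)] (σ : CoreState P W) (y : ChC P) :
    Function.update σ.enc (treg .c) (tern (ZMod P.q) y) = (σ.setC y).enc :=
  update_treg ⟨rfl, rfl, rfl⟩ rfl fun v hv => by
    cases v <;> first | rfl | exact absurd rfl hv

theorem does_r : Does M L P.bnd (CoreState.enc (P := P) (W := W))
    (fun _ σ => (distR P).map σ.setR) 1 :=
  Does.sampleFam (le_bnd (by rw [Fintype.card_prod, card_J, Fintype.card_fin]; omega))
    (injective_treg r_inj) .bin iid_bin_sample extend_r

theorem does_z3 : Does M L P.bnd (CoreState.enc (P := P) (W := W))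
    (fun _ σ => (distY3 P).map fun y => σ.setZ3 (redVec P.q y)) 1 :=
  Does.sampleFam card_E (injective_treg z3_inj) .gauss3 (iid_curry_map _)
    fun σ y => extend_z3 σ (redVec P.q y)

theorem does_z1 : Does M L P.bnd (CoreState.enc (P := P) (W := W))
    (fun _ σ => (distY1 P).map fun y => σ.setZ1 (redVec P.q y)) 1 :=
  Does.sampleFam card_MIdx_le (injective_treg z1_inj) .gauss1 (iid_curry_map _)
    fun σ y => extend_z1 σ (redVec P.q y)

theorem does_z2 : Does M L P.bnd (CoreState.enc (P := P) (W := W))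
    (fun _ σ => (distY2 P).map fun y => σ.setZ2 (redVec P.q y)) 1 :=
  Does.sampleFam card_fin_n (injective_treg z2_inj) .gauss2 (iid_curry_map _)
    fun σ y => extend_z2 σ (redVec P.q y)

theorem does_c : Does M L P.bnd (CoreState.enc (P := P) (W := W))
    (fun _ σ => P.chal.map σ.setC) 0 :=
  Does.sample .chal rfl fun σ y => @update_c P W (fun _ _ => Classical.propDecidable _) σ y

theorem does_f : Does M L P.bnd (CoreState.enc (P := P) (W := W))
    (fun _ σ => (iid (Fin P.κ) P.unif).map σ.setF) 1 :=
  Does.sampleFam (dec := id) card_fin_κ (injective_treg f_inj) .unif (PMF.map_id _).symm extend_f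

theorem does_u1 : Does M L P.bnd (CoreState.enc (P := P) (W := W))
    (fun _ σ => (iid P.E P.unif).map σ.setU1) 1 :=
  Does.sampleFam (dec := id) card_E (injective_treg u1_inj) .unif (PMF.map_id _).symm extend_u1

theorem does_u2 : Does M L P.bnd (CoreState.enc (P := P) (W := W))
    (fun _ σ => P.unif.map σ.setU2) 0 :=
  Does.sample (dec := id) .unif (PMF.map_id _).symm fun σ y => @update_u2 P W (fun _ _ => Classical.propDecidable _) σ y

theorem does_h : Does M L P.bnd (CoreState.enc (P := P) (W := W))
    (fun _ σ => P.unif.map fun y => σ.setH (dropConst y)) 6 := by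
  have hB := four_le_bnd (P := P)
  have h1 : Does M L P.bnd (CoreState.enc (P := P) (W := W)) (fun _ σ => P.unif.map σ.setH) 0 :=
    Does.sample (dec := id) .unif (PMF.map_id _).symm fun σ y => @update_h P W (fun _ _ => Classical.propDecidable _) σ y
  have h2 : Does M L P.bnd (CoreState.enc (P := P) (W := W))
      (fun _ σ => PMF.pure (σ.setH (dropConst σ.t.m3.h))) 5 :=
    (Does.set hB (treg .h) ((Comp.reg hB (treg .h)).sub hB
      ((Comp.reg hB (treg .h)).coeff hB 0)) fun σ => @update_h P W (fun _ _ => Classical.propDecidable _) σ _).mono hB (by norm_num)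
  obtain ⟨k, hk, h⟩ := h1.seq hB h2
  refine ⟨k, hk, fun θ σ => ?_⟩
  rw [h]
  congr 1
  refine pmf_ext_ex fun F => ?_
  simp only [ex_bind, ex_map, ex_pure]
  rfl

/-- Uniform ring elements are drawn first, and each register is then replaced by its own constant
coefficient. -/
theorem does_dd : Does M L P.bnd (CoreState.enc (P := P) (W := W))
    (fun _ σ => (distD P).map σ.setDd) 5 := by
  have hB := four_le_bnd (P := P)
  have hr := injective_treg (W := W) (dd_inj (P := P))
  refine ⟨_, ((Impl.sampleFam card_J_le hr .unif).seq hB (Impl.setFam hB card_J_le hr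
      (f := fun j s => AdjoinRoot.of _ (coeff (s (treg (.dd j))) 0))
      (fun j => (Comp.reg hB _).coeff hB 0) ?_)).mono hB (by norm_num), ?_⟩
  · intro i j s x hij
    simp [hij.symm]
  · intro θ σ
    refine pmf_ext_ex fun F => ?_
    simp only [ex_bind, ex_map, ex_pure]
    rw [distD, ← map_coeff_unif, ex_iid_map]
    congr 1
    ext y
    congr 1
    simp only [hr.extend_apply]
    rw [← extend_dd]
    refine extend_eq hr (fun j => by rw [hr.extend_apply]) fun v hv => ?_
    rw [Function.extend_apply' _ _ _ fun ⟨i, hi⟩ => hv i hi,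
      Function.extend_apply' _ _ _ fun ⟨i, hi⟩ => hv i hi]

/-! ### The third message -/

/-- The commitment `w` for which given responses are accepted. -/
def simW (pp : PP P) (t : Transcript P) : Fin P.κ → P.Rq :=
  pp.A3 *ᵥ t.m4.z1 + pp.A4 *ᵥ t.m4.z2 - tern (ZMod P.q) t.c • t.m1.f

/-- The vector `v` for which given responses are accepted. -/
def simV (pp : PP P) (x : Stmt P) (t : Transcript P) : (Fin 2 × Fin P.n) ⊕ Unit → P.Rq :=
  matT x t.R t.dd *ᵥ Sum.elim t.m4.z1 (Sum.elim (tern (ZMod P.q) t.c • t.m1.u1 - pp.B1 *ᵥ t.m4.z2)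
    fun _ => tern (ZMod P.q) t.c * t.m1.u2 - pp.B2 ⬝ᵥ t.m4.z2)
    - tern (ZMod P.q) t.c • Sum.elim x.u fun _ => t.m3.h + affine x t.R t.z3 t.dd

theorem does_w : Does M L P.bnd (CoreState.enc (P := P) (W := W))
    (fun _ σ => PMF.pure (σ.setW (simW σ.pp σ.t))) 12 := by
  have hB := four_le_bnd (P := P)
  refine (Does.setFam hB card_fin_κ (injective_treg w_inj)
    (f := fun i s => (∑ j, s (preg (.A3 i j)) * s (treg (.z1 j))) +
      (∑ j, s (preg (.A4 i j)) * s (treg (.z2 j))) - s (treg .c) * s (treg (.f i)))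
    (fun i => (((Comp.sum hB card_MIdx_le fun j => (Comp.reg hB _).mul hB (Comp.reg hB _)).add hB
      (Comp.sum hB card_fin_n fun j => (Comp.reg hB _).mul hB (Comp.reg hB _))).sub hB
      ((Comp.reg hB _).mul hB (Comp.reg hB _)))) ?_
    fun σ => extend_w σ (simW σ.pp σ.t)).mono hB (by norm_num)
  intro i j s x _
  simp

/-- The entries of the matrix `Ã`, read from registers. -/
def regATilde (s : Core P ⊕ W → P.Rq) (r : Fin 2 × Fin P.n) (c : P.MIdx) : P.Rq :=
  if r.1 = c.1 then
    match c.2 with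
    | Sum.inl i => s (sreg (.A i r.2))
    | Sum.inr j => if r.2 = j then 1 else 0
  else 0

/-- The entries of the matrix `C̃`, read from registers. -/
def regCTilde (s : Core P ⊕ W → P.Rq) (r : Fin 2) (c : P.MIdx) : P.Rq :=
  if r = c.1 then
    match c.2 with
    | Sum.inl i => s (sreg (.c0 i)) - s (sreg (.c0' i))
    | Sum.inr _ => 0
  else 0

/-- The vector `ũ`, read from registers. -/
def regUTilde (s : Core P ⊕ W → P.Rq) : Fin 2 → P.Rq :=
  ![s (sreg .c1) - s (sreg .c1'), s (sreg .c2) - s (sreg .c2')]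

/-- The last entry of the vector `v`, computed from registers. -/
def regV (s : Core P ⊕ W → P.Rq) : P.Rq :=
  (∑ i, (∑ j, s (treg (.dd j)) * ∑ b, PoE.conj (s (treg (.r j b))) * regCTilde s b i) *
    s (treg (.z1 i))) +
  ((∑ a, (∑ j, s (treg (.dd j)) * PoE.conj (evec j a)) *
    (s (treg .c) * s (treg (.u1 a)) - ∑ k, s (preg (.B1 a k)) * s (treg (.z2 k)))) +
  (s (treg .c) * s (treg .u2) - ∑ k, s (preg (.B2 k)) * s (treg (.z2 k)))) -
  s (treg .c) * (s (treg .h) + ∑ j, s (treg (.dd j)) *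
    ((∑ a, PoE.conj (evec j a) * s (treg (.z3 a))) +
      ∑ b, PoE.conj (s (treg (.r j b))) * regUTilde s b))

theorem comp_regATilde (r : Fin 2 × Fin P.n) (c : P.MIdx) :
    Comp (P := P) L P.bnd (fun s => regATilde s r c) 1 := by
  have hB := four_le_bnd (P := P)
  unfold regATilde
  obtain ⟨b, i | j⟩ := c <;> dsimp only <;> split_ifs
  · exact Comp.reg hB _
  · exact (Comp.const _).mono hB zero_le_one
  · exact (Comp.const _).mono hB zero_le_one
  · exact (Comp.const _).mono hB zero_le_one
  · exact (Comp.const _).mono hB zero_le_one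

theorem comp_regCTilde (r : Fin 2) (c : P.MIdx) :
    Comp (P := P) L P.bnd (fun s => regCTilde s r c) 3 := by
  have hB := four_le_bnd (P := P)
  unfold regCTilde
  obtain ⟨b, i | j⟩ := c <;> dsimp only <;> split_ifs
  · exact ((Comp.reg hB _).sub hB (Comp.reg hB _)).mono hB (by norm_num)
  · exact (Comp.const _).mono hB (by norm_num)
  · exact (Comp.const _).mono hB (by norm_num)
  · exact (Comp.const _).mono hB (by norm_num)

theorem comp_regUTilde (r : Fin 2) : Comp (P := P) L P.bnd (fun s => regUTilde s r) 3 := by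
  have hB := four_le_bnd (P := P)
  fin_cases r
  · exact ((Comp.reg hB (sreg .c1)).sub hB (Comp.reg hB (sreg .c1'))).mono hB (by norm_num)
  · exact ((Comp.reg hB (sreg .c2)).sub hB (Comp.reg hB (sreg .c2'))).mono hB (by norm_num)

theorem comp_regV : Comp (P := P) L P.bnd regV 20 := by
  have hB := four_le_bnd (P := P)
  have hr : ∀ v, Comp (P := P) L P.bnd (fun s => s v) 1 := Comp.reg hB
  have h1 : ∀ i, Comp (P := P) L P.bnd (fun s => (∑ j, s (treg (.dd j)) *
      ∑ b, PoE.conj (s (treg (.r j b))) * regCTilde s b i) * s (treg (.z1 i))) 11 := fun i =>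
    ((Comp.sum hB card_J_le fun j => (hr _).mul hB (Comp.sum hB card_two_le fun b =>
      ((hr _).conj hB).mul hB (comp_regCTilde b i))).mul hB (hr _)).mono hB (by norm_num)
  have h2 : ∀ a, Comp (P := P) L P.bnd (fun s => (∑ j, s (treg (.dd j)) * PoE.conj (evec j a)) *
      (s (treg .c) * s (treg (.u1 a)) - ∑ k, s (preg (.B1 a k)) * s (treg (.z2 k)))) 7 := fun a =>
    ((Comp.sum hB card_J_le fun j => (hr _).mul hB (Comp.const _)).mul hB
      (((hr _).mul hB (hr _)).sub hB
        (Comp.sum hB card_fin_n fun k => (hr _).mul hB (hr _)))).mono hB (by norm_num)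
  have h3 : Comp (P := P) L P.bnd (fun s => s (treg .c) * s (treg .u2) -
      ∑ k, s (preg (.B2 k)) * s (treg (.z2 k))) 6 :=
    (((hr _).mul hB (hr _)).sub hB (Comp.sum hB card_fin_n fun k =>
      (hr _).mul hB (hr _))).mono hB (by norm_num)
  have h4 : ∀ j, Comp (P := P) L P.bnd (fun s => s (treg (.dd j)) *
      ((∑ a, PoE.conj (evec j a) * s (treg (.z3 a))) +
      ∑ b, PoE.conj (s (treg (.r j b))) * regUTilde s b)) 8 := fun j =>
    ((hr _).mul hB ((Comp.sum hB card_E fun a => (Comp.const _).mul hB (hr _)).add hB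
      (Comp.sum hB card_two_le fun b => ((hr _).conj hB).mul hB (comp_regUTilde b)))).mono hB
        (by norm_num)
  have h5 := ((Comp.sum hB card_MIdx_le h1).add hB ((Comp.sum hB card_E h2).add hB h3)).sub hB
    ((hr (treg .c)).mul hB ((hr (treg .h)).add hB (Comp.sum hB card_J_le h4)))
  exact h5.mono hB (by norm_num)

/-- Scalars are held in registers as constant polynomials, so the scalar action becomes ring
multiplication. -/
theorem regV_enc (σ : CoreState P W) : regV σ.enc = simV σ.pp σ.x σ.t (Sum.inr ()) := by
  rw [simV, matT_mulVec]
  simp only [Pi.sub_apply, Pi.smul_apply, Sum.elim_inr, smul_eq_mul]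
  have h1 : ∀ i, rowC σ.x σ.t.R σ.t.dd i = ∑ j, σ.enc (treg (.dd j)) *
      ∑ b, PoE.conj (σ.enc (treg (.r j b))) * regCTilde σ.enc b i := by
    intro i
    rw [rowC, Finset.sum_apply]
    exact Finset.sum_congr rfl fun j _ => (of_mul_eq_smul _ _).symm
  have h2 : ∀ a, rowE σ.t.dd a = ∑ j, σ.enc (treg (.dd j)) * PoE.conj (evec j a) := by
    intro a
    rw [rowE, Finset.sum_apply]
    exact Finset.sum_congr rfl fun j _ => (of_mul_eq_smul _ _).symm
  have h3 : affine σ.x σ.t.R σ.t.z3 σ.t.dd = ∑ j, σ.enc (treg (.dd j)) *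
      ((∑ a, PoE.conj (evec j a) * σ.enc (treg (.z3 a))) +
      ∑ b, PoE.conj (σ.enc (treg (.r j b))) * regUTilde σ.enc b) :=
    Finset.sum_congr rfl fun j _ => (of_mul_eq_smul _ _).symm
  rw [h3, dotProduct, dotProduct]
  simp only [h1, h2]
  rfl

theorem does_v : Does M L P.bnd (CoreState.enc (P := P) (W := W))
    (fun _ σ => PMF.pure (σ.setV (simV σ.pp σ.x σ.t))) 22 := by
  have hB := four_le_bnd (P := P)
  have hcard : Fintype.card ((Fin 2 × Fin P.n) ⊕ Unit) ≤ P.bnd := le_bnd (by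
    simp only [Fintype.card_sum, Fintype.card_prod, Fintype.card_fin, Fintype.card_unit,
      Params.size, Params.n]
    omega)
  refine (Does.setFam hB hcard (injective_treg v_inj) (a := 20)
    (f := Sum.elim (fun r s => (∑ c, regATilde s r c * s (treg (.z1 c))) -
      s (treg .c) * s (sreg (.pk r.1 r.2))) fun _ => regV) ?_ ?_ ?_)
  · rintro (r | _)
    · exact ((Comp.sum hB card_MIdx_le fun c => (comp_regATilde r c).mul hB (Comp.reg hB _)).sub hB
        ((Comp.reg hB _).mul hB (Comp.reg hB _))).mono hB (by norm_num)
    · exact comp_regV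
  · rintro (r | _) j s x _
    · simp [regATilde]
    · simp [regV, regCTilde, regUTilde]
  · intro σ
    rw [← extend_v]
    congr 1
    ext i
    rcases i with r | _
    · rw [simV, matT_mulVec]
      rfl
    · exact regV_enc σ

end CoreState

end

section

variable {P : Params}

/-! ### Simulated transcripts -/

/-- The transcript in which the commitments of the third message are computed from the rest. -/
def simTr (pp : PP P) (x : Stmt P) (f : Fin P.κ → P.Rq) (u1 : P.E → P.Rq) (u2 : P.Rq) (R : ChR P)
    (dd : ChD P) (c : ChC P) (z1 : P.MIdx × Fin P.d → ℤ) (z2 : Fin P.n × Fin P.d → ℤ)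
    (z3 : P.J → ℤ) (h : P.Rq) : Transcript P :=
  let t : Transcript P := ⟨⟨f, u1, u2⟩, R, redVec P.q z3, dd, ⟨h, 0, 0⟩, c,
    ⟨redVec P.q z1, redVec P.q z2⟩⟩
  { t with m3 := ⟨h, simW pp t, simV pp x t⟩ }

/-- The projection `Rℓ` modulo `q`. -/
def projQ (x : Stmt P) (m : P.MIdx → Fin P.d → SignType) (R : ChR P) : P.E → P.Rq :=
  redVec P.q (projVec x m R)

/-- The difference between `h` and the mask `g`. -/
def hShift (x : Stmt P) (m : P.MIdx → Fin P.d → SignType) (R : ChR P) (dd : ChD P) : P.Rq :=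
  ∑ j, dd j • ((fun b => conj (rvec R j b)) ⬝ᵥ x.ell (ternVec P.q m) -
    (fun a => conj (evec j a)) ⬝ᵥ projQ x m R)

/-- The honest transcript as a function of the responses and of the products of the key and the
randomness. -/
def lweTr (pp : PP P) (x : Stmt P) (m : P.MIdx → Fin P.d → SignType) (t1 : Fin P.κ → P.Rq)
    (t2 : P.E → P.Rq) (t3 : P.Rq) (R : ChR P) (dd : ChD P) (c : ChC P)
    (z1 : P.MIdx × Fin P.d → ℤ) (z2 : Fin P.n × Fin P.d → ℤ) (z3 : P.J → ℤ) (h : P.Rq) :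
    Transcript P :=
  simTr pp x (t1 + pp.A3 *ᵥ ternVec P.q m) (t2 + (redVec P.q z3 - projQ x m R))
    (t3 + (h - hShift x m R dd)) R dd c z1 z2 z3 h

theorem redVec_sub {ι : Type} {q d : ℕ} (a b : ι × Fin d → ℤ) :
    redVec q (a - b) = redVec q a - redVec q b := by
  rw [eq_sub_iff_add_eq, ← redVec_add, sub_add_cancel]

theorem hShift_eq (x : Stmt P) (m : P.MIdx → Fin P.d → SignType) (R : ChR P) (dd : ChD P)
    (z3 : P.J → ℤ) :
    rowC x R dd ⬝ᵥ ternVec P.q m + rowE dd ⬝ᵥ redVec P.q (z3 - projVec x m R) -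
      affine x R (redVec P.q z3) dd = hShift x m R dd := by
  rw [linear_relation_eq, hShift]
  refine Finset.sum_congr rfl fun j _ => ?_
  rw [redVec_sub, sub_sub_cancel_left, dotProduct_neg, ← sub_eq_add_neg]
  rfl

/-- For honest values the relation holds exactly modulo `q`. Therefore shifting the mask by `hShift`
commutes with removing the constant coefficient. -/
theorem coeff_hShift (x : Stmt P) (m : P.MIdx → Fin P.d → SignType) (R : ChR P) (dd : ChD P) :
    coeff (hShift x m R dd) 0 = 0 := by
  rw [← hShift_eq x m R dd 0, coeff_linear_relation]
  refine Finset.sum_eq_zero fun j _ => ?_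
  have h := projErr_honest x m (0 - projVec x m R) R j
  rw [sub_add_cancel] at h
  rw [h, mul_zero]

/-- Given the responses, `w` and `v` are forced by the verification equations, `y₃ = z₃ - Rℓ`, and
the mask in `u₂` is `h - hShift`. The randomness `s` is left only in the three products with the
key. -/
theorem honestTrZ_eq (pp : PP P) (x : Stmt P) (m : P.MIdx → Fin P.d → SignType)
    (hm : x.ATilde *ᵥ ternVec P.q m = x.u)
    (sT : Fin P.n → Fin P.d → SignType) (g0 : P.Rq) (R : ChR P) (dd : ChD P) (c : ChC P)
    (z1 : P.MIdx × Fin P.d → ℤ) (z2 : Fin P.n × Fin P.d → ℤ) (z3 : P.J → ℤ) :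
    honestTrZ pp x m sT g0 R dd c z1 z2 z3 =
      lweTr pp x m (pp.A4 *ᵥ ternVec P.q sT) (pp.B1 *ᵥ ternVec P.q sT) (pp.B2 ⬝ᵥ ternVec P.q sT)
        R dd c z1 z2 z3 (dropConst (g0 + hShift x m R dd)) := by
  have hw := honestTr_w pp x m sT g0 (z1 - chalMul c m) (z2 - chalMul c sT)
    (z3 - projVec x m R) R dd c
  have hv := honestTr_v pp x m sT g0 (z1 - chalMul c m) (z2 - chalMul c sT)
    (z3 - projVec x m R) R dd c hm
  have hh : dropConst (g0 + hShift x m R dd) = dropConst g0 + hShift x m R dd := by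
    unfold dropConst
    rw [coeff_add, coeff_hShift, add_zero]
    abel
  have e1 : (honestTrZ pp x m sT g0 R dd c z1 z2 z3).m1 =
      ⟨pp.A4 *ᵥ ternVec P.q sT + pp.A3 *ᵥ ternVec P.q m,
        pp.B1 *ᵥ ternVec P.q sT + (redVec P.q z3 - projQ x m R),
        pp.B2 ⬝ᵥ ternVec P.q sT + (dropConst (g0 + hShift x m R dd) - hShift x m R dd)⟩ := by
    rw [hh, add_sub_cancel_right, projQ, ← redVec_sub, add_comm (pp.A4 *ᵥ ternVec P.q sT)]
    rfl
  have e3 : (honestTrZ pp x m sT g0 R dd c z1 z2 z3).z3 = redVec P.q z3 := by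
    simp only [honestTrZ, honestTr, sub_add_cancel]
  have e4 : (honestTrZ pp x m sT g0 R dd c z1 z2 z3).m4 = ⟨redVec P.q z1, redVec P.q z2⟩ := by
    simp only [honestTrZ, honestTr, sub_add_cancel]
  have e5 : (honestTrZ pp x m sT g0 R dd c z1 z2 z3).m3.h =
      dropConst (g0 + hShift x m R dd) := by
    rw [hh, ← hShift_eq x m R dd z3]
    simp only [honestTrZ, honestTr, sub_add_cancel]
    rfl
  set t := honestTrZ pp x m sT g0 R dd c z1 z2 z3 with ht
  have hw' : t.m3.w = simW pp t := by
    rw [simW]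
    exact eq_sub_of_add_eq hw.symm
  have hv' : t.m3.v = simV pp x t := hv
  have key : ∀ t' : Transcript P, t'.m3.w = simW pp t' → t'.m3.v = simV pp x t' →
      t' = ⟨t'.m1, t'.R, t'.z3, t'.dd, ⟨t'.m3.h, simW pp t', simV pp x t'⟩, t'.c, t'.m4⟩ := by
    rintro ⟨m1, R, z3, dd, ⟨h, w, v⟩, c, m4⟩ h1 h2
    simp only at h1 h2
    rw [← h1, ← h2]
  rw [key t hw' hv']
  simp only [lweTr, simTr, simW, simV, e1, e3, e4, e5]
  rfl

/-! ### Translation of uniform elements -/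

theorem ex_comp_equiv {α : Type} {μ : PMF α} (e : α ≃ α) (he : ∀ a, μ (e a) = μ a)
    (F : α → ℝ≥0∞) : ex μ (fun a => F (e a)) = ex μ F := by
  unfold ex
  rw [← e.tsum_eq fun a => μ a * F a]
  simp only [he]

theorem unif_apply (y : P.Rq) :
    P.unif y = PMF.uniformOfFintype (Fin P.d → ZMod P.q) 0 := by
  classical
  rw [Params.unif, PMF.map_apply, tsum_eq_single (coeff y)]
  · rw [if_pos (ofCoeffs_coeff y).symm]
    simp only [PMF.uniformOfFintype_apply]
  · intro a ha
    rw [if_neg]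
    intro h
    refine ha (funext fun k => ?_)
    rw [h, coeff_ofCoeffs]

theorem ex_unif_add (y : P.Rq) (F : P.Rq → ℝ≥0∞) : ex P.unif (fun t => F (t + y)) = ex P.unif F :=
  ex_comp_equiv (Equiv.addRight y) (fun t => by rw [unif_apply, unif_apply]) F

theorem ex_iid_unif_add {κ : Type} [Fintype κ] (y : κ → P.Rq) (F : (κ → P.Rq) → ℝ≥0∞) :
    ex (iid κ P.unif) (fun t => F (t + y)) = ex (iid κ P.unif) F :=
  ex_comp_equiv (Equiv.addRight y) (fun t => by simp only [iid_apply, unif_apply]) F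

/-! ### Ideal, LWE and simulated expectations -/

/-- The expectation over the challenges and the responses. -/
def exResp (P : Params) (F : ChR P → ChD P → ChC P → (P.MIdx × Fin P.d → ℤ) →
    (Fin P.n × Fin P.d → ℤ) → (P.J → ℤ) → P.Rq → ℝ≥0∞) : ℝ≥0∞ :=
  ex (distR P) fun R => ex (distD P) fun dd => ex P.chal fun c => ex (distY1 P) fun z1 =>
    ex (distY2 P) fun z2 => ex (distY3 P) fun z3 => ex P.unif fun h => F R dd c z1 z2 z3 (dropConst h)

/-- As `g0` is uniform, it may be translated by `hShift`; then `h` is independent of the secrets. -/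
theorem exIdeal_eq (pp : PP P) (x : Stmt P) (m : P.MIdx → Fin P.d → SignType)
    (hm : x.ATilde *ᵥ ternVec P.q m = x.u) (G : Transcript P → ℝ≥0∞) :
    exIdeal pp x m G = ex (distS P) fun sT => exResp P fun R dd c z1 z2 z3 h =>
      G (lweTr pp x m (pp.A4 *ᵥ ternVec P.q sT) (pp.B1 *ᵥ ternVec P.q sT)
        (pp.B2 ⬝ᵥ ternVec P.q sT) R dd c z1 z2 z3 h) := by
  unfold exIdeal exResp
  congr 1; ext sT
  rw [ex_comm]; congr 1; ext R
  rw [ex_comm]; congr 1; ext dd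
  rw [ex_comm]; congr 1; ext c
  rw [ex_comm]; congr 1; ext z1
  rw [ex_comm]; congr 1; ext z2
  rw [ex_comm]; congr 1; ext z3
  simp only [honestTrZ_eq pp x m hm]
  exact ex_unif_add (hShift x m R dd) fun h => G (lweTr pp x m _ _ _ R dd c z1 z2 z3 (dropConst h))

theorem ex_exResp {α : Type} (μ : PMF α) (F : α → ChR P → ChD P → ChC P →
    (P.MIdx × Fin P.d → ℤ) → (Fin P.n × Fin P.d → ℤ) → (P.J → ℤ) → P.Rq → ℝ≥0∞) :
    ex μ (fun a => exResp P (F a)) = exResp P fun R dd c z1 z2 z3 h =>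
      ex μ fun a => F a R dd c z1 z2 z3 h := by
  unfold exResp
  rw [ex_comm]; congr 1; ext R
  rw [ex_comm]; congr 1; ext dd
  rw [ex_comm]; congr 1; ext c
  rw [ex_comm]; congr 1; ext z1
  rw [ex_comm]; congr 1; ext z2
  rw [ex_comm]; congr 1; ext z3
  rw [ex_comm]

/-- The expectation over simulated transcripts. -/
def exSim (pp : PP P) (x : Stmt P) (G : Transcript P → ℝ≥0∞) : ℝ≥0∞ :=
  ex (iid (Fin P.κ) P.unif) fun f => ex (iid P.E P.unif) fun u1 => ex P.unif fun u2 =>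
    exResp P fun R dd c z1 z2 z3 h => G (simTr pp x f u1 u2 R dd c z1 z2 z3 h)

/-- Translation invariance of the uniform distribution removes every dependence on `m`. The shifts
depend on challenges and responses, so the uniform vectors are first moved inside `exResp`. -/
theorem exSim_eq (pp : PP P) (x : Stmt P) (m : P.MIdx → Fin P.d → SignType)
    (G : Transcript P → ℝ≥0∞) :
    (ex (iid (Fin P.κ) P.unif) fun t1 => ex (iid P.E P.unif) fun t2 => ex P.unif fun t3 =>
      exResp P fun R dd c z1 z2 z3 h => G (lweTr pp x m t1 t2 t3 R dd c z1 z2 z3 h)) =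
      exSim pp x G := by
  unfold exSim lweTr
  simp only [ex_exResp]
  congr 1; ext R dd c z1 z2 z3 h
  have s3 : ∀ f u1, ex P.unif (fun t3 =>
      G (simTr pp x f u1 (t3 + (h - hShift x m R dd)) R dd c z1 z2 z3 h)) =
      ex P.unif fun u2 => G (simTr pp x f u1 u2 R dd c z1 z2 z3 h) := fun f u1 =>
    ex_unif_add _ fun u2 => G (simTr pp x f u1 u2 R dd c z1 z2 z3 h)
  simp only [s3]
  rw [ex_iid_unif_add (pp.A3 *ᵥ ternVec P.q m) fun f => ex (iid P.E P.unif) fun t2 =>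
    ex P.unif fun t3 => G (simTr pp x f (t2 + (redVec P.q z3 - projQ x m R)) t3 R dd c z1 z2 z3 h)]
  congr 1; ext f
  exact ex_iid_unif_add (redVec P.q z3 - projQ x m R) fun u1 => ex P.unif fun u2 =>
    G (simTr pp x f u1 u2 R dd c z1 z2 z3 h)

/-! ### The rejection steps -/

/-- Conditioning on non-abortion changes probabilities only slightly. -/
theorem abs_div_sub_le {p₁ p₀ I₁ I₀ : ℝ} (h1 : p₁ ≤ I₁ / 27) (h0 : p₀ ≤ I₀ / 27) (hp1 : 0 ≤ p₁)
    (hp0 : 0 ≤ p₀) (hI : I₁ + I₀ = 1) (hm : 1 / 27 * (1 - 1 / 2 ^ 101) ≤ p₁ + p₀) :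
    |p₁ / (p₁ + p₀) - I₁| ≤ 1 / 2 ^ 100 := by
  have hb : 0 < p₁ + p₀ := lt_of_lt_of_le (by norm_num) hm
  have hI1 : 0 ≤ I₁ := by linarith
  have hI0 : 0 ≤ I₀ := by linarith
  rw [abs_le]
  constructor
  -- The lower bound uses the upper bound for the complementary event: `p₁` is the total minus `p₀`,
  -- and `p₀ ≤ I₀/27`.
  · rw [le_sub_iff_add_le, le_div_iff₀ hb]
    nlinarith
  · rw [sub_le_iff_le_add, div_le_iff₀ hb]
    nlinarith

end

section

variable {P : Params}

/-! ### The simulator -/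

section Simulator

/-- Programs as instructions of a machine without parameter. -/
def progMachine (P : Params) (ι : Type) : Machine P ι where
  I := Instr P ι
  Θ := Unit
  step _ := Instr.run
  emb := id
  step_emb _ _ _ := rfl

variable {W ι : Type} {M : Machine P ι} {L : Layout (Core P ⊕ W) ι}

/-- Sampling of the challenges, the responses and `h`. -/
def kSamp (σ : CoreState P W) : PMF (CoreState P W) :=
  ((distR P).map σ.setR).bind fun σ => ((distD P).map σ.setDd).bind fun σ =>
    (P.chal.map σ.setC).bind fun σ => ((distY1 P).map fun y => σ.setZ1 (redVec P.q y)).bind fun σ =>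
      ((distY2 P).map fun y => σ.setZ2 (redVec P.q y)).bind fun σ =>
        ((distY3 P).map fun y => σ.setZ3 (redVec P.q y)).bind fun σ =>
          P.unif.map fun y => σ.setH (dropConst y)

theorem does_samp : Does M L P.bnd (CoreState.enc (P := P) (W := W)) (fun _ => kSamp) 12 := by
  have hB := four_le_bnd (P := P)
  exact (does_r.seq hB (does_dd.seq hB (does_c.seq hB (does_z1.seq hB (does_z2.seq hB
    (does_z3.seq hB does_h)))))).mono hB (by norm_num)

theorem ex_kSamp (σ : CoreState P W) (F : CoreState P W → ℝ≥0∞) :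
    ex (kSamp σ) F = exResp P fun R dd c z1 z2 z3 h =>
      F (((((((σ.setR R).setDd dd).setC c).setZ1 (redVec P.q z1)).setZ2 (redVec P.q z2)).setZ3
        (redVec P.q z3)).setH h) := by
  simp only [kSamp, exResp, ex_bind, ex_map]

/-- Computation of the commitments of the third message. -/
def kThird (σ : CoreState P W) : PMF (CoreState P W) :=
  (PMF.pure (σ.setW (simW σ.pp σ.t))).bind fun σ => PMF.pure (σ.setV (simV σ.pp σ.x σ.t))

theorem does_third : Does M L P.bnd (CoreState.enc (P := P) (W := W)) (fun _ => kThird) 23 :=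
  (does_w.seq four_le_bnd does_v).mono four_le_bnd (by norm_num)

/-- The simulator on abstract states. -/
def kSim (σ : CoreState P W) : PMF (CoreState P W) :=
  ((iid (Fin P.κ) P.unif).map σ.setF).bind fun σ => ((iid P.E P.unif).map σ.setU1).bind fun σ =>
    (P.unif.map σ.setU2).bind fun σ => (kSamp σ).bind kThird

theorem does_sim : Does M L P.bnd (CoreState.enc (P := P) (W := W)) (fun _ => kSim) 27 := by
  have hB := four_le_bnd (P := P)
  exact (does_f.seq hB (does_u1.seq hB (does_u2.seq hB (does_samp.seq hB does_third)))).mono hB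
    (by norm_num)

theorem ex_kSim (σ : CoreState P W) (F : CoreState P W → ℝ≥0∞) :
    ex (kSim σ) F = exSim σ.pp σ.x fun t => F { σ with t := t } := by
  simp only [kSim, ex_bind, ex_map, ex_kSamp, kThird, ex_pure, exSim, simTr, simW, simV,
    CoreState.setF, CoreState.setU1, CoreState.setU2, CoreState.setR, CoreState.setDd,
    CoreState.setC, CoreState.setZ1, CoreState.setZ2, CoreState.setZ3, CoreState.setH,
    CoreState.setW, CoreState.setV]

/-- The transcript with vanishing entries. -/
def zeroTr (P : Params) : Transcript P :=
  ⟨⟨0, 0, 0⟩, fun _ _ _ => 0, 0, 0, ⟨0, 0, 0⟩, fun _ => 0, ⟨0, 0⟩⟩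

theorem tern_zero {q d : ℕ} : tern (ZMod q) (fun _ : Fin d => 0) = 0 := by
  simp [tern, ofCoeffs]

theorem zeroTr_enc (v : TVar P) : (zeroTr P).enc v = 0 := by
  cases v <;> simp [zeroTr, Transcript.enc, rvec, tern_zero]

/-- The registers of the simulator. -/
def simLayout (P : Params) :
    Layout (Core P ⊕ Empty) (Regs (PPVar P ⊕ StmtVar P) (TVar P)) where
  reg := Sum.elim (Sum.elim Sum.inl fun t => Sum.inr (Sum.inl t)) Empty.elim
  tmp n := Sum.inr (Sum.inr n)
  reg_inj := by
    rintro ((v | v) | v) ((w | w) | w) h <;> first | exact v.elim | exact w.elim | simp_all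
  tmp_inj n k h := by simpa using h
  disj := by
    rintro ((v | v) | v) n <;> first | exact v.elim | simp

theorem exists_simulator (P : Params) : ∃ S : Prog P (PPVar P ⊕ StmtVar P) (TVar P),
    S.length ≤ P.bnd ^ 27 ∧ ∀ (pp : PP P) (x : Stmt P) (F : (TVar P → P.Rq) → ℝ≥0∞),
      ex (S.out (Sum.elim pp.enc x.enc)) F = exSim pp x fun t => F t.enc := by
  obtain ⟨C, hC, h⟩ := (does_sim (M := progMachine P _) (L := simLayout P)).run
  refine ⟨C, hC, fun pp x F => ?_⟩
  have h1 := h () (initState (Sum.elim pp.enc x.enc)) ⟨pp, x, zeroTr P, Empty.elim⟩ (by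
    ext v
    rcases v with ((v | v) | v) | v
    · rfl
    · rfl
    · exact (zeroTr_enc v).symm
    · exact v.elim)
  have h2 : Prog.out (P := P) C (Sum.elim pp.enc x.enc) =
      ((runList Instr.run C (initState (Sum.elim pp.enc x.enc))).map
        (· ∘ (simLayout P).reg)).map fun v o => v (Sum.inl (Sum.inr o)) := by
    rw [PMF.map_comp]
    rfl
  rw [h2]
  refine (congrArg (fun μ => ex (PMF.map _ μ) F) h1).trans ?_
  rw [ex_map, ex_map, ex_kSim]
  rfl

end Simulator

/-! ### The reduction -/

section Reduction

/-- The indices of the rows of an instance. -/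
def rowEquiv (P : Params) : (Fin P.κ ⊕ P.E) ⊕ Fin 1 ≃ Fin (P.κ + 256 / P.d + 1) :=
  (Equiv.sumCongr finSumFinEquiv (Equiv.refl _)).trans finSumFinEquiv

/-- Registers of the reduction: the instance, and those of a distinguisher. -/
abbrev RedW (P : Params) : Type := LWEVar (Fin (P.κ + 256 / P.d + 1)) (Fin P.n) ⊕ (Unit ⊕ ℕ)

/-- The commitment key that consists of a matrix `A₃` and an instance. -/
def lwePP (A3 : Matrix (Fin P.κ) P.MIdx P.Rq)
    (M : Matrix (Fin (P.κ + 256 / P.d + 1)) (Fin P.n) P.Rq) : PP P :=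
  ⟨A3, fun i => M (rowEquiv P (Sum.inl (Sum.inl i))), fun a => M (rowEquiv P (Sum.inl (Sum.inr a))),
    M (rowEquiv P (Sum.inr 0))⟩

theorem ppVar_surj : Function.Surjective (Sum.elim (fun p : Fin P.κ × P.MIdx => PPVar.A3 p.1 p.2)
    (Sum.elim (fun p : Fin P.κ × Fin P.n => PPVar.A4 p.1 p.2)
      (Sum.elim (fun p : P.E × Fin P.n => PPVar.B1 p.1 p.2) (PPVar.B2 (P := P))))) := by
  rintro (⟨i, j⟩ | ⟨i, j⟩ | ⟨i, j⟩ | j)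
  · exact ⟨Sum.inl (i, j), rfl⟩
  · exact ⟨Sum.inr (Sum.inl (i, j)), rfl⟩
  · exact ⟨Sum.inr (Sum.inr (Sum.inl (i, j))), rfl⟩
  · exact ⟨Sum.inr (Sum.inr (Sum.inr j)), rfl⟩

open Classical in
instance : Fintype (PPVar P) := Fintype.ofSurjective _ ppVar_surj

theorem card_ppVar_le : Fintype.card (PPVar P) ≤ P.bnd := by
  refine (Fintype.card_le_of_surjective _ ppVar_surj).trans ?_
  have h : 256 / P.d ≤ 256 := Nat.div_le_self _ _
  have h2 : 256 / P.d * (P.κ + P.lam + 3) ≤ 256 * (P.κ + P.lam + 3) := Nat.mul_le_mul_right _ h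
  simp only [Fintype.card_sum, Fintype.card_prod, Fintype.card_fin, Params.bnd, Params.size,
    Params.n]
  nlinarith [Nat.zero_le (P.κ * P.lam), Nat.zero_le (P.κ * P.d), Nat.zero_le (P.lam * P.d),
    Nat.zero_le (P.κ * P.κ), Nat.zero_le (P.lam * P.lam), Nat.zero_le (P.d * P.d)]

/-- The constructors for registers of statements. -/
def stmtVarOf (P : Params) : (Fin P.κ × Fin P.n) ⊕ ((Fin 2 × Fin P.n) ⊕ ((Fin P.κ ⊕ Fin P.κ) ⊕ Fin 6)) →
    StmtVar P :=
  Sum.elim (fun p => .A p.1 p.2) (Sum.elim (fun p => .pk p.1 p.2)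
    (Sum.elim (Sum.elim .c0 .c0') ![.c1, .c2, .c3, .c1', .c2', .c3']))

theorem stmtVarOf_surj : Function.Surjective (stmtVarOf P) := by
  rintro (⟨i, j⟩ | ⟨i, j⟩ | i | _ | _ | _ | i | _ | _ | _)
  · exact ⟨Sum.inl (i, j), rfl⟩
  · exact ⟨Sum.inr (Sum.inl (i, j)), rfl⟩
  · exact ⟨Sum.inr (Sum.inr (Sum.inl (Sum.inl i))), rfl⟩
  · exact ⟨Sum.inr (Sum.inr (Sum.inr 0)), rfl⟩
  · exact ⟨Sum.inr (Sum.inr (Sum.inr 1)), rfl⟩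
  · exact ⟨Sum.inr (Sum.inr (Sum.inr 2)), rfl⟩
  · exact ⟨Sum.inr (Sum.inr (Sum.inl (Sum.inr i))), rfl⟩
  · exact ⟨Sum.inr (Sum.inr (Sum.inr 3)), rfl⟩
  · exact ⟨Sum.inr (Sum.inr (Sum.inr 4)), rfl⟩
  · exact ⟨Sum.inr (Sum.inr (Sum.inr 5)), rfl⟩

open Classical in
instance : Fintype (StmtVar P) := Fintype.ofSurjective _ stmtVarOf_surj

theorem card_stmtVar_le : Fintype.card (StmtVar P) ≤ P.bnd := by
  refine (Fintype.card_le_of_surjective _ stmtVarOf_surj).trans ?_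
  simp only [Fintype.card_sum, Fintype.card_prod, Fintype.card_fin, Params.bnd, Params.size,
    Params.n]
  nlinarith [Nat.zero_le (P.κ * P.lam), Nat.zero_le (P.κ * P.d), Nat.zero_le (P.lam * P.d),
    Nat.zero_le (P.κ * P.κ), Nat.zero_le (P.lam * P.lam), Nat.zero_le (P.d * P.d)]

theorem tVar_countable : Countable (TVar P) := by
  let g : Fin P.κ ⊕ P.E ⊕ Unit ⊕ (P.J × Fin 2) ⊕ P.E ⊕ P.J ⊕ Unit ⊕ Fin P.κ ⊕
      ((Fin 2 × Fin P.n) ⊕ Unit) ⊕ Unit ⊕ P.MIdx ⊕ Fin P.n → TVar P :=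
    Sum.elim .f (Sum.elim .u1 (Sum.elim (fun _ => .u2) (Sum.elim (fun p => .r p.1 p.2)
      (Sum.elim .z3 (Sum.elim .dd (Sum.elim (fun _ => .h) (Sum.elim .w (Sum.elim .v
        (Sum.elim (fun _ => .c) (Sum.elim .z1 .z2))))))))))
  refine Function.Surjective.countable (f := g) ?_
  rintro (i | a | _ | ⟨j, b⟩ | a | j | _ | i | i | _ | i | i)
  · exact ⟨.inl i, rfl⟩
  · exact ⟨.inr (.inl a), rfl⟩
  · exact ⟨.inr (.inr (.inl ())), rfl⟩
  · exact ⟨.inr (.inr (.inr (.inl (j, b)))), rfl⟩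
  · exact ⟨.inr (.inr (.inr (.inr (.inl a)))), rfl⟩
  · exact ⟨.inr (.inr (.inr (.inr (.inr (.inl j))))), rfl⟩
  · exact ⟨.inr (.inr (.inr (.inr (.inr (.inr (.inl ())))))), rfl⟩
  · exact ⟨.inr (.inr (.inr (.inr (.inr (.inr (.inr (.inl i))))))), rfl⟩
  · exact ⟨.inr (.inr (.inr (.inr (.inr (.inr (.inr (.inr (.inl i)))))))), rfl⟩
  · exact ⟨.inr (.inr (.inr (.inr (.inr (.inr (.inr (.inr (.inr (.inl ()))))))))), rfl⟩
  · exact ⟨.inr (.inr (.inr (.inr (.inr (.inr (.inr (.inr (.inr (.inr (.inl i)))))))))), rfl⟩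
  · exact ⟨.inr (.inr (.inr (.inr (.inr (.inr (.inr (.inr (.inr (.inr (.inr i)))))))))), rfl⟩

/-- Work registers are numbered by `ℕ`, so an injection suffices for placing key, statement and
transcript there; it does not affect running time. -/
theorem exists_core_encoding (P : Params) : ∃ f : Core P → ℕ, Function.Injective f := by
  have := tVar_countable (P := P)
  have : Countable (PPVar P) := Finite.to_countable
  have : Countable (StmtVar P) := Finite.to_countable
  exact Countable.exists_injective_nat _

/-- The registers of the reduction. -/
def redLayout (P : Params) : Layout (Core P ⊕ RedW P)
    (Regs (LWEVar (Fin (P.κ + 256 / P.d + 1)) (Fin P.n)) Unit) where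
  -- Work registers are divided by residues modulo `3`: prepared data, work registers of the
  -- distinguisher, scratch. The distinguisher's own registers must still be zero when it starts.
  reg := Sum.elim (fun v => Sum.inr (Sum.inr (3 * (exists_core_encoding P).choose v)))
    (Sum.elim Sum.inl (Sum.elim (fun u => Sum.inr (Sum.inl u))
      fun n => Sum.inr (Sum.inr (3 * n + 1))))
  tmp n := Sum.inr (Sum.inr (3 * n + 2))
  reg_inj := by
    have h := (exists_core_encoding P).choose_spec
    rintro (v | v | v | v) (w | w | w | w) hvw <;> simp at hvw
    · rw [h hvw]
    · omega
    · rw [hvw]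
    · rfl
    · omega
    · rw [hvw]
  tmp_inj n k h := by simpa using h
  disj := by
    rintro (v | v | v | v) n <;> simp <;> omega

end Reduction

end

section

variable {P : Params}

section Reduction

variable {ι : Type} {M : Machine P ι} {L : Layout (Core P ⊕ RedW P) ι}

abbrev lweMat (i : Fin (P.κ + 256 / P.d + 1)) (j : Fin P.n) : Core P ⊕ RedW P :=
  Sum.inr (Sum.inl (.mat i j))
abbrev lweVec (i : Fin (P.κ + 256 / P.d + 1)) : Core P ⊕ RedW P := Sum.inr (Sum.inl (.vec i))

/-- The matrix of the instance. -/
def CoreState.lweM (σ : CoreState P (RedW P)) : Matrix (Fin (P.κ + 256 / P.d + 1)) (Fin P.n) P.Rq :=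
  fun i j => σ.w (Sum.inl (.mat i j))

/-- The vector of the instance. -/
def CoreState.lweT (σ : CoreState P (RedW P)) : Fin (P.κ + 256 / P.d + 1) → P.Rq :=
  fun i => σ.w (Sum.inl (.vec i))

theorem iid_unif_matrix (r c : Type) [Fintype r] [Fintype c] :
    iid (r × c) P.unif = (unifMatrix P r c).map fun A p => A p.1 p.2 := by
  refine pmf_ext_ex fun F => ?_
  rw [ex_iid_curry, ex_map]
  rfl

theorem does_A3 : Does M L P.bnd CoreState.enc (fun _ (σ : CoreState P (RedW P)) =>
    (unifMatrix P (Fin P.κ) P.MIdx).map fun A => { σ with pp := { σ.pp with A3 := A } }) 1 := by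
  have hr : Function.Injective fun p : Fin P.κ × P.MIdx =>
      (preg (.A3 p.1 p.2) : Core P ⊕ RedW P) := by
    rintro ⟨i, j⟩ ⟨i', j'⟩ h
    simpa using h
  refine Does.sampleFam ?_ hr .unif (iid_unif_matrix _ _) fun σ A =>
    extend_eq (s' := CoreState.enc { σ with pp := { σ.pp with A3 := A } }) hr (fun _ => rfl) ?_
  · refine le_trans ?_ (card_ppVar_le (P := P))
    exact Fintype.card_le_of_injective (fun p : Fin P.κ × P.MIdx => PPVar.A3 p.1 p.2) fun p p' h =>
      hr (congrArg preg h)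
  · rintro (((v | v) | v) | v) h
    · cases v <;> first | rfl | exact absurd rfl (h (_, _))
    · rfl
    · rfl
    · rfl

/-- The rows of the instance become `A₄`, `B'`, `B''`; the independent matrix `A₃` has been sampled
by the reduction itself. -/
theorem does_ppCopy : Does M L P.bnd CoreState.enc (fun _ (σ : CoreState P (RedW P)) =>
    PMF.pure { σ with pp := lwePP σ.pp.A3 σ.lweM }) 3 := by
  have hB := four_le_bnd (P := P)
  have hr : Function.Injective (preg : PPVar P → Core P ⊕ RedW P) := fun v w h => by simpa using h
  let g : PPVar P → Core P ⊕ RedW P := fun v => match v with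
    | .A3 i j => preg (.A3 i j)
    | .A4 i j => lweMat (rowEquiv P (Sum.inl (Sum.inl i))) j
    | .B1 a j => lweMat (rowEquiv P (Sum.inl (Sum.inr a))) j
    | .B2 j => lweMat (rowEquiv P (Sum.inr 0)) j
  refine Does.setFam hB card_ppVar_le hr (f := fun v s => s (g v)) (fun v => Comp.reg hB _) ?_
    fun σ => extend_eq (s' := CoreState.enc { σ with pp := lwePP σ.pp.A3 σ.lweM }) hr ?_ ?_
  · rintro v w s y hvw
    cases v <;> simp [g, hvw.symm]
  · rintro (v | v | v | v) <;> rfl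
  · rintro (((v | v) | v) | v) h
    · exact absurd rfl (h v)
    · rfl
    · rfl
    · rfl

/-- The reduction may depend on the statement and on the honest secret key, so both can be written
into the program as constants. -/
theorem does_stmtConst (x : Stmt P) : Does M L P.bnd CoreState.enc
    (fun _ (σ : CoreState P (RedW P)) => PMF.pure { σ with x := x }) 2 := by
  have hB := four_le_bnd (P := P)
  have hr : Function.Injective (sreg : StmtVar P → Core P ⊕ RedW P) := fun v w h => by simpa using h
  refine Does.setFam hB card_stmtVar_le hr (f := fun v _ => x.enc v) (fun v => Comp.const _) ?_
    fun σ => extend_eq (s' := CoreState.enc { σ with x := x }) hr ?_ ?_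
  · exact fun _ _ _ _ _ => rfl
  · exact fun _ => rfl
  · rintro (((v | v) | v) | v) h
    · rfl
    · exact absurd rfl (h v)
    · rfl
    · rfl

/-- The projection `Rℓ` computed from registers. -/
def regProj (x : Stmt P) (m : P.MIdx → Fin P.d → SignType) (s : Core P ⊕ RedW P → P.Rq) (a : P.E) :
    P.Rq :=
  ∑ k : Fin P.d, AdjoinRoot.of _ (coeff (∑ b, PoE.conj (s (treg (.r (a, k) b))) *
    x.ell (ternVec P.q m) b) 0) * rt (ZMod P.q) P.d ^ (k : ℕ)

/-- The difference between `h` and the mask, computed from registers. -/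
def regShift (x : Stmt P) (m : P.MIdx → Fin P.d → SignType) (s : Core P ⊕ RedW P → P.Rq) : P.Rq :=
  ∑ j, s (treg (.dd j)) * ((∑ b, PoE.conj (s (treg (.r j b))) * x.ell (ternVec P.q m) b) -
    ∑ a, PoE.conj (evec j a) * regProj x m s a)

variable (x : Stmt P) (m : P.MIdx → Fin P.d → SignType)

theorem comp_regProj (a : P.E) : Comp (P := P) L P.bnd (fun s => regProj x m s a) 9 := by
  have hB := four_le_bnd (P := P)
  exact (Comp.sum hB card_fin_d fun k => ((Comp.sum hB card_two_le fun b =>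
    ((Comp.reg hB _).conj hB).mul hB (Comp.const _)).coeff hB 0).mul hB (Comp.const _)).mono hB
      (by norm_num)

theorem comp_regShift : Comp (P := P) L P.bnd (regShift x m) 17 := by
  have hB := four_le_bnd (P := P)
  exact (Comp.sum hB card_J_le fun j => (Comp.reg hB _).mul hB ((Comp.sum hB card_two_le fun b =>
    ((Comp.reg hB _).conj hB).mul hB (Comp.const _)).sub hB (Comp.sum hB card_E fun a =>
      (Comp.const _).mul hB (comp_regProj x m a)))).mono hB (by norm_num)

/-- Integer inner products are recovered through `σ₋₁`: each entry of `Rℓ` modulo `q` is the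
constant coefficient of a ring product. -/
theorem regProj_enc (σ : CoreState P (RedW P)) (a : P.E) :
    regProj x m σ.enc a = projQ x m σ.t.R a := by
  refine coeff_ext fun k => ?_
  have h : ∀ k : Fin P.d, coeff (∑ b, PoE.conj (σ.enc (treg (.r (a, k) b))) *
      x.ell (ternVec P.q m) b) 0 = ((projVec x m σ.t.R (a, k) : ℤ) : ZMod P.q) := by
    intro k
    refine (coeff_conj_rvec_dotProduct σ.t.R (a, k) (x.ell (ternVec P.q m))).trans ?_
    unfold projVec
    simp only [Int.cast_sum, Int.cast_mul, cent_cast]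
    rfl
  unfold regProj projQ redVec
  simp only [h]
  rfl

theorem regShift_enc (σ : CoreState P (RedW P)) :
    regShift x m σ.enc = hShift x m σ.t.R σ.t.dd := by
  unfold regShift hShift
  refine Finset.sum_congr rfl fun j _ => ?_
  simp only [regProj_enc]
  exact of_mul_eq_smul _ _

theorem does_lweF : Does M L P.bnd CoreState.enc (fun _ (σ : CoreState P (RedW P)) =>
    PMF.pure (σ.setF ((fun i => σ.lweT (rowEquiv P (Sum.inl (Sum.inl i)))) +
      σ.pp.A3 *ᵥ ternVec P.q m))) 7 := by
  have hB := four_le_bnd (P := P)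
  refine (Does.setFam hB card_fin_κ (injective_treg f_inj)
    (f := fun i s => s (lweVec (rowEquiv P (Sum.inl (Sum.inl i)))) +
      ∑ j, s (preg (.A3 i j)) * ternVec P.q m j) (fun i => (Comp.reg hB _).add hB
        (Comp.sum hB card_MIdx_le fun j => (Comp.reg hB _).mul hB (Comp.const _))) ?_
    fun σ => extend_f σ _).mono hB (by norm_num)
  intro i j s y _
  simp

theorem does_lweU1 : Does M L P.bnd CoreState.enc (fun _ (σ : CoreState P (RedW P)) =>
    PMF.pure (σ.setU1 ((fun a => σ.lweT (rowEquiv P (Sum.inl (Sum.inr a)))) +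
      (σ.t.z3 - projQ x m σ.t.R)))) 14 := by
  have hB := four_le_bnd (P := P)
  refine (Does.setFam hB card_E (injective_treg u1_inj)
    (f := fun a s => s (lweVec (rowEquiv P (Sum.inl (Sum.inr a)))) +
      (s (treg (.z3 a)) - regProj x m s a)) (fun a => (Comp.reg hB _).add hB
        ((Comp.reg hB _).sub hB (comp_regProj x m a))) ?_ fun σ => ?_).mono hB (by norm_num)
  · intro i j s y _
    simp [regProj]
  · rw [← extend_u1]
    congr 1
    ext a
    rw [regProj_enc]
    rfl

theorem does_lweU2 : Does M L P.bnd CoreState.enc (fun _ (σ : CoreState P (RedW P)) =>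
    PMF.pure (σ.setU2 (σ.lweT (rowEquiv P (Sum.inr 0)) +
      (σ.t.m3.h - hShift x m σ.t.R σ.t.dd)))) 21 := by
  have hB := four_le_bnd (P := P)
  refine (Does.set hB (treg .u2) ((Comp.reg hB (lweVec (rowEquiv P (Sum.inr 0)))).add hB
    ((Comp.reg hB (treg .h)).sub hB (comp_regShift x m))) fun σ => ?_).mono hB (by norm_num)
  rw [regShift_enc]
  exact @update_u2 P _ (fun _ _ => Classical.propDecidable _) σ _

/-- The preparation of the input of a distinguisher from an instance. -/
def kRed (σ : CoreState P (RedW P)) : PMF (CoreState P (RedW P)) :=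
  ((unifMatrix P (Fin P.κ) P.MIdx).map fun A => { σ with pp := { σ.pp with A3 := A } }).bind fun σ =>
    (PMF.pure { σ with pp := lwePP σ.pp.A3 σ.lweM }).bind fun σ =>
      (PMF.pure { σ with x := x }).bind fun σ => (kSamp σ).bind fun σ =>
        (PMF.pure (σ.setF ((fun i => σ.lweT (rowEquiv P (Sum.inl (Sum.inl i)))) +
          σ.pp.A3 *ᵥ ternVec P.q m))).bind fun σ =>
          (PMF.pure (σ.setU1 ((fun a => σ.lweT (rowEquiv P (Sum.inl (Sum.inr a)))) +
            (σ.t.z3 - projQ x m σ.t.R)))).bind fun σ =>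
            (PMF.pure (σ.setU2 (σ.lweT (rowEquiv P (Sum.inr 0)) +
              (σ.t.m3.h - hShift x m σ.t.R σ.t.dd)))).bind kThird

theorem does_red : Does M L P.bnd CoreState.enc (fun _ => kRed x m) 30 := by
  have hB := four_le_bnd (P := P)
  exact (does_A3.seq hB (does_ppCopy.seq hB ((does_stmtConst x).seq hB (does_samp.seq hB
    ((does_lweF m).seq hB ((does_lweU1 x m).seq hB ((does_lweU2 x m).seq hB does_third))))))).mono
      hB (by norm_num)

theorem ex_kRed (σ : CoreState P (RedW P)) (F : CoreState P (RedW P) → ℝ≥0∞) :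
    ex (kRed x m σ) F = ex (unifMatrix P (Fin P.κ) P.MIdx) fun A3 =>
      exResp P fun R dd c z1 z2 z3 h => F ⟨lwePP A3 σ.lweM, x, lweTr (lwePP A3 σ.lweM) x m
        (fun i => σ.lweT (rowEquiv P (Sum.inl (Sum.inl i))))
        (fun a => σ.lweT (rowEquiv P (Sum.inl (Sum.inr a)))) (σ.lweT (rowEquiv P (Sum.inr 0)))
        R dd c z1 z2 z3 h, σ.w⟩ := by
  simp only [kRed, ex_bind, ex_map, ex_kSamp, kThird, ex_pure, lweTr, simTr, simW, simV,
    CoreState.setF, CoreState.setU1, CoreState.setU2, CoreState.setR, CoreState.setDd,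
    CoreState.setC, CoreState.setZ1, CoreState.setZ2, CoreState.setZ3, CoreState.setH,
    CoreState.setW, CoreState.setV]
  rfl

/-- The registers of a distinguisher among those of the reduction. -/
def distReg : Regs (PPVar P ⊕ TVar P) Unit → Core P ⊕ RedW P :=
  Sum.elim (Sum.elim preg treg) fun v => Sum.inr (Sum.inr v)

theorem distReg_inj : Function.Injective (distReg (P := P)) := by
  rintro ((v | v) | v) ((w | w) | w) h <;> simp_all [distReg]

theorem exists_reduction (D : Prog P (PPVar P ⊕ TVar P) Unit) :
    ∃ B : Prog P (LWEVar (Fin (P.κ + 256 / P.d + 1)) (Fin P.n)) Unit,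
      B.length ≤ D.length + P.bnd ^ 30 ∧ ∀ A t F, ex (B.bit (encLWE A t)) F =
        ex (unifMatrix P (Fin P.κ) P.MIdx) fun A3 => exResp P fun R dd c z1 z2 z3 h =>
          ex (D.bit (Sum.elim (lwePP A3 A).enc (lweTr (lwePP A3 A) x m
            (fun i => t (rowEquiv P (Sum.inl (Sum.inl i))))
            (fun a => t (rowEquiv P (Sum.inl (Sum.inr a)))) (t (rowEquiv P (Sum.inr 0)))
            R dd c z1 z2 z3 h).enc)) F := by
  classical
  obtain ⟨C, hC, h⟩ := (does_red (M := progMachine P _) (L := redLayout P) x m).run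
  change List (Instr P _) at C
  set φ := (redLayout P).reg ∘ distReg with hφ
  have hφi : Function.Injective φ := (redLayout P).reg_inj.comp distReg_inj
  refine ⟨C ++ D.map (Instr.rename φ), ?_, fun A t F => ?_⟩
  · rw [List.length_append, List.length_map, add_comm]
    exact Nat.add_le_add_left hC _
  · have h1 := h () (initState (encLWE A t)) ⟨⟨0, 0, 0, 0⟩, ⟨0, 0, ⟨0, 0, 0, 0⟩, ⟨0, 0, 0, 0⟩⟩,
      zeroTr P, Sum.elim (encLWE A t) 0⟩ (by
        ext v
        rcases v with ((v | v) | v) | v | v | v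
        · cases v <;> rfl
        · cases v <;> rfl
        · exact (zeroTr_enc v).symm
        · rfl
        · rfl
        · rfl)
    have h2 : Prog.out (P := P) (C ++ D.map (Instr.rename φ)) (encLWE A t) =
        ((runList Instr.run C (initState (encLWE A t))).map (· ∘ (redLayout P).reg)).bind fun v =>
          (runList Instr.run D (v ∘ distReg)).map fun st o => st (Sum.inr (Sum.inl o)) := by
      rw [Prog.out, runList_append, PMF.map_bind, PMF.bind_map]
      congr 1
      ext1 s
      have h3 := runList_rename hφi D s
      change _ = ((runList Instr.run D (s ∘ φ)).map fun st o => st (Sum.inr (Sum.inl o)))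
      rw [← h3, PMF.map_comp]
      rfl
    rw [Prog.bit, h2, ex_map, ex_bind]
    refine (congrArg (fun μ => ex μ _) h1).trans ?_
    rw [ex_map, ex_kRed]
    congr 1
    ext A3
    congr 1
    ext R dd c z1 z2 z3 h
    -- The preparation leaves all further registers as they were, so the distinguisher finds exactly
    -- its initial state.
    have h4 : ∀ o : CoreState P (RedW P), o.w = Sum.elim (encLWE A t) 0 →
        o.enc ∘ distReg = initState (Sum.elim o.pp.enc o.t.enc) := by
      rintro o ho
      ext v
      rcases v with (v | v) | v | v
      · rfl
      · rfl
      · exact congrFun ho (Sum.inr (Sum.inl v))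
      · exact congrFun ho (Sum.inr (Sum.inr v))
    rw [Prog.bit, ex_map, Prog.out, h4 _ rfl]
    simp only [ex_map]
    rfl

end Reduction

end

/-! ### The hybrid argument for zero-knowledge. -/

section

variable {P : Params}

/-- The rows of the Module-LWE instance. -/
def joinRows {α : Type} (a : Fin P.κ → α) (b : P.E → α) (c : α) : Fin (P.κ + 256 / P.d + 1) → α :=
  Sum.elim (Sum.elim a b) (fun _ => c) ∘ (rowEquiv P).symm

theorem joinRows_inl_inl {α : Type} (a : Fin P.κ → α) (b : P.E → α) (c : α) (i : Fin P.κ) :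
    joinRows a b c (rowEquiv P (Sum.inl (Sum.inl i))) = a i := by
  simp [joinRows]

theorem joinRows_inl_inr {α : Type} (a : Fin P.κ → α) (b : P.E → α) (c : α) (i : P.E) :
    joinRows a b c (rowEquiv P (Sum.inl (Sum.inr i))) = b i := by
  simp [joinRows]

theorem joinRows_inr {α : Type} (a : Fin P.κ → α) (b : P.E → α) (c : α) :
    joinRows a b c (rowEquiv P (Sum.inr 0)) = c := by
  simp [joinRows]

theorem ex_rows {α : Type} (μ : PMF α) (F : (Fin (P.κ + 256 / P.d + 1) → α) → ℝ≥0∞) :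
    ex (iid (Fin (P.κ + 256 / P.d + 1)) μ) F = ex (iid (Fin P.κ) μ) fun a => ex (iid P.E μ) fun b =>
      ex μ fun c => F (joinRows a b c) := by
  rw [ex_iid_equiv (rowEquiv P), ex_iid_sum, ex_iid_sum]
  simp only [ex_iid_unique]
  rfl

/-- Stacking independent uniform rows gives a uniform matrix, so a random key is a random `A₃`
together with a random LWE matrix. -/
theorem ex_samplePP (F : PP P → ℝ≥0∞) :
    ex (samplePP P) F = ex (unifMatrix P (Fin P.κ) P.MIdx) fun A3 =>
      ex (unifMatrix P (Fin (P.κ + 256 / P.d + 1)) (Fin P.n)) fun M => F (lwePP A3 M) := by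
  simp only [samplePP, ex_bind', ex_pure']
  congr 1
  ext A3
  refine ((ex_rows _ _).trans ?_).symm
  simp only [lwePP, joinRows_inl_inl, joinRows_inl_inr, joinRows_inr]
  rfl

/-- The expected value of `F` at the bit of a distinguisher on a transcript. -/
def bitEx (D : Prog P (PPVar P ⊕ TVar P) Unit) (F : Bool → ℝ≥0∞) (pp : PP P)
    (t : Transcript P) : ℝ≥0∞ :=
  ex (D.bit (Sum.elim pp.enc t.enc)) F

/-- `B` turns Module-LWE instances into inputs of `D`. -/
def IsReduction (x : Stmt P) (m : P.MIdx → Fin P.d → SignType) (D : Prog P (PPVar P ⊕ TVar P) Unit)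
    (B : Prog P (LWEVar (Fin (P.κ + 256 / P.d + 1)) (Fin P.n)) Unit) : Prop :=
  ∀ A t F, ex (B.bit (encLWE A t)) F =
    ex (unifMatrix P (Fin P.κ) P.MIdx) fun A3 => exResp P fun R dd c z1 z2 z3 h =>
      bitEx D F (lwePP A3 A) (lweTr (lwePP A3 A) x m (fun i => t (rowEquiv P (Sum.inl (Sum.inl i))))
        (fun a => t (rowEquiv P (Sum.inl (Sum.inr a)))) (t (rowEquiv P (Sum.inr 0)))
        R dd c z1 z2 z3 h)

section Reduction

variable {x : Stmt P} {m : P.MIdx → Fin P.d → SignType} {D : Prog P (PPVar P ⊕ TVar P) Unit}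
  {B : Prog P (LWEVar (Fin (P.κ + 256 / P.d + 1)) (Fin P.n)) Unit}

/-- On a genuine sample the reduction feeds the distinguisher an ideal transcript; on a uniform one
(`ex_lweRandom`) it feeds a simulated transcript. -/
theorem ex_lweReal (hB : IsReduction x m D B) (hm : x.ATilde *ᵥ ternVec P.q m = x.u) (F : Bool → ℝ≥0∞) :
    ex (lweReal B) F = ex (samplePP P) fun pp => exIdeal pp x m (bitEx D F pp) := by
  simp only [lweReal, ex_bind', hB _ _ _, ex_samplePP]
  rw [ex_comm (unifMatrix P (Fin P.κ) P.MIdx)]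
  congr 1
  ext M
  rw [ex_comm]
  congr 1
  ext A3
  rw [exIdeal_eq _ x m hm, ex_iid_map]
  rfl

theorem ex_lweRandom (hB : IsReduction x m D B) (F : Bool → ℝ≥0∞) :
    ex (lweRandom B) F = ex (samplePP P) fun pp => exSim pp x (bitEx D F pp) := by
  simp only [lweRandom, ex_bind', hB _ _ _, ex_samplePP]
  rw [ex_comm (unifMatrix P (Fin P.κ) P.MIdx)]
  congr 1
  ext M
  rw [ex_comm]
  congr 1
  ext A3
  rw [← exSim_eq _ x m, ex_rows]
  simp only [joinRows_inl_inl, joinRows_inl_inr, joinRows_inr]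

end Reduction

theorem ex_realBit (x : Stmt P) (m : P.MIdx → Fin P.d → SignType)
    (D : Prog P (PPVar P ⊕ TVar P) Unit) (F : Bool → ℝ≥0∞) :
    ex (realBit x m D) (fun o => o.elim 0 F) = ex (samplePP P) fun pp =>
      ex (honestRun pp x m) fun o => o.elim 0 (bitEx D F pp) := by
  rw [realBit, ex_bind']
  congr 1
  ext pp
  rw [ex_bind']
  congr 1
  ext o
  cases o with
  | none => exact ex_pure' _ _
  | some t => exact ex_map _ _ _

theorem ex_ind_bool (μ : PMF Bool) : ex μ (fun b => ind (b = true)) + ex μ (fun b => ind (b = false)) = 1 := by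
  rw [← ex_add]
  refine Eq.trans ?_ (ex_const μ 1)
  congr 1
  ext b
  cases b <;> simp [ind]

theorem ex_ind_le_one {α : Type} (μ : PMF α) (p : α → Prop) : ex μ (fun a => ind (p a)) ≤ 1 :=
  ex_le_const μ fun _ => ind_le_one _

theorem Pr_some_eq {α : Type} (μ : PMF (Option α)) (S : Set (Option α)) (p : α → Prop)
    (hnone : none ∉ S) (hsome : ∀ a, some a ∈ S ↔ p a) :
    Pr μ S = (ex μ fun o => o.elim 0 fun a => ind (p a)).toReal := by
  rw [Pr_eq_ex_ind]
  congr 2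
  ext o
  cases o with
  | none => exact ind_false hnone
  | some a => simp only [hsome, Option.elim_some]

theorem toReal_nonabort_bound :
    ((27⁻¹ : ℝ≥0∞) * (1 - (2 ^ 101)⁻¹)).toReal = 1 / 27 * (1 - 1 / 2 ^ 101) := by
  generalize hk : 101 = k
  have h : ((2 : ℝ≥0∞) ^ k)⁻¹ ≤ 1 := ENNReal.inv_le_one.2 (one_le_pow₀ one_le_two)
  rw [ENNReal.toReal_mul, ENNReal.toReal_sub_of_le h ENNReal.one_ne_top, ENNReal.toReal_inv,
    ENNReal.toReal_inv, ENNReal.toReal_pow, ENNReal.toReal_one, ENNReal.toReal_ofNat,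
    ENNReal.toReal_ofNat, one_div, one_div]

theorem nonabort_toReal_le {a b : ℝ≥0∞} (ha : a ≠ ⊤) (hb : b ≠ ⊤)
    (h : 27⁻¹ * (1 - (2 ^ 101)⁻¹) ≤ a + b) : 1 / 27 * (1 - 1 / 2 ^ 101) ≤ a.toReal + b.toReal := by
  rw [← toReal_nonabort_bound, ← ENNReal.toReal_add ha hb]
  exact ENNReal.toReal_mono (ENNReal.add_ne_top.2 ⟨ha, hb⟩) h

/-- Two hops: from the conditioned honest transcript to the ideal one, at cost `2^(-100)`, and from
the ideal to the simulated one, at cost `ε`. -/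
theorem hvzk (P : Params) {τ : ℕ} (hτ : P.bnd ^ 30 ≤ τ) : HVZK P τ := by
  obtain ⟨S, hS, hSim⟩ := exists_simulator P
  have hbnd : 1 ≤ P.bnd := le_trans (by norm_num) (four_le_bnd (P := P))
  refine ⟨S, hS.trans ((Nat.pow_le_pow_right hbnd (by norm_num)).trans hτ), ?_⟩
  intro T ε hard x m hx D hD
  obtain ⟨B, hBl, hB⟩ := exists_reduction x m D
  change IsReduction x m D B at hB
  have hadv := hard B (hBl.trans (by omega))
  have hreal := ex_lweReal hB hx.1
  have hsimb : Pr (simBit x S D) {true} = Pr (lweRandom B) {true} := by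
    simp only [Pr_eq_ex_ind, ex_lweRandom hB, simBit, ex_bind', hSim]
    rfl
  set p : Bool → ℝ≥0∞ := fun b => ex (realBit x m D) fun o => o.elim 0 fun b' => ind (b' = b)
    with hp
  set I : Bool → ℝ≥0∞ := fun b => ex (lweReal B) fun b' => ind (b' = b) with hI
  -- Domination is needed for both values of the output bit, since `abs_div_sub_le` also uses the
  -- complementary event.
  have hpI : ∀ b, p b ≤ 27⁻¹ * I b := fun b => by
    simp only [hp, hI, hreal, ex_realBit, ← ex_mul_left]
    exact ex_mono _ fun pp => ex_honestRun_le pp x m _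
  have hItop : ∀ b, I b ≠ ⊤ := fun b =>
    ((ex_ind_le_one _ _).trans_lt ENNReal.one_lt_top).ne
  have hptop : ∀ b, p b ≠ ⊤ := fun b =>
    ((hpI b).trans_lt (ENNReal.mul_lt_top (by simp) (hItop b).lt_top)).ne
  have hsum : p true + p false = ex (realBit x m D) fun o => o.elim 0 fun _ => 1 := by
    rw [hp, ← ex_add]
    congr 1
    ext o
    rcases o with _ | _ | _ <;> simp [ind]
  have hlow : 27⁻¹ * (1 - (2 ^ 101)⁻¹) ≤ p true + p false := by
    rw [hsum, ex_realBit]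
    refine le_ex_const _ fun pp => (honestRun_nonabort pp x m hx).trans (le_of_eq ?_)
    congr 1
    ext o
    cases o with
    | none => rfl
    | some t => exact (ex_const _ _).symm
  have h1 : Pr (realBit x m D) {some true} = (p true).toReal :=
    Pr_some_eq _ _ _ (by simp) (by simp)
  have h2 : Pr (realBit x m D) {b | b ≠ none} = (p true).toReal + (p false).toReal := by
    rw [Pr_some_eq _ _ (fun _ => True) (by simp) (by simp),
      ← ENNReal.toReal_add (hptop _) (hptop _), hsum]
    simp only [ind_true trivial]
  have h3 : Pr (lweReal B) {true} = (I true).toReal := by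
    rw [Pr_eq_ex_ind]
    rfl
  have hle : ∀ b, (p b).toReal ≤ (I b).toReal / 27 := fun b => by
    refine (ENNReal.toReal_mono (ENNReal.mul_ne_top (by simp) (hItop b)) (hpI b)).trans
      (le_of_eq ?_)
    rw [ENNReal.toReal_mul, ENNReal.toReal_inv, ENNReal.toReal_ofNat]
    ring
  have hIsum : (I true).toReal + (I false).toReal = 1 := by
    rw [← ENNReal.toReal_add (hItop _) (hItop _), ex_ind_bool, ENNReal.toReal_one]
  have hlow' := nonabort_toReal_le (hptop true) (hptop false) hlow
  have hfin := abs_div_sub_le (hle true) (hle false) ENNReal.toReal_nonneg ENNReal.toReal_nonneg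
    hIsum hlow'
  rw [zkAdvantage, hsimb, h1, h2]
  rw [h3] at hadv
  refine (abs_sub_le _ (I true).toReal _).trans ?_
  have h100 : (2 : ℝ) ^ (-100 : ℝ) = 1 / 2 ^ 100 := by
    rw [Real.rpow_neg zero_le_two, one_div, Real.rpow_ofNat]
  rw [h100]
  linarith

end

section

variable {P : Params}

/-! ### Reading challenges from registers -/

/-- For `q = 2` one would have `ζ^l = -1 = 1`, against the order `2l` of `ζ`. Oddness of `q` makes
`-1`, `0`, `1` distinct residues, so ternary challenges can be read back from registers. -/
theorem Params.two_lt_q (P : Params) : 2 < P.q := by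
  refine lt_of_le_of_ne P.q_prime.two_le fun h => ?_
  have h1 := zeta_pow_l P
  have h2 : (-1 : ZMod P.q) = 1 := by
    rw [neg_eq_iff_add_eq_zero, one_add_one_eq_two]
    have h3 := ZMod.natCast_self P.q
    have h4 : ((2 : ℕ) : ZMod P.q) = (P.q : ZMod P.q) := congrArg _ h
    rw [h3] at h4
    exact_mod_cast h4
  have hl : 0 < P.l := Nat.pos_of_dvd_of_pos P.l_dvd P.d_pos
  exact absurd (P.ζ_prim.dvd_of_pow_eq_one P.l (h1.trans h2)) (Nat.not_dvd_of_pos_of_lt hl (by omega))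

theorem decTern_tern (a : Fin P.d → SignType) : decTern (tern (ZMod P.q) a) = a := by
  ext k
  have hq := P.two_lt_q
  have h : (((a k : SignType) : ℤ) : ZMod P.q).valMinAbs = ((a k : SignType) : ℤ) := by
    rw [ZMod.valMinAbs_spec]
    refine ⟨rfl, ?_⟩
    rcases a k with _ | _ | _ <;> simp <;> omega
  rw [decTern, cent, coeff_tern, h]
  rcases a k with _ | _ | _ <;> rfl

theorem decTern_rvec (R : ChR P) : (fun j b => decTern (rvec R j b)) = R := by
  funext j b
  exact decTern_tern (R j b)

theorem coeff_of_zero (y : ZMod P.q) :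
    coeff (AdjoinRoot.of (X ^ P.d + 1 : (ZMod P.q)[X]) y) (0 : Fin P.d) = y := by
  rw [coeff_of, if_pos rfl]

/-! ### The extractor -/

section Extractor

/-- Names for the last challenge and the responses of a transcript. -/
abbrev RespVar (P : Params) : Type := Unit ⊕ (P.MIdx ⊕ Fin P.n)

/-- The last challenge and the responses of a transcript. -/
def Transcript.resp (t : Transcript P) : RespVar P → P.Rq :=
  Sum.elim (fun _ => tern (ZMod P.q) t.c) (Sum.elim t.m4.z1 t.m4.z2)

/-- The registers for the last challenge and the responses. -/
def respVar : RespVar P → TVar P := Sum.elim (fun _ => .c) (Sum.elim .z1 .z2)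

/-- Registers of the extractor beside key, statement and transcript: its outputs, and the last
messages of four transcripts. -/
abbrev KW (P : Params) : Type := KOut P ⊕ (Fin 4 × RespVar P)

/-- The extractor as a machine whose parameter is the prover. -/
def oracleMachine (P : Params) : Machine P (KRegs P) where
  I := KInstr P
  Θ := Strategy P
  step := KInstr.run
  emb := .op
  step_emb _ _ _ := rfl

theorem exists_store_encoding (P : Params) : ∃ f : Fin 4 × RespVar P → ℕ, Function.Injective f :=
  Countable.exists_injective_nat _

/-- The registers of the extractor. -/
def extractorLayout (P : Params) : Layout (Core P ⊕ KW P) (KRegs P) where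
  -- Stored responses occupy even work registers and scratch values odd ones.
  reg := Sum.elim Sum.inl (Sum.elim (fun o => Sum.inr (Sum.inl o))
    fun v => Sum.inr (Sum.inr (2 * (exists_store_encoding P).choose v)))
  tmp n := Sum.inr (Sum.inr (2 * n + 1))
  reg_inj := by
    have h := (exists_store_encoding P).choose_spec
    rintro (v | v | v) (w | w | w) hvw <;>
      simp only [Sum.elim_inl, Sum.elim_inr, Sum.inl.injEq, Sum.inr.injEq, reduceCtorEq] at hvw
    · rw [hvw]
    · rw [hvw]
    · rw [h (show (exists_store_encoding P).choose v = (exists_store_encoding P).choose w by omega)]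
  tmp_inj n k h := by simpa using h
  disj := by
    rintro (v | v | v) n <;> simp
    omega

/-- The oracle call on abstract states. -/
def CoreState.query (A : Strategy P) (σ : CoreState P (KW P)) : CoreState P (KW P) :=
  { σ with t := A.transcript σ.t.R σ.t.dd σ.t.c }

/-- Encoding and decoding of challenges are inverse to each other, so the oracle sees the challenges
of the abstract state. -/
theorem does_query : Does (oracleMachine P) (extractorLayout P) P.bnd CoreState.enc
    (fun (A : Strategy P) (σ : CoreState P (KW P)) => PMF.pure (σ.query A)) 0 := by
  refine ⟨fun (A : Strategy P) s =>
    PMF.pure (Sum.elim (Sum.elim (fun i => s (Sum.inl (Sum.inl i)))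
      (A.transcript (fun j b => decTern (s (treg (.r j b)))) (fun j => coeff (s (treg (.dd j))) 0)
        (decTern (s (treg .c)))).enc) fun v => s (Sum.inr v)),
    ⟨[KInstr.query], by rw [pow_zero]; exact le_rfl, fun A s => ?_⟩, fun A σ => ?_⟩
  · refine (congrArg (PMF.map _) (runList_singleton _ _ _)).trans ?_
    refine (PMF.pure_map _ _).trans (congrArg PMF.pure ?_)
    ext v
    rcases v with (v | v) | v | v <;> rfl
  · rw [PMF.pure_map]
    refine congrArg PMF.pure ?_
    have hR : (fun j b => decTern (σ.enc (treg (.r j b)))) = σ.t.R := decTern_rvec σ.t.R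
    have hd : (fun j => coeff (σ.enc (treg (.dd j))) 0) = σ.t.dd :=
      funext fun j => coeff_of_zero (σ.t.dd j)
    have hc : decTern (σ.enc (treg .c)) = σ.t.c := decTern_tern σ.t.c
    rw [hR, hd, hc]
    ext v
    rcases v with ((v | v) | v) | v <;> rfl

/-- Storing of the last messages of a transcript. -/
def store (k : Fin 4) (t : Transcript P) (w : KW P → P.Rq) : KW P → P.Rq :=
  Sum.elim (fun o => w (Sum.inl o)) fun v => if v.1 = k then t.resp v.2 else w (Sum.inr v)

variable {ι : Type} {M : Machine P ι} {L : Layout (Core P ⊕ KW P) ι}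

theorem card_respVar_le : Fintype.card (RespVar P) ≤ P.bnd := by
  simp only [Fintype.card_sum, Fintype.card_prod, Fintype.card_fin, Fintype.card_unit, Params.bnd,
    Params.size, Params.n]
  nlinarith [Nat.zero_le (4 * (P.κ + P.lam + P.d))]

theorem does_store (k : Fin 4) : Does M L P.bnd CoreState.enc
    (fun _ (σ : CoreState P (KW P)) => PMF.pure { σ with w := store k σ.t σ.w }) 3 := by
  have hB := four_le_bnd (P := P)
  have hr : Function.Injective (fun v => Sum.inr (Sum.inr (k, v)) : RespVar P → Core P ⊕ KW P) :=
    fun v w h => by simpa using h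
  refine Does.setFam hB card_respVar_le hr (f := fun v s => s (treg (respVar v)))
    (fun v => Comp.reg hB _) (fun i j s x _ => by simp)
    fun σ => extend_eq (s' := CoreState.enc { σ with w := store k σ.t σ.w }) hr ?_ ?_
  · rintro (v | v | v) <;> exact (if_pos rfl).symm
  · rintro (((v | v) | v) | v | ⟨k', v⟩) h
    · rfl
    · rfl
    · rfl
    · rfl
    · refine (if_neg fun hk => h v ?_).symm
      change k' = k at hk
      rw [hk]

/-- The value opened by two of the stored messages. -/
def openAt (a b : Fin 4) (g : Fin 4 × RespVar P → P.Rq) (i : P.MIdx ⊕ Fin P.n) : P.Rq :=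
  Ring.inverse (g (a, Sum.inl ()) - g (b, Sum.inl ())) * (g (a, Sum.inr i) - g (b, Sum.inr i))

/-- The outputs of the extractor. -/
def outVal (g : Fin 4 × RespVar P → P.Rq) : KOut P → P.Rq
  | .cbar => g (0, Sum.inl ()) - g (1, Sum.inl ())
  | .m i => openAt 0 1 g (Sum.inl i)
  | .s i => openAt 0 1 g (Sum.inr i)
  | .y i => (g (0, Sum.inl ()) - g (1, Sum.inl ())) * (g (2, Sum.inl ()) - g (3, Sum.inl ())) *
    (openAt 0 1 g i - openAt 2 3 g i)

theorem comp_stored_sub (a b : Fin 4) (v : RespVar P) :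
    Comp (P := P) L P.bnd (fun s => s (Sum.inr (Sum.inr (a, v))) - s (Sum.inr (Sum.inr (b, v)))) 3 :=
  ((Comp.reg four_le_bnd _).sub four_le_bnd (Comp.reg four_le_bnd _)).mono four_le_bnd (by norm_num)

theorem comp_openAt (a b : Fin 4) (i : P.MIdx ⊕ Fin P.n) :
    Comp (P := P) L P.bnd (fun s => openAt a b (fun v => s (Sum.inr (Sum.inr v))) i) 5 :=
  (((comp_stored_sub a b (Sum.inl ())).inv four_le_bnd).mul four_le_bnd
    (comp_stored_sub a b (Sum.inr i))).mono four_le_bnd (by norm_num)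

theorem comp_outVal (o : KOut P) :
    Comp (P := P) L P.bnd (fun s => outVal (fun v => s (Sum.inr (Sum.inr v))) o) 8 := by
  have hB := four_le_bnd (P := P)
  cases o with
  | cbar => exact (comp_stored_sub _ _ _).mono hB (by norm_num)
  | m i => exact (comp_openAt _ _ _).mono hB (by norm_num)
  | s i => exact (comp_openAt _ _ _).mono hB (by norm_num)
  | y i =>
    exact (((comp_stored_sub _ _ _).mul hB (comp_stored_sub _ _ _)).mul hB
      ((comp_openAt _ _ _).sub hB (comp_openAt _ _ _))).mono hB (by norm_num)

/-- The constructors for output registers. -/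
def kOutOf (P : Params) : Unit ⊕ (P.MIdx ⊕ Fin P.n) ⊕ (P.MIdx ⊕ Fin P.n) → KOut P :=
  Sum.elim (fun _ => .cbar) (Sum.elim (Sum.elim .m .s) .y)

theorem kOutOf_surj : Function.Surjective (kOutOf P) := by
  rintro (_ | i | i | i)
  · exact ⟨.inl (), rfl⟩
  · exact ⟨.inr (.inl (.inl i)), rfl⟩
  · exact ⟨.inr (.inl (.inr i)), rfl⟩
  · exact ⟨.inr (.inr i), rfl⟩

open Classical in
instance : Fintype (KOut P) := Fintype.ofSurjective _ kOutOf_surj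

theorem card_kOut_le : Fintype.card (KOut P) ≤ P.bnd := by
  refine (Fintype.card_le_of_surjective _ kOutOf_surj).trans ?_
  simp only [Fintype.card_sum, Fintype.card_prod, Fintype.card_fin, Fintype.card_unit, Params.bnd,
    Params.size, Params.n]
  nlinarith [Nat.zero_le (4 * (P.κ + P.lam + P.d))]

/-- Writing of the outputs. -/
def writeOut (w : KW P → P.Rq) : KW P → P.Rq :=
  Sum.elim (outVal fun v => w (Sum.inr v)) fun v => w (Sum.inr v)

theorem does_out : Does M L P.bnd CoreState.enc
    (fun _ (σ : CoreState P (KW P)) => PMF.pure { σ with w := writeOut σ.w }) 10 := by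
  have hB := four_le_bnd (P := P)
  have hr : Function.Injective (fun o => Sum.inr (Sum.inl o) : KOut P → Core P ⊕ KW P) :=
    fun v w h => by simpa using h
  refine Does.setFam hB card_kOut_le hr
    (f := fun o s => outVal (fun v => s (Sum.inr (Sum.inr v))) o) comp_outVal
    (fun i j s x _ => ?_)
    fun σ => extend_eq (s' := CoreState.enc { σ with w := writeOut σ.w }) hr (fun _ => rfl) ?_
  · congr 1
    ext v
    simp
  · rintro (((v | v) | v) | v | v) h
    · rfl
    · rfl
    · rfl
    · exact absurd rfl (h v)
    · rfl

/-- Two executions with the same first two challenges. -/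
def kPair (k k' : Fin 4) (A : Strategy P) (σ : CoreState P (KW P)) : PMF (CoreState P (KW P)) :=
  ((distR P).map σ.setR).bind fun σ => ((distD P).map σ.setDd).bind fun σ =>
    (P.chal.map σ.setC).bind fun σ => (PMF.pure (σ.query A)).bind fun σ =>
      -- A query returns the challenges it was given, so `R` and `d` are still in place for the
      -- second run; only `c` is drawn anew.
      (PMF.pure { σ with w := store k σ.t σ.w }).bind fun σ => (P.chal.map σ.setC).bind fun σ =>
        (PMF.pure (σ.query A)).bind fun σ => PMF.pure { σ with w := store k' σ.t σ.w }

theorem does_pair (k k' : Fin 4) : Does (oracleMachine P) (extractorLayout P) P.bnd CoreState.enc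
    (kPair (P := P) k k') 12 := by
  have hB := four_le_bnd (P := P)
  exact (does_r.seq hB (does_dd.seq hB (does_c.seq hB (does_query.seq hB ((does_store k).seq hB
    (does_c.seq hB (does_query.seq hB (does_store k')))))))).mono hB (by norm_num)

theorem ex_kPair (k k' : Fin 4) (A : Strategy P) (σ : CoreState P (KW P))
    (F : CoreState P (KW P) → ℝ≥0∞) :
    ex (kPair k k' A σ) F = ex (distR P) fun R => ex (distD P) fun dd => ex P.chal fun c =>
      ex P.chal fun c' => F ⟨σ.pp, σ.x, A.transcript R dd c',
        store k' (A.transcript R dd c') (store k (A.transcript R dd c) σ.w)⟩ := by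
  simp only [kPair, ex_bind, ex_map, ex_pure]
  rfl

/-- The extractor on abstract states. -/
def kExtract (A : Strategy P) (σ : CoreState P (KW P)) : PMF (CoreState P (KW P)) :=
  (kPair 0 1 A σ).bind fun σ => (kPair 2 3 A σ).bind fun σ => PMF.pure { σ with w := writeOut σ.w }

theorem does_extract : Does (oracleMachine P) (extractorLayout P) P.bnd CoreState.enc
    (kExtract (P := P)) 14 := by
  have hB := four_le_bnd (P := P)
  exact ((does_pair 0 1).seq hB ((does_pair 2 3).seq hB does_out)).mono hB (by norm_num)

theorem outVal_store (t₁ t₁' t₂ t₂' : Transcript P) (w : KW P → P.Rq) (o : KOut P) :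
    outVal (fun v => store 3 t₂' (store 2 t₂ (store 1 t₁' (store 0 t₁ w))) (Sum.inr v)) o =
      match o with
      | .cbar => cbar t₁ t₁'
      | .m i => openM t₁ t₁' i
      | .s i => openS t₁ t₁' i
      | .y i => sisVec t₁ t₁' t₂ t₂' i := by
  rcases o with _ | i | i | (i | i) <;> rfl

theorem ex_kExtract (A : Strategy P) (σ : CoreState P (KW P)) (F : CoreState P (KW P) → ℝ≥0∞) :
    ex (kExtract A σ) F = exPairs A fun t₁ t₁' t₂ t₂' => F ⟨σ.pp, σ.x, t₂',
      writeOut (store 3 t₂' (store 2 t₂ (store 1 t₁' (store 0 t₁ σ.w))))⟩ := by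
  simp only [kExtract, ex_bind, ex_kPair, ex_pure, exPairs]

theorem extracted_iff (pp : PP P) (x : Stmt P) {t₁ t₁' t₂ t₂' : Transcript P} {o : KOut P → P.Rq}
    {w : KW P → P.Rq} (ho : ∀ i, o i =
      outVal (fun v => store 3 t₂' (store 2 t₂ (store 1 t₁' (store 0 t₁ w))) (Sum.inr v)) i) :
    Extracted pp x t₁.m1.f o ↔ PairsExtract pp x t₁ t₁' t₂ t₂' := by
  simp only [Extracted, PairsExtract, ho, outVal_store]

theorem exPairs_congr (A : Strategy P)
    {F G : Transcript P → Transcript P → Transcript P → Transcript P → ℝ≥0∞}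
    (h : ∀ R dd c c' R₂ dd₂ c₂ c₂', F (A.transcript R dd c) (A.transcript R dd c')
      (A.transcript R₂ dd₂ c₂) (A.transcript R₂ dd₂ c₂') = G (A.transcript R dd c)
      (A.transcript R dd c') (A.transcript R₂ dd₂ c₂) (A.transcript R₂ dd₂ c₂')) :
    exPairs A F = exPairs A G := by
  simp only [exPairs, h]

/-- The witness and the Module-SIS candidate are both always written. The extractor never has to
decide which of them is valid. -/
theorem exists_extractor (P : Params) : ∃ K : List (KInstr P), K.length ≤ P.bnd ^ 14 ∧
    ∀ pp x A, ex (extract K pp x A) (fun o => ind (Extracted pp x A.m1.f o)) =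
      exPairs A fun t₁ t₁' t₂ t₂' => ind (PairsExtract pp x t₁ t₁' t₂ t₂') := by
  obtain ⟨K, hK, h⟩ := (does_extract (P := P)).run
  change List (KInstr P) at K
  refine ⟨K, hK, fun pp x A => ?_⟩
  have h1 := h A (initState (Sum.elim (Sum.elim pp.enc x.enc) fun _ => 0)) ⟨pp, x, zeroTr P, 0⟩ (by
    ext v
    rcases v with ((v | v) | v) | v | v
    · rfl
    · rfl
    · exact (zeroTr_enc v).symm
    · rfl
    · rfl)
  have h2 : extract K pp x A = ((runList (KInstr.run A) K
      (initState (Sum.elim (Sum.elim pp.enc x.enc) fun _ => 0))).map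
        (· ∘ (extractorLayout P).reg)).map fun v o => v (Sum.inr (Sum.inl o)) := by
    rw [PMF.map_comp]
    rfl
  rw [h2]
  refine (congrArg (fun μ => ex (PMF.map _ μ) _) h1).trans ?_
  rw [ex_map, ex_map, ex_kExtract]
  exact exPairs_congr A fun R dd c c' R₂ dd₂ c₂ c₂' => congrArg ind (propext
    (extracted_iff (t₁ := A.transcript R dd c) pp x fun _ => rfl))

end Extractor

theorem knowledgeSound (P : Params) {τ : ℕ} (hτ : P.bnd ^ 14 ≤ τ) {K : ℝ} (hK : P.NearUniform K) :
    KnowledgeSound P τ 4 (K * (P.l / (P.q : ℝ) ^ (P.d / P.l)) + 1 / P.q + 1 / 2 ^ 256) := by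
  obtain ⟨E, hE, hex⟩ := exists_extractor P
  refine ⟨E, hE.trans hτ, fun pp x A hA => ?_⟩
  have h := accept_sub_pow_le hK A
    (S := fun A => ex (extract E pp x A) fun o => ind (Extracted pp x A.m1.f o))
    (fun A => (hex pp x A).ge) (fun A => ex_ind_le_one _ _) hA
  have hp : extractProb E pp x A =
      (ex A fun A => ex (extract E pp x A) fun o => ind (Extracted pp x A.m1.f o)).toReal := by
    rw [extractProb, Pr_eq_ex_ind]
    simp only [ex_bind', ex_pure']
    rfl
  have hτ1 : (1 : ℝ) ≤ τ := by
    have : 1 ≤ P.bnd ^ 14 := Nat.one_le_pow _ _ (lt_of_lt_of_le (by norm_num) (four_le_bnd (P := P)))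
    exact_mod_cast this.trans hτ
  rw [← hp] at h
  exact h.trans (le_mul_of_one_le_left ENNReal.toReal_nonneg hτ1)

end

/-! ### The polynomial time bound and the conclusion. -/

section

/-- The polynomial that bounds running times. -/
def timePoly (k : ℕ) : Polynomial ℕ := ((C 4 * X + C 1000) ^ 2) ^ k

theorem eval_timePoly (P : Params) (k : ℕ) : (timePoly k).eval P.size = P.bnd ^ k := by
  simp only [timePoly, Params.bnd, eval_pow, eval_add, eval_mul, eval_C, eval_X]

theorem bnd_pow_le {P : Params} {j k : ℕ} (h : j ≤ k) : P.bnd ^ j ≤ (timePoly k).eval P.size := by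
  rw [eval_timePoly]
  exact Nat.pow_le_pow_right (lt_of_lt_of_le (by norm_num) (four_le_bnd (P := P))) h

end

end PoE

end

theorem mainTheorem8 :
    ∃ (poly : Polynomial ℕ) (e : ℕ), 0 < e ∧
      ∀ P : PoE.Params,
        PoE.Complete P ∧
        PoE.HVZK P (poly.eval P.size) ∧
        ∀ K : ℝ, P.NearUniform K →
          PoE.KnowledgeSound P (poly.eval P.size) e
            (K * (P.l / (P.q : ℝ) ^ (P.d / P.l)) + 1 / P.q + 1 / 2 ^ 256) := by
  -- The reduction is the longest program and needs exponent `30`; the exponent `4` comes from two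
  -- pairs of executions.
  refine ⟨PoE.timePoly 30, 4, by norm_num, fun P => ⟨PoE.complete P, ?_, fun K hK => ?_⟩⟩
  · exact PoE.hvzk P (PoE.bnd_pow_le le_rfl)
  · exact PoE.knowledgeSound P (PoE.bnd_pow_le (by norm_num)) hK
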